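/- **Setting.** Let $(X_i,Y_i)_{i\ge 1}$ be independent copies of a random vector $(X,Y)$ with marginal distribution functions $F_1,F_2$. For a distribution function $F$ put $F^\leftarrow(s)=\inf\{x\in\mathbb R: F(x)\ge s\}$, let $U_i(t)=F_i^\leftarrow(1-1/t)$ (with $U_i(t)=-\infty$ for $0\le t\le 1$), and let $U(x,y)=(U_1(x),U_2(y))$. Expressions $(x^\gamma-1)/\gamma$ and $(1+\gamma y)^{1/\gamma}$ are read as $\log x$ and $e^y$ for $\gamma=0$; where $(1+\gamma y)^{1/\gamma}$ is undefined it is $0$ if $\gamma>0$ and $\infty$ if $\gamma<0$ (and at $y=-\infty$, arising from $U_i=-\infty$, it is $0$). Let $\gamma_i\in\mathbb R$ and functions $a_i>0$, $b_i$ satisfy $\lim_{t\to\infty}(U_i(tx)-b_i(t))/a_i(t)=(x^{\gamma_i}-1)/\gamma_i$ for all $x>0$, $i=1,2$. Let $k=k_n>0$, $d_n>0$, $e_n>0$, $k\to\infty$, $k/n\to0$, $d_n\to\infty$, $c_n=ke_n/n$, and let $\hat a_i,\hat b_i,\hat\gamma_i$ (depending on $n$) be random variables, the estimators of $a_i(n/k),b_i(n/k),\gamma_i$.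 Set $$\hat T_n^\leftarrow(x_1,x_2)=\Big(\big(1+\hat\gamma_i\tfrac{x_i-\hat b_i}{\hat a_i}\big)^{1/\hat\gamma_i}\Big)_{i=1,2},\qquad \hat\nu_n(B)=\frac1k\sum_{i=1}^n \mathbf 1\{\hat T_n^\leftarrow(X_i,Y_i)\in B\}.$$ **Assumptions.** (M1) For $i=1,2$ there is $x_i^0<F_i^\leftarrow(1)$ such that $F_i$ is continuous and strictly increasing on $[x_i^0,F_i^\leftarrow(1)]\cap\mathbb R$. (M2) There are $\rho_i<0$ and functions $A_i\neq0$ such that for all $x>0$, $\big(\frac{U_i(tx)-b_i(t)}{a_i(t)}-\frac{x^{\gamma_i}-1}{\gamma_i}\big)/A_i(t)\to\bar\psi_i(x)$ as $t\to\infty$, where $\bar\psi_i(x)=x^{\gamma_i+\rho_i}/(\gamma_i+\rho_i)$ (read as $\log x$ if $\gamma_i+\rho_i=0$); moreover $a_i,b_i,A_i$ are chosen such that for all $\varepsilon,\delta>0$ there is $t_0$ such that the difference of the two sides is at most $\delta x^{\gamma_i+\rho_i}\max(x^\varepsilon,x^{-\varepsilon})$ in absolute value whenever $t,tx>t_0$.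 (M3) $k^{1/2}\big(\hat a_i/a_i(n/k)-1,(\hat b_i-b_i(n/k))/a_i(n/k),\hat\gamma_i-\gamma_i\big)_{i=1,2}$ converges weakly in $\mathbb R^6$ to some random vector. (Q1) $D_n=U(d_nS)\cap\mathbb R^2$ with $S=\{(x,y)\in[0,\infty)^2: y\ge q(x)\}\ne\emptyset$, where $q:[0,\infty)\to[0,\infty]$ is non-increasing, continuous from the right, and $q(0)>0$. Put $x_l=\inf\{x\ge0:q(x)<\infty\}$, $q(\infty)=\lim_{x\to\infty}q(x)$, $q^\leftarrow(v)=\inf\{x>0:q(x)\le v\}$. (Q2) $x^{(1-\gamma_1)/2}|\log x|=O(q(x))$ as $x\downarrow x_l$, and $y^{(1-\gamma_2)/2}|\log y|=O(q^\leftarrow(y))$ as $y\downarrow q(\infty)$. (D1) There is a measure $\nu$ on $[0,\infty)^2$ (the exponent measure) with $tP\{(X,Y)\in U(tB)\}\to\nu(B)$ as $t\to\infty$ for all $\nu$-continuous Borel sets $B\subset[0,\infty)^2$ bounded away from the origin. Furthermore there are a function $A_0>0$ with $A_0(t)\to0$ as $t\to\infty$ and constants $u_0>x_l$, $v_0>q(\infty)$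 such that $$t_nP\Big\{\Big(\big(1+\gamma_1\tfrac{X-b_1(t_n)}{a_1(t_n)}\big)^{1/\gamma_1},\big(1+\gamma_2\tfrac{Y-b_2(t_n)}{a_2(t_n)}\big)^{1/\gamma_2}\Big)\in B\Big\}-\nu(B)=O(A_0(t_n))$$ as $n\to\infty$, in each of the following two cases. * $t_n=n/k$: for every $M>0$, uniformly over all $B=\{(\tilde H^{(n,1)}(x_1),\tilde H^{(n,2)}(x_2)):(x_1,x_2)\in C\}$, where $$\tilde H^{(n,i)}(x)=\Big[1+\gamma_i\Big(\tfrac{c_n^{-(\gamma_i-k^{-1/2}\theta_i)}-1}{\gamma_i-k^{-1/2}\theta_i}(1+k^{-1/2}\xi_i)+c_n^{-(\gamma_i+k^{-1/2}\chi_i)}\tfrac{U_i(d_nx)-b_i(n/k)}{a_i(n/k)}\Big)\Big]^{1/\gamma_i}$$ with $\theta_i,\chi_i,\xi_i\in[-M,M]$, and $C$ is $S\cap([u,\infty)\times[v,\infty))$ with $u,v>0$, or $[x_l,u)\times[q(u-),\infty)$ with $0<u\le u_0$, or $[q^\leftarrow(v),\infty)\times[q(\infty),v)$ with $0<v\le v_0$.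 * $t_n=d_n$: uniformly over all $B=\{((1+\gamma_i\frac{U_i(d_nx_i)-b_i(d_n)}{a_i(d_n)})^{1/\gamma_i})_{i=1,2}:(x_1,x_2)\in C\}$ with $C$ of the second or third kind. (D2) $\nu$ has a Lebesgue density $\eta$ that is continuous and strictly positive on $[0,\infty)^2\setminus\{(0,0)\}$. (S1) $n=O(e_n)$, $0<\liminf d_n/e_n\le\limsup d_n/e_n<\infty$, and $w_n(\gamma_i)=o(k^{1/2})$ for $i=1,2$, where $w_n(\gamma)=\log c_n$ if $\gamma>0$, $\frac12\log^2c_n$ if $\gamma=0$, $(d_nk/n)^{-\gamma}$ if $\gamma<0$. (S2) $A_i(n/k)=o(k^{-1/2}w_n(\gamma_i))$ for $i=1,2$, and $A_0(n/k)=o(k^{-1/2}\max(w_n(\gamma_1),w_n(\gamma_2)))$. (S3) $k^{1/2}=O(\max(c_n,c_n^{\gamma_i}))$ if $\gamma_i\ge0$, $i=1,2$; $k^{1/2}=o(c_n^{1-\gamma_1})$ if $\gamma_1<0$ and $x_l=0$; $k^{1/2}=o(c_n^{1-\gamma_2})$ if $\gamma_2<0$ and $q(\infty)=0$. **Claim.**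 Let all these conditions hold, let $\ell_n>0$, $\ell_n\downarrow0$ with $k^{-1/2}w_n(\gamma_i)=o(\ell_n)$ for $i=1,2$, and suppose that, for each choice of the sign, the uniform approximation in (D1) at $t_n=n/k$ (with the same $\nu$ and $A_0$, and some $u_0>x_l$, $v_0>q(\infty)$) also holds when $c_n$ is replaced with $c_n/(1\pm\ell_n)$ in $\tilde H^{(n,2)}$. Let $$\hat S_{n,2}^\pm=\Big\{(u,(1\pm\ell_n)v):(u,v)\in\frac n{ke_n}\hat T_n^\leftarrow(D_n)\Big\},\qquad \hat I_{n,2}=\frac{\hat\nu_n(\hat S_{n,2}^-)-\hat\nu_n(\hat S_{n,2}^+)}{2\ell_n}.$$ Then $u\mapsto q(u)\eta(u,q(u))$ is integrable on $(x_l,\infty)$ and $$\hat I_{n,2}=\frac{e_n}{d_n}\int_{x_l}^\infty q(u)\,\eta(u,q(u))\,du\,\bigl(1+o_P(1)\bigr)\qquad(n\to\infty).$$ -/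

import Mathlib

open MeasureTheory ProbabilityTheory Filter Topology Asymptotics
open scoped ENNReal

noncomputable section

namespace ExtremeFailure

/-! ### Marginals and tail quantile functions -/

/-- The distribution function `F_i` of the `i`-th coordinate (`i = 0, 1`) of a random pair with
law `μ`. -/
def margCDF (μ : Measure (ℝ × ℝ)) (i : Fin 2) (x : ℝ) : ℝ :=
  cdf (if i = 0 then μ.fst else μ.snd) x

/-- The tail quantile function `U_i(t) = inf {x | F_i(x) ≥ 1 - 1/t}`. This real number is the
right value for `t > 1`; for `0 ≤ t ≤ 1` the infimum is over all of `ℝ`, so that `U_i(t) = -∞`,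
and this range of `t` is treated separately wherever `U_i` is used. -/
def tailQ (μ : Measure (ℝ × ℝ)) (i : Fin 2) (t : ℝ) : ℝ :=
  sInf {x : ℝ | 1 - 1 / t ≤ margCDF μ i x}

/-- The right endpoint `F_i^←(1) ∈ (-∞, ∞]`. -/
def rightEnd (μ : Measure (ℝ × ℝ)) (i : Fin 2) : EReal :=
  sInf ((fun x : ℝ => (x : EReal)) '' {x : ℝ | 1 ≤ margCDF μ i x})

/-- For `B ⊆ [0,∞)²`, the set `U(B) ∩ ℝ²`, where `U(x,y) = (U_1(x), U_2(y))`. Points with a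
coordinate in `[0,1]` have an image with a coordinate `-∞` and drop out. -/
def imageU (μ : Measure (ℝ × ℝ)) (B : Set (ℝ × ℝ)) : Set (ℝ × ℝ) :=
  {z | ∃ p ∈ B, 1 < p.1 ∧ 1 < p.2 ∧ z = (tailQ μ 0 p.1, tailQ μ 1 p.2)}

/-- The dilation `t B`. -/
def dilate (t : ℝ) (B : Set (ℝ × ℝ)) : Set (ℝ × ℝ) :=
  (fun p : ℝ × ℝ => (t * p.1, t * p.2)) '' B

/-- The closed quadrant `[0,∞)²`. -/
def quadrant : Set (ℝ × ℝ) := {p | 0 ≤ p.1 ∧ 0 ≤ p.2}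

/-! ### Generalized Pareto transformations -/

/-- `(x^g - 1)/g`, read as `log x` for `g = 0`. -/
def boxCox (g x : ℝ) : ℝ := if g = 0 then Real.log x else (x ^ g - 1) / g

/-- `(1 + g y)^{1/g} ∈ [0,∞]`, read as `exp y` for `g = 0`; where this is not defined, the value
is `0` if `g > 0` and `∞` if `g < 0`. This makes it a non-decreasing function of `y`. -/
def gpdInv (g y : ℝ) : ℝ≥0∞ :=
  if g = 0 then ENNReal.ofReal (Real.exp y)
  else if 0 < 1 + g * y then ENNReal.ofReal ((1 + g * y) ^ (1 / g))
  else if 0 < g then 0 else ⊤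

/-- The marginal standardization
`(x,y) ↦ ((1 + γ_1 (x - b_1)/a_1)^{1/γ_1}, (1 + γ_2 (y - b_2)/a_2)^{1/γ_2})`. -/
def standardize (γ a b : Fin 2 → ℝ) (z : ℝ × ℝ) : ℝ≥0∞ × ℝ≥0∞ :=
  (gpdInv (γ 0) ((z.1 - b 0) / a 0), gpdInv (γ 1) ((z.2 - b 1) / a 1))

/-- The second order limit function `ψ̄_{g,ρ}`. -/
def psiBar (g ρ x : ℝ) : ℝ := if g + ρ = 0 then Real.log x else x ^ (g + ρ) / (g + ρ)

/-! ### Conditions on the margins and on the marginal estimators -/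

/-- Regularity of the upper tails: `F_i` is continuous and strictly increasing on `[x_i^0, F_i^←(1)] ∩ ℝ` for some
`x_i^0 < F_i^←(1)`. -/
def CondM1 (μ : Measure (ℝ × ℝ)) : Prop :=
  ∀ i : Fin 2, ∃ x0 : ℝ, (x0 : EReal) < rightEnd μ i ∧
    ContinuousOn (margCDF μ i) {x : ℝ | x0 ≤ x ∧ (x : EReal) ≤ rightEnd μ i} ∧
    StrictMonoOn (margCDF μ i) {x : ℝ | x0 ≤ x ∧ (x : EReal) ≤ rightEnd μ i}

/-- The first order (domain of attraction) condition on the margins. -/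
def FirstOrder (μ : Measure (ℝ × ℝ)) (γ : Fin 2 → ℝ) (a b : Fin 2 → ℝ → ℝ) : Prop :=
  ∀ i : Fin 2, ∀ x : ℝ, 0 < x →
    Tendsto (fun t : ℝ => (tailQ μ i (t * x) - b i t) / a i t) atTop (𝓝 (boxCox (γ i) x))

/-- The second order condition with `ρ_i < 0`, the normalizing functions `a_i > 0`, `b_i`,
`A_i ≠ 0` being chosen such that the usual uniform version holds. -/
def CondM2 (μ : Measure (ℝ × ℝ)) (γ ρ : Fin 2 → ℝ) (a b A : Fin 2 → ℝ → ℝ) : Prop :=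
  ∀ i : Fin 2, ρ i < 0 ∧ (∀ t : ℝ, 0 < t → 0 < a i t ∧ A i t ≠ 0) ∧
    (∀ x : ℝ, 0 < x →
      Tendsto (fun t : ℝ =>
        ((tailQ μ i (t * x) - b i t) / a i t - boxCox (γ i) x) / A i t) atTop
        (𝓝 (psiBar (γ i) (ρ i) x))) ∧
    (∀ ε : ℝ, 0 < ε → ∀ δ : ℝ, 0 < δ → ∃ t0 : ℝ, 0 < t0 ∧
      ∀ t x : ℝ, 0 < x → t0 < t → t0 < t * x →
        |((tailQ μ i (t * x) - b i t) / a i t - boxCox (γ i) x) / A i t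
            - psiBar (γ i) (ρ i) x|
          ≤ δ * (x ^ (γ i + ρ i) * max (x ^ ε) (x ^ (-ε))))

/-- The normalized estimation errors
`k^{1/2} (â_i/a_i - 1, (b̂_i - b_i)/a_i, γ̂_i - γ_i)`, `i = 0, 1`, for sample size `n`, where the
normalizing functions are taken at `n/k`. -/
def marginalError {Ω : Type*} (γ : Fin 2 → ℝ) (a b : Fin 2 → ℝ → ℝ) (k : ℕ → ℝ)
    (ahat bhat γhat : Fin 2 → ℕ → Ω → ℝ) (n : ℕ) (ω : Ω) : Fin 2 → ℝ × ℝ × ℝ :=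
  fun i =>
    (Real.sqrt (k n) * (ahat i n ω / a i (n / k n) - 1),
     Real.sqrt (k n) * ((bhat i n ω - b i (n / k n)) / a i (n / k n)),
     Real.sqrt (k n) * (γhat i n ω - γ i))

/-! ### The failure set -/

/-- `S = {(x,y) ∈ [0,∞)² | y ≥ q(x)}`. -/
def baseSet (q : ℝ → ℝ≥0∞) : Set (ℝ × ℝ) :=
  {p | 0 ≤ p.1 ∧ 0 ≤ p.2 ∧ q p.1 ≤ ENNReal.ofReal p.2}

/-- `D_n = U(d_n S) ∩ ℝ²`, with `d = d_n`. -/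
def failureSet (μ : Measure (ℝ × ℝ)) (q : ℝ → ℝ≥0∞) (d : ℝ) : Set (ℝ × ℝ) :=
  imageU μ (dilate d (baseSet q))

/-- `x_l = inf {x ≥ 0 | q(x) < ∞}`. -/
def xLow (q : ℝ → ℝ≥0∞) : ℝ := sInf {x : ℝ | 0 ≤ x ∧ q x < ⊤}

/-- `q(∞) = lim_{x → ∞} q(x)`, for non-increasing `q` that is not identically `∞`. -/
def qInfty (q : ℝ → ℝ≥0∞) : ℝ := (⨅ x ∈ Set.Ici (0 : ℝ), q x).toReal

/-- The left limit `q(u-)`, for non-increasing `q` and `u > 0`. -/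
def qLeft (q : ℝ → ℝ≥0∞) (u : ℝ) : ℝ≥0∞ := ⨅ x ∈ Set.Ico (0 : ℝ) u, q x

/-- `q^←(v) = inf {x > 0 | q(x) ≤ v}`. It is used only for `v > q(∞)`, where it is finite. -/
def qInv (q : ℝ → ℝ≥0∞) (v : ℝ) : ℝ := sInf {x : ℝ | 0 < x ∧ q x ≤ ENNReal.ofReal v}

/-- The conditions on `q : [0,∞) → [0,∞]`: non-increasing, continuous from the right,
`q(0) > 0`. It is also required that `S` is not empty. -/
def CondQ1 (q : ℝ → ℝ≥0∞) : Prop :=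
  AntitoneOn q (Set.Ici 0) ∧ (∀ x : ℝ, 0 ≤ x → ContinuousWithinAt q (Set.Ici x) x) ∧
    0 < q 0 ∧ (baseSet q).Nonempty

/-- The growth conditions on `q` at `x_l` and on `q^←` at `q(∞)`. -/
def CondQ2 (γ : Fin 2 → ℝ) (q : ℝ → ℝ≥0∞) : Prop :=
  ((fun x : ℝ => x ^ ((1 - γ 0) / 2) * |Real.log x|)
      =O[𝓝[>] (xLow q)] (fun x : ℝ => (q x).toReal)) ∧
    ((fun y : ℝ => y ^ ((1 - γ 1) / 2) * |Real.log y|)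
      =O[𝓝[>] (qInfty q)] (fun y : ℝ => qInv q y))

/-! ### The exponent measure -/

/-- `ν` is the exponent measure of the law `μ`: a measure on `[0,∞)²` with
`t P{(X,Y) ∈ U(tB)} → ν(B)` for all `ν`-continuous Borel sets `B ⊆ [0,∞)²` that are bounded away
from the origin. -/
def IsExponentMeasure (μ ν : Measure (ℝ × ℝ)) : Prop :=
  ν quadrantᶜ = 0 ∧
    ∀ B : Set (ℝ × ℝ), MeasurableSet B → B ⊆ quadrant → (0, 0) ∉ closure B →
      ν (frontier B) = 0 →
      Tendsto (fun t : ℝ => ENNReal.ofReal t * μ (imageU μ (dilate t B))) atTop (𝓝 (ν B))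

/-- `ν` has the Lebesgue density `η`, which is continuous and strictly positive on
`[0,∞)² \ {0}`. -/
def CondD2 (ν : Measure (ℝ × ℝ)) (η : ℝ × ℝ → ℝ) : Prop :=
  ν = (volume.restrict quadrant).withDensity (fun p => ENNReal.ofReal (η p)) ∧
    ContinuousOn η (quadrant \ {(0, 0)}) ∧ ∀ p ∈ quadrant \ {(0, 0)}, 0 < η p

/-- The part in `[0,∞)²` of a subset of `[0,∞]²`. -/
def finitePart (B : Set (ℝ≥0∞ × ℝ≥0∞)) : Set (ℝ × ℝ) :=
  {p | p ∈ quadrant ∧ (ENNReal.ofReal p.1, ENNReal.ofReal p.2) ∈ B}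

/-- The bound `|t P{T^←(X,Y) ∈ B} - ν(B)| ≤ r`, including finiteness of `ν(B)`; here `T^←` is the
standardization with parameters `γ`, `a`, `b`. -/
def TailApprox (μ ν : Measure (ℝ × ℝ)) (γ a b : Fin 2 → ℝ) (t : ℝ) (B : Set (ℝ≥0∞ × ℝ≥0∞))
    (r : ℝ) : Prop :=
  ν (finitePart B) ≠ ⊤ ∧
    |t * μ.real {z | standardize γ a b z ∈ B} - (ν (finitePart B)).toReal| ≤ r

/-- The sets `S ∩ [u,∞) × [v,∞)`, `u, v > 0`. -/
def IsCorner (q : ℝ → ℝ≥0∞) (C : Set (ℝ × ℝ)) : Prop :=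
  ∃ u v : ℝ, 0 < u ∧ 0 < v ∧ C = {p | p ∈ baseSet q ∧ u ≤ p.1 ∧ v ≤ p.2}

/-- The strips `[x_l,u) × [q(u-),∞)` with `0 < u ≤ u0`, and `[q^←(v),∞) × [q(∞),v)` with
`0 < v ≤ v0`. (They are empty for `u ≤ x_l` and for `v ≤ q(∞)`, respectively.) -/
def IsStrip (q : ℝ → ℝ≥0∞) (u0 v0 : ℝ) (C : Set (ℝ × ℝ)) : Prop :=
  (∃ u : ℝ, 0 < u ∧ u ≤ u0 ∧
      C = {p | xLow q ≤ p.1 ∧ p.1 < u ∧ 0 ≤ p.2 ∧ qLeft q u ≤ ENNReal.ofReal p.2}) ∨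
    (∃ v : ℝ, 0 < v ∧ v ≤ v0 ∧
      C = {p | qInv q v ≤ p.1 ∧ qInfty q ≤ p.2 ∧ p.2 < v})

/-- The perturbed marginal transformation `H̃_{θ,χ,ξ}(x)`, where `g` is the extreme value index,
`α = a_i(n/k)`, `β = b_i(n/k)`, `U = U_i`, and `(c^{-g'} - 1)/g'` is read as `-log c` for
`g' = 0`. For `d x ≤ 1`, that is `U(d x) = -∞`, the value is the limit `0`. -/
def tildeH (g α β : ℝ) (U : ℝ → ℝ) (k c d θ χ ξ x : ℝ) : ℝ≥0∞ :=
  if 1 < d * x then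
    gpdInv g
      ((if g - θ / Real.sqrt k = 0 then -Real.log c
          else (c ^ (-(g - θ / Real.sqrt k)) - 1) / (g - θ / Real.sqrt k))
          * (1 + ξ / Real.sqrt k)
        + c ^ (-(g + χ / Real.sqrt k)) * ((U (d * x) - β) / α))
  else 0

/-- Uniform rate of convergence to `ν` at the level `t_n = n/k`, for a general pair `c = (c_1, c_2)` of sequences in the two
marginal transformations: for every `M`, uniformly over the images `B` of the corners and strips
under `(H̃_{θ_1,χ_1,ξ_1}, H̃_{θ_2,χ_2,ξ_2})` with `θ_i, χ_i, ξ_i ∈ [-M,M]`,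
`(n/k) P{T_n^←(X,Y) ∈ B} - ν(B) = O(A_0(n/k))`. -/
def CondD1Sample (μ ν : Measure (ℝ × ℝ)) (γ : Fin 2 → ℝ) (a b : Fin 2 → ℝ → ℝ) (A0 : ℝ → ℝ)
    (q : ℝ → ℝ≥0∞) (k d : ℕ → ℝ) (c : Fin 2 → ℕ → ℝ) (u0 v0 : ℝ) : Prop :=
  ∀ M : ℝ, 0 < M → ∃ K : ℝ, ∀ᶠ n : ℕ in atTop, ∀ θ χ ξ : Fin 2 → ℝ,
    (∀ i, |θ i| ≤ M ∧ |χ i| ≤ M ∧ |ξ i| ≤ M) →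
    ∀ C : Set (ℝ × ℝ), IsCorner q C ∨ IsStrip q u0 v0 C →
      TailApprox μ ν γ (fun i => a i (n / k n)) (fun i => b i (n / k n)) (n / k n)
        ((fun p : ℝ × ℝ =>
          (tildeH (γ 0) (a 0 (n / k n)) (b 0 (n / k n)) (tailQ μ 0) (k n) (c 0 n) (d n)
              (θ 0) (χ 0) (ξ 0) p.1,
           tildeH (γ 1) (a 1 (n / k n)) (b 1 (n / k n)) (tailQ μ 1) (k n) (c 1 n) (d n)
              (θ 1) (χ 1) (ξ 1) p.2)) '' C)
        (K * A0 (n / k n))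

/-- Uniform rate of convergence to `ν` at the level `t_n = d_n`: uniformly over the images `B` of the strips under the
standardizations `x_i ↦ (1 + γ_i (U_i(d_n x_i) - b_i(d_n))/a_i(d_n))^{1/γ_i}` (with value `0`
where `U_i(d_n x_i) = -∞`), `d_n P{T^←(X,Y) ∈ B} - ν(B) = O(A_0(d_n))`. -/
def CondD1Model (μ ν : Measure (ℝ × ℝ)) (γ : Fin 2 → ℝ) (a b : Fin 2 → ℝ → ℝ) (A0 : ℝ → ℝ)
    (q : ℝ → ℝ≥0∞) (d : ℕ → ℝ) (u0 v0 : ℝ) : Prop :=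
  ∃ K : ℝ, ∀ᶠ n : ℕ in atTop, ∀ C : Set (ℝ × ℝ), IsStrip q u0 v0 C →
    TailApprox μ ν γ (fun i => a i (d n)) (fun i => b i (d n)) (d n)
      ((fun p : ℝ × ℝ =>
        ((if 1 < d n * p.1 then
            gpdInv (γ 0) ((tailQ μ 0 (d n * p.1) - b 0 (d n)) / a 0 (d n)) else 0),
         (if 1 < d n * p.2 then
            gpdInv (γ 1) ((tailQ μ 1 (d n * p.2) - b 1 (d n)) / a 1 (d n)) else 0))) '' C)
      (K * A0 (d n))

/-- `c_n = k e_n / n`. -/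
def cSeq (k e : ℕ → ℝ) (n : ℕ) : ℝ := k n / n * e n

/-- The rate condition: `A_0 > 0`, `A_0 → 0`, and the uniform rate of convergence holds at the
levels `n/k` and `d_n`, with the strips taken for `u ≤ u0`,
`v ≤ v0` with some `u0 > x_l` and `v0 > q(∞)`. -/
def CondD1 (μ ν : Measure (ℝ × ℝ)) (γ : Fin 2 → ℝ) (a b : Fin 2 → ℝ → ℝ) (A0 : ℝ → ℝ)
    (q : ℝ → ℝ≥0∞) (k d e : ℕ → ℝ) : Prop :=
  (∀ t : ℝ, 0 < t → 0 < A0 t) ∧ Tendsto A0 atTop (𝓝 0) ∧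
    ∃ u0 v0 : ℝ, xLow q < u0 ∧ qInfty q < v0 ∧
      CondD1Sample μ ν γ a b A0 q k d (fun _ => cSeq k e) u0 v0 ∧
      CondD1Model μ ν γ a b A0 q d u0 v0

/-- The analog of the rate condition at the level `n/k` where, in the transformation of the second coordinate, `c_n` is replaced
with `c_n / (1 + s_n)`. -/
def CondD1Analog (μ ν : Measure (ℝ × ℝ)) (γ : Fin 2 → ℝ) (a b : Fin 2 → ℝ → ℝ) (A0 : ℝ → ℝ)
    (q : ℝ → ℝ≥0∞) (k d e s : ℕ → ℝ) : Prop :=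
  ∃ u0 v0 : ℝ, xLow q < u0 ∧ qInfty q < v0 ∧
    CondD1Sample μ ν γ a b A0 q k d
      (fun i n => if i = 0 then cSeq k e n else cSeq k e n / (1 + s n)) u0 v0

/-! ### Conditions on the sequences -/

/-- The weights `w_n(g)`. -/
def weight (k d e : ℕ → ℝ) (g : ℝ) (n : ℕ) : ℝ :=
  if 0 < g then Real.log (cSeq k e n)
  else if g = 0 then Real.log (cSeq k e n) ^ 2 / 2
  else (d n * k n / n) ^ (-g)

/-- The standing assumptions on `k`, `d`, `e` and their growth conditions. -/
def CondS1 (γ : Fin 2 → ℝ) (k d e : ℕ → ℝ) : Prop :=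
  (∀ n, 0 < k n ∧ 0 < d n ∧ 0 < e n) ∧
    Tendsto k atTop atTop ∧ Tendsto (fun n : ℕ => k n / n) atTop (𝓝 0) ∧
    Tendsto d atTop atTop ∧
    (fun n : ℕ => (n : ℝ)) =O[atTop] e ∧ d =Θ[atTop] e ∧
    ∀ i : Fin 2, weight k d e (γ i) =o[atTop] (fun n => Real.sqrt (k n))

/-- Negligibility of the bias terms `A_i(n/k)` and `A_0(n/k)`. -/
def CondS2 (γ : Fin 2 → ℝ) (A : Fin 2 → ℝ → ℝ) (A0 : ℝ → ℝ) (k d e : ℕ → ℝ) : Prop :=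
  (∀ i : Fin 2, (fun n : ℕ => A i (n / k n))
      =o[atTop] (fun n => weight k d e (γ i) n / Real.sqrt (k n))) ∧
    (fun n : ℕ => A0 (n / k n)) =o[atTop]
      (fun n => max (weight k d e (γ 0) n) (weight k d e (γ 1) n) / Real.sqrt (k n))

/-- Lower bounds on the growth of `c_n` relative to `k`. -/
def CondS3 (γ : Fin 2 → ℝ) (q : ℝ → ℝ≥0∞) (k e : ℕ → ℝ) : Prop :=
  (∀ i : Fin 2, 0 ≤ γ i → (fun n => Real.sqrt (k n)) =O[atTop]
      (fun n => max (cSeq k e n) (cSeq k e n ^ γ i))) ∧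
    (γ 0 < 0 → xLow q = 0 → (fun n => Real.sqrt (k n)) =o[atTop]
      (fun n => cSeq k e n ^ (1 - γ 0))) ∧
    (γ 1 < 0 → qInfty q = 0 → (fun n => Real.sqrt (k n)) =o[atTop]
      (fun n => cSeq k e n ^ (1 - γ 1)))

/-! ### The estimator -/

open Classical in
/-- `ν̂_n(B) = k^{-1} #{i < n | T̂_n^←(Z_i) ∈ B}`, for the observed pairs `Z_0, …, Z_{n-1}` and
the estimated parameters `γ`, `a`, `b`. -/
def nuHat (k : ℝ) (n : ℕ) (γ a b : Fin 2 → ℝ) (Z : ℕ → ℝ × ℝ) (B : Set (ℝ≥0∞ × ℝ≥0∞)) : ℝ :=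
  1 / k * ((Finset.range n).filter (fun i => standardize γ a b (Z i) ∈ B)).card

/-- `{(u, (1 + s) v) | (u,v) ∈ n/(k e) T̂_n^←(D)}`. -/
def blownUpSet (k e : ℝ) (n : ℕ) (γ a b : Fin 2 → ℝ) (D : Set (ℝ × ℝ)) (s : ℝ) :
    Set (ℝ≥0∞ × ℝ≥0∞) :=
  (fun z : ℝ × ℝ =>
    (ENNReal.ofReal (n / (k * e)) * (standardize γ a b z).1,
     ENNReal.ofReal (1 + s) * (ENNReal.ofReal (n / (k * e)) * (standardize γ a b z).2))) '' D

/-- `Î_{n,2} = (ν̂_n(Ŝ_{n,2}^-) - ν̂_n(Ŝ_{n,2}^+)) / (2 ℓ_n)`. -/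
def IHat {Ω : Type*} (μ : Measure (ℝ × ℝ)) (q : ℝ → ℝ≥0∞) (k d e ℓ : ℕ → ℝ)
    (ahat bhat γhat : Fin 2 → ℕ → Ω → ℝ) (Z : ℕ → Ω → ℝ × ℝ) (n : ℕ) (ω : Ω) : ℝ :=
  (nuHat (k n) n (fun i => γhat i n ω) (fun i => ahat i n ω) (fun i => bhat i n ω)
      (fun i => Z i ω)
      (blownUpSet (k n) (e n) n (fun i => γhat i n ω) (fun i => ahat i n ω)
        (fun i => bhat i n ω) (failureSet μ q (d n)) (-ℓ n))
    - nuHat (k n) n (fun i => γhat i n ω) (fun i => ahat i n ω) (fun i => bhat i n ω)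
      (fun i => Z i ω)
      (blownUpSet (k n) (e n) n (fun i => γhat i n ω) (fun i => ahat i n ω)
        (fun i => bhat i n ω) (failureSet μ q (d n)) (ℓ n))) / (2 * ℓ n)

end ExtremeFailure

end

open ExtremeFailure

namespace ExtremeFailure

/-! ### Algebra of the generalized Pareto transformations -/

/-! For `s = ±ℓ_n`, the core is that `ν̂_n` of the estimated set equals `ν (scaledSet q (d/e) (d/e *
(1+s)))` up to `o_P(ℓ_n)` (`tendsto_measureReal_nuHat_sub`). The exponent measure is homogeneous of
order `-1`, so this mass is `e/d` times `ν (scaledSet q 1 (1+s))` (`measure_scaledSet`). The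
symmetric difference quotient of the latter at `s = 0` tends to the integral of `q η(u, q(u))`
(`derivative_scaledSet`): the layer between the two sets has height `2 ℓ q(u)` over `u`, and `η` is
continuous. The integral is strictly positive (`setIntegral_boundary_pos`) and `d/e` is bounded, so
an error of `o_P(1)` in the quotient is a relative error.

Masses near the boundary are controlled as follows. The density is homogeneous of degree `-3`, hence
at most `C / max(x,y)^3`. The growth conditions on `q` and on its inverse, both in the form
`AxisGrowth`, make this bound integrable against the displacement of the boundary that estimation
errors cause (`AxisGrowth.le_majorant`). Relative displacements of size `κ (x^(-m) + x^(1/2))`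
therefore change the mass by only `O(κ)` (`exists_crossing_set`).

The set in question is random. On the scale of normalized levels, the rescaled estimated
transformation is an affine function of the tail quantile function (`MarginBracket.hatBranch`). If
the normalized estimation errors are at most `M`, it lies between two deterministic transformations
(`exists_marginBracket`). Since `S` is an upper set, the random event is then enclosed between two
deterministic events (`exists_sandwich`). On corners away from the axes their probabilities are
compared with `ν` by the uniform rate condition. Near the axes the mass is found by subtraction,
namely marginal tail minus corner (`edgeEvent_measure_le`), and far out the marginal tails alone
suffice.

All deterministic errors are of order `errRate`, the larger weight divided by `√k`, which is
`o(ℓ_n)`. The empirical fluctuation of the two enclosing events is of order `k^(-1/2)` by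
Chebyshev's inequality. This is smaller still, because the weights diverge. -/

/-- The real-valued version of `gpdInv`, meaningful where `0 < 1 + g * y`. -/
noncomputable def gpdR (g y : ℝ) : ℝ := if g = 0 then Real.exp y else (1 + g * y) ^ (1 / g)

lemma gpdInv_eq_ofReal {g y : ℝ} (h : 0 < 1 + g * y) :
    gpdInv g y = ENNReal.ofReal (gpdR g y) := by
  unfold gpdInv gpdR
  split_ifs <;> rfl

lemma gpdR_pos {g y : ℝ} (h : 0 < 1 + g * y) : 0 < gpdR g y := by
  unfold gpdR
  split_ifs
  · exact Real.exp_pos y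
  · exact Real.rpow_pos_of_pos h _

lemma gpdInv_pos {g y : ℝ} (h : 0 < 1 + g * y) : 0 < gpdInv g y := by
  rw [gpdInv_eq_ofReal h]
  exact ENNReal.ofReal_pos.2 (gpdR_pos h)

lemma gpdInv_ne_top {g y : ℝ} (h : 0 < 1 + g * y) : gpdInv g y ≠ ⊤ := by
  rw [gpdInv_eq_ofReal h]
  exact ENNReal.ofReal_ne_top

lemma one_add_mul_boxCox (g x : ℝ) : 1 + g * boxCox g x = x ^ g := by
  unfold boxCox
  split_ifs with h
  · simp [h]
  · field_simp
    ring

lemma gpdR_boxCox {g x : ℝ} (hx : 0 < x) : gpdR g (boxCox g x) = x := by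
  by_cases h : g = 0
  · simp [gpdR, boxCox, h, Real.exp_log hx]
  · rw [gpdR, if_neg h, one_add_mul_boxCox, ← Real.rpow_mul hx.le, mul_one_div_cancel h,
      Real.rpow_one]

lemma boxCox_gpdR {g y : ℝ} (hy : 0 < 1 + g * y) : boxCox g (gpdR g y) = y := by
  by_cases h : g = 0
  · simp [gpdR, boxCox, h]
  · rw [gpdR, boxCox, if_neg h, if_neg h, ← Real.rpow_mul hy.le, one_div_mul_cancel h,
      Real.rpow_one]
    field_simp
    ring

lemma boxCox_mul {g x y : ℝ} (hx : 0 < x) (hy : 0 < y) :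
    boxCox g (x * y) = boxCox g x + x ^ g * boxCox g y := by
  unfold boxCox
  split_ifs with h
  · simp [h, Real.log_mul hx.ne' hy.ne']
  · rw [Real.mul_rpow hx.le hy.le]
    field_simp
    ring

lemma boxCox_one (g : ℝ) : boxCox g 1 = 0 := by simp [boxCox]

lemma boxCox_strictMonoOn (g : ℝ) : StrictMonoOn (boxCox g) (Set.Ioi 0) := by
  intro x hx y hy hxy
  have hx : 0 < x := hx
  unfold boxCox
  split_ifs with h
  · exact Real.log_lt_log hx hxy
  · rcases lt_or_gt_of_ne h with h' | h'
    · have := Real.rpow_lt_rpow_of_neg hx hxy h'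
      rw [div_lt_div_right_of_neg h']
      linarith
    · have := Real.rpow_lt_rpow hx.le hxy h'
      gcongr

lemma boxCox_le_boxCox {g x y : ℝ} (hx : 0 < x) (hxy : x ≤ y) : boxCox g x ≤ boxCox g y :=
  (boxCox_strictMonoOn g).monotoneOn hx (lt_of_lt_of_le hx hxy : (0:ℝ) < y) hxy

lemma gpdR_lt_gpdR {g y z : ℝ} (hy : 0 < 1 + g * y) (hz : 0 < 1 + g * z) (h : y < z) :
    gpdR g y < gpdR g z := by
  rw [← (boxCox_strictMonoOn g).lt_iff_lt (gpdR_pos hy) (gpdR_pos hz), boxCox_gpdR hy,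
    boxCox_gpdR hz]
  exact h

lemma boxCox_le_of_le_gpdR {g y x : ℝ} (hy : 0 < 1 + g * y) (hx : 0 < x) (h : x ≤ gpdR g y) :
    boxCox g x ≤ y := by
  have := boxCox_le_boxCox (g := g) hx h
  rwa [boxCox_gpdR hy] at this

lemma le_boxCox_of_gpdR_le {g y x : ℝ} (hy : 0 < 1 + g * y) (h : gpdR g y ≤ x) :
    y ≤ boxCox g x := by
  have := boxCox_le_boxCox (g := g) (gpdR_pos hy) h
  rwa [boxCox_gpdR hy] at this

lemma gpdInv_eq_zero {g y : ℝ} (hg : 0 < g) (h : 1 + g * y ≤ 0) : gpdInv g y = 0 := by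
  rw [gpdInv, if_neg hg.ne', if_neg h.not_gt, if_pos hg]

lemma gpdInv_eq_top {g y : ℝ} (hg : g < 0) (h : 1 + g * y ≤ 0) : gpdInv g y = ⊤ := by
  rw [gpdInv, if_neg hg.ne, if_neg h.not_gt, if_neg hg.le.not_gt]

/-- Strictness can fail only where `gpdInv` is truncated to `0` or `⊤`, so one regular argument
suffices. Leaving the regular range upwards is possible only for `g < 0`, and then the larger value
is `⊤`. -/
lemma gpdInv_lt_of_lt_left {g y z : ℝ} (hy : 0 < 1 + g * y) (h : y < z) :
    gpdInv g y < gpdInv g z := by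
  by_cases hz : 0 < 1 + g * z
  · rw [gpdInv_eq_ofReal hy, gpdInv_eq_ofReal hz]
    exact (ENNReal.ofReal_lt_ofReal_iff (gpdR_pos hz)).2 (gpdR_lt_gpdR hy hz h)
  · have hg : g < 0 := by
      by_contra hg
      have : g * y ≤ g * z := mul_le_mul_of_nonneg_left h.le (not_lt.1 hg)
      linarith
    rw [gpdInv_eq_top hg (not_lt.1 hz)]
    exact (gpdInv_ne_top hy).lt_top

lemma gpdInv_lt_of_lt_right {g y z : ℝ} (hz : 0 < 1 + g * z) (h : y < z) :
    gpdInv g y < gpdInv g z := by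
  by_cases hy : 0 < 1 + g * y
  · exact gpdInv_lt_of_lt_left hy h
  · have hg : 0 < g := by
      by_contra hg
      have : g * z ≤ g * y := mul_le_mul_of_nonpos_left h.le (not_lt.1 hg)
      linarith
    rw [gpdInv_eq_zero hg (not_lt.1 hy)]
    exact gpdInv_pos hz

/-- `gpdInv g` reflects the order as soon as one argument is in its regular range. -/
lemma le_of_gpdInv_le {g y z : ℝ} (hz : 0 < 1 + g * y ∨ 0 < 1 + g * z)
    (h : gpdInv g y ≤ gpdInv g z) : y ≤ z := by
  by_contra hlt
  have hlt := not_le.1 hlt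
  rcases hz with hz | hz
  · exact absurd h (gpdInv_lt_of_lt_right hz hlt).not_ge
  · exact absurd h (gpdInv_lt_of_lt_left hz hlt).not_ge

lemma gpdInv_mono (g : ℝ) : Monotone (gpdInv g) := by
  intro y z h
  rcases h.eq_or_lt with rfl | h
  · exact le_rfl
  by_cases hy : 0 < 1 + g * y
  · exact (gpdInv_lt_of_lt_left hy h).le
  by_cases hz : 0 < 1 + g * z
  · exact (gpdInv_lt_of_lt_right hz h).le
  rcases lt_trichotomy g 0 with hg | hg | hg
  · rw [gpdInv_eq_top hg (not_lt.1 hy), gpdInv_eq_top hg (not_lt.1 hz)]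
  · simp [hg] at hy
  · rw [gpdInv_eq_zero hg (not_lt.1 hy), gpdInv_eq_zero hg (not_lt.1 hz)]

lemma eq_of_gpdInv_eq {g y z : ℝ} (hz : 0 < 1 + g * z) (h : gpdInv g y = gpdInv g z) : y = z :=
  le_antisymm (le_of_gpdInv_le (Or.inr hz) h.le) (le_of_gpdInv_le (Or.inl hz) h.ge)

/-- The affine map acts on `1 + g y` as multiplication by a positive number, so it preserves the
regular range. -/
lemma one_add_mul_rescale {g c y : ℝ} (hc : 0 < c) :
    1 + g * (boxCox g c⁻¹ + c ^ (-g) * y) = c ^ (-g) * (1 + g * y) := by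
  have := one_add_mul_boxCox g c⁻¹
  rw [Real.inv_rpow hc.le, ← Real.rpow_neg hc.le] at this
  linear_combination this

/-- Scaling by `1/c` on the standardized scale is an affine map on the original scale. -/
lemma gpdInv_rescale {g c y : ℝ} (hc : 0 < c) (hy : 0 < 1 + g * y) :
    ENNReal.ofReal c⁻¹ * gpdInv g y = gpdInv g (boxCox g c⁻¹ + c ^ (-g) * y) := by
  have h2 : 0 < 1 + g * (boxCox g c⁻¹ + c ^ (-g) * y) := by
    rw [one_add_mul_rescale hc]
    exact mul_pos (Real.rpow_pos_of_pos hc _) hy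
  rw [gpdInv_eq_ofReal hy, gpdInv_eq_ofReal h2, ← ENNReal.ofReal_mul (inv_pos.2 hc).le]
  congr 1
  have h3 : boxCox g (c⁻¹ * gpdR g y) = boxCox g c⁻¹ + c ^ (-g) * y := by
    rw [boxCox_mul (inv_pos.2 hc) (gpdR_pos hy), boxCox_gpdR hy, Real.inv_rpow hc.le,
      ← Real.rpow_neg hc.le]
  rw [← h3, gpdR_boxCox (mul_pos (inv_pos.2 hc) (gpdR_pos hy))]

/-- `boxCox g x` is non-decreasing in the index `g`. -/
lemma boxCox_mono_index {x g h : ℝ} (hx : 0 < x) (hgh : g ≤ h) : boxCox g x ≤ boxCox h x := by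
  have key : ∀ r : ℝ, r ≠ 0 → (0 < r → Real.log x ≤ (x ^ r - 1) / r) ∧
      (r < 0 → (x ^ r - 1) / r ≤ Real.log x) := by
    intro r _
    have h1 : Real.log x * r ≤ x ^ r - 1 := by
      have := Real.add_one_le_exp (Real.log x * r)
      rw [Real.rpow_def_of_pos hx]
      linarith
    exact ⟨fun hr => by rwa [le_div_iff₀ hr], fun hr => by rwa [div_le_iff_of_neg hr]⟩
  -- For nonzero index, the Box-Cox value is the slope of the convex function `r ↦ x ^ r` between
  -- `0` and that index, and slopes from a fixed point increase.
  have hconv : ConvexOn ℝ Set.univ (fun r : ℝ => x ^ r) := by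
    have : (fun r : ℝ => x ^ r) = Real.exp ∘ (LinearMap.mulLeft ℝ (Real.log x)) := by
      funext r
      simp [Real.rpow_def_of_pos hx]
    rw [this]
    exact convexOn_exp.comp_linearMap (LinearMap.mulLeft ℝ (Real.log x))
  unfold boxCox
  split_ifs with h1 h2 h2
  · exact le_rfl
  · exact (key h h2).1 (lt_of_le_of_ne (h1 ▸ hgh) (Ne.symm h2))
  · exact (key g h1).2 (lt_of_le_of_ne (h2 ▸ hgh) h1)
  · have := hconv.secant_mono (a := 0) (x := g) (y := h) trivial trivial trivial h1 h2 hgh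
    simpa using this

/-- The left side is the Box-Cox value at index `-1`, so monotonicity in the index gives the bound.
This is where a lower bound on the extreme value index enters the tail estimate. -/
lemma one_sub_inv_le_boxCox {g y : ℝ} (hg : -1 ≤ g) (hy : 0 < y) : 1 - y⁻¹ ≤ boxCox g y := by
  refine le_trans (le_of_eq ?_) (boxCox_mono_index hy hg)
  rw [boxCox, if_neg (by norm_num), Real.rpow_neg_one]
  ring

/-! ### Quantile functions of continuous tails -/

/-- The law of the `i`-th coordinate. -/
noncomputable def margLaw (μ : Measure (ℝ × ℝ)) (i : Fin 2) : Measure ℝ :=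
  if i = 0 then μ.fst else μ.snd

/-- The `i`-th coordinate of a point. -/
def coord (i : Fin 2) (z : ℝ × ℝ) : ℝ := if i = 0 then z.1 else z.2

lemma measurable_coord (i : Fin 2) : Measurable (coord i) := by
  unfold coord
  split_ifs
  · exact measurable_fst
  · exact measurable_snd

lemma margLaw_eq_map (μ : Measure (ℝ × ℝ)) (i : Fin 2) : margLaw μ i = μ.map (coord i) := by
  unfold margLaw coord
  split_ifs <;> rfl

instance (μ : Measure (ℝ × ℝ)) [IsProbabilityMeasure μ] (i : Fin 2) :
    IsProbabilityMeasure (margLaw μ i) := by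
  rw [margLaw_eq_map]
  exact Measure.isProbabilityMeasure_map (measurable_coord i).aemeasurable

lemma margCDF_eq (μ : Measure (ℝ × ℝ)) (i : Fin 2) (x : ℝ) :
    margCDF μ i x = cdf (margLaw μ i) x := rfl

section Quantile

variable {μ : Measure (ℝ × ℝ)} {i : Fin 2}

lemma margCDF_mono : Monotone (margCDF μ i) := fun _ _ h => (cdf (margLaw μ i)).mono h

lemma margCDF_rightCont (x : ℝ) : ContinuousWithinAt (margCDF μ i) (Set.Ici x) x :=
  (cdf (margLaw μ i)).right_continuous x

/-- The Galois connection between the distribution function and the tail quantile function. -/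
lemma tailQ_le_iff {t : ℝ} (ht : 1 < t) (x : ℝ) :
    tailQ μ i t ≤ x ↔ 1 - 1 / t ≤ margCDF μ i x := by
  have ht0 : 0 < t := by linarith
  have hp1 : 1 - 1 / t < 1 := by
    have : 0 < 1 / t := by positivity
    linarith
  have hp0 : 0 < 1 - 1 / t := by
    rw [sub_pos, div_lt_one ht0]
    exact ht
  have hne : {x : ℝ | 1 - 1 / t ≤ margCDF μ i x}.Nonempty := by
    have := (tendsto_cdf_atTop (margLaw μ i)).eventually (lt_mem_nhds hp1)
    obtain ⟨y, hy⟩ := this.exists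
    exact ⟨y, le_of_lt hy⟩
  have hbdd : BddBelow {x : ℝ | 1 - 1 / t ≤ margCDF μ i x} := by
    have := (tendsto_cdf_atBot (margLaw μ i)).eventually (gt_mem_nhds hp0)
    obtain ⟨y, hy⟩ := this.exists
    refine ⟨y, fun z hz => ?_⟩
    by_contra hlt
    have h1 : margCDF μ i z ≤ margCDF μ i y := margCDF_mono (not_le.1 hlt).le
    have h2 : margCDF μ i y < 1 - 1 / t := hy
    exact absurd (lt_of_le_of_lt h1 h2) (not_lt.2 hz)
  constructor
  · intro h
    have hF : ∀ y, x < y → 1 - 1 / t ≤ margCDF μ i y := by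
      intro y hy
      obtain ⟨z, hz, hzy⟩ := exists_lt_of_csInf_lt hne (lt_of_le_of_lt h hy)
      exact le_trans hz (margCDF_mono hzy.le)
    have hr := (margCDF_rightCont (μ := μ) (i := i) x).mono Set.Ioi_subset_Ici_self
    exact ge_of_tendsto hr (eventually_nhdsWithin_of_forall fun y hy => hF y hy)
  · intro h
    exact csInf_le hbdd h

lemma le_margCDF_tailQ {t : ℝ} (ht : 1 < t) : 1 - 1 / t ≤ margCDF μ i (tailQ μ i t) :=
  (tailQ_le_iff ht _).1 le_rfl

lemma tailQ_mono {s t : ℝ} (hs : 1 < s) (hst : s ≤ t) : tailQ μ i s ≤ tailQ μ i t := by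
  rw [tailQ_le_iff hs]
  refine le_trans ?_ (le_margCDF_tailQ (lt_of_lt_of_le hs hst))
  have : 1 / t ≤ 1 / s := one_div_le_one_div_of_le (by linarith) hst
  linarith

/-- Consequences of the continuity and strict monotonicity of the tail of `F_i`. -/
lemma exists_regular_tail (hM1 : CondM1 μ) (i : Fin 2) : ∃ t1 : ℝ, 1 < t1 ∧
    (∀ t, t1 ≤ t → margCDF μ i (tailQ μ i t) = 1 - 1 / t) ∧
    (∀ y, tailQ μ i t1 ≤ y → margCDF μ i y < 1 →
      t1 ≤ 1 / (1 - margCDF μ i y) ∧ tailQ μ i (1 / (1 - margCDF μ i y)) = y) := by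
  obtain ⟨x0, hx0, hcont, hstrict⟩ := hM1 i
  have hFx0 : margCDF μ i x0 < 1 := by
    by_contra h
    have : rightEnd μ i ≤ x0 := sInf_le ⟨x0, not_lt.1 h, rfl⟩
    exact absurd hx0 this.not_gt
  have hle1 : ∀ y, margCDF μ i y ≤ 1 := fun y => cdf_le_one _ _
  have hF0 : 0 ≤ margCDF μ i x0 := cdf_nonneg _ _
  have hlt_end : ∀ y, margCDF μ i y < 1 → (y : EReal) ≤ rightEnd μ i := by
    intro y hy
    refine le_sInf ?_
    rintro _ ⟨w, hw, rfl⟩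
    have hyw : y ≤ w := by
      by_contra h
      exact absurd (le_trans hw (margCDF_mono (not_le.1 h).le)) hy.not_ge
    exact EReal.coe_le_coe_iff.2 hyw
  have hend : ∀ t, 1 < t → (tailQ μ i t : EReal) ≤ rightEnd μ i := by
    intro t ht
    refine le_sInf ?_
    rintro _ ⟨w, hw, rfl⟩
    have : tailQ μ i t ≤ w := by
      rw [tailQ_le_iff ht]
      have : 0 < 1 / t := by positivity
      have hw : 1 ≤ margCDF μ i w := hw
      linarith
    exact EReal.coe_le_coe_iff.2 this
  -- The factor `2` puts `1 - 1/t1` halfway between `F(x0)` and `1`, so all quantiles from level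
  -- `t1` on lie strictly to the right of `x0`.
  set t1 : ℝ := 2 / (1 - margCDF μ i x0) with ht1
  have hpos : 0 < 1 - margCDF μ i x0 := by linarith
  have ht1_gt : 1 < t1 := by
    rw [ht1, lt_div_iff₀ hpos]
    linarith
  have hx0lt : ∀ t, t1 ≤ t → x0 < tailQ μ i t := by
    intro t ht
    have ht' : 1 < t := lt_of_lt_of_le ht1_gt ht
    by_contra h
    rw [not_lt, tailQ_le_iff ht'] at h
    have h1 : 1 / t ≤ 1 / t1 := one_div_le_one_div_of_le (by linarith) ht
    have h2 : 1 / t1 = (1 - margCDF μ i x0) / 2 := by rw [ht1, one_div_div]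
    linarith
  have hval : ∀ t, t1 ≤ t → margCDF μ i (tailQ μ i t) = 1 - 1 / t := by
    intro t ht
    have ht' : 1 < t := lt_of_lt_of_le ht1_gt ht
    refine le_antisymm ?_ (le_margCDF_tailQ ht')
    have hmem : tailQ μ i t ∈ {x : ℝ | x0 ≤ x ∧ (x : EReal) ≤ rightEnd μ i} :=
      ⟨(hx0lt t ht).le, hend t ht'⟩
    -- Points to the left of the quantile have values below `1 - 1/t`. Continuity from the left
    -- therefore excludes a jump over this level.
    have hc : ContinuousWithinAt (margCDF μ i) (Set.Ico x0 (tailQ μ i t)) (tailQ μ i t) := by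
      refine (hcont _ hmem).mono fun y hy => ⟨hy.1, ?_⟩
      exact le_trans (by exact_mod_cast hy.2.le) (hend t ht')
    have hne : (𝓝[Set.Ico x0 (tailQ μ i t)] (tailQ μ i t)).NeBot := by
      rw [← mem_closure_iff_nhdsWithin_neBot, closure_Ico (hx0lt t ht).ne]
      exact ⟨(hx0lt t ht).le, le_rfl⟩
    refine le_of_tendsto hc (eventually_nhdsWithin_of_forall fun y hy => ?_)
    by_contra h
    have := (tailQ_le_iff (μ := μ) (i := i) ht' y).2 (not_le.1 h).le
    exact absurd hy.2 this.not_gt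
  refine ⟨t1, ht1_gt, hval, ?_⟩
  intro y hy hFy
  have hpos' : 0 < 1 - margCDF μ i y := by linarith
  have h1 : 1 - 1 / t1 ≤ margCDF μ i y := by
    rw [← hval t1 le_rfl]
    exact margCDF_mono hy
  have ht : t1 ≤ 1 / (1 - margCDF μ i y) := by
    rw [le_div_iff₀ hpos']
    have h2 : 1 - margCDF μ i y ≤ 1 / t1 := by linarith
    have : t1 * (1 - margCDF μ i y) ≤ t1 * (1 / t1) :=
      mul_le_mul_of_nonneg_left h2 (by linarith)
    rwa [mul_one_div_cancel (by linarith)] at this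
  refine ⟨ht, ?_⟩
  have ht' := lt_of_lt_of_le ht1_gt ht
  refine hstrict.injOn ⟨(hx0lt _ ht).le, hend _ ht'⟩
    ⟨((hx0lt t1 le_rfl).le.trans hy), hlt_end y hFy⟩ ?_
  rw [hval _ ht, one_div_one_div]
  ring

lemma measure_Ioi_eq [IsProbabilityMeasure μ] (x : ℝ) :
    margLaw μ i (Set.Ioi x) = ENNReal.ofReal (1 - margCDF μ i x) := by
  have h : margCDF μ i x = (margLaw μ i).real (Set.Iic x) := by
    rw [margCDF_eq, cdf_eq_real]
  rw [h, ← Set.compl_Iic, ← probReal_compl_eq_one_sub measurableSet_Iic, measureReal_def,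
    ENNReal.ofReal_toReal (measure_ne_top _ _)]

/-- Exact tail probabilities at large quantiles. -/
lemma measure_Ici_tailQ [IsProbabilityMeasure μ] {t1 : ℝ} (ht1 : 1 < t1)
    (hval : ∀ t, t1 ≤ t → margCDF μ i (tailQ μ i t) = 1 - 1 / t) {t : ℝ} (ht : t1 < t) :
    margLaw μ i (Set.Ici (tailQ μ i t)) = ENNReal.ofReal (1 / t) := by
  refine le_antisymm ?_ ?_
  -- The closed tail at the quantile of `t` lies in the open tail at that of any `s < t`, whose mass
  -- is exactly `1/s`. Then `s` increases to `t`.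
  · have hc : Tendsto (fun s : ℝ => ENNReal.ofReal (1 / s)) (𝓝[<] t)
        (𝓝 (ENNReal.ofReal (1 / t))) := by
      refine (ENNReal.continuous_ofReal.tendsto _).comp (Tendsto.mono_left ?_ nhdsWithin_le_nhds)
      exact tendsto_const_nhds.div tendsto_id (by linarith)
    refine ge_of_tendsto hc ?_
    filter_upwards [Ioo_mem_nhdsLT ht] with s hs
    have h1 : tailQ μ i s < tailQ μ i t := by
      refine lt_of_le_of_ne (tailQ_mono (by linarith [hs.1]) hs.2.le) fun h => ?_
      have e1 := hval s hs.1.le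
      rw [h, hval t ht.le] at e1
      have : 1 / t < 1 / s := one_div_lt_one_div_of_lt (by linarith [hs.1]) hs.2
      linarith
    calc margLaw μ i (Set.Ici (tailQ μ i t)) ≤ margLaw μ i (Set.Ioi (tailQ μ i s)) :=
          measure_mono fun y hy => lt_of_lt_of_le h1 hy
      _ = _ := by rw [measure_Ioi_eq, hval s hs.1.le, sub_sub_cancel]
  · rw [← sub_sub_cancel 1 (1 / t), ← hval t ht.le, ← measure_Ioi_eq]
    exact measure_mono Set.Ioi_subset_Ici_self

/-- The points with value `1` lie in every tail `[U(t), ∞)`, and such a tail has mass `1/t` for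
large `t`. -/
lemma measure_margCDF_eq_one [IsProbabilityMeasure μ] (hM1 : CondM1 μ) (i : Fin 2) :
    ∀ᵐ y ∂(margLaw μ i), margCDF μ i y < 1 := by
  obtain ⟨t1, ht1, hval, -⟩ := exists_regular_tail hM1 i
  have hsub : ∀ t, t1 < t → margLaw μ i {y | ¬ margCDF μ i y < 1} ≤ ENNReal.ofReal (1 / t) := by
    intro t ht
    rw [← measure_Ici_tailQ ht1 hval ht]
    refine measure_mono fun y hy => ?_
    have hy : ¬ margCDF μ i y < 1 := hy
    have : 0 < 1 / t := by
      have : 0 < t := by linarith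
      positivity
    exact (tailQ_le_iff (by linarith) y).2 (by linarith [not_lt.1 hy])
  have hlim : Tendsto (fun t : ℝ => ENNReal.ofReal (1 / t)) atTop (𝓝 0) := by
    have : Tendsto (fun t : ℝ => 1 / t) atTop (𝓝 0) := by
      simpa using tendsto_inv_atTop_zero (𝕜 := ℝ)
    simpa using ENNReal.tendsto_ofReal this
  refine le_antisymm (ge_of_tendsto hlim ?_) bot_le
  filter_upwards [eventually_gt_atTop t1] with t ht using hsub t ht

/-- If `S` has a largest element, one initial piece is all of `S`. Otherwise countably many initial
pieces with rational endpoints exhaust it. It serves to discard the flat stretches of a distribution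
function. -/
lemma measure_eq_zero_of_inter_Iic {m : Measure ℝ} (S : Set ℝ)
    (hS : ∀ y ∈ S, m (S ∩ Set.Iic y) = 0) : m S = 0 := by
  by_cases hmax : ∃ y ∈ S, ∀ z ∈ S, z ≤ y
  · obtain ⟨y, hy, hmax⟩ := hmax
    have h : S ∩ Set.Iic y = S := Set.inter_eq_left.2 fun z hz => hmax z hz
    rw [← hS y hy, h]
  push Not at hmax
  have hnull : m (⋃ s ∈ {s : ℚ | m (S ∩ Set.Iic (s : ℝ)) = 0}, S ∩ Set.Iic (s : ℝ)) = 0 :=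
    (measure_biUnion_null_iff (Set.to_countable _)).2 fun s hs => hs
  refine measure_mono_null (fun y hy => ?_) hnull
  obtain ⟨z, hz, hyz⟩ := hmax y hy
  obtain ⟨s, hys, hsz⟩ := exists_rat_btwn hyz
  refine Set.mem_biUnion (x := s) ?_ ⟨hy, hys.le⟩
  exact measure_mono_null (Set.inter_subset_inter_right _ (Set.Iic_subset_Iic.2 hsz.le)) (hS z hz)

lemma measure_Iic_eq [IsProbabilityMeasure μ] (x : ℝ) :
    margLaw μ i (Set.Iic x) = ENNReal.ofReal (margCDF μ i x) := by
  rw [margCDF_eq, ofReal_cdf]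

lemma measure_Ioc_eq [IsProbabilityMeasure μ] (x y : ℝ) :
    margLaw μ i (Set.Ioc x y) = ENNReal.ofReal (margCDF μ i y - margCDF μ i x) := by
  rw [margCDF_eq, margCDF_eq, ← StieltjesFunction.measure_Ioc, measure_cdf]

/-- Almost every point is the quantile belonging to its value of the distribution function. -/
lemma ae_tailQ_margCDF [IsProbabilityMeasure μ] (hM1 : CondM1 μ) (i : Fin 2) :
    ∀ᵐ y ∂(margLaw μ i), margCDF μ i y < 1 ∧ 1 < 1 / (1 - margCDF μ i y) ∧
      tailQ μ i (1 / (1 - margCDF μ i y)) = y := by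
  have h0 : ∀ᵐ y ∂(margLaw μ i), margCDF μ i y ≠ 0 := by
    change margLaw μ i {y | ¬ margCDF μ i y ≠ 0} = 0
    refine measure_eq_zero_of_inter_Iic _ fun y hy => ?_
    refine measure_mono_null Set.inter_subset_right ?_
    rw [measure_Iic_eq, not_not.1 hy, ENNReal.ofReal_zero]
  -- An interval `(r, y]` on which `F` is flat has no mass. Rational `r` suffice: if the quantile at
  -- level `F(y)` were below `y`, a rational in between would exhibit a flat stretch ending at `y`.
  have h1 : ∀ᵐ y ∂(margLaw μ i), ∀ r : ℚ, (r : ℝ) < y → margCDF μ i y ≠ margCDF μ i r := by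
    rw [ae_all_iff]
    intro r
    change margLaw μ i {y | ¬ ((r : ℝ) < y → margCDF μ i y ≠ margCDF μ i r)} = 0
    refine measure_eq_zero_of_inter_Iic _ fun y hy => ?_
    have hy : ¬ ((r : ℝ) < y → margCDF μ i y ≠ margCDF μ i r) := hy
    push Not at hy
    refine measure_mono_null (t := Set.Ioc (r : ℝ) y) (fun z hz => ?_) ?_
    · have hz1 : ¬ ((r : ℝ) < z → margCDF μ i z ≠ margCDF μ i r) := hz.1
      push Not at hz1
      exact ⟨hz1.1, hz.2⟩
    · rw [measure_Ioc_eq, hy.2, sub_self, ENNReal.ofReal_zero]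
  filter_upwards [h0, h1, measure_margCDF_eq_one hM1 i] with y hy0 hy1 hy2
  have hpos : 0 < margCDF μ i y := lt_of_le_of_ne (cdf_nonneg _ _) (Ne.symm hy0)
  have hpos' : 0 < 1 - margCDF μ i y := by linarith
  have hgt : 1 < 1 / (1 - margCDF μ i y) := by
    rw [lt_div_iff₀ hpos']
    linarith
  refine ⟨hy2, hgt, le_antisymm ?_ ?_⟩
  · rw [tailQ_le_iff hgt, one_div_one_div]
    linarith
  · by_contra hlt
    obtain ⟨r, hr1, hr2⟩ := exists_rat_btwn (not_le.1 hlt)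
    have h3 := (tailQ_le_iff hgt _).1 hr1.le
    rw [one_div_one_div] at h3
    exact hy1 r hr2 (le_antisymm (by linarith) (margCDF_mono hr2.le))

end Quantile

/-! ### The exponent measure -/

lemma isClosed_quadrant : IsClosed quadrant :=
  (isClosed_le continuous_const continuous_fst).inter (isClosed_le continuous_const continuous_snd)

lemma convex_quadrant : Convex ℝ quadrant := by
  have h1 : Convex ℝ {p : ℝ × ℝ | 0 ≤ p.1} := convex_halfSpace_ge (LinearMap.fst ℝ ℝ ℝ).isLinear 0
  have h2 : Convex ℝ {p : ℝ × ℝ | 0 ≤ p.2} := convex_halfSpace_ge (LinearMap.snd ℝ ℝ ℝ).isLinear 0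
  exact h1.inter h2

section ExponentMeasure

variable {μ ν : Measure (ℝ × ℝ)} {η : ℝ × ℝ → ℝ}

lemma CondD2.apply (hD2 : CondD2 ν η) {B : Set (ℝ × ℝ)} (hB : MeasurableSet B) :
    ν B = ∫⁻ p in B ∩ quadrant, ENNReal.ofReal (η p) := by
  rw [hD2.1, withDensity_apply _ hB, Measure.restrict_restrict hB]

lemma CondD2.absolutelyContinuous (hD2 : CondD2 ν η) : ν ≪ volume := by
  rw [hD2.1]
  exact (withDensity_absolutelyContinuous _ _).trans Measure.absolutelyContinuous_restrict

/-- Boundaries of convex sets are Lebesgue null, so balls and half-quadrants qualify as test sets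
for the exponent measure. -/
lemma CondD2.frontier_eq_zero (hD2 : CondD2 ν η) {B : Set (ℝ × ℝ)} (hB : Convex ℝ B) :
    ν (frontier B) = 0 :=
  hD2.absolutelyContinuous (hB.addHaar_frontier volume)

lemma dilate_mul (s t : ℝ) (B : Set (ℝ × ℝ)) : dilate t (dilate s B) = dilate (t * s) B := by
  unfold dilate
  rw [Set.image_image]
  simp only [mul_assoc]

/-- Along `t * s` and along `t` the same probabilities appear, since `(ts) P{U(tsB)} = s · t P{U(t ·
sB)}`. Uniqueness of limits gives homogeneity of order `-1` on test sets. -/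
lemma IsExponentMeasure.dilate_eq (hν : IsExponentMeasure μ ν) {B : Set (ℝ × ℝ)} {s : ℝ}
    (hs : 0 < s) (hB : MeasurableSet B) (hq : B ⊆ quadrant) (h0 : (0, 0) ∉ closure B)
    (hf : ν (frontier B) = 0) (hB' : MeasurableSet (dilate s B)) (hq' : dilate s B ⊆ quadrant)
    (h0' : (0, 0) ∉ closure (dilate s B)) (hf' : ν (frontier (dilate s B)) = 0) :
    ν B = ENNReal.ofReal s * ν (dilate s B) := by
  have h1 := hν.2 B hB hq h0 hf
  have h2 := hν.2 _ hB' hq' h0' hf'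
  have h3 : Tendsto (fun t : ℝ => t * s) atTop atTop := tendsto_id.atTop_mul_const hs
  refine tendsto_nhds_unique (h1.comp h3) ?_
  refine (ENNReal.Tendsto.const_mul (a := ENNReal.ofReal s) h2
    (Or.inr ENNReal.ofReal_ne_top)).congr' ?_
  filter_upwards [eventually_gt_atTop 0] with t ht
  simp only [Function.comp]
  rw [dilate_mul, ENNReal.ofReal_mul ht.le]
  ring

lemma dilate_closedBall {s : ℝ} (hs : 0 < s) (p : ℝ × ℝ) (r : ℝ) :
    dilate s (Metric.closedBall p r) = Metric.closedBall (s • p) (s * r) := by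
  have := smul_closedBall' hs.ne' p r
  rw [Real.norm_of_nonneg hs.le] at this
  rw [← this]
  rfl

lemma closedBall_subset_pos {p : ℝ × ℝ} {r : ℝ} (h1 : r < p.1) (h2 : r < p.2) :
    Metric.closedBall p r ⊆ {x | 0 < x.1 ∧ 0 < x.2} := by
  intro x hx
  rw [Metric.mem_closedBall, Prod.dist_eq, max_le_iff, Real.dist_eq, Real.dist_eq, abs_le,
    abs_le] at hx
  exact ⟨by linarith, by linarith⟩

lemma pos_subset_quadrant : {x : ℝ × ℝ | 0 < x.1 ∧ 0 < x.2} ⊆ quadrant :=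
  fun _ hx => ⟨hx.1.le, hx.2.le⟩

lemma pos_subset_punctured : {x : ℝ × ℝ | 0 < x.1 ∧ 0 < x.2} ⊆ quadrant \ {(0, 0)} :=
  fun x hx => ⟨⟨hx.1.le, hx.2.le⟩, fun h => by
    have h : x = (0, 0) := h
    rw [h] at hx
    exact lt_irrefl _ hx.1⟩

lemma measure_closedBall_smul (hν : IsExponentMeasure μ ν) (hD2 : CondD2 ν η) {p : ℝ × ℝ}
    {r s : ℝ} (hs : 0 < s) (h1 : r < p.1) (h2 : r < p.2) :
    ν (Metric.closedBall p r) = ENNReal.ofReal s * ν (Metric.closedBall (s • p) (s * r)) := by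
  have hsub := closedBall_subset_pos h1 h2
  have hsub' : Metric.closedBall (s • p) (s * r) ⊆ {x | 0 < x.1 ∧ 0 < x.2} :=
    closedBall_subset_pos (mul_lt_mul_of_pos_left h1 hs) (mul_lt_mul_of_pos_left h2 hs)
  have h := hν.dilate_eq (B := Metric.closedBall p r) hs Metric.isClosed_closedBall.measurableSet
    (hsub.trans pos_subset_quadrant)
    (by rw [Metric.isClosed_closedBall.closure_eq]; exact fun h => lt_irrefl _ (hsub h).1)
    (hD2.frontier_eq_zero (convex_closedBall _ _))
  rw [dilate_closedBall hs] at h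
  exact h Metric.isClosed_closedBall.measurableSet (hsub'.trans pos_subset_quadrant)
    (by rw [Metric.isClosed_closedBall.closure_eq]; exact fun h => lt_irrefl _ (hsub' h).1)
    (hD2.frontier_eq_zero (convex_closedBall _ _))

lemma volume_closedBall_prod (p : ℝ × ℝ) {r : ℝ} (hr : 0 ≤ r) :
    volume (Metric.closedBall p r) = ENNReal.ofReal (4 * r ^ 2) := by
  rw [← closedBall_prod_same, Measure.volume_eq_prod, Measure.prod_prod, Real.volume_closedBall,
    Real.volume_closedBall, ← ENNReal.ofReal_mul (by positivity)]
  congr 1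
  ring

/-- The density of the exponent measure is homogeneous of degree `-3` (one inequality). -/
lemma density_le_smul (hν : IsExponentMeasure μ ν) (hD2 : CondD2 ν η) {p : ℝ × ℝ} {s : ℝ}
    (hs : 0 < s) (h1 : 0 < p.1) (h2 : 0 < p.2) : η p ≤ s ^ 3 * η (s • p) := by
  by_contra hlt
  rw [not_le] at hlt
  -- A gap `s³ η(s p) < a < b < η(p)` persists on a small ball by continuity. The mass of the ball
  -- is then at least `b` times its area. The dilated ball has `s²` times that area and density at
  -- most `a / s³`, so `s` times its mass is too small.
  obtain ⟨b, hb1, hb2⟩ := exists_between hlt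
  obtain ⟨a, ha1, ha2⟩ := exists_between hb1
  have hopen : IsOpen {x : ℝ × ℝ | 0 < x.1 ∧ 0 < x.2} :=
    (isOpen_lt continuous_const continuous_fst).inter (isOpen_lt continuous_const continuous_snd)
  have hcont : ∀ x : ℝ × ℝ, 0 < x.1 → 0 < x.2 → ContinuousAt η x := fun x hx1 hx2 =>
    (hD2.2.1.mono pos_subset_punctured).continuousAt (hopen.mem_nhds ⟨hx1, hx2⟩)
  have hpos : 0 < η (s • p) := hD2.2.2 _ (pos_subset_punctured ⟨mul_pos hs h1, mul_pos hs h2⟩)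
  have ha0 : 0 < a := lt_trans (by positivity) ha1
  have e1 : ∀ᶠ x in 𝓝 p, b < η x := (hcont p h1 h2).eventually (lt_mem_nhds hb2)
  have e2 : ∀ᶠ x in 𝓝 p, s ^ 3 * η (s • x) < a := by
    have hc : ContinuousAt (fun x : ℝ × ℝ => s ^ 3 * η (s • x)) p := by
      refine ContinuousAt.mul continuousAt_const ?_
      refine ContinuousAt.comp (f := fun x : ℝ × ℝ => s • x) (g := η) ?_ ?_
      · exact hcont _ (mul_pos hs h1) (mul_pos hs h2)
      · exact (continuous_const_smul s).continuousAt
    exact hc.eventually (gt_mem_nhds ha1)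
  obtain ⟨ε, hε, hball⟩ := Metric.eventually_nhds_iff_ball.1 (e1.and e2)
  set r : ℝ := min (ε / 2) (min (p.1 / 2) (p.2 / 2)) with hr
  have hr0 : 0 < r := by positivity
  have hrε : r < ε := lt_of_le_of_lt (min_le_left _ _) (by linarith)
  have hr1 : r < p.1 := lt_of_le_of_lt ((min_le_right _ _).trans (min_le_left _ _)) (by linarith)
  have hr2 : r < p.2 := lt_of_le_of_lt ((min_le_right _ _).trans (min_le_right _ _)) (by linarith)
  have hsub := closedBall_subset_pos hr1 hr2
  have hsub' : Metric.closedBall (s • p) (s * r) ⊆ {x | 0 < x.1 ∧ 0 < x.2} :=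
    closedBall_subset_pos (mul_lt_mul_of_pos_left hr1 hs) (mul_lt_mul_of_pos_left hr2 hs)
  have hlow : ENNReal.ofReal (b * (4 * r ^ 2)) ≤ ν (Metric.closedBall p r) := by
    rw [hD2.apply Metric.isClosed_closedBall.measurableSet,
      Set.inter_eq_left.2 (hsub.trans pos_subset_quadrant),
      ENNReal.ofReal_mul (ha0.trans ha2).le, ← volume_closedBall_prod p hr0.le,
      ← setLIntegral_const]
    refine setLIntegral_mono' Metric.isClosed_closedBall.measurableSet fun x hx => ?_
    exact ENNReal.ofReal_le_ofReal (hball x (Metric.closedBall_subset_ball hrε hx)).1.le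
  have hup : ν (Metric.closedBall (s • p) (s * r)) ≤
      ENNReal.ofReal (a / s ^ 3 * (4 * (s * r) ^ 2)) := by
    rw [hD2.apply Metric.isClosed_closedBall.measurableSet,
      Set.inter_eq_left.2 (hsub'.trans pos_subset_quadrant),
      ENNReal.ofReal_mul (by positivity), ← volume_closedBall_prod (s • p) (by positivity),
      ← setLIntegral_const]
    refine setLIntegral_mono' Metric.isClosed_closedBall.measurableSet fun x hx => ?_
    rw [← dilate_closedBall hs] at hx
    obtain ⟨y, hy, rfl⟩ := hx
    have := (hball y (Metric.closedBall_subset_ball hrε hy)).2.le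
    refine ENNReal.ofReal_le_ofReal ?_
    rw [le_div_iff₀ (by positivity), mul_comm]
    exact this
  rw [measure_closedBall_smul hν hD2 hs hr1 hr2] at hlow
  have hfin := hlow.trans (mul_le_mul_right hup (ENNReal.ofReal s))
  rw [← ENNReal.ofReal_mul hs.le, ENNReal.ofReal_le_ofReal_iff (by positivity)] at hfin
  have : s * (a / s ^ 3 * (4 * (s * r) ^ 2)) = a * (4 * r ^ 2) := by
    field_simp
  rw [this] at hfin
  have := le_of_mul_le_mul_right hfin (by positivity)
  linarith

lemma density_smul (hν : IsExponentMeasure μ ν) (hD2 : CondD2 ν η) {p : ℝ × ℝ} {s : ℝ}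
    (hs : 0 < s) (h1 : 0 < p.1) (h2 : 0 < p.2) : η p = s ^ 3 * η (s • p) := by
  refine le_antisymm (density_le_smul hν hD2 hs h1 h2) ?_
  have := density_le_smul hν hD2 (p := s • p) (inv_pos.2 hs) (mul_pos hs h1) (mul_pos hs h2)
  rw [smul_smul, inv_mul_cancel₀ hs.ne', one_smul] at this
  calc s ^ 3 * η (s • p) ≤ s ^ 3 * (s⁻¹ ^ 3 * η p) := by gcongr
    _ = η p := by field_simp

/-- The density bound which all estimates of `ν` rely on. -/
def DensityBound (η : ℝ × ℝ → ℝ) (C : ℝ) : Prop :=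
  0 < C ∧ ∀ p : ℝ × ℝ, 0 < p.1 → 0 < p.2 → η p ≤ C / max p.1 p.2 ^ 3

/-- Homogeneity moves every point of the open quadrant to the unit sphere of the maximum norm. The
part of this sphere in the quadrant is compact and avoids the origin, so `η` is bounded there. -/
lemma exists_densityBound (hν : IsExponentMeasure μ ν) (hD2 : CondD2 ν η) :
    ∃ C, DensityBound η C := by
  have hK : IsCompact (Metric.sphere (0 : ℝ × ℝ) 1 ∩ quadrant) :=
    (isCompact_sphere _ _).inter_right isClosed_quadrant
  obtain ⟨C, hC⟩ := hK.exists_bound_of_continuousOn (f := η) (hD2.2.1.mono fun x hx => ⟨hx.2, by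
    rintro rfl
    have := hx.1
    simp at this⟩)
  refine ⟨max C 1, by positivity, fun p h1 h2 => ?_⟩
  have hm : 0 < max p.1 p.2 := lt_max_of_lt_left h1
  have hn : ‖p‖ = max p.1 p.2 := by
    rw [Prod.norm_def, Real.norm_of_nonneg h1.le, Real.norm_of_nonneg h2.le]
  rw [density_smul hν hD2 (inv_pos.2 hm) h1 h2]
  have h3 := hC ((max p.1 p.2)⁻¹ • p) ⟨by
    rw [mem_sphere_zero_iff_norm, norm_smul, hn, norm_inv, Real.norm_of_nonneg hm.le,
      inv_mul_cancel₀ hm.ne'], ⟨mul_nonneg (inv_pos.2 hm).le h1.le,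
      mul_nonneg (inv_pos.2 hm).le h2.le⟩⟩
  rw [inv_pow, div_eq_inv_mul]
  gcongr
  exact (le_abs_self _).trans (h3.trans (le_max_left _ _))

/-- Exact univariate marginals of the exponent measure. -/
lemma exponentMeasure_marginal [IsProbabilityMeasure μ] (hν : IsExponentMeasure μ ν)
    (hD2 : CondD2 ν η) (hM1 : CondM1 μ) (i : Fin 2) {T : ℝ} (hT : 0 < T) :
    ν {p | p ∈ quadrant ∧ T ≤ coord i p} = ENNReal.ofReal (1 / T) := by
  have hcoord : Continuous (coord i) := by
    unfold coord
    split_ifs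
    · exact continuous_fst
    · exact continuous_snd
  have hclosed : IsClosed {p | p ∈ quadrant ∧ T ≤ coord i p} :=
    isClosed_quadrant.inter (isClosed_le continuous_const hcoord)
  have hconv : Convex ℝ {p | p ∈ quadrant ∧ T ≤ coord i p} := by
    refine convex_quadrant.inter ?_
    unfold coord
    split_ifs
    · exact convex_halfSpace_ge (LinearMap.fst ℝ ℝ ℝ).isLinear T
    · exact convex_halfSpace_ge (LinearMap.snd ℝ ℝ ℝ).isLinear T
  have h1 := hν.2 _ hclosed.measurableSet (fun p hp => hp.1)
    (by
      rw [hclosed.closure_eq]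
      intro h
      have := h.2
      unfold coord at this
      split_ifs at this <;> exact absurd this hT.not_ge)
    (hD2.frontier_eq_zero hconv)
  refine tendsto_nhds_unique h1 (tendsto_const_nhds.congr' ?_)
  obtain ⟨t1, ht1, hval, -⟩ := exists_regular_tail hM1 i
  have hae : ∀ j, ∀ᵐ z ∂μ, margCDF μ j (coord j z) < 1 ∧ 1 < 1 / (1 - margCDF μ j (coord j z)) ∧
      tailQ μ j (1 / (1 - margCDF μ j (coord j z))) = coord j z := by
    intro j
    have := ae_tailQ_margCDF hM1 j
    rw [margLaw_eq_map] at this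
    exact ae_of_ae_map (measurable_coord j).aemeasurable this
  filter_upwards [eventually_gt_atTop (t1 / T), eventually_gt_atTop 0] with t htT ht
  rw [div_lt_iff₀ hT] at htT
  -- Almost surely each coordinate is the quantile at its own level. Up to a null set, the image of
  -- the half-quadrant is therefore a marginal tail event, whose mass is known exactly.
  have hset : μ (imageU μ (dilate t {p | p ∈ quadrant ∧ T ≤ coord i p})) =
      μ (coord i ⁻¹' Set.Ici (tailQ μ i (t * T))) := by
    refine measure_congr ?_
    filter_upwards [hae 0, hae 1] with z hz0 hz1
    refine propext ⟨?_, fun hz => ?_⟩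
    · rintro ⟨_, ⟨p, ⟨-, hpT⟩, rfl⟩, hp1, hp2, rfl⟩
      change tailQ μ i (t * T) ≤ _
      have hle : t * T ≤ t * coord i p := mul_le_mul_of_nonneg_left hpT ht.le
      have := tailQ_mono (μ := μ) (i := i) (by linarith) hle
      refine this.trans (le_of_eq ?_)
      fin_cases i <;> rfl
    · have hz : tailQ μ i (t * T) ≤ coord i z := hz
      have hgt : 1 < t * T := by linarith
      rw [tailQ_le_iff hgt] at hz
      have hzi : margCDF μ i (coord i z) < 1 := by
        fin_cases i
        exacts [hz0.1, hz1.1]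
      have hw : t * T ≤ 1 / (1 - margCDF μ i (coord i z)) := by
        rw [le_div_iff₀ (by linarith)]
        have h4 : 1 - margCDF μ i (coord i z) ≤ 1 / (t * T) := by linarith
        have := mul_le_mul_of_nonneg_left h4 (by linarith : 0 ≤ t * T)
        rwa [mul_one_div_cancel (by linarith)] at this
      refine ⟨(1 / (1 - margCDF μ 0 (coord 0 z)), 1 / (1 - margCDF μ 1 (coord 1 z))),
        ⟨(1 / (1 - margCDF μ 0 (coord 0 z)) / t, 1 / (1 - margCDF μ 1 (coord 1 z)) / t),
        ⟨⟨?_, ?_⟩, ?_⟩, ?_⟩, hz0.2.1, hz1.2.1, ?_⟩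
      · exact div_nonneg (by linarith [hz0.2.1]) ht.le
      · exact div_nonneg (by linarith [hz1.2.1]) ht.le
      · have : T ≤ 1 / (1 - margCDF μ i (coord i z)) / t := by
          rw [le_div_iff₀ ht, mul_comm]
          exact hw
        refine this.trans (le_of_eq ?_)
        fin_cases i <;> rfl
      · simp only [Prod.mk.injEq]
        exact ⟨mul_div_cancel₀ _ ht.ne', mul_div_cancel₀ _ ht.ne'⟩
      · rw [hz0.2.2, hz1.2.2]
        rfl
  rw [hset, ← Measure.map_apply (measurable_coord i) measurableSet_Ici, ← margLaw_eq_map,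
    measure_Ici_tailQ ht1 hval htT, ← ENNReal.ofReal_mul ht.le]
  congr 1
  field_simp

end ExponentMeasure

/-! ### An integrable majorant and the growth conditions at the axes -/

/-- An antitone integrable majorant. -/
noncomputable def majorant (x : ℝ) : ℝ := ((1 + x) * (1 + Real.log (1 + x) ^ 2))⁻¹

lemma majorant_pos {x : ℝ} (hx : 0 ≤ x) : 0 < majorant x := by
  unfold majorant
  positivity

lemma majorant_anti {x y : ℝ} (hx : 0 ≤ x) (hxy : x ≤ y) : majorant y ≤ majorant x := by
  unfold majorant
  have hl : 0 ≤ Real.log (1 + x) := Real.log_nonneg (by linarith)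
  have : Real.log (1 + x) ≤ Real.log (1 + y) := Real.log_le_log (by linarith) (by linarith)
  have hy : 0 ≤ 1 + y := by linarith
  gcongr

lemma measurable_majorant : Measurable majorant := by
  unfold majorant
  fun_prop

/-- An antiderivative is `arctan (log (1 + x))`, which is bounded. The squared logarithm in the
denominator is matched to the one that the growth conditions supply. -/
lemma integrableOn_majorant : IntegrableOn majorant (Set.Ioi 0) := by
  have hderiv : ∀ x ∈ Set.Ici (0 : ℝ),
      HasDerivAt (fun y => Real.arctan (Real.log (1 + y))) (majorant x) x := by
    intro x hx
    have hx : (0 : ℝ) ≤ x := hx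
    have h1 : HasDerivAt (fun y : ℝ => 1 + y) 1 x := (hasDerivAt_id x).const_add 1
    have h2 := (h1.log (by linarith)).arctan
    convert h2 using 1
    unfold majorant
    field_simp
  refine integrableOn_Ioi_deriv_of_nonneg' hderiv (fun x hx => (majorant_pos (le_of_lt hx)).le)
    (l := Real.pi / 2) ?_
  have h3 : Tendsto (fun y : ℝ => Real.log (1 + y)) atTop atTop :=
    Real.tendsto_log_atTop.comp (tendsto_atTop_add_const_left _ _ tendsto_id)
  exact (Real.tendsto_arctan_atTop.mono_right nhdsWithin_le_nhds).comp h3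

lemma lintegral_majorant_lt_top {R : ℝ} (hR : 0 < R) :
    ∫⁻ s in Set.Ioi (0 : ℝ), ENNReal.ofReal (majorant (s / R)) < ⊤ := by
  have h := (integrableOn_Ioi_comp_mul_right_iff majorant 0 (inv_pos.2 hR)).2
    (by simpa using integrableOn_majorant)
  simp only [← div_eq_mul_inv] at h
  exact h.lintegral_lt_top

/-- From `log z ≤ 4 z^(1/4)` one gets `log² z ≤ 16 z^(1/2)`, so a decay of order `3/2` beats the
majorant up to `17 = 1 + 16`. -/
lemma rpow_le_majorant {x : ℝ} (hx : 0 ≤ x) {p : ℝ} (hp : 3 / 2 ≤ p) :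
    (1 + x) ^ (-p) ≤ 17 * majorant x := by
  have h1 : 1 ≤ 1 + x := by linarith
  have h0 : 0 < 1 + x := by linarith
  have hlog : Real.log (1 + x) ≤ 4 * (1 + x) ^ (1 / 4 : ℝ) := by
    have := Real.log_le_rpow_div h0.le (ε := 1 / 4) (by norm_num)
    linarith
  have hl0 : 0 ≤ Real.log (1 + x) := Real.log_nonneg h1
  have hsq : Real.log (1 + x) ^ 2 ≤ 16 * (1 + x) ^ (1 / 2 : ℝ) := by
    calc Real.log (1 + x) ^ 2 ≤ (4 * (1 + x) ^ (1 / 4 : ℝ)) ^ 2 := by gcongr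
      _ = 16 * ((1 + x) ^ (1 / 4 : ℝ)) ^ 2 := by ring
      _ = _ := by
        rw [← Real.rpow_natCast, ← Real.rpow_mul h0.le]
        norm_num
  have hone : 1 ≤ (1 + x) ^ (1 / 2 : ℝ) := Real.one_le_rpow h1 (by norm_num)
  have hden : (1 + x) * (1 + Real.log (1 + x) ^ 2) ≤ 17 * (1 + x) ^ (3 / 2 : ℝ) := by
    calc (1 + x) * (1 + Real.log (1 + x) ^ 2)
        ≤ (1 + x) * ((1 + x) ^ (1 / 2 : ℝ) + 16 * (1 + x) ^ (1 / 2 : ℝ)) := by gcongr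
      _ = 17 * ((1 + x) ^ (1 : ℝ) * (1 + x) ^ (1 / 2 : ℝ)) := by rw [Real.rpow_one]; ring
      _ = _ := by
        rw [← Real.rpow_add h0]
        norm_num
  have hp' : (1 + x) ^ (-p) ≤ (1 + x) ^ (-(3 / 2) : ℝ) :=
    Real.rpow_le_rpow_of_exponent_le h1 (by linarith)
  refine hp'.trans ?_
  rw [Real.rpow_neg h0.le, majorant, ← div_eq_mul_inv, inv_eq_one_div,
    div_le_div_iff₀ (by positivity) (by positivity)]
  linarith

lemma rpow_le_of_comparable {z Q e : ℝ} (hQ : 0 < Q) (h1 : Q / 2 ≤ z) (h2 : z ≤ 2 * Q) :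
    z ^ e ≤ 2 ^ |e| * Q ^ e := by
  have hz : 0 < z := by linarith
  rcases le_total 0 e with he | he
  · rw [abs_of_nonneg he, ← Real.mul_rpow (by norm_num) hQ.le]
    exact Real.rpow_le_rpow hz.le h2 he
  · rw [abs_of_nonpos he]
    calc z ^ e ≤ (Q / 2) ^ e := Real.rpow_le_rpow_of_nonpos (by positivity) h1 he
      _ = _ := by
        rw [Real.div_rpow hQ.le (by norm_num), Real.rpow_neg (by norm_num)]
        field_simp

/-- Growth of `q` (through its inverse) near level `0`: a point `(x, Q)` above the graph of `q`
with small `Q` has a first coordinate that is bounded away from `0` and grows fast enough. -/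
def AxisGrowth (g : ℝ) (q : ℝ → ℝ≥0∞) : Prop :=
  ∃ δ C x0 : ℝ, 0 < δ ∧ δ ≤ Real.exp (-1) ∧ 0 < C ∧ 0 < x0 ∧ ∀ x Q : ℝ, 0 ≤ x → 0 < Q → Q < δ →
    q x ≤ ENNReal.ofReal Q → x0 ≤ x ∧ Q ^ ((1 - g) / 2) * |Real.log Q| ≤ C * x

lemma one_le_abs_log {Q : ℝ} (hQ : 0 < Q) (h : Q < Real.exp (-1)) : 1 ≤ |Real.log Q| := by
  have : Real.log Q ≤ -1 := by
    rw [← Real.log_exp (-1)]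
    exact Real.log_le_log hQ h.le
  rw [abs_of_neg (by linarith)]
  linarith

/-- Squaring the growth condition turns the exponent `(1 - g)/2` into `1 - g` and leaves a factor
`log² Q` in the denominator, which makes the borderline case integrable. -/
lemma AxisGrowth.sq_le {g δ C x Q : ℝ} (hQ : 0 < Q) (hδ : δ ≤ Real.exp (-1))
    (hQδ : Q < δ) (h : Q ^ ((1 - g) / 2) * |Real.log Q| ≤ C * x) :
    Q ^ (1 - g) ≤ C ^ 2 * x ^ 2 / Real.log Q ^ 2 := by
  have hl := one_le_abs_log hQ (hQδ.trans_le hδ)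
  have hl2 : 0 < Real.log Q ^ 2 := by
    rw [← sq_abs]
    positivity
  rw [le_div_iff₀ hl2]
  have e : Q ^ (1 - g) = (Q ^ ((1 - g) / 2)) ^ 2 := by
    rw [← Real.rpow_natCast, ← Real.rpow_mul hQ.le]
    congr 1
    push_cast
    ring
  rw [e, ← sq_abs (Real.log Q), ← mul_pow, ← mul_pow]
  have h0 : 0 ≤ Q ^ ((1 - g) / 2) * |Real.log Q| := by positivity
  gcongr

/-- The strips near the axes are negligible. -/
lemma AxisGrowth.strip_le {g : ℝ} {q : ℝ → ℝ≥0∞} (h : AxisGrowth g q) (R : ℝ) (hR : 0 < R) :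
    ∃ K κ0 : ℝ, 0 < K ∧ 0 < κ0 ∧ ∀ κ x Q : ℝ, 0 < κ → κ < κ0 → 0 ≤ x → 0 < Q →
      Q ≤ R * κ ^ (1 / max g 1) → q x ≤ ENNReal.ofReal Q → 0 < x ∧ Q / x ^ 2 ≤ K * κ := by
  obtain ⟨δ, C, x0, hδ, hδe, hC, hx0, H⟩ := h
  have hm : 0 < max g 1 := lt_max_of_lt_right one_pos
  have hlim : Tendsto (fun κ : ℝ => R * κ ^ (1 / max g 1)) (𝓝 0) (𝓝 0) := by
    have h1 : ContinuousAt (fun κ : ℝ => R * κ ^ (1 / max g 1)) 0 :=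
      continuousAt_const.mul (Real.continuousAt_rpow_const _ _ (Or.inr (by positivity)))
    have h2 := h1.tendsto
    rwa [Real.zero_rpow (by positivity), mul_zero] at h2
  obtain ⟨κ0, hκ0, hball⟩ := Metric.eventually_nhds_iff.1 (hlim.eventually (gt_mem_nhds hδ))
  refine ⟨R / x0 ^ 2 + C ^ 2 * R ^ g, κ0, by positivity, hκ0, fun κ x Q hκ hκ' hx hQ hQu hq => ?_⟩
  have hQδ : Q < δ := lt_of_le_of_lt hQu (hball (by rw [Real.dist_eq, sub_zero, abs_of_pos hκ]
                                                    exact hκ'))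
  obtain ⟨hx0x, hgr⟩ := H x Q hx hQ hQδ hq
  have hxpos : 0 < x := hx0.trans_le hx0x
  refine ⟨hxpos, ?_⟩
  -- For `g ≤ 1` the width `Q` is itself `O(κ)` and `x` stays away from `0`. For `g > 1` one factors
  -- `Q = Q^g · Q^(1-g)`: the first factor is `O(κ)` and the second is `O(x²)` by the growth
  -- condition.
  rcases le_total g 1 with hg | hg
  · rw [max_eq_right hg, div_one, Real.rpow_one] at hQu
    calc Q / x ^ 2 ≤ (R * κ) / x0 ^ 2 := by gcongr
      _ = R / x0 ^ 2 * κ := by ring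
      _ ≤ _ := by
        gcongr
        linarith [show 0 ≤ C ^ 2 * R ^ g by positivity]
  · rw [max_eq_left hg] at hQu
    have hsq := AxisGrowth.sq_le hQ hδe hQδ hgr
    have hl := one_le_abs_log hQ (hQδ.trans_le hδe)
    have hl2 : 1 ≤ Real.log Q ^ 2 := by
      rw [← sq_abs]
      nlinarith
    have h3 : Q ^ (1 - g) ≤ C ^ 2 * x ^ 2 := hsq.trans (div_le_self (by positivity) hl2)
    have h4 : Q = Q ^ g * Q ^ (1 - g) := by
      rw [← Real.rpow_add hQ, add_sub_cancel, Real.rpow_one]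
    have h5 : Q ^ g ≤ R ^ g * κ := by
      calc Q ^ g ≤ (R * κ ^ (1 / g)) ^ g := Real.rpow_le_rpow hQ.le hQu (by linarith)
        _ = R ^ g * κ := by
          rw [Real.mul_rpow hR.le (by positivity), ← Real.rpow_mul hκ.le,
            one_div_mul_cancel (by linarith), Real.rpow_one]
    rw [div_le_iff₀ (by positivity)]
    calc Q = Q ^ g * Q ^ (1 - g) := h4
      _ ≤ (R ^ g * κ) * (C ^ 2 * x ^ 2) := by gcongr
      _ = (C ^ 2 * R ^ g) * κ * x ^ 2 := by ring
      _ ≤ _ := by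
        gcongr
        linarith [show 0 ≤ R / x0 ^ 2 by positivity]

/-- The lower bound `c0` makes `max x Q` comparable with `1 + x` from below, and the remaining decay
`3 - e` is at least `3/2`. -/
lemma div_max_pow_le {x Q e c0 : ℝ} (hx : 0 < x) (hc0 : 0 < c0) (hc : c0 ≤ max x Q)
    (he : 0 ≤ e) (he' : e ≤ 3 / 2) :
    max x Q ^ e / max x Q ^ 3 ≤ 17 * ((1 + c0⁻¹) ^ (3 : ℝ)) * majorant x := by
  have hM : 0 < max x Q := lt_max_of_lt_left hx
  set M := max x Q with hMdef
  have h1 : 1 + x ≤ (1 + c0⁻¹) * M := by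
    have : 1 ≤ c0⁻¹ * M := by
      rw [inv_mul_eq_div, le_div_iff₀ hc0, one_mul]
      exact hc
    have : x ≤ M := le_max_left _ _
    linarith
  have h2 : M ^ e / M ^ 3 = M ^ (-(3 - e)) := by
    rw [← Real.rpow_natCast M 3, ← Real.rpow_sub hM]
    congr 1
    push_cast
    ring
  rw [h2]
  have h3 : (0 : ℝ) < 1 + c0⁻¹ := by positivity
  calc M ^ (-(3 - e)) = (1 + c0⁻¹) ^ (3 - e) * ((1 + c0⁻¹) * M) ^ (-(3 - e)) := by
        rw [Real.mul_rpow h3.le hM.le, ← mul_assoc, ← Real.rpow_add h3, add_neg_cancel,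
          Real.rpow_zero, one_mul]
    _ ≤ (1 + c0⁻¹) ^ (3 : ℝ) * (1 + x) ^ (-(3 - e)) := by
        gcongr ?_ * ?_
        · exact Real.rpow_le_rpow_of_exponent_le (by linarith [inv_pos.2 hc0]) (by linarith)
        · exact Real.rpow_le_rpow_of_nonpos (by linarith) h1 (by linarith)
    _ ≤ (1 + c0⁻¹) ^ (3 : ℝ) * (17 * majorant x) := by
        gcongr
        exact rpow_le_majorant hx.le (by linarith)
    _ = _ := by ring

/-- The perturbation of the boundary of the failure set, weighted with the density bound, is
dominated by the integrable majorant. -/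
lemma AxisGrowth.le_majorant {g : ℝ} {q : ℝ → ℝ≥0∞} (h : AxisGrowth g q) :
    ∃ D : ℝ, 0 < D ∧ ∀ x Q : ℝ, 0 < x → 0 < Q → q x ≤ ENNReal.ofReal Q →
      (Q ^ (1 - max g (1 / 2)) + Q ^ (3 / 2 : ℝ)) / max x Q ^ 3 ≤ D * majorant x := by
  obtain ⟨δ, C, x0, hδ, hδe, hC, hx0, H⟩ := h
  obtain ⟨m, hm⟩ : ∃ m, m = max g (1 / 2) := ⟨_, rfl⟩
  rw [← hm]
  have hm2 : 1 / 2 ≤ m := hm ▸ le_max_right _ _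
  obtain ⟨c0, hc0⟩ : ∃ c0, c0 = min x0 δ := ⟨_, rfl⟩
  have hc0pos : 0 < c0 := hc0 ▸ lt_min hx0 hδ
  obtain ⟨B, hB⟩ : ∃ B, B = 17 * ((1 + c0⁻¹) ^ (3 : ℝ)) := ⟨_, rfl⟩
  have hBpos : 0 < B := by rw [hB]; positivity
  obtain ⟨E, hE⟩ : ∃ E, E = 4 * C ^ 2 * ((g - 1) ^ 2 + 1) * (1 + x0⁻¹) := ⟨_, rfl⟩
  have hE0 : 0 < E := by rw [hE]; positivity
  refine ⟨2 * B + δ ^ (1 - m) * B + E, by positivity, fun x Q hx hQ hq => ?_⟩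
  have hmaj := majorant_pos hx.le
  have hM : 0 < max x Q := lt_max_of_lt_left hx
  have hcM : c0 ≤ max x Q := by
    by_cases hQδ : Q < δ
    · exact hc0 ▸ (min_le_left _ _).trans ((H x Q hx.le hQ hQδ hq).1.trans (le_max_left _ _))
    · exact hc0 ▸ (min_le_right _ _).trans ((not_lt.1 hQδ).trans (le_max_right _ _))
  have hdiv : ∀ {e : ℝ}, 0 ≤ e → e ≤ 3 / 2 → max x Q ^ e / max x Q ^ 3 ≤ B * majorant x :=
    fun he he' => hB ▸ div_max_pow_le hx hc0pos hcM he he'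
  have hlarge : Q ^ (3 / 2 : ℝ) / max x Q ^ 3 ≤ B * majorant x := by
    refine le_trans ?_ (hdiv (e := 3 / 2) (by norm_num) (by norm_num))
    gcongr
    exact le_max_right _ _
  have hconst : 1 / max x Q ^ 3 ≤ B * majorant x := by
    have := hdiv (e := 0) (by norm_num) (by norm_num)
    rwa [Real.rpow_zero] at this
  have hsmall : Q ^ (1 - m) / max x Q ^ 3 ≤ (B + δ ^ (1 - m) * B + E) * majorant x := by
    have hEpos : 0 ≤ E * majorant x := by positivity
    have hδB : 0 ≤ δ ^ (1 - m) * B * majorant x := by positivity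
    have hB0 : 0 ≤ B * majorant x := by positivity
    have hsplit : (B + δ ^ (1 - m) * B + E) * majorant x =
      B * majorant x + δ ^ (1 - m) * B * majorant x + E * majorant x := by ring
    rw [hsplit]
    -- Only small `Q` with `m > 1` is delicate, as `Q ^ (1 - m)` is then unbounded. In all other
    -- cases the numerator is bounded or at most the square root of `max x Q`, and cubic decay
    -- suffices.
    rcases le_total 1 Q with hQ1 | hQ1
    · have : Q ^ (1 - m) / max x Q ^ 3 ≤ B * majorant x := by
        refine le_trans ?_ (hdiv (e := 1 / 2) (by norm_num) (by norm_num))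
        gcongr
        calc Q ^ (1 - m) ≤ Q ^ (1 / 2 : ℝ) :=
              Real.rpow_le_rpow_of_exponent_le hQ1 (by linarith)
          _ ≤ _ := Real.rpow_le_rpow hQ.le (le_max_right _ _) (by norm_num)
      linarith
    rcases le_total m 1 with hm1 | hm1
    · have : Q ^ (1 - m) / max x Q ^ 3 ≤ B * majorant x := by
        refine le_trans ?_ hconst
        gcongr
        exact Real.rpow_le_one hQ.le hQ1 (by linarith)
      linarith
    rcases le_or_gt δ Q with hQδ | hQδ
    · have : Q ^ (1 - m) / max x Q ^ 3 ≤ δ ^ (1 - m) * (B * majorant x) := by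
        rw [div_eq_mul_one_div]
        have hp : Q ^ (1 - m) ≤ δ ^ (1 - m) :=
          Real.rpow_le_rpow_of_nonpos hδ hQδ (by linarith)
        exact mul_le_mul hp hconst (by positivity) (by positivity)
      rw [← mul_assoc] at this
      linarith
    · obtain ⟨hx0x, hgr⟩ := H x Q hx.le hQ hQδ hq
      rcases eq_or_lt_of_le hm1 with hm1 | hm1
      · have hone : Q ^ (1 - m) = 1 := by rw [← hm1, sub_self, Real.rpow_zero]
        rw [hone]
        linarith
      have hgm : m = g := by
        rcases max_choice g (1 / 2) with h' | h'
        · rw [hm, h']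
        · rw [hm, h'] at hm1
          norm_num at hm1
      have hx1 : (0 : ℝ) < 1 + x := by linarith
      -- Above this threshold, `Q ^ (1 - m) ≤ 1 + x` and the cubic decay is enough. Below it, `|log
      -- Q|` is at least `log (1 + x) / (m - 1)`, and the squared logarithm from the growth
      -- condition yields the majorant.
      rcases le_total ((1 + x) ^ (-(1 / (m - 1)))) Q with hcase | hcase
      · have h1 : Q ^ (1 - m) ≤ 1 + x := by
          calc Q ^ (1 - m) ≤ ((1 + x) ^ (-(1 / (m - 1)))) ^ (1 - m) :=
                Real.rpow_le_rpow_of_nonpos (by positivity) hcase (by linarith)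
            _ = 1 + x := by
              rw [← Real.rpow_mul hx1.le]
              have hne : m - 1 ≠ 0 := by linarith
              have : -(1 / (m - 1)) * (1 - m) = 1 := by
                field_simp
                ring
              rw [this, Real.rpow_one]
        have h2 : Q ^ (1 - m) / max x Q ^ 3 ≤ B * majorant x + B * majorant x := by
          calc Q ^ (1 - m) / max x Q ^ 3 ≤ (1 + max x Q ^ (1 : ℝ)) / max x Q ^ 3 := by
                gcongr
                rw [Real.rpow_one]
                linarith [le_max_left x Q]
            _ = 1 / max x Q ^ 3 + max x Q ^ (1 : ℝ) / max x Q ^ 3 := by rw [add_div]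
            _ ≤ _ := add_le_add hconst
                (hdiv (e := 1) (by norm_num) (by norm_num))
        have h3 : 1 ≤ δ ^ (1 - m) :=
          Real.one_le_rpow_of_pos_of_le_one_of_nonpos hδ
            (hδe.trans (by rw [Real.exp_le_one_iff]; norm_num)) (by linarith)
        have h4 : B * majorant x ≤ δ ^ (1 - m) * B * majorant x := by
          rw [mul_assoc]
          exact le_mul_of_one_le_left hB0 h3
        linarith
      · have hsq := AxisGrowth.sq_le hQ hδe hQδ hgr
        rw [← hgm] at hsq
        have hl := one_le_abs_log hQ (hQδ.trans_le hδe)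
        have hlog0 : 0 ≤ Real.log (1 + x) := Real.log_nonneg (by linarith)
        have hlogx : Real.log (1 + x) ≤ (m - 1) * |Real.log Q| := by
          have h1 : Real.log Q ≤ -(1 / (m - 1)) * Real.log (1 + x) := by
            rw [← Real.log_rpow hx1]
            exact Real.log_le_log hQ hcase
          have h2 : -Real.log Q ≤ |Real.log Q| := neg_le_abs _
          have h3 : (1 / (m - 1)) * Real.log (1 + x) ≤ |Real.log Q| := by linarith
          rwa [one_div, inv_mul_le_iff₀ (by linarith)] at h3
        have hL : 1 + Real.log (1 + x) ^ 2 ≤ ((g - 1) ^ 2 + 1) * Real.log Q ^ 2 := by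
          rw [← sq_abs (Real.log Q), ← hgm]
          have : Real.log (1 + x) ^ 2 ≤ ((m - 1) * |Real.log Q|) ^ 2 := by gcongr
          nlinarith
        have hxx : 1 + x ≤ (1 + x0⁻¹) * x := by
          have : 1 ≤ x0⁻¹ * x := by
            rw [inv_mul_eq_div, le_div_iff₀ hx0, one_mul]
            exact hx0x
          linarith
        have hlogpos : 0 < Real.log Q ^ 2 := by
          rw [← sq_abs]
          positivity
        have hmain : Q ^ (1 - m) / max x Q ^ 3 ≤ E * majorant x := by
          calc Q ^ (1 - m) / max x Q ^ 3 ≤ (C ^ 2 * x ^ 2 / Real.log Q ^ 2) / x ^ 3 := by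
                gcongr
                exact le_max_left _ _
            _ = C ^ 2 * (x * Real.log Q ^ 2)⁻¹ := by
                field_simp
            _ ≤ C ^ 2 * (((g - 1) ^ 2 + 1) * (1 + x0⁻¹) * majorant x) := by
                gcongr
                rw [majorant, ← div_eq_mul_inv, inv_eq_one_div,
                  div_le_div_iff₀ (by positivity) (by positivity), one_mul]
                calc (1 + x) * (1 + Real.log (1 + x) ^ 2)
                    ≤ ((1 + x0⁻¹) * x) * (((g - 1) ^ 2 + 1) * Real.log Q ^ 2) := by gcongr
                  _ = _ := by ring
            _ = (1 / 4) * (E * majorant x) := by rw [hE]; ring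
            _ ≤ _ := by linarith
        linarith
  rw [add_div]
  calc _ ≤ (B + δ ^ (1 - m) * B + E) * majorant x + B * majorant x := add_le_add hsmall hlarge
    _ = _ := by ring

/-! ### Mass near the boundary of the failure set -/

lemma measurableSet_quadrant : MeasurableSet quadrant := isClosed_quadrant.measurableSet

lemma restrict_quadrant : (volume.restrict quadrant : Measure (ℝ × ℝ)) =
    (volume.restrict (Set.Ioi (0 : ℝ))).prod (volume.restrict (Set.Ioi (0 : ℝ))) := by
  have h : quadrant = Set.Ici (0 : ℝ) ×ˢ Set.Ici (0 : ℝ) := rfl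
  rw [h, Measure.volume_eq_prod, ← Measure.prod_restrict, Measure.restrict_congr_set
    (Ioi_ae_eq_Ici (a := (0 : ℝ)))]

/-- The upper bound for the density of the exponent measure. -/
noncomputable def kernel (C : ℝ) (p : ℝ × ℝ) : ℝ≥0∞ := ENNReal.ofReal (C / max p.1 p.2 ^ 3)

lemma measurable_kernel (C : ℝ) : Measurable (kernel C) := by
  unfold kernel
  fun_prop

lemma kernel_swap (C : ℝ) (p : ℝ × ℝ) : kernel C p.swap = kernel C p := by
  unfold kernel
  rw [Prod.fst_swap, Prod.snd_swap, max_comm]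

lemma restrict_quadrant' : (volume.restrict quadrant : Measure (ℝ × ℝ)) =
    volume.restrict (Set.Ioi (0 : ℝ) ×ˢ Set.Ioi (0 : ℝ)) := by
  rw [restrict_quadrant, Measure.prod_restrict, Measure.volume_eq_prod]

lemma ae_pos_of_quadrant : ∀ᵐ p ∂(volume.restrict quadrant : Measure (ℝ × ℝ)),
    0 < p.1 ∧ 0 < p.2 := by
  rw [restrict_quadrant']
  exact ae_restrict_mem (measurableSet_Ioi.prod measurableSet_Ioi)

/-- The mass of `W` under the upper bound for the density. -/
noncomputable def kernelMass (C : ℝ) (W : Set (ℝ × ℝ)) : ℝ≥0∞ :=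
  ∫⁻ s in Set.Ioi (0 : ℝ), ∫⁻ t in Set.Ioi (0 : ℝ), W.indicator (kernel C) (s, t)

section Mass

variable {ν : Measure (ℝ × ℝ)} {η : ℝ × ℝ → ℝ} {C : ℝ}

lemma CondD2.le_lintegral (hD2 : CondD2 ν η) (hb : DensityBound η C) {W : Set (ℝ × ℝ)}
    (hW : MeasurableSet W) :
    ν W ≤ ∫⁻ p in quadrant, W.indicator (kernel C) p := by
  rw [hD2.1, withDensity_apply _ hW, ← lintegral_indicator hW]
  refine lintegral_mono_ae ?_
  filter_upwards [ae_pos_of_quadrant] with p hp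
  exact Set.indicator_le_indicator (ENNReal.ofReal_le_ofReal (hb.2 p hp.1 hp.2))

lemma CondD2.le_kernelMass (hD2 : CondD2 ν η) (hb : DensityBound η C) {W : Set (ℝ × ℝ)}
    (hW : MeasurableSet W) : ν W ≤ kernelMass C W := by
  refine (hD2.le_lintegral hb hW).trans (le_of_eq ?_)
  rw [restrict_quadrant, lintegral_prod _ ((measurable_kernel C).indicator hW).aemeasurable]
  rfl

/-- The kernel is symmetric, so integrating in the other order amounts to reflecting `W`. Estimates
along one axis thus serve for the other one as well. -/
lemma CondD2.le_kernelMass_swap (hD2 : CondD2 ν η) (hb : DensityBound η C) {W : Set (ℝ × ℝ)}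
    (hW : MeasurableSet W) : ν W ≤ kernelMass C (Prod.swap ⁻¹' W) := by
  refine (hD2.le_lintegral hb hW).trans (le_of_eq ?_)
  rw [restrict_quadrant, lintegral_prod_symm _ ((measurable_kernel C).indicator hW).aemeasurable]
  unfold kernelMass
  refine lintegral_congr fun s => lintegral_congr fun t => ?_
  by_cases h : ((t, s) : ℝ × ℝ) ∈ W
  · rw [Set.indicator_of_mem h, Set.indicator_of_mem (by exact h), ← kernel_swap]
    rfl
  · rw [Set.indicator_of_notMem h, Set.indicator_of_notMem (by exact h)]

/-- On the strip the kernel is at most `C t^(-3)`. Integration over `t` beyond `b` gives less than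
`C / b²`, and the first coordinate contributes the width. -/
lemma kernelMass_strip_le (hC : 0 < C) {a b : ℝ} (hb : 0 < b) :
    kernelMass C {p | p.1 ≤ a ∧ b ≤ p.2} ≤ ENNReal.ofReal (C * a / b ^ 2) := by
  have hint : ∫⁻ t in Set.Ioi b, ENNReal.ofReal (C * t ^ (-3 : ℝ)) ≤ ENNReal.ofReal (C / b ^ 2) := by
    rw [← ofReal_integral_eq_lintegral_ofReal
      ((integrableOn_Ioi_rpow_of_lt (by norm_num) hb).const_mul C)
      ((ae_restrict_iff' measurableSet_Ioi).2 (Eventually.of_forall fun t ht => by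
        have : 0 < t := hb.trans ht
        positivity)), integral_const_mul, integral_Ioi_rpow_of_lt (by norm_num) hb]
    refine ENNReal.ofReal_le_ofReal ?_
    have e : b ^ (-3 + 1 : ℝ) = (b ^ 2)⁻¹ := by
      rw [← Real.rpow_natCast, ← Real.rpow_neg hb.le]
      norm_num
    rw [e]
    have : 0 < C / b ^ 2 := by positivity
    calc C * (-(b ^ 2)⁻¹ / (-3 + 1)) = (C / b ^ 2) / 2 := by ring
      _ ≤ _ := by linarith
  calc kernelMass C {p | p.1 ≤ a ∧ b ≤ p.2}
      ≤ ∫⁻ s in Set.Ioi (0 : ℝ), (Set.Iic a).indicator (fun _ => ENNReal.ofReal (C / b ^ 2)) s := by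
        refine setLIntegral_mono' measurableSet_Ioi fun s hs => ?_
        by_cases hsa : s ≤ a
        · rw [Set.indicator_of_mem (show s ∈ Set.Iic a from hsa)]
          refine le_trans ?_ hint
          have hb' : ∫⁻ t in Set.Ioi b, ENNReal.ofReal (C * t ^ (-3 : ℝ)) =
              ∫⁻ t in Set.Ici b, ENNReal.ofReal (C * t ^ (-3 : ℝ)) := by
            rw [Measure.restrict_congr_set Ioi_ae_eq_Ici]
          rw [hb', ← lintegral_indicator measurableSet_Ici]
          refine le_trans (setLIntegral_le_lintegral _ _) (lintegral_mono fun t => ?_)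
          by_cases ht : b ≤ t
          · have ht0 : 0 < t := hb.trans_le ht
            rw [Set.indicator_of_mem (show t ∈ Set.Ici b from ht)]
            refine (Set.indicator_le_self _ _ _).trans (ENNReal.ofReal_le_ofReal ?_)
            rw [Real.rpow_neg ht0.le, ← div_eq_mul_inv]
            have : t ≤ max s t := le_max_right _ _
            have e : t ^ (3 : ℝ) = t ^ 3 := by
              rw [← Real.rpow_natCast]
              norm_num
            rw [e]
            gcongr
          · rw [Set.indicator_of_notMem (fun h => ht h.2)]
            exact bot_le
        · have : ∀ t, Set.indicator {p : ℝ × ℝ | p.1 ≤ a ∧ b ≤ p.2} (kernel C) (s, t) = 0 :=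
            fun t => Set.indicator_of_notMem (fun h => hsa h.1) _
          simp [this]
    _ = ENNReal.ofReal (C / b ^ 2) * ENNReal.ofReal a := by
        rw [lintegral_indicator measurableSet_Iic, lintegral_const, Measure.restrict_restrict
          measurableSet_Iic, Measure.restrict_apply_univ, Set.Iic_inter_Ioi, Real.volume_Ioc, sub_zero]
    _ = _ := by
        rw [← ENNReal.ofReal_mul (by positivity)]
        congr 1
        ring

lemma CondD2.strip_le (hD2 : CondD2 ν η) (hC : DensityBound η C) {a b : ℝ} (hb : 0 < b) : ν {p | p.1 ≤ a ∧ b ≤ p.2} ≤ ENNReal.ofReal (C * a / b ^ 2) := by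
  refine (hD2.le_kernelMass hC ?_).trans (kernelMass_strip_le hC.1 hb)
  exact (measurableSet_le measurable_fst measurable_const).inter
    (measurableSet_le measurable_const measurable_snd)

lemma CondD2.strip_le_swap (hD2 : CondD2 ν η) (hC : DensityBound η C) {a b : ℝ} (hb : 0 < b) : ν {p | p.2 ≤ a ∧ b ≤ p.1} ≤ ENNReal.ofReal (C * a / b ^ 2) := by
  refine (hD2.le_kernelMass_swap hC ?_).trans (kernelMass_strip_le hC.1 hb)
  exact (measurableSet_le measurable_snd measurable_const).inter
    (measurableSet_le measurable_const measurable_fst)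

end Mass

/-- Points near the graph of `q ∘ w` carry little mass. -/
lemma AxisGrowth.kernelMass_le {g C r R K : ℝ} {q : ℝ → ℝ≥0∞} (hg : AxisGrowth g q)
    (hq : AntitoneOn q (Set.Ici 0)) (hC : 0 < C) (hr : 0 < r) (hrR : r ≤ R) (hK : 0 < K) :
    ∃ C' : ℝ, 0 < C' ∧ ∀ κ l1 l2 : ℝ, 0 < κ → l1 ∈ Set.Icc r R → l2 ∈ Set.Icc r R →
      ∀ w : ℝ → ℝ, Measurable w → (∀ s, 0 < s → s / l1 / 2 ≤ w s ∧ w s ≤ 2 * (s / l1)) →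
      ∃ W : Set (ℝ × ℝ), MeasurableSet W ∧ kernelMass C W ≤ ENNReal.ofReal (C' * κ) ∧
        ∀ s t Q : ℝ, 0 < s → 0 < t → q (w s) = ENNReal.ofReal Q → 0 < Q → Q / 2 ≤ t / l2 →
          |t / l2 - Q| ≤ K * κ * (Q ^ (1 - max g (1 / 2)) + Q ^ (3 / 2 : ℝ)) → (s, t) ∈ W := by
  obtain ⟨D, hD, hmaj⟩ := hg.le_majorant
  have hR : 0 < R := hr.trans_le hrR
  set I : ℝ≥0∞ := ∫⁻ s in Set.Ioi (0 : ℝ), ENNReal.ofReal (majorant (s / (2 * R))) with hI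
  have hIfin : I < ⊤ := lintegral_majorant_lt_top (by positivity)
  obtain ⟨B, hB⟩ : ∃ B, B = C * (2 / r) ^ 3 * (2 * R * K) * D := ⟨_, rfl⟩
  have hBpos : 0 < B := by
    rw [hB]
    positivity
  refine ⟨B * (I.toReal + 1), by positivity, fun κ l1 l2 hκ hl1 hl2 w hw hwb => ?_⟩
  have hl1p : 0 < l1 := hr.trans_le hl1.1
  have hl2p : 0 < l2 := hr.trans_le hl2.1
  -- The value `⊤` on the negative axis makes the function antitone on the whole line and hence
  -- measurable. It is only evaluated at `w s > 0`, where nothing changes.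
  set q' : ℝ → ℝ≥0∞ := fun x => if x < 0 then ⊤ else q x with hq'
  have hq'anti : Antitone q' := by
    intro x y hxy
    simp only [hq']
    split_ifs with h1 h2 h2
    · exact le_rfl
    · exact absurd (lt_of_le_of_lt hxy h1) h2
    · exact le_top
    · exact hq (not_lt.1 h2) (not_lt.1 h1) hxy
  set F : ℝ → ℝ := fun s => (q' (w s)).toReal with hF
  have hFm : Measurable F := (hq'anti.measurable.comp hw).ennreal_toReal
  set H : ℝ → ℝ := fun s => K * κ * (F s ^ (1 - max g (1 / 2)) + F s ^ (3 / 2 : ℝ)) with hH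
  have hHm : Measurable H := by
    simp only [hH]
    fun_prop
  -- A vertical tube around the graph of `F`. Its section over `s` lies in an interval of length `2
  -- l2 H(s)`.
  set W : Set (ℝ × ℝ) := {p | (q' (w p.1) ≠ ⊤ ∧ 0 < F p.1) ∧ (F p.1 / 2 ≤ p.2 / l2 ∧
    |p.2 / l2 - F p.1| ≤ H p.1)} with hWdef
  refine ⟨W, ?_, ?_, ?_⟩
  · refine MeasurableSet.inter (MeasurableSet.inter ?_ ?_) (MeasurableSet.inter ?_ ?_)
    · exact ((hq'anti.measurable.comp hw).comp measurable_fst) (measurableSet_singleton _).compl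
    · exact measurableSet_lt measurable_const (hFm.comp measurable_fst)
    · exact measurableSet_le (f := fun p : ℝ × ℝ => F p.1 / 2) (g := fun p : ℝ × ℝ => p.2 / l2)
        (by fun_prop) (by fun_prop)
    · exact measurableSet_le (f := fun p : ℝ × ℝ => |p.2 / l2 - F p.1|)
        (g := fun p : ℝ × ℝ => H p.1) (by fun_prop) (by fun_prop)
  · calc kernelMass C W ≤ ∫⁻ s in Set.Ioi (0 : ℝ),
          ENNReal.ofReal (B * κ) * ENNReal.ofReal (majorant (s / (2 * R))) := by
          refine setLIntegral_mono' measurableSet_Ioi fun s hs => ?_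
          have hs : 0 < s := hs
          by_cases hA : q' (w s) ≠ ⊤ ∧ 0 < F s
          swap
          · have : ∀ t, W.indicator (kernel C) (s, t) = 0 :=
              fun t => Set.indicator_of_notMem (fun h => hA h.1) _
            simp [this]
          obtain ⟨hfin, hQ⟩ := hA
          have hws : 0 < w s := lt_of_lt_of_le (by positivity) (hwb s hs).1
          have hqw : q (w s) ≤ ENNReal.ofReal (F s) := by
            rw [hF, ENNReal.ofReal_toReal hfin, hq']
            simp only
            rw [if_neg hws.le.not_gt]
          have hM : 0 < max (w s) (F s) := lt_max_of_lt_left hws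
          have hm1 := hmaj (w s) (F s) hws hQ hqw
          have hm2 : majorant (w s) ≤ majorant (s / (2 * R)) := by
            refine majorant_anti (by positivity) (le_trans ?_ (hwb s hs).1)
            rw [div_div, mul_comm l1]
            have := hl1.2
            gcongr
          have hHpos : 0 ≤ H s := by
            simp only [hH]
            positivity
          -- On the tube, `s` and `t` are at least `r/2` times `w s` and `F s`. The kernel is
          -- therefore bounded on the section by a constant, which is multiplied by the length of
          -- the section.
          calc ∫⁻ t in Set.Ioi (0 : ℝ), W.indicator (kernel C) (s, t)
              ≤ ∫⁻ t in Set.Icc (l2 * F s - l2 * H s) (l2 * F s + l2 * H s),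
                  ENNReal.ofReal (C * (2 / r) ^ 3 / max (w s) (F s) ^ 3) := by
                rw [← lintegral_indicator measurableSet_Icc]
                refine le_trans (setLIntegral_le_lintegral _ _) (lintegral_mono fun t => ?_)
                by_cases ht : (s, t) ∈ W
                · have ht2 := ht.2.2
                  have ht1 := ht.2.1
                  simp only at ht1 ht2
                  have e : t = l2 * (t / l2) := by field_simp
                  rw [abs_le] at ht2
                  rw [Set.indicator_of_mem ht, Set.indicator_of_mem]
                  · refine ENNReal.ofReal_le_ofReal ?_
                    have hc : r / 2 * max (w s) (F s) ≤ max s t := by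
                      rw [mul_max_of_nonneg _ _ (by positivity)]
                      refine max_le_max ?_ ?_
                      · calc r / 2 * w s ≤ l1 / 2 * (2 * (s / l1)) := by
                              have := (hwb s hs).2
                              have := hl1.1
                              gcongr
                          _ = s := by field_simp
                      · calc r / 2 * F s ≤ l2 * (F s / 2) := by
                              have := hl2.1
                              nlinarith
                          _ ≤ l2 * (t / l2) := by gcongr
                          _ = t := e.symm
                    calc C / max s t ^ 3 ≤ C / (r / 2 * max (w s) (F s)) ^ 3 := by gcongr
                      _ = _ := by
                        field_simp
                  · constructor
                    · rw [e]
                      nlinarith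
                    · rw [e]
                      nlinarith
                · rw [Set.indicator_of_notMem ht]
                  exact bot_le
            _ = ENNReal.ofReal (C * (2 / r) ^ 3 / max (w s) (F s) ^ 3 * (2 * l2 * H s)) := by
                rw [setLIntegral_const, Real.volume_Icc, ← ENNReal.ofReal_mul (by positivity)]
                congr 2
                ring
            _ ≤ ENNReal.ofReal (B * κ * majorant (s / (2 * R))) := by
                refine ENNReal.ofReal_le_ofReal ?_
                calc C * (2 / r) ^ 3 / max (w s) (F s) ^ 3 * (2 * l2 * H s)
                    ≤ C * (2 / r) ^ 3 / max (w s) (F s) ^ 3 * (2 * R * H s) := by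
                      have := hl2.2
                      gcongr
                  _ = C * (2 / r) ^ 3 * (2 * R * K) * κ *
                      ((F s ^ (1 - max g (1 / 2)) + F s ^ (3 / 2 : ℝ)) / max (w s) (F s) ^ 3) := by
                      simp only [hH]
                      ring
                  _ ≤ C * (2 / r) ^ 3 * (2 * R * K) * κ * (D * majorant (s / (2 * R))) := by
                      gcongr
                      exact hm1.trans (by gcongr)
                  _ = _ := by
                      rw [hB]
                      ring
            _ = _ := ENNReal.ofReal_mul (by positivity)
      _ = ENNReal.ofReal (B * κ) * I := by
          rw [lintegral_const_mul _ (by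
            have := measurable_majorant
            fun_prop)]
      _ ≤ _ := by
          conv_lhs => rw [← ENNReal.ofReal_toReal hIfin.ne, ← ENNReal.ofReal_mul (by positivity)]
          refine ENNReal.ofReal_le_ofReal ?_
          have : 0 ≤ B * κ := by positivity
          nlinarith
  · intro s t Q hs ht hqQ hQ h1 h2
    have hws : 0 < w s := lt_of_lt_of_le (by positivity) (hwb s hs).1
    have e1 : q' (w s) = ENNReal.ofReal Q := by
      rw [← hqQ, hq']
      simp [hws.le]
    have e2 : F s = Q := by
      simp only [hF]
      rw [e1, ENNReal.toReal_ofReal hQ.le]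
    refine ⟨⟨?_, ?_⟩, ?_, ?_⟩
    · simp only
      rw [e1]
      exact ENNReal.ofReal_ne_top
    · simp only
      rw [e2]
      exact hQ
    · simp only
      rw [e2]
      exact h1
    · simp only [hH]
      rw [e2]
      exact h2

/-! ### Perturbations of the failure set -/

/-- `p` is approximately `l * x`, with a relative error that may grow at the boundary. -/
def Close (E l m p x : ℝ) : Prop :=
  |p / (l * x) - 1| ≤ 1 / 2 ∧ |p / (l * x) - 1| ≤ E * (x ^ (-m) + x ^ (1 / 2 : ℝ))

/-- The relative error in terms of the perturbed point. -/
noncomputable def relErr (E m z : ℝ) : ℝ := 2 ^ (m + 1) * E * (z ^ (-m) + z ^ (1 / 2 : ℝ))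

/-- An upper envelope for the unknown point `x` when only its approximate multiple is observed. The
cap at `2`, like the floor `1/2` in `shrink`, keeps the envelope comparable with `z` where `relErr`
is large. -/
noncomputable def stretch (E m z : ℝ) : ℝ := z * min (1 + relErr E m z) 2

noncomputable def shrink (E m z : ℝ) : ℝ := z * max (1 - relErr E m z) (1 / 2)

lemma measurable_stretch (E m : ℝ) : Measurable (stretch E m) := by
  unfold stretch relErr
  fun_prop

lemma measurable_shrink (E m : ℝ) : Measurable (shrink E m) := by
  unfold shrink relErr
  fun_prop

lemma relErr_nonneg {E m z : ℝ} (hE : 0 ≤ E) (hz : 0 < z) : 0 ≤ relErr E m z := by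
  unfold relErr
  positivity

lemma stretch_bounds {E m z : ℝ} (hE : 0 ≤ E) (hz : 0 < z) :
    z ≤ stretch E m z ∧ stretch E m z ≤ 2 * z ∧ stretch E m z ≤ z + z * relErr E m z := by
  have h := relErr_nonneg (m := m) hE hz
  unfold stretch
  refine ⟨?_, ?_, ?_⟩
  · have : 1 ≤ min (1 + relErr E m z) 2 := le_min (by linarith) (by norm_num)
    nlinarith
  · have : min (1 + relErr E m z) 2 ≤ 2 := min_le_right _ _
    nlinarith
  · have : min (1 + relErr E m z) 2 ≤ 1 + relErr E m z := min_le_left _ _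
    nlinarith

lemma shrink_bounds {E m z : ℝ} (hE : 0 ≤ E) (hz : 0 < z) :
    shrink E m z ≤ z ∧ z / 2 ≤ shrink E m z ∧ z - z * relErr E m z ≤ shrink E m z := by
  have h := relErr_nonneg (m := m) hE hz
  unfold shrink
  refine ⟨?_, ?_, ?_⟩
  · have : max (1 - relErr E m z) (1 / 2) ≤ 1 := max_le (by linarith) (by norm_num)
    nlinarith
  · have : 1 / 2 ≤ max (1 - relErr E m z) (1 / 2) := le_max_right _ _
    nlinarith
  · have : 1 - relErr E m z ≤ max (1 - relErr E m z) (1 / 2) := le_max_left _ _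
    nlinarith

/-- `Close` measures the error at `x`, but the sets to be bounded are described through the observed
point `z = p / l`. A relative error of at most `1/2` makes `x` and `z` comparable within a factor
`2`, so powers of `x` can be traded for powers of `z`. -/
lemma Close.bounds {E l m p x : ℝ} (hE : 0 ≤ E) (hm : 1 / 2 ≤ m) (hx : 0 < x)
    (h : Close E l m p x) :
    0 < p / l ∧ x ≤ stretch E m (p / l) ∧ shrink E m (p / l) ≤ x := by
  obtain ⟨h1, h2⟩ := h
  set z := p / l with hz
  have hpz : p / (l * x) = z / x := by rw [hz, div_div]
  rw [hpz] at h1 h2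
  have hzx : z / x - 1 = (z - x) / x := by field_simp
  rw [hzx, abs_div, abs_of_pos hx, div_le_iff₀ hx] at h1 h2
  rw [abs_le] at h1
  have hz0 : 0 < z := by linarith
  have hx2 : x ≤ 2 * z := by linarith
  have hx1 : z / 2 ≤ x := by linarith
  have hpow : x ^ (-m) + x ^ (1 / 2 : ℝ) ≤ 2 ^ m * (z ^ (-m) + z ^ (1 / 2 : ℝ)) := by
    have e1 := rpow_le_of_comparable (e := -m) hz0 hx1 hx2
    have e2 := rpow_le_of_comparable (e := 1 / 2) hz0 hx1 hx2
    rw [abs_neg, abs_of_nonneg (by linarith)] at e1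
    rw [abs_of_nonneg (by norm_num)] at e2
    have e3 : (2 : ℝ) ^ (1 / 2 : ℝ) ≤ 2 ^ m := Real.rpow_le_rpow_of_exponent_le (by norm_num) hm
    have e4 : (2 : ℝ) ^ (1 / 2 : ℝ) * z ^ (1 / 2 : ℝ) ≤ 2 ^ m * z ^ (1 / 2 : ℝ) := by gcongr
    linarith
  have habs : |z - x| ≤ z * relErr E m z := by
    calc |z - x| ≤ E * (x ^ (-m) + x ^ (1 / 2 : ℝ)) * x := h2
      _ ≤ E * (2 ^ m * (z ^ (-m) + z ^ (1 / 2 : ℝ))) * (2 * z) := by gcongr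
      _ = z * relErr E m z := by
        rw [relErr, Real.rpow_add (by norm_num), Real.rpow_one]
        ring
  rw [abs_le] at habs
  refine ⟨hz0, ?_, ?_⟩
  · unfold stretch
    rw [mul_min_of_nonneg _ _ hz0.le]
    exact le_min (by linarith) (by linarith)
  · unfold shrink
    rw [mul_max_of_nonneg _ _ hz0.le]
    exact max_le (by linarith) (by linarith)

/-- A boundary value between the two envelopes of `z` differs from `z` by at most `z * relErr E m
z`. The factor `z` turns the exponents `-m` and `1/2` into `1 - m` and `3/2`, those of the
integrable majorant. -/
lemma near_of_between {E m z Q : ℝ} (hE : 0 ≤ E) (hz : 0 < z) (h1 : shrink E m z < Q)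
    (h2 : Q ≤ stretch E m z) : 0 < Q ∧ Q / 2 ≤ z ∧
      |z - Q| ≤ 2 ^ (m + 1) * 2 ^ (|1 - m| + 3 / 2) * E * (Q ^ (1 - m) + Q ^ (3 / 2 : ℝ)) := by
  have hs := stretch_bounds (m := m) hE hz
  have hr := shrink_bounds (m := m) hE hz
  have hQ : 0 < Q := by linarith
  refine ⟨hQ, by linarith, ?_⟩
  have habs : |z - Q| ≤ z * relErr E m z := by
    rw [abs_le]
    constructor <;> linarith
  refine habs.trans ?_
  have e1 := rpow_le_of_comparable (e := 1 - m) hQ (by linarith : Q / 2 ≤ z) (by linarith)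
  have e2 := rpow_le_of_comparable (e := 3 / 2) hQ (by linarith : Q / 2 ≤ z) (by linarith)
  rw [abs_of_nonneg (by norm_num : (0 : ℝ) ≤ 3 / 2)] at e2
  have p1 : (1 : ℝ) ≤ 2 ^ |1 - m| := Real.one_le_rpow (by norm_num) (abs_nonneg _)
  have p2 : (1 : ℝ) ≤ 2 ^ (3 / 2 : ℝ) := Real.one_le_rpow (by norm_num) (by norm_num)
  have hQ1 : 0 < Q ^ (1 - m) := Real.rpow_pos_of_pos hQ _
  have hQ2 : 0 < Q ^ (3 / 2 : ℝ) := Real.rpow_pos_of_pos hQ _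
  have hz1 : z * (z ^ (-m) + z ^ (1 / 2 : ℝ)) = z ^ (1 - m) + z ^ (3 / 2 : ℝ) := by
    rw [mul_add]
    congr 1
    · rw [sub_eq_add_neg, Real.rpow_add hz, Real.rpow_one]
    · have : (3 / 2 : ℝ) = 1 + 1 / 2 := by norm_num
      rw [this, Real.rpow_add hz, Real.rpow_one]
  calc z * relErr E m z = 2 ^ (m + 1) * E * (z ^ (1 - m) + z ^ (3 / 2 : ℝ)) := by
        rw [relErr, ← hz1]
        ring
    _ ≤ 2 ^ (m + 1) * E *
        ((2 ^ |1 - m| * 2 ^ (3 / 2 : ℝ)) * Q ^ (1 - m) +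
          (2 ^ |1 - m| * 2 ^ (3 / 2 : ℝ)) * Q ^ (3 / 2 : ℝ)) := by
        gcongr
        · refine e1.trans ?_
          gcongr
          exact le_mul_of_one_le_right (by positivity) p2
        · refine e2.trans ?_
          gcongr
          exact le_mul_of_one_le_left (by positivity) p1
    _ = _ := by
        rw [Real.rpow_add (by norm_num) |1 - m|]
        ring

/-- `q` and `f` describe the same upper set as functions of the first and of the second
coordinate. -/
structure DualPair (q f : ℝ → ℝ≥0∞) : Prop where
  anti : AntitoneOn q (Set.Ici 0)
  anti' : AntitoneOn f (Set.Ici 0)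
  iff : ∀ x y : ℝ, 0 ≤ x → 0 ≤ y → (q x ≤ ENNReal.ofReal y ↔ f y ≤ ENNReal.ofReal x)

lemma DualPair.mono {q f : ℝ → ℝ≥0∞} (h : DualPair q f) {x y x' y' : ℝ} (hx : 0 ≤ x)
    (hxx : x ≤ x') (hyy : y ≤ y') (hS : q x ≤ ENNReal.ofReal y) : q x' ≤ ENNReal.ofReal y' :=
  (h.anti hx (hx.trans hxx) hxx).trans (hS.trans (ENNReal.ofReal_le_ofReal hyy))

section Perturb

variable {ν : Measure (ℝ × ℝ)} {η : ℝ × ℝ → ℝ} {C g1 g2 r R : ℝ} {q f : ℝ → ℝ≥0∞}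

/-- The points for which small perturbations of the rescaled point are on both sides of the
boundary have small mass. -/
lemma exists_crossing_set (hD2 : CondD2 ν η) (hb : DensityBound η C) (hqf : DualPair q f)
    (hgq : AxisGrowth g2 q) (hgf : AxisGrowth g1 f) (hr : 0 < r) (hrR : r ≤ R) {E0 : ℝ}
    (hE0 : 0 < E0) :
    ∃ C' : ℝ, 0 < C' ∧ ∀ κ l1 l2 : ℝ, 0 < κ → l1 ∈ Set.Icc r R → l2 ∈ Set.Icc r R →
      ∃ W : Set (ℝ × ℝ), ν W ≤ ENNReal.ofReal (C' * κ) ∧ ∀ (p : ℝ × ℝ) (x y x' y' : ℝ),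
        0 < x → 0 < y → 0 < x' → 0 < y' →
        Close (E0 * κ) l1 (max g1 (1 / 2)) p.1 x → Close (E0 * κ) l1 (max g1 (1 / 2)) p.1 x' →
        Close (E0 * κ) l2 (max g2 (1 / 2)) p.2 y → Close (E0 * κ) l2 (max g2 (1 / 2)) p.2 y' →
        q x ≤ ENNReal.ofReal y → ¬ q x' ≤ ENNReal.ofReal y' → p ∈ W := by
  obtain ⟨C1, hC1, H1⟩ := hgq.kernelMass_le (C := C) hqf.anti hb.1 hr hrR
    (K := 2 ^ (max g2 (1 / 2) + 1) * 2 ^ (|1 - max g2 (1 / 2)| + 3 / 2) * E0) (by positivity)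
  obtain ⟨C2, hC2, H2⟩ := hgf.kernelMass_le (C := C) hqf.anti' hb.1 hr hrR
    (K := 2 ^ (max g1 (1 / 2) + 1) * 2 ^ (|1 - max g1 (1 / 2)| + 3 / 2) * E0) (by positivity)
  refine ⟨C1 + C2, by positivity, fun κ l1 l2 hκ hl1 hl2 => ?_⟩
  have hl1p : 0 < l1 := hr.trans_le hl1.1
  have hl2p : 0 < l2 := hr.trans_le hl2.1
  have hE : 0 ≤ E0 * κ := by positivity
  obtain ⟨W1, hW1m, hW1, hW1'⟩ := H1 κ l1 l2 hκ hl1 hl2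
    (fun s => shrink (E0 * κ) (max g1 (1 / 2)) (s / l1))
    ((measurable_shrink _ _).comp (measurable_id.div_const l1)) (fun s hs => by
      have := shrink_bounds (m := max g1 (1 / 2)) hE (z := s / l1) (by positivity)
      have h0 : 0 < s / l1 := by positivity
      exact ⟨this.2.1, by linarith [this.1]⟩)
  obtain ⟨W2, hW2m, hW2, hW2'⟩ := H2 κ l2 l1 hκ hl2 hl1
    (fun s => stretch (E0 * κ) (max g2 (1 / 2)) (s / l2))
    ((measurable_stretch _ _).comp (measurable_id.div_const l2)) (fun s hs => by
      have := stretch_bounds (m := max g2 (1 / 2)) hE (z := s / l2) (by positivity)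
      have h0 : 0 < s / l2 := by positivity
      exact ⟨by linarith [this.1], this.2.1⟩)
  refine ⟨W1 ∪ Prod.swap ⁻¹' W2, ?_, ?_⟩
  · refine (measure_union_le _ _).trans ?_
    rw [add_mul, ENNReal.ofReal_add (by positivity) (by positivity)]
    exact add_le_add ((hD2.le_kernelMass hb hW1m).trans hW1)
      ((hD2.le_kernelMass_swap hb (hW2m.preimage measurable_swap)).trans hW2)
  · intro p x y x' y' hx hy hx' hy' cx cx' cy cy' hS hS'
    obtain ⟨hz1, hxu, -⟩ := cx.bounds hE (le_max_right _ _) hx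
    obtain ⟨-, -, hxl⟩ := cx'.bounds hE (le_max_right _ _) hx'
    obtain ⟨hz2, hyu, -⟩ := cy.bounds hE (le_max_right _ _) hy
    obtain ⟨-, -, hyl⟩ := cy'.bounds hE (le_max_right _ _) hy'
    have b1 := shrink_bounds (m := max g1 (1 / 2)) hE hz1
    have b2 := stretch_bounds (m := max g2 (1 / 2)) hE hz2
    have b3 := stretch_bounds (m := max g1 (1 / 2)) hE hz1
    have b4 := shrink_bounds (m := max g2 (1 / 2)) hE hz2
    have hp1 : 0 < p.1 := by
      have := mul_pos hz1 hl1p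
      rwa [div_mul_cancel₀ _ hl1p.ne'] at this
    have hp2 : 0 < p.2 := by
      have := mul_pos hz2 hl2p
      rwa [div_mul_cancel₀ _ hl2p.ne'] at this
    have hup := hqf.mono hx.le hxu hyu hS
    have hlow : ¬ q (shrink (E0 * κ) (max g1 (1 / 2)) (p.1 / l1)) ≤
        ENNReal.ofReal (shrink (E0 * κ) (max g2 (1 / 2)) (p.2 / l2)) :=
      fun h => hS' (hqf.mono (by linarith) hxl hyl h)
    -- One intermediate corner is tested: first coordinate shrunk, second stretched. If it lies
    -- above the boundary, the crossing happens in the vertical direction and is caught by the tube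
    -- around the graph of `q`. Otherwise it happens horizontally and is caught by the tube around
    -- the graph of `f`.
    by_cases hmid : q (shrink (E0 * κ) (max g1 (1 / 2)) (p.1 / l1)) ≤
        ENNReal.ofReal (stretch (E0 * κ) (max g2 (1 / 2)) (p.2 / l2))
    · left
      have hfin := ne_top_of_le_ne_top ENNReal.ofReal_ne_top hmid
      obtain ⟨Q, hQ0, hQ⟩ : ∃ Q : ℝ, 0 ≤ Q ∧
          q (shrink (E0 * κ) (max g1 (1 / 2)) (p.1 / l1)) = ENNReal.ofReal Q :=
        ⟨_, ENNReal.toReal_nonneg, (ENNReal.ofReal_toReal hfin).symm⟩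
      rw [hQ, ENNReal.ofReal_le_ofReal_iff (by linarith)] at hmid
      rw [hQ, ENNReal.ofReal_le_ofReal_iff (by linarith), not_le] at hlow
      obtain ⟨n1, n2, n3⟩ := near_of_between hE hz2 hlow hmid
      exact hW1' p.1 p.2 Q hp1 hp2 hQ n1 n2 (n3.trans (le_of_eq (by ring)))
    · right
      rw [hqf.iff _ _ (by linarith) (by linarith)] at hmid hup
      have hfin := ne_top_of_le_ne_top ENNReal.ofReal_ne_top hup
      obtain ⟨Q, hQ0, hQ⟩ : ∃ Q : ℝ, 0 ≤ Q ∧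
          f (stretch (E0 * κ) (max g2 (1 / 2)) (p.2 / l2)) = ENNReal.ofReal Q :=
        ⟨_, ENNReal.toReal_nonneg, (ENNReal.ofReal_toReal hfin).symm⟩
      rw [hQ, ENNReal.ofReal_le_ofReal_iff (by linarith)] at hup
      rw [hQ, ENNReal.ofReal_le_ofReal_iff (by linarith), not_le] at hmid
      obtain ⟨n1, n2, n3⟩ := near_of_between hE hz1 hmid hup
      exact hW2' p.2 p.1 Q hp2 hp1 hQ n1 n2 (n3.trans (le_of_eq (by ring)))

/-- The rescaled failure set. -/
def scaledSet (q : ℝ → ℝ≥0∞) (l1 l2 : ℝ) : Set (ℝ × ℝ) :=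
  {p | p ∈ quadrant ∧ q (p.1 / l1) ≤ ENNReal.ofReal (p.2 / l2)}

lemma close_self {E l m p : ℝ} (hE : 0 ≤ E) (hl : 0 < l) (hp : 0 < p) : Close E l m p (p / l) := by
  have h : p / (l * (p / l)) - 1 = 0 := by field_simp; ring
  rw [Close, h, abs_zero]
  exact ⟨by norm_num, by positivity⟩

/-- The growth condition for `f` bounds `u / y²` by a multiple of `κ`. Up to constants this is the
kernel mass of a strip of width `u` that starts at height `y`. -/
lemma AxisGrowth.strip_measure_le (hD2 : CondD2 ν η) (hb : DensityBound η C)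
    (hqf : DualPair q f) (hgf : AxisGrowth g1 f) (hr : 0 < r) (hrR : r ≤ R) :
    ∃ C' κ0 : ℝ, 0 < C' ∧ 0 < κ0 ∧ ∀ κ l1 l2 u y : ℝ, 0 < κ → κ < κ0 → l1 ∈ Set.Icc r R →
      l2 ∈ Set.Icc r R → 0 < u → u ≤ 2 * κ ^ (1 / max g1 1) → 0 ≤ y →
      q u ≤ ENNReal.ofReal y → 0 < y ∧
        ν {p | p.1 ≤ 2 * l1 * u ∧ l2 * y / 2 ≤ p.2} ≤ ENNReal.ofReal (C' * κ) := by
  obtain ⟨K, κ0, hK, hκ0, H⟩ := hgf.strip_le 2 (by norm_num)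
  have hR : 0 < R := hr.trans_le hrR
  have hC := hb.1
  refine ⟨C * (2 * R) * 4 / r ^ 2 * K, κ0, by positivity, hκ0, ?_⟩
  intro κ l1 l2 u y hκ hκ' hl1 hl2 hu huκ hy hS
  rw [hqf.iff u y hu.le hy] at hS
  obtain ⟨hy0, hle⟩ := H κ y u hκ hκ' hy hu huκ hS
  have hl2p : 0 < l2 := hr.trans_le hl2.1
  have hl1p : 0 < l1 := hr.trans_le hl1.1
  refine ⟨hy0, (hD2.strip_le hb (by positivity)).trans (ENNReal.ofReal_le_ofReal ?_)⟩
  calc C * (2 * l1 * u) / (l2 * y / 2) ^ 2 = C * (2 * l1) * 4 / l2 ^ 2 * (u / y ^ 2) := by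
        field_simp
        ring
    _ ≤ C * (2 * R) * 4 / r ^ 2 * (K * κ) := by
        have h1 := hl1.2
        have h2 := hl2.1
        gcongr
    _ = _ := by ring

lemma AxisGrowth.strip_measure_le_swap (hD2 : CondD2 ν η) (hb : DensityBound η C)
    (hqf : DualPair q f) (hgq : AxisGrowth g2 q) (hr : 0 < r) (hrR : r ≤ R) :
    ∃ C' κ0 : ℝ, 0 < C' ∧ 0 < κ0 ∧ ∀ κ l1 l2 v x : ℝ, 0 < κ → κ < κ0 → l1 ∈ Set.Icc r R →
      l2 ∈ Set.Icc r R → 0 < v → v ≤ 2 * κ ^ (1 / max g2 1) → 0 ≤ x →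
      f v ≤ ENNReal.ofReal x → 0 < x ∧
        ν {p | p.2 ≤ 2 * l2 * v ∧ l1 * x / 2 ≤ p.1} ≤ ENNReal.ofReal (C' * κ) := by
  obtain ⟨K, κ0, hK, hκ0, H⟩ := hgq.strip_le 2 (by norm_num)
  have hR : 0 < R := hr.trans_le hrR
  have hC := hb.1
  refine ⟨C * (2 * R) * 4 / r ^ 2 * K, κ0, by positivity, hκ0, ?_⟩
  intro κ l1 l2 v x hκ hκ' hl1 hl2 hv hvκ hx hS
  rw [← hqf.iff x v hx hv.le] at hS
  obtain ⟨hx0, hle⟩ := H κ x v hκ hκ' hx hv hvκ hS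
  have hl2p : 0 < l2 := hr.trans_le hl2.1
  have hl1p : 0 < l1 := hr.trans_le hl1.1
  refine ⟨hx0, (hD2.strip_le_swap hb (by positivity)).trans (ENNReal.ofReal_le_ofReal ?_)⟩
  calc C * (2 * l2 * v) / (l1 * x / 2) ^ 2 = C * (2 * l2) * 4 / l1 ^ 2 * (v / x ^ 2) := by
        field_simp
        ring
    _ ≤ C * (2 * R) * 4 / r ^ 2 * (K * κ) := by
        have h1 := hl1.1
        have h2 := hl2.2
        gcongr
    _ = _ := by ring

/-- Upper bound for the mass of a perturbation of the rescaled failure set. -/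
lemma exists_perturbed_le (hD2 : CondD2 ν η) (hb : DensityBound η C) (hqf : DualPair q f)
    (hgq : AxisGrowth g2 q) (hgf : AxisGrowth g1 f) (hr : 0 < r) (hrR : r ≤ R) {E0 : ℝ}
    (hE0 : 0 < E0) :
    ∃ C' : ℝ, 0 < C' ∧ ∀ κ l1 l2 X1 X2 : ℝ, 0 < κ → l1 ∈ Set.Icc r R → l2 ∈ Set.Icc r R →
      ∀ B : Set (ℝ × ℝ), (∀ p ∈ B, p.1 < X1 → p.2 < X2 → ∃ x y : ℝ, 0 < x ∧ 0 < y ∧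
        Close (E0 * κ) l1 (max g1 (1 / 2)) p.1 x ∧ Close (E0 * κ) l2 (max g2 (1 / 2)) p.2 y ∧
        q x ≤ ENNReal.ofReal y) →
      ν B ≤ ν (scaledSet q l1 l2) + ENNReal.ofReal (C' * κ) + ν {p | X1 ≤ p.1} +
        ν {p | X2 ≤ p.2} := by
  obtain ⟨C', hC', H⟩ := exists_crossing_set hD2 hb hqf hgq hgf hr hrR hE0
  refine ⟨C', hC', fun κ l1 l2 X1 X2 hκ hl1 hl2 B hB => ?_⟩
  obtain ⟨W, hW, hW'⟩ := H κ l1 l2 hκ hl1 hl2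
  have hl1p : 0 < l1 := hr.trans_le hl1.1
  have hl2p : 0 < l2 := hr.trans_le hl2.1
  have hE : 0 ≤ E0 * κ := by positivity
  have hsub : B ⊆ ((scaledSet q l1 l2 ∪ W) ∪ {p | X1 ≤ p.1}) ∪ {p | X2 ≤ p.2} := by
    intro p hp
    by_cases h1 : X1 ≤ p.1
    · exact Or.inl (Or.inr h1)
    by_cases h2 : X2 ≤ p.2
    · exact Or.inr h2
    obtain ⟨x, y, hx, hy, cx, cy, hS⟩ := hB p hp (not_le.1 h1) (not_le.1 h2)
    have hz1 := (cx.bounds hE (le_max_right _ _) hx).1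
    have hz2 := (cy.bounds hE (le_max_right _ _) hy).1
    have hp1 : 0 < p.1 := by
      have := mul_pos hz1 hl1p
      rwa [div_mul_cancel₀ _ hl1p.ne'] at this
    have hp2 : 0 < p.2 := by
      have := mul_pos hz2 hl2p
      rwa [div_mul_cancel₀ _ hl2p.ne'] at this
    refine Or.inl (Or.inl ?_)
    by_cases hq : q (p.1 / l1) ≤ ENNReal.ofReal (p.2 / l2)
    · exact Or.inl ⟨⟨hp1.le, hp2.le⟩, hq⟩
    · exact Or.inr (hW' p x y _ _ hx hy hz1 hz2 cx (close_self hE hl1p hp1) cy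
        (close_self hE hl2p hp2) hS hq)
  refine (measure_mono hsub).trans ?_
  refine (measure_union_le _ _).trans (add_le_add ?_ le_rfl)
  refine (measure_union_le _ _).trans (add_le_add ?_ le_rfl)
  exact (measure_union_le _ _).trans (add_le_add le_rfl hW)

/-- Lower bound for the mass of a perturbation of the rescaled failure set. -/
lemma exists_le_perturbed (hD2 : CondD2 ν η) (hb : DensityBound η C) (hqf : DualPair q f)
    (hgq : AxisGrowth g2 q) (hgf : AxisGrowth g1 f) (hr : 0 < r) (hrR : r ≤ R) {E0 : ℝ}
    (hE0 : 0 < E0) :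
    ∃ C' κ0 : ℝ, 0 < C' ∧ 0 < κ0 ∧ ∀ κ l1 l2 X1 X2 : ℝ, 0 < κ → κ < κ0 → l1 ∈ Set.Icc r R →
      l2 ∈ Set.Icc r R →
      ∀ B : Set (ℝ × ℝ), (∀ p : ℝ × ℝ, 2 * l1 * κ ^ (1 / max g1 1) < p.1 →
        2 * l2 * κ ^ (1 / max g2 1) < p.2 → p.1 < X1 → p.2 < X2 → ∃ x y : ℝ, 0 < x ∧ 0 < y ∧
        Close (E0 * κ) l1 (max g1 (1 / 2)) p.1 x ∧ Close (E0 * κ) l2 (max g2 (1 / 2)) p.2 y ∧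
        (q x ≤ ENNReal.ofReal y → p ∈ B)) →
      ν (scaledSet q l1 l2) ≤ ν B + ENNReal.ofReal (C' * κ) + ν {p | X1 ≤ p.1} +
        ν {p | X2 ≤ p.2} := by
  obtain ⟨C1, hC1, H1⟩ := exists_crossing_set hD2 hb hqf hgq hgf hr hrR hE0
  obtain ⟨C2, κ2, hC2, hκ2, H2⟩ := hgf.strip_measure_le hD2 hb hqf hr hrR
  obtain ⟨C3, κ3, hC3, hκ3, H3⟩ := hgq.strip_measure_le_swap hD2 hb hqf hr hrR
  refine ⟨C1 + C2 + C3, min κ2 κ3, by positivity, by positivity, ?_⟩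
  intro κ l1 l2 X1 X2 hκ hκ' hl1 hl2 B hB
  obtain ⟨W, hW, hW'⟩ := H1 κ l1 l2 hκ hl1 hl2
  have hl1p : 0 < l1 := hr.trans_le hl1.1
  have hl2p : 0 < l2 := hr.trans_le hl2.1
  have hE : 0 ≤ E0 * κ := by positivity
  set u := κ ^ (1 / max g1 1) with hu
  set v := κ ^ (1 / max g2 1) with hv
  have hu0 : 0 < u := Real.rpow_pos_of_pos hκ _
  have hv0 : 0 < v := Real.rpow_pos_of_pos hκ _
  -- By monotonicity, points of the set to the left of the cut lie above the value of `q` at `2 *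
  -- u`. They form a negligible strip, or none exist if this value is `⊤`.
  have hA2 : ν {p | p ∈ scaledSet q l1 l2 ∧ p.1 ≤ 2 * l1 * u} ≤ ENNReal.ofReal (C2 * κ) := by
    by_cases htop : q (2 * u) = ⊤
    · have : {p | p ∈ scaledSet q l1 l2 ∧ p.1 ≤ 2 * l1 * u} = ∅ := by
        refine Set.eq_empty_of_forall_notMem fun p hp => ?_
        have h1 : q (2 * u) ≤ q (p.1 / l1) := hqf.anti (div_nonneg hp.1.1.1 hl1p.le)
          (by positivity : (0 : ℝ) ≤ 2 * u) (by rw [div_le_iff₀ hl1p]; linarith [hp.2])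
        rw [htop, top_le_iff] at h1
        have := hp.1.2
        rw [h1, top_le_iff] at this
        exact ENNReal.ofReal_ne_top this
      rw [this, measure_empty]
      exact bot_le
    · have hq := ENNReal.ofReal_toReal htop
      have h2 := H2 κ l1 l2 (2 * u) (q (2 * u)).toReal hκ (hκ'.trans_le (min_le_left _ _)) hl1 hl2
        (by positivity) le_rfl ENNReal.toReal_nonneg hq.ge
      refine le_trans (measure_mono ?_) h2.2
      intro p hp
      have h1 : q (2 * u) ≤ q (p.1 / l1) := hqf.anti (div_nonneg hp.1.1.1 hl1p.le)
          (by positivity : (0 : ℝ) ≤ 2 * u) (by rw [div_le_iff₀ hl1p]; linarith [hp.2])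
      have h3 := h1.trans hp.1.2
      rw [← hq, ENNReal.ofReal_le_ofReal_iff (div_nonneg hp.1.1.2 hl2p.le),
        le_div_iff₀ hl2p] at h3
      have h4 : 0 < l1 * u := by positivity
      have h5 : 0 < l2 * (q (2 * u)).toReal := mul_pos hl2p h2.1
      exact ⟨by linarith [hp.2], by linarith⟩
  have hA3 : ν {p | p ∈ scaledSet q l1 l2 ∧ p.2 ≤ 2 * l2 * v} ≤ ENNReal.ofReal (C3 * κ) := by
    by_cases htop : f (2 * v) = ⊤
    · have : {p | p ∈ scaledSet q l1 l2 ∧ p.2 ≤ 2 * l2 * v} = ∅ := by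
        refine Set.eq_empty_of_forall_notMem fun p hp => ?_
        have h1 : f (2 * v) ≤ f (p.2 / l2) := hqf.anti' (div_nonneg hp.1.1.2 hl2p.le)
          (by positivity : (0 : ℝ) ≤ 2 * v) (by rw [div_le_iff₀ hl2p]; linarith [hp.2])
        rw [htop, top_le_iff] at h1
        have := hp.1.2
        rw [hqf.iff _ _ (div_nonneg hp.1.1.1 hl1p.le) (div_nonneg hp.1.1.2 hl2p.le), h1,
          top_le_iff] at this
        exact ENNReal.ofReal_ne_top this
      rw [this, measure_empty]
      exact bot_le
    · have hq := ENNReal.ofReal_toReal htop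
      have h2 := H3 κ l1 l2 (2 * v) (f (2 * v)).toReal hκ (hκ'.trans_le (min_le_right _ _)) hl1 hl2
        (by positivity) le_rfl ENNReal.toReal_nonneg hq.ge
      refine le_trans (measure_mono ?_) h2.2
      intro p hp
      have h1 : f (2 * v) ≤ f (p.2 / l2) := hqf.anti' (div_nonneg hp.1.1.2 hl2p.le)
          (by positivity : (0 : ℝ) ≤ 2 * v) (by rw [div_le_iff₀ hl2p]; linarith [hp.2])
      have h3 := h1.trans ((hqf.iff _ _ (div_nonneg hp.1.1.1 hl1p.le)
        (div_nonneg hp.1.1.2 hl2p.le)).1 hp.1.2)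
      rw [← hq, ENNReal.ofReal_le_ofReal_iff (div_nonneg hp.1.1.1 hl1p.le),
        le_div_iff₀ hl1p] at h3
      have h4 : 0 < l2 * v := by positivity
      have h5 : 0 < l1 * (f (2 * v)).toReal := mul_pos hl1p h2.1
      exact ⟨by linarith [hp.2], by linarith⟩
  have hsub : scaledSet q l1 l2 ⊆ ((((B ∪ W) ∪ {p | p ∈ scaledSet q l1 l2 ∧ p.1 ≤ 2 * l1 * u}) ∪
      {p | p ∈ scaledSet q l1 l2 ∧ p.2 ≤ 2 * l2 * v}) ∪ {p | X1 ≤ p.1}) ∪ {p | X2 ≤ p.2} := by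
    intro p hp
    by_cases h1 : X1 ≤ p.1
    · exact Or.inl (Or.inr h1)
    by_cases h2 : X2 ≤ p.2
    · exact Or.inr h2
    by_cases h3 : p.1 ≤ 2 * l1 * u
    · exact Or.inl (Or.inl (Or.inl (Or.inr ⟨hp, h3⟩)))
    by_cases h4 : p.2 ≤ 2 * l2 * v
    · exact Or.inl (Or.inl (Or.inr ⟨hp, h4⟩))
    rw [not_le] at h1 h2 h3 h4
    obtain ⟨x, y, hx, hy, cx, cy, hS⟩ := hB p h3 h4 h1 h2
    have hz1 := (cx.bounds hE (le_max_right _ _) hx).1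
    have hz2 := (cy.bounds hE (le_max_right _ _) hy).1
    have hp1 : 0 < p.1 := lt_trans (by positivity) h3
    have hp2 : 0 < p.2 := lt_trans (by positivity) h4
    refine Or.inl (Or.inl (Or.inl (Or.inl ?_)))
    by_cases hq : q x ≤ ENNReal.ofReal y
    · exact Or.inl (hS hq)
    · exact Or.inr (hW' p _ _ x y hz1 hz2 hx hy (close_self hE hl1p hp1) cx
        (close_self hE hl2p hp2) cy hp.2 hq)
  refine (measure_mono hsub).trans ?_
  refine (measure_union_le _ _).trans (add_le_add ?_ le_rfl)
  refine (measure_union_le _ _).trans (add_le_add ?_ le_rfl)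
  rw [add_mul, add_mul, ENNReal.ofReal_add (by positivity) (by positivity),
    ENNReal.ofReal_add (by positivity) (by positivity), ← add_assoc, ← add_assoc]
  refine (measure_union_le _ _).trans (add_le_add ?_ hA3)
  refine (measure_union_le _ _).trans (add_le_add ?_ hA2)
  exact (measure_union_le _ _).trans (add_le_add le_rfl hW)

end Perturb

/-! ### Scaling and differentiation of the mass of the failure set -/

section Derivative

variable {μ ν : Measure (ℝ × ℝ)} {η : ℝ × ℝ → ℝ} {q f : ℝ → ℝ≥0∞}

lemma measurable_extend {q : ℝ → ℝ≥0∞} (hq : AntitoneOn q (Set.Ici 0)) :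
    Measurable (fun x : ℝ => if x < 0 then ⊤ else q x) := by
  refine Antitone.measurable fun x y hxy => ?_
  split_ifs with h1 h2 h2
  · exact le_rfl
  · exact absurd (lt_of_le_of_lt hxy h1) h2
  · exact le_top
  · exact hq (not_lt.1 h2) (not_lt.1 h1) hxy

lemma measurableSet_scaledSet (hq : AntitoneOn q (Set.Ici 0)) {l1 l2 : ℝ} (hl1 : 0 < l1) :
    MeasurableSet (scaledSet q l1 l2) := by
  have h : scaledSet q l1 l2 = quadrant ∩
      {p | (if p.1 / l1 < 0 then ⊤ else q (p.1 / l1)) ≤ ENNReal.ofReal (p.2 / l2)} := by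
    ext p
    simp only [scaledSet, Set.mem_ofPred_eq, Set.mem_inter_iff]
    refine and_congr_right fun hp => ?_
    rw [if_neg (div_nonneg hp.1 hl1.le).not_gt]
  rw [h]
  refine measurableSet_quadrant.inter (measurableSet_le ?_ (by fun_prop))
  exact (measurable_extend hq).comp (by fun_prop : Measurable fun p : ℝ × ℝ => p.1 / l1)

lemma CondD2.apply_indicator (hD2 : CondD2 ν η) {B : Set (ℝ × ℝ)} (hB : MeasurableSet B) :
    ν B = ∫⁻ p, (B ∩ quadrant).indicator (fun p => ENNReal.ofReal (η p)) p := by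
  rw [hD2.apply hB, lintegral_indicator (hB.inter measurableSet_quadrant)]

lemma ae_ne_fst (c : ℝ) : ∀ᵐ p : ℝ × ℝ, p.1 ≠ c := by
  have h := (Measure.quasiMeasurePreserving_fst (μ := (volume : Measure ℝ))
    (ν := (volume : Measure ℝ))).ae (p := fun x => x ≠ c) (by simp [ae_iff])
  exact h

lemma ae_ne_snd (c : ℝ) : ∀ᵐ p : ℝ × ℝ, p.2 ≠ c := by
  have h := (Measure.quasiMeasurePreserving_snd (μ := (volume : Measure ℝ))
    (ν := (volume : Measure ℝ))).ae (p := fun x => x ≠ c) (by simp [ae_iff])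
  exact h

/-- Homogeneity of the exponent measure. -/
lemma measure_preimage_smul (hν : IsExponentMeasure μ ν) (hD2 : CondD2 ν η) {B B' : Set (ℝ × ℝ)}
    (hB : MeasurableSet B) (hB' : MeasurableSet B') {s : ℝ} (hs : 0 < s)
    (h : ∀ p, s • p ∈ B' ↔ p ∈ B) : ν B' = ENNReal.ofReal s⁻¹ * ν B := by
  rw [hD2.apply_indicator hB, hD2.apply_indicator hB']
  set F : ℝ × ℝ → ℝ≥0∞ := (B' ∩ quadrant).indicator (fun p => ENNReal.ofReal (η p)) with hF
  -- Lebesgue measure contributes `s^(-2)` and the density `s^(-3)`. Comparing both expressions for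
  -- the same integral leaves the factor `s^(-1)`.
  have h1 : ∫⁻ p, F (s • p) = ENNReal.ofReal (s ^ 2)⁻¹ * ∫⁻ p, F p := by
    have e := lintegral_map_equiv (μ := (volume : Measure (ℝ × ℝ))) F
      (Homeomorph.smulOfNeZero s hs.ne').toMeasurableEquiv
    have e2 : Measure.map (⇑(Homeomorph.smulOfNeZero s hs.ne').toMeasurableEquiv)
        (volume : Measure (ℝ × ℝ)) = ENNReal.ofReal |(s ^ 2)⁻¹| • volume := by
      have := Measure.map_addHaar_smul (volume : Measure (ℝ × ℝ)) hs.ne'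
      rw [Module.finrank_prod, Module.finrank_self] at this
      exact this
    rw [e2, lintegral_smul_measure, abs_of_pos (by positivity)] at e
    exact e.symm
  have h2 : ∫⁻ p, F (s • p) = ENNReal.ofReal (s ^ 3)⁻¹ *
      ∫⁻ p, (B ∩ quadrant).indicator (fun p => ENNReal.ofReal (η p)) p := by
    rw [← lintegral_const_mul' _ _ ENNReal.ofReal_ne_top]
    refine lintegral_congr_ae ?_
    filter_upwards [ae_ne_fst 0, ae_ne_snd 0] with p hp1 hp2
    have hquad : s • p ∈ quadrant ↔ p ∈ quadrant := by
      change (0 ≤ s * p.1 ∧ 0 ≤ s * p.2) ↔ (0 ≤ p.1 ∧ 0 ≤ p.2)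
      rw [mul_nonneg_iff_of_pos_left hs, mul_nonneg_iff_of_pos_left hs]
    by_cases hp : p ∈ B ∩ quadrant
    · rw [hF, Set.indicator_of_mem hp, Set.indicator_of_mem
        (show s • p ∈ B' ∩ quadrant from ⟨(h p).2 hp.1, hquad.2 hp.2⟩),
        ← ENNReal.ofReal_mul (by positivity)]
      congr 1
      rw [density_smul hν hD2 hs (lt_of_le_of_ne hp.2.1 (Ne.symm hp1))
        (lt_of_le_of_ne hp.2.2 (Ne.symm hp2))]
      field_simp
    · rw [hF, Set.indicator_of_notMem hp, Set.indicator_of_notMem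
        (fun h' => hp ⟨(h p).1 h'.1, hquad.1 h'.2⟩), mul_zero]
  rw [h2] at h1
  have e : ENNReal.ofReal s⁻¹ = ENNReal.ofReal (s ^ 2) * ENNReal.ofReal (s ^ 3)⁻¹ := by
    rw [← ENNReal.ofReal_mul (by positivity)]
    congr 1
    field_simp
  rw [e, mul_assoc, h1, ← mul_assoc, ← ENNReal.ofReal_mul (by positivity),
    mul_inv_cancel₀ (by positivity), ENNReal.ofReal_one, one_mul]

/-- Dilation by `l` carries `scaledSet q 1 s` onto `scaledSet q l (l * s)`. With `l = d/e` this
produces the factor `e/d` of the final formula. -/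
lemma measure_scaledSet (hν : IsExponentMeasure μ ν) (hD2 : CondD2 ν η)
    (hq : AntitoneOn q (Set.Ici 0)) {l s : ℝ} (hl : 0 < l) :
    ν (scaledSet q l (l * s)) = ENNReal.ofReal l⁻¹ * ν (scaledSet q 1 s) := by
  refine measure_preimage_smul hν hD2 (measurableSet_scaledSet hq one_pos)
    (measurableSet_scaledSet hq hl) hl fun p => ?_
  change ((0 ≤ l * p.1 ∧ 0 ≤ l * p.2) ∧ q (l * p.1 / l) ≤ ENNReal.ofReal (l * p.2 / (l * s))) ↔
    ((0 ≤ p.1 ∧ 0 ≤ p.2) ∧ q (p.1 / 1) ≤ ENNReal.ofReal (p.2 / s))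
  rw [mul_nonneg_iff_of_pos_left hl, mul_nonneg_iff_of_pos_left hl, mul_div_cancel_left₀ _ hl.ne',
    mul_div_mul_left _ _ hl.ne', div_one]

lemma measure_fst_ge (hν : IsExponentMeasure μ ν) [IsProbabilityMeasure μ] (hD2 : CondD2 ν η)
    (hM1 : CondM1 μ) {T : ℝ} (hT : 0 < T) : ν {p | T ≤ p.1} = ENNReal.ofReal (1 / T) := by
  rw [← exponentMeasure_marginal hν hD2 hM1 0 hT]
  refine measure_congr ?_
  have h : ∀ᵐ p ∂ν, p ∈ quadrant := hν.1
  filter_upwards [h] with p hp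
  exact propext ⟨fun h' => ⟨hp, h'⟩, fun h' => h'.2⟩

lemma measure_snd_ge (hν : IsExponentMeasure μ ν) [IsProbabilityMeasure μ] (hD2 : CondD2 ν η)
    (hM1 : CondM1 μ) {T : ℝ} (hT : 0 < T) : ν {p | T ≤ p.2} = ENNReal.ofReal (1 / T) := by
  rw [← exponentMeasure_marginal hν hD2 hM1 1 hT]
  refine measure_congr ?_
  have h : ∀ᵐ p ∂ν, p ∈ quadrant := hν.1
  filter_upwards [h] with p hp
  exact propext ⟨fun h' => ⟨hp, h'⟩, fun h' => h'.2⟩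

/-- `AxisGrowth` keeps the set away from the origin: a point with small second coordinate has first
coordinate at least `x0`. Two marginal tails of finite mass therefore cover it. -/
lemma measure_scaledSet_lt_top (hν : IsExponentMeasure μ ν) [IsProbabilityMeasure μ]
    (hD2 : CondD2 ν η) (hM1 : CondM1 μ) {g : ℝ} (hgq : AxisGrowth g q) {s : ℝ} (hs : 0 < s) :
    ν (scaledSet q 1 s) < ⊤ := by
  obtain ⟨δ, C, x0, hδ, -, -, hx0, H⟩ := hgq
  have hsub : scaledSet q 1 s ⊆ {p | x0 ≤ p.1} ∪ {p | s * (δ / 2) ≤ p.2} := by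
    intro p hp
    by_cases h : s * (δ / 2) ≤ p.2
    · exact Or.inr h
    left
    have hle : p.2 / s ≤ δ / 2 := by
      rw [div_le_iff₀ hs]
      linarith
    have := (H p.1 (δ / 2) hp.1.1 (by positivity) (by linarith) (by
      have h2 := hp.2
      rw [div_one] at h2
      exact h2.trans (ENNReal.ofReal_le_ofReal hle))).1
    exact this
  refine lt_of_le_of_lt ((measure_mono hsub).trans (measure_union_le _ _)) ?_
  rw [measure_fst_ge hν hD2 hM1 hx0, measure_snd_ge hν hD2 hM1 (by positivity)]
  exact ENNReal.add_lt_top.2 ⟨ENNReal.ofReal_lt_top, ENNReal.ofReal_lt_top⟩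

end Derivative

/-! ### Differentiation of the mass with respect to the vertical scale. -/

section Derivative

variable {μ ν : Measure (ℝ × ℝ)} {η : ℝ × ℝ → ℝ} {q f : ℝ → ℝ≥0∞}

/-- The open quadrant. -/
def openQuadrant : Set (ℝ × ℝ) := {p | 0 < p.1 ∧ 0 < p.2}

lemma measurableSet_openQuadrant : MeasurableSet openQuadrant :=
  (measurableSet_lt measurable_const measurable_fst).inter
    (measurableSet_lt measurable_const measurable_snd)

/-- The density, set to `0` outside the open quadrant. -/
noncomputable def cutDensity (η : ℝ × ℝ → ℝ) (p : ℝ × ℝ) : ℝ≥0∞ :=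
  openQuadrant.indicator (fun p => ENNReal.ofReal (η p)) p

lemma CondD2.measurable_cutDensity (hD2 : CondD2 ν η) : Measurable (cutDensity η) := by
  classical
  have h : ContinuousOn (fun p => ENNReal.ofReal (η p)) openQuadrant :=
    ENNReal.continuous_ofReal.comp_continuousOn (hD2.2.1.mono pos_subset_punctured)
  have := h.measurable_piecewise (g := fun _ => (0 : ℝ≥0∞)) continuousOn_const
    measurableSet_openQuadrant
  have e : openQuadrant.piecewise (fun p => ENNReal.ofReal (η p)) (fun _ => (0 : ℝ≥0∞)) =
      cutDensity η := by
    ext p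
    simp only [Set.piecewise, cutDensity, Set.indicator]
  rwa [e] at this

lemma CondD2.apply_iterated (hD2 : CondD2 ν η) {B : Set (ℝ × ℝ)} (hB : MeasurableSet B) :
    ν B = ∫⁻ s in Set.Ioi (0 : ℝ), ∫⁻ t in Set.Ioi (0 : ℝ), B.indicator (cutDensity η) (s, t) := by
  rw [← lintegral_prod _ (hD2.measurable_cutDensity.indicator hB).aemeasurable,
    ← restrict_quadrant, hD2.1, withDensity_apply _ hB, ← lintegral_indicator hB]
  refine lintegral_congr_ae ?_
  filter_upwards [ae_pos_of_quadrant] with p hp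
  by_cases h : p ∈ B
  · rw [Set.indicator_of_mem h, Set.indicator_of_mem h, cutDensity,
      Set.indicator_of_mem (show p ∈ openQuadrant from hp)]
  · rw [Set.indicator_of_notMem h, Set.indicator_of_notMem h]

/-- Difference quotients of the integral of a function which is continuous at `Q`. -/
lemma tendsto_average_Ico {h : ℝ → ℝ} {Q : ℝ} (hQ : 0 < Q) (hc : ContinuousAt h Q) :
    Tendsto (fun l : ℝ => ENNReal.ofReal (1 / (2 * l)) *
      ∫⁻ t in Set.Ico ((1 - l) * Q) ((1 + l) * Q), ENNReal.ofReal (h t)) (𝓝[>] 0)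
      (𝓝 (ENNReal.ofReal (Q * h Q))) := by
  have hsmall : ∀ p : ℝ → Prop, (∀ᶠ t in 𝓝 Q, p t) →
      ∀ᶠ l : ℝ in 𝓝[>] 0, ∀ t ∈ Set.Ico ((1 - l) * Q) ((1 + l) * Q), p t := by
    intro p hp
    obtain ⟨ε, hε, hball⟩ := Metric.eventually_nhds_iff.1 hp
    filter_upwards [Ioo_mem_nhdsGT (show (0 : ℝ) < ε / (2 * Q) by positivity)] with l hl t ht
    refine hball ?_
    have h2 : l * Q < ε := by
      have := hl.2
      rw [lt_div_iff₀ (by positivity)] at this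
      linarith [mul_pos hl.1 hQ]
    rw [Real.dist_eq, abs_lt]
    constructor <;> nlinarith [ht.1, ht.2]
  -- The interval has length `2 l Q`, so the normalized integral of the constant `r / Q` is exactly
  -- `r`. Comparison with such constants yields both bounds for the limit.
  have hconst : ∀ l r : ℝ, 0 < l → 0 ≤ r → ENNReal.ofReal (1 / (2 * l)) *
      ∫⁻ _ in Set.Ico ((1 - l) * Q) ((1 + l) * Q), ENNReal.ofReal (r / Q) = ENNReal.ofReal r := by
    intro l r hl hr
    rw [setLIntegral_const, Real.volume_Ico, ← ENNReal.ofReal_mul (by positivity),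
      ← ENNReal.ofReal_mul (by positivity)]
    congr 1
    field_simp
    ring
  refine tendsto_order.2 ⟨fun a ha => ?_, fun a ha => ?_⟩
  · obtain ⟨r, hr0, har, hr⟩ := ENNReal.lt_iff_exists_real_btwn.1 ha
    rw [ENNReal.ofReal_lt_ofReal_iff_of_nonneg hr0] at hr
    have h1 : r / Q < h Q := by rwa [div_lt_iff₀ hQ, mul_comm]
    filter_upwards [hsmall _ (hc.eventually (lt_mem_nhds h1)), self_mem_nhdsWithin] with l hl hl0
    refine har.trans_le ?_
    rw [← hconst l r hl0 hr0]
    gcongr 1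
    exact setLIntegral_mono' measurableSet_Ico fun t ht => ENNReal.ofReal_le_ofReal (hl t ht).le
  · obtain ⟨r, hr0, har, hr⟩ := ENNReal.lt_iff_exists_real_btwn.1 ha
    have hr0' : 0 < r := ENNReal.ofReal_pos.1 (lt_of_le_of_lt bot_le har)
    rw [ENNReal.ofReal_lt_ofReal_iff hr0'] at har
    have h1 : h Q < r / Q := by rwa [lt_div_iff₀ hQ, mul_comm]
    filter_upwards [hsmall _ (hc.eventually (gt_mem_nhds h1)), self_mem_nhdsWithin] with l hl hl0
    refine lt_of_le_of_lt ?_ hr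
    rw [← hconst l r hl0 hr0]
    gcongr 1
    exact setLIntegral_mono' measurableSet_Ico fun t ht => ENNReal.ofReal_le_ofReal (hl t ht).le

/-- The mass of the difference of two rescaled failure sets, to first order. -/
lemma derivative_scaledSet [IsProbabilityMeasure μ] (hν : IsExponentMeasure μ ν)
    (hD2 : CondD2 ν η) (hM1 : CondM1 μ) (hq : AntitoneOn q (Set.Ici 0)) {g : ℝ}
    (hgq : AxisGrowth g q) {xl : ℝ} (hxl : 0 ≤ xl) (hlt : ∀ x, 0 ≤ x → x < xl → q x = ⊤)
    (hgt : ∀ x, xl < x → q x < ⊤) :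
    IntegrableOn (fun u : ℝ => (q u).toReal * η (u, (q u).toReal)) (Set.Ioi xl) ∧
      Tendsto (fun l : ℝ => ((ν (scaledSet q 1 (1 - l))).toReal -
        (ν (scaledSet q 1 (1 + l))).toReal) / (2 * l)) (𝓝[>] 0)
        (𝓝 (∫ u in Set.Ioi xl, (q u).toReal * η (u, (q u).toReal))) := by
  obtain ⟨C, hb⟩ := exists_densityBound hν hD2
  have hC := hb.1
  obtain ⟨D, hD, hmaj⟩ := hgq.le_majorant
  have hmaj' : ∀ x Q : ℝ, 0 < x → 0 < Q → q x ≤ ENNReal.ofReal Q →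
      Q / max x Q ^ 3 ≤ D * majorant x := by
    intro x Q hx hQ hqQ
    refine le_trans ?_ (hmaj x Q hx hQ hqQ)
    have hM : 0 < max x Q := lt_max_of_lt_left hx
    gcongr
    have e1 : 0 < Q ^ (1 - max g (1 / 2)) := Real.rpow_pos_of_pos hQ _
    have e2 : 0 < Q ^ (3 / 2 : ℝ) := Real.rpow_pos_of_pos hQ _
    rcases le_total Q 1 with h1 | h1
    · have : Q ^ (1 : ℝ) ≤ Q ^ (1 - max g (1 / 2)) :=
        Real.rpow_le_rpow_of_exponent_ge hQ h1 (by linarith [le_max_right g (1 / 2)])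
      rw [Real.rpow_one] at this
      linarith
    · have : Q ^ (1 : ℝ) ≤ Q ^ (3 / 2 : ℝ) :=
        Real.rpow_le_rpow_of_exponent_le h1 (by norm_num)
      rw [Real.rpow_one] at this
      linarith
  have hIfin : ∫⁻ s in Set.Ioi (0 : ℝ), ENNReal.ofReal (8 * C * D * majorant s) < ⊤ :=
    (integrableOn_majorant.const_mul (8 * C * D)).lintegral_lt_top
  set T : ℝ → Set (ℝ × ℝ) := fun l => scaledSet q 1 (1 - l) \ scaledSet q 1 (1 + l) with hT
  have hTm : ∀ l, MeasurableSet (T l) := fun l =>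
    (measurableSet_scaledSet hq one_pos).diff (measurableSet_scaledSet hq one_pos)
  have hηc : ∀ x y : ℝ, 0 < x → 0 < y → ContinuousAt η (x, y) := fun x y hx hy =>
    (hD2.2.1.mono pos_subset_punctured).continuousAt
      (((isOpen_lt continuous_const continuous_fst).inter
        (isOpen_lt continuous_const continuous_snd)).mem_nhds ⟨hx, hy⟩)
  -- The difference quotient along the vertical line through `s`. Its limit is `G s`, and dominated
  -- convergence transfers the limit to the integral over `s`.
  set F : ℝ → ℝ → ℝ≥0∞ := fun l s => ENNReal.ofReal (1 / (2 * l)) *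
    ∫⁻ t in Set.Ioi (0 : ℝ), (T l).indicator (cutDensity η) (s, t) with hF
  set G : ℝ → ℝ≥0∞ := (Set.Ioi xl).indicator
    (fun s => ENNReal.ofReal ((q s).toReal * η (s, (q s).toReal))) with hG
  -- sections
  have hsec : ∀ l s t : ℝ, 0 < l → l < 1 → 0 < s → 0 < t → ((s, t) ∈ T l ↔ q s < ⊤ ∧
      t ∈ Set.Ico ((1 - l) * (q s).toReal) ((1 + l) * (q s).toReal)) := by
    intro l s t hl hl1 hs ht
    have h1 : (s, t) ∈ T l ↔ q s ≤ ENNReal.ofReal (t / (1 - l)) ∧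
        ¬ q s ≤ ENNReal.ofReal (t / (1 + l)) := by
      simp only [hT, scaledSet, Set.mem_sdiff, Set.mem_ofPred_eq, div_one]
      have : ((s, t) : ℝ × ℝ) ∈ quadrant := ⟨hs.le, ht.le⟩
      simp [this]
    rw [h1]
    have hl' : 0 < 1 - l := by linarith
    constructor
    · rintro ⟨h2, h3⟩
      have hfin := ne_top_of_le_ne_top ENNReal.ofReal_ne_top h2
      refine ⟨hfin.lt_top, ?_, ?_⟩
      · have := ENNReal.toReal_le_of_le_ofReal (by positivity) h2
        rw [le_div_iff₀ hl'] at this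
        linarith
      · have h4 := ENNReal.toReal_lt_toReal ENNReal.ofReal_ne_top hfin |>.2 (not_le.1 h3)
        rw [ENNReal.toReal_ofReal (by positivity), div_lt_iff₀ (by linarith)] at h4
        linarith
    · rintro ⟨hfin, h2, h3⟩
      rw [← ENNReal.ofReal_toReal hfin.ne]
      refine ⟨ENNReal.ofReal_le_ofReal ?_, ?_⟩
      · rw [le_div_iff₀ hl']
        linarith
      · rw [not_le, ENNReal.ofReal_lt_ofReal_iff_of_nonneg (by positivity),
          div_lt_iff₀ (by linarith)]
        linarith
  have hinner : ∀ l s : ℝ, 0 < l → l < 1 → 0 < s → q s < ⊤ →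
      ∫⁻ t in Set.Ioi (0 : ℝ), (T l).indicator (cutDensity η) (s, t) =
      ∫⁻ t in Set.Ico ((1 - l) * (q s).toReal) ((1 + l) * (q s).toReal),
        ENNReal.ofReal (η (s, t)) := by
    intro l s hl hl1 hs hfin
    have hQ : 0 ≤ (q s).toReal := ENNReal.toReal_nonneg
    rw [← lintegral_indicator measurableSet_Ico, ← lintegral_indicator measurableSet_Ioi]
    refine lintegral_congr_ae ?_
    have h0 : ∀ᵐ t : ℝ, t ≠ 0 := by simp [ae_iff]
    filter_upwards [h0] with t ht0
    by_cases ht : 0 < t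
    · rw [Set.indicator_of_mem (show t ∈ Set.Ioi (0 : ℝ) from ht)]
      by_cases hmem : (s, t) ∈ T l
      · rw [Set.indicator_of_mem hmem, Set.indicator_of_mem ((hsec l s t hl hl1 hs ht).1 hmem).2,
          cutDensity, Set.indicator_of_mem (show ((s, t) : ℝ × ℝ) ∈ openQuadrant from ⟨hs, ht⟩)]
      · rw [Set.indicator_of_notMem hmem, Set.indicator_of_notMem
          (fun h => hmem ((hsec l s t hl hl1 hs ht).2 ⟨hfin, h⟩))]
    · rw [Set.indicator_of_notMem (show t ∉ Set.Ioi (0 : ℝ) from ht), Set.indicator_of_notMem]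
      intro h
      have h1 : 0 ≤ (1 - l) * (q s).toReal := mul_nonneg (by linarith) hQ
      exact ht (lt_of_le_of_ne (h1.trans h.1) (Ne.symm ht0))
  have hzero : ∀ l s : ℝ, 0 < l → l < 1 → 0 < s → q s = ⊤ →
      ∫⁻ t in Set.Ioi (0 : ℝ), (T l).indicator (cutDensity η) (s, t) = 0 := by
    intro l s hl hl1 hs hfin
    rw [← lintegral_zero (μ := volume.restrict (Set.Ioi (0 : ℝ)))]
    refine setLIntegral_congr_fun measurableSet_Ioi fun t ht => ?_
    refine Set.indicator_of_notMem (fun h => ?_) _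
    have := ((hsec l s t hl hl1 hs ht).1 h).1
    exact this.ne hfin
  -- For `l < 1/2` the section stays above `Q/2`, so `max s t` is at least half of `max s Q`. The
  -- cube of this half gives the factor `8`, and averaging contributes `Q`.
  have hFbound : ∀ l s : ℝ, 0 < l → l < 1 / 2 → 0 < s →
      F l s ≤ ENNReal.ofReal (8 * C * D * majorant s) := by
    intro l s hl hl1 hs
    simp only [hF]
    by_cases hfin : q s = ⊤
    · rw [hzero l s hl (by linarith) hs hfin, mul_zero]
      exact bot_le
    rw [hinner l s hl (by linarith) hs (lt_top_iff_ne_top.2 hfin)]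
    obtain ⟨Q, hQ⟩ : ∃ Q, Q = (q s).toReal := ⟨_, rfl⟩
    rw [← hQ]
    have hQ0 : 0 ≤ Q := hQ ▸ ENNReal.toReal_nonneg
    rcases hQ0.eq_or_lt with hQ0 | hQ0
    · rw [← hQ0]
      simp
    have hM : 0 < max s Q := lt_max_of_lt_left hs
    have hpt : ∀ t ∈ Set.Ico ((1 - l) * Q) ((1 + l) * Q),
        ENNReal.ofReal (η (s, t)) ≤ ENNReal.ofReal (8 * C / max s Q ^ 3) := by
      intro t ht
      have htQ : Q / 2 ≤ t := by nlinarith [ht.1]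
      have ht0 : 0 < t := by linarith
      refine ENNReal.ofReal_le_ofReal ((hb.2 (s, t) hs ht0).trans ?_)
      have h2 : max s Q / 2 ≤ max s t := by
        have := le_max_left s t
        have := le_max_right s t
        rcases max_cases s Q with h | h <;> rw [h.1] <;> linarith
      calc C / max s t ^ 3 ≤ C / (max s Q / 2) ^ 3 := by gcongr
        _ = _ := by field_simp; norm_num
    calc ENNReal.ofReal (1 / (2 * l)) * ∫⁻ t in Set.Ico ((1 - l) * Q) ((1 + l) * Q),
          ENNReal.ofReal (η (s, t))
        ≤ ENNReal.ofReal (1 / (2 * l)) * ∫⁻ _ in Set.Ico ((1 - l) * Q) ((1 + l) * Q),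
          ENNReal.ofReal (8 * C / max s Q ^ 3) := by
          gcongr 1
          exact setLIntegral_mono' measurableSet_Ico hpt
      _ = ENNReal.ofReal (8 * C * (Q / max s Q ^ 3)) := by
          rw [setLIntegral_const, Real.volume_Ico, ← ENNReal.ofReal_mul (by positivity),
            ← ENNReal.ofReal_mul (by positivity)]
          congr 1
          field_simp
          ring
      _ ≤ _ := by
          refine ENNReal.ofReal_le_ofReal ?_
          rw [mul_assoc (8 * C)]
          gcongr
          refine hmaj' s Q hs hQ0 ?_
          rw [hQ, ENNReal.ofReal_toReal hfin]
  have hFm : ∀ l, Measurable (F l) := fun l =>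
    (Measurable.lintegral_prod_right' (hD2.measurable_cutDensity.indicator (hTm l))).const_mul _
  have hlim : ∀ᵐ s ∂(volume.restrict (Set.Ioi (0 : ℝ))),
      Tendsto (fun l => F l s) (𝓝[>] 0) (𝓝 (G s)) := by
    have h0 : ∀ᵐ s : ℝ ∂(volume.restrict (Set.Ioi (0 : ℝ))), s ≠ xl :=
      ae_restrict_of_ae (by simp [ae_iff])
    filter_upwards [h0, ae_restrict_mem measurableSet_Ioi] with s hsx hs
    have hs : 0 < s := hs
    have hev : ∀ᶠ l : ℝ in 𝓝[>] 0, 0 < l ∧ l < 1 :=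
      Ioo_mem_nhdsGT (show (0 : ℝ) < 1 by norm_num)
    rcases lt_or_gt_of_ne hsx with hlt' | hgt'
    · rw [hG, Set.indicator_of_notMem (show s ∉ Set.Ioi xl from not_lt.2 hlt'.le)]
      refine tendsto_const_nhds.congr' ?_
      filter_upwards [hev] with l hl
      simp only [hF]
      rw [hzero l s hl.1 hl.2 hs (hlt s hs.le hlt'), mul_zero]
    · rw [hG, Set.indicator_of_mem (show s ∈ Set.Ioi xl from hgt')]
      have hfin := hgt s hgt'
      obtain ⟨Q, hQ⟩ : ∃ Q, Q = (q s).toReal := ⟨_, rfl⟩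
      have hQ0 : 0 ≤ Q := hQ ▸ ENNReal.toReal_nonneg
      have hFeq : ∀ᶠ l : ℝ in 𝓝[>] 0, ENNReal.ofReal (1 / (2 * l)) *
          ∫⁻ t in Set.Ico ((1 - l) * Q) ((1 + l) * Q), ENNReal.ofReal (η (s, t)) = F l s := by
        filter_upwards [hev] with l hl
        simp only [hF]
        rw [hinner l s hl.1 hl.2 hs hfin, hQ]
      refine Tendsto.congr' hFeq ?_
      rw [← hQ]
      rcases hQ0.eq_or_lt with hQ0 | hQ0
      · rw [← hQ0]
        simp
      · refine tendsto_average_Ico hQ0 (h := fun t => η (s, t)) ?_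
        exact ContinuousAt.comp (f := fun t : ℝ => ((s, t) : ℝ × ℝ)) (g := η) (hηc s Q hs hQ0)
          (by fun_prop)
  have htend : Tendsto (fun l => ∫⁻ s in Set.Ioi (0 : ℝ), F l s) (𝓝[>] 0)
      (𝓝 (∫⁻ s in Set.Ioi (0 : ℝ), G s)) := by
    refine tendsto_lintegral_filter_of_dominated_convergence
      (fun s => ENNReal.ofReal (8 * C * D * majorant s)) (Eventually.of_forall hFm) ?_ hIfin.ne hlim
    filter_upwards [Ioo_mem_nhdsGT (show (0 : ℝ) < 1 / 2 by norm_num)] with l hl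
    exact (ae_restrict_iff' measurableSet_Ioi).2
      (Eventually.of_forall fun s hs => hFbound l s hl.1 hl.2 hs)
  have hGint : ∫⁻ s in Set.Ioi (0 : ℝ), G s =
      ∫⁻ s in Set.Ioi xl, ENNReal.ofReal ((q s).toReal * η (s, (q s).toReal)) := by
    rw [hG, lintegral_indicator measurableSet_Ioi, Measure.restrict_restrict measurableSet_Ioi,
      Set.inter_eq_left.2 (Set.Ioi_subset_Ioi hxl)]
  have hnonneg : ∀ s, xl < s → 0 ≤ (q s).toReal * η (s, (q s).toReal) := by
    intro s hs
    have hs0 : 0 < s := lt_of_le_of_lt hxl hs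
    rcases (ENNReal.toReal_nonneg (a := q s)).eq_or_lt with h0 | h0
    · rw [← h0, zero_mul]
    · exact mul_nonneg h0.le (hD2.2.2 _ (pos_subset_punctured ⟨hs0, h0⟩)).le
  have hGbound : ∀ s, xl < s →
      (q s).toReal * η (s, (q s).toReal) ≤ 8 * C * D * majorant s := by
    intro s hs
    have hs0 : 0 < s := lt_of_le_of_lt hxl hs
    have hm := majorant_pos hs0.le
    rcases (ENNReal.toReal_nonneg (a := q s)).eq_or_lt with h0 | h0
    · rw [← h0, zero_mul]
      positivity
    · have h1 := hb.2 (s, (q s).toReal) hs0 h0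
      have h2 := hmaj' s (q s).toReal hs0 h0 (by rw [ENNReal.ofReal_toReal (hgt s hs).ne])
      calc (q s).toReal * η (s, (q s).toReal)
          ≤ (q s).toReal * (C / max s (q s).toReal ^ 3) := by gcongr
        _ = C * ((q s).toReal / max s (q s).toReal ^ 3) := by ring
        _ ≤ C * (D * majorant s) := by gcongr
        _ ≤ _ := by
          have : 0 < C * (D * majorant s) := by positivity
          linarith
  have hmeas : AEStronglyMeasurable (fun u : ℝ => (q u).toReal * η (u, (q u).toReal))
      (volume.restrict (Set.Ioi xl)) := by
    have hqm := measurable_extend hq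
    have hpair : Measurable fun u : ℝ => ((u, (if u < 0 then ⊤ else q u).toReal) : ℝ × ℝ) :=
      measurable_id.prodMk hqm.ennreal_toReal
    have hm : Measurable fun u : ℝ => (if u < 0 then ⊤ else q u).toReal *
        (cutDensity η (u, (if u < 0 then ⊤ else q u).toReal)).toReal :=
      hqm.ennreal_toReal.mul (hD2.measurable_cutDensity.comp hpair).ennreal_toReal
    refine hm.aestronglyMeasurable.congr ?_
    refine (ae_restrict_iff' measurableSet_Ioi).2 (Eventually.of_forall fun u hu => ?_)
    have hu0 : 0 < u := lt_of_le_of_lt hxl hu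
    simp only
    rw [if_neg hu0.le.not_gt]
    rcases (ENNReal.toReal_nonneg (a := q u)).eq_or_lt with h0 | h0
    · rw [← h0, zero_mul, zero_mul]
    · rw [cutDensity, Set.indicator_of_mem (show (u, (q u).toReal) ∈ openQuadrant from ⟨hu0, h0⟩),
        ENNReal.toReal_ofReal (hD2.2.2 _ (pos_subset_punctured ⟨hu0, h0⟩)).le]
  have hInt : IntegrableOn (fun u : ℝ => (q u).toReal * η (u, (q u).toReal)) (Set.Ioi xl) := by
    refine Integrable.mono' ((integrableOn_majorant.mono_set (Set.Ioi_subset_Ioi hxl)).const_mul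
      (8 * C * D)) hmeas ?_
    refine (ae_restrict_iff' measurableSet_Ioi).2 (Eventually.of_forall fun u hu => ?_)
    rw [Real.norm_of_nonneg (hnonneg u hu)]
    exact hGbound u hu
  refine ⟨hInt, ?_⟩
  have hGreal : (∫⁻ s in Set.Ioi (0 : ℝ), G s).toReal =
      ∫ u in Set.Ioi xl, (q u).toReal * η (u, (q u).toReal) := by
    rw [hGint, ← ofReal_integral_eq_lintegral_ofReal hInt
      ((ae_restrict_iff' measurableSet_Ioi).2 (Eventually.of_forall hnonneg)),
      ENNReal.toReal_ofReal (setIntegral_nonneg measurableSet_Ioi hnonneg)]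
  rw [← hGreal]
  have hGfin : ∫⁻ s in Set.Ioi (0 : ℝ), G s ≠ ⊤ := by
    rw [hGint]
    exact hInt.lintegral_lt_top.ne
  refine ((ENNReal.tendsto_toReal hGfin).comp htend).congr' ?_
  filter_upwards [Ioo_mem_nhdsGT (show (0 : ℝ) < 1 / 2 by norm_num)] with l hl
  have hl0 : 0 < l := hl.1
  have hl1 : l < 1 / 2 := hl.2
  have hsub : scaledSet q 1 (1 + l) ⊆ scaledSet q 1 (1 - l) := by
    intro p hp
    refine ⟨hp.1, hp.2.trans (ENNReal.ofReal_le_ofReal ?_)⟩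
    have h2 := hp.1.2
    have h3 : 0 < 1 - l := by linarith
    gcongr
    linarith
  have hfin1 := measure_scaledSet_lt_top hν hD2 hM1 hgq (show 0 < 1 + l by linarith)
  have hfin2 := measure_scaledSet_lt_top hν hD2 hM1 hgq (show 0 < 1 - l by linarith)
  have hdiff : ν (T l) = ν (scaledSet q 1 (1 - l)) - ν (scaledSet q 1 (1 + l)) :=
    measure_sdiff hsub (measurableSet_scaledSet hq one_pos).nullMeasurableSet hfin1.ne
  have hFint : ∫⁻ s in Set.Ioi (0 : ℝ), F l s = ENNReal.ofReal (1 / (2 * l)) * ν (T l) := by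
    rw [hD2.apply_iterated (hTm l)]
    simp only [hF]
    rw [lintegral_const_mul']
    exact ENNReal.ofReal_ne_top
  simp only [Function.comp]
  rw [hFint, hdiff, ENNReal.toReal_mul, ENNReal.toReal_sub_of_le (measure_mono hsub) hfin2.ne,
    ENNReal.toReal_ofReal (by positivity)]
  ring

end Derivative

/-! ### The boundary function -/

section Boundary

variable {q : ℝ → ℝ≥0∞} {γ : Fin 2 → ℝ}

lemma xLow_nonneg (q : ℝ → ℝ≥0∞) : 0 ≤ xLow q := Real.sInf_nonneg fun _ h => h.1

lemma eq_top_of_lt_xLow {x : ℝ} (hx : 0 ≤ x) (h : x < xLow q) : q x = ⊤ := by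
  by_contra hne
  exact h.not_ge (csInf_le ⟨0, fun _ h => h.1⟩ ⟨hx, lt_top_iff_ne_top.2 hne⟩)

lemma CondQ1.lt_top (hQ1 : CondQ1 q) {x : ℝ} (h : xLow q < x) : q x < ⊤ := by
  obtain ⟨p, hp⟩ := hQ1.2.2.2
  obtain ⟨z, hz, hzx⟩ := exists_lt_of_csInf_lt
    (⟨p.1, hp.1, hp.2.2.trans_lt ENNReal.ofReal_lt_top⟩ :
      {x : ℝ | 0 ≤ x ∧ q x < ⊤}.Nonempty) h
  exact (hQ1.1 hz.1 (hz.1.trans hzx.le) hzx.le).trans_lt hz.2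

/-- The generalized inverse of `q`. -/
noncomputable def dualFn (q : ℝ → ℝ≥0∞) (y : ℝ) : ℝ≥0∞ :=
  ⨅ x ∈ {x : ℝ | 0 ≤ x ∧ q x ≤ ENNReal.ofReal y}, ENNReal.ofReal x

/-- Right-continuity of `q` makes the infimum in `dualFn` attained, which is the nontrivial
direction of the equivalence. -/
lemma CondQ1.dualPair (hQ1 : CondQ1 q) : DualPair q (dualFn q) where
  anti := hQ1.1
  anti' := fun y _ y' _ hyy' => biInf_mono fun _ hx =>
    ⟨hx.1, hx.2.trans (ENNReal.ofReal_le_ofReal hyy')⟩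
  iff := by
    intro x y hx hy
    refine ⟨fun h => iInf₂_le x ⟨hx, h⟩, fun h => ?_⟩
    have hright : ∀ x', x < x' → q x' ≤ ENNReal.ofReal y := by
      intro x' hx'
      have h1 : dualFn q y < ENNReal.ofReal x' :=
        h.trans_lt ((ENNReal.ofReal_lt_ofReal_iff (hx.trans_lt hx')).2 hx')
      simp only [dualFn, iInf_lt_iff] at h1
      obtain ⟨z, hz, hzx⟩ := h1
      have hzx := (ENNReal.ofReal_lt_ofReal_iff_of_nonneg hz.1).1 hzx
      exact (hQ1.1 hz.1 (hx.trans hx'.le) hzx.le).trans hz.2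
    have hc : Tendsto q (𝓝[>] x) (𝓝 (q x)) :=
      (hQ1.2.1 x hx).mono_left (nhdsWithin_mono _ Set.Ioi_subset_Ici_self)
    exact le_of_tendsto hc (eventually_nhdsWithin_of_forall hright)

/-- Right-continuity at `0` and `q 0 > 0`. This separates the failure set from the origin. -/
lemma CondQ1.exists_lt_near_zero (hQ1 : CondQ1 q) :
    ∃ δ x0 : ℝ, 0 < δ ∧ 0 < x0 ∧ ∀ x, 0 ≤ x → x < x0 → ENNReal.ofReal δ < q x := by
  obtain ⟨δ, -, hδ0, hδ⟩ := ENNReal.lt_iff_exists_real_btwn.1 hQ1.2.2.1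
  have hδ0 := ENNReal.ofReal_pos.1 hδ0
  have h := (hQ1.2.1 0 le_rfl).eventually (lt_mem_nhds hδ)
  obtain ⟨x0, hx0, hx⟩ := (mem_nhdsGE_iff_exists_Ico_subset).1 h
  exact ⟨δ, x0, hδ0, hx0, fun x h1 h2 => hx ⟨h1, h2⟩⟩

lemma qInv_le {x v : ℝ} (hx : 0 < x) (h : q x ≤ ENNReal.ofReal v) : qInv q v ≤ x :=
  csInf_le ⟨0, fun _ h => h.1.le⟩ ⟨hx, h⟩

lemma qInfty_le {x v : ℝ} (hx : 0 ≤ x) (hv : 0 ≤ v) (h : q x ≤ ENNReal.ofReal v) :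
    qInfty q ≤ v :=
  ENNReal.toReal_le_of_le_ofReal hv ((iInf₂_le x hx).trans h)

/-- If `q(∞) = 0`, the growth condition on `qInv` applies, because `qInv q Q ≤ x` whenever `q x ≤ Q`
and `x > 0`. If `q(∞) > 0`, no point of the set has a second coordinate below `q(∞)`, and the
requirement is void for small `δ`. -/
lemma CondQ1.axisGrowth (hQ1 : CondQ1 q) (hQ2 : CondQ2 γ q) : AxisGrowth (γ 1) q := by
  obtain ⟨δ0, x0, hδ0, hx0, hnear⟩ := hQ1.exists_lt_near_zero
  have hx0le : ∀ δ x Q : ℝ, δ ≤ δ0 → 0 ≤ x → Q < δ → q x ≤ ENNReal.ofReal Q → x0 ≤ x := by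
    intro δ x Q hδ hx hQδ h
    by_contra hlt
    exact (hnear x hx (not_le.1 hlt)).not_ge
      (h.trans (ENNReal.ofReal_le_ofReal (hQδ.le.trans hδ)))
  have hq0 : 0 ≤ qInfty q := ENNReal.toReal_nonneg
  rcases hq0.eq_or_lt with h0 | h0
  · obtain ⟨C, hC, hbig⟩ := hQ2.2.exists_pos
    have hev := hbig.bound
    rw [← h0] at hev
    obtain ⟨δ1, hδ1, hsub⟩ := mem_nhdsGT_iff_exists_Ioo_subset.1 hev
    refine ⟨min (Real.exp (-1)) (min δ0 δ1), C, x0, lt_min (Real.exp_pos _) (lt_min hδ0 hδ1),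
      min_le_left _ _, hC, hx0, fun x Q hx hQ hQδ h => ?_⟩
    have hx0x := hx0le _ x Q ((min_le_right _ _).trans (min_le_left _ _)) hx hQδ h
    refine ⟨hx0x, ?_⟩
    have h1 := hsub ⟨hQ, hQδ.trans_le ((min_le_right _ _).trans (min_le_right _ _))⟩
    have hnn : 0 ≤ qInv q Q := Real.sInf_nonneg fun _ h => h.1.le
    have h2 : ‖Q ^ ((1 - γ 1) / 2) * |Real.log Q|‖ ≤ C * ‖qInv q Q‖ := h1
    rw [Real.norm_of_nonneg (by positivity), Real.norm_of_nonneg hnn] at h2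
    refine h2.trans ?_
    gcongr
    exact qInv_le (hx0.trans_le hx0x) h
  · refine ⟨min (Real.exp (-1)) (min δ0 (qInfty q)), 1, x0,
      lt_min (Real.exp_pos _) (lt_min hδ0 h0), min_le_left _ _, one_pos, hx0,
      fun x Q hx hQ hQδ h => ?_⟩
    have := qInfty_le hx hQ.le h
    have := hQδ.trans_le ((min_le_right _ _).trans (min_le_right _ _))
    linarith

/-- The roles are reversed. If `x_l = 0`, the growth condition on `q` is used directly. If `x_l >
0`, then `q` is infinite at small arguments and the requirement is void. -/
lemma CondQ1.axisGrowth_dual (hQ1 : CondQ1 q) (hQ2 : CondQ2 γ q) :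
    AxisGrowth (γ 0) (dualFn q) := by
  obtain ⟨δ0, x0, hδ0, hx0, hnear⟩ := hQ1.exists_lt_near_zero
  have hdual := hQ1.dualPair
  have hle : ∀ Q y : ℝ, 0 < Q → Q < x0 → 0 ≤ y → q Q ≤ ENNReal.ofReal y → δ0 ≤ y := by
    intro Q y hQ hQx hy h
    have := (hnear Q hQ.le hQx).trans_le h
    exact (ENNReal.ofReal_lt_ofReal_iff_of_nonneg hδ0.le).1 this |>.le
  rcases (xLow_nonneg q).eq_or_lt with h0 | h0
  · obtain ⟨C, hC, hbig⟩ := hQ2.1.exists_pos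
    have hev := hbig.bound
    rw [← h0] at hev
    obtain ⟨δ1, hδ1, hsub⟩ := mem_nhdsGT_iff_exists_Ioo_subset.1 hev
    refine ⟨min (Real.exp (-1)) (min x0 δ1), C, δ0, lt_min (Real.exp_pos _) (lt_min hx0 hδ1),
      min_le_left _ _, hC, hδ0, fun y Q hy hQ hQδ h => ?_⟩
    have h := (hdual.iff Q y hQ.le hy).2 h
    refine ⟨hle Q y hQ (hQδ.trans_le ((min_le_right _ _).trans (min_le_left _ _))) hy h, ?_⟩
    have h1 := hsub ⟨hQ, hQδ.trans_le ((min_le_right _ _).trans (min_le_right _ _))⟩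
    have h2 : ‖Q ^ ((1 - γ 0) / 2) * |Real.log Q|‖ ≤ C * ‖(q Q).toReal‖ := h1
    rw [Real.norm_of_nonneg (by positivity), Real.norm_of_nonneg ENNReal.toReal_nonneg] at h2
    refine h2.trans ?_
    gcongr
    exact ENNReal.toReal_le_of_le_ofReal hy h
  · refine ⟨min (Real.exp (-1)) (min x0 (xLow q)), 1, δ0,
      lt_min (Real.exp_pos _) (lt_min hx0 h0), min_le_left _ _, one_pos, hδ0,
      fun y Q hy hQ hQδ h => ?_⟩
    have h := (hdual.iff Q y hQ.le hy).2 h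
    rw [eq_top_of_lt_xLow hQ.le (hQδ.trans_le ((min_le_right _ _).trans (min_le_right _ _)))] at h
    exact absurd h (not_le.2 ENNReal.ofReal_lt_top)

/-- The growth condition bounds `q` from below just to the right of `x_l` by a multiple of a
function that vanishes only at `1`. The integrand is therefore positive on a set of positive length.
-/
lemma setIntegral_boundary_pos {ν : Measure (ℝ × ℝ)} {η : ℝ × ℝ → ℝ} (hD2 : CondD2 ν η)
    (hQ2 : CondQ2 γ q)
    (hint : IntegrableOn (fun u : ℝ => (q u).toReal * η (u, (q u).toReal)) (Set.Ioi (xLow q))) :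
    0 < ∫ u in Set.Ioi (xLow q), (q u).toReal * η (u, (q u).toReal) := by
  have hηpos : ∀ u, xLow q < u → 0 < η (u, (q u).toReal) := fun u hu => by
    have hu0 := (xLow_nonneg q).trans_lt hu
    refine hD2.2.2 _ ⟨⟨hu0.le, ENNReal.toReal_nonneg⟩, fun h => ?_⟩
    exact hu0.ne' (Prod.ext_iff.1 h).1
  rw [setIntegral_pos_iff_support_of_nonneg_ae ?_ hint]
  · obtain ⟨C, hC, hbig⟩ := hQ2.1.exists_pos
    obtain ⟨δ1, hδ1, hsub⟩ := mem_nhdsGT_iff_exists_Ioo_subset.1 hbig.bound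
    have hpos : 0 < volume (Set.Ioo (xLow q) δ1 \ {1}) := by
      rw [measure_sdiff_null (by simp), Real.volume_Ioo, ENNReal.ofReal_pos]
      exact sub_pos.2 hδ1
    refine hpos.trans_le (measure_mono fun u hu => ⟨?_, hu.1.1⟩)
    have hu0 := (xLow_nonneg q).trans_lt hu.1.1
    have h2 : ‖u ^ ((1 - γ 0) / 2) * |Real.log u|‖ ≤ C * ‖(q u).toReal‖ := hsub hu.1
    have hlog : Real.log u ≠ 0 := Real.log_ne_zero_of_pos_of_ne_one hu0 hu.2
    have h3 : 0 < u ^ ((1 - γ 0) / 2) * |Real.log u| :=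
      mul_pos (Real.rpow_pos_of_pos hu0 _) (abs_pos.2 hlog)
    rw [Real.norm_of_nonneg h3.le, Real.norm_of_nonneg ENNReal.toReal_nonneg] at h2
    have h4 : (q u).toReal ≠ 0 := by
      intro h
      rw [h] at h2
      linarith
    exact mul_ne_zero h4 (hηpos u hu.1.1).ne'
  · refine (ae_restrict_iff' measurableSet_Ioi).2 (Eventually.of_forall fun u hu => ?_)
    exact mul_nonneg ENNReal.toReal_nonneg (hηpos u hu).le

end Boundary

/-! ### Second order bounds for the tail quantile functions -/

section SecondOrder

variable {μ : Measure (ℝ × ℝ)} {γ ρ : Fin 2 → ℝ} {a b A : Fin 2 → ℝ → ℝ}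

lemma abs_log_le_rpow {x s : ℝ} (hx : 0 < x) (hs : 0 < s) :
    |Real.log x| ≤ (x ^ s + x ^ (-s)) / s := by
  have h1 := Real.log_le_rpow_div hx.le hs
  have h2 := Real.log_le_rpow_div (inv_pos.2 hx).le hs
  rw [Real.log_inv, Real.inv_rpow hx.le, ← Real.rpow_neg hx.le] at h2
  have h3 : 0 < x ^ s / s := by positivity
  have h4 : 0 < x ^ (-s) / s := by positivity
  rw [add_div, abs_le]
  constructor <;> linarith

/-- As the second order index is negative, the limit function is of smaller order than `x ^ g` away
from `0`. The logarithmic case occurs only for `g > 0`. -/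
lemma abs_psiBar_le (g : ℝ) {r x0 : ℝ} (hr : r < 0) (hx0 : 0 < x0) :
    ∃ K : ℝ, 0 < K ∧ ∀ x, x0 ≤ x → |psiBar g r x| ≤ K * x ^ g := by
  by_cases h : g + r = 0
  · have hg : 0 < g := by linarith
    refine ⟨(1 + x0 ^ (-(2 * g))) / g, by positivity, fun x hx => ?_⟩
    have hx' : 0 < x := hx0.trans_le hx
    rw [psiBar, if_pos h]
    refine (abs_log_le_rpow hx' hg).trans ?_
    have h1 : x ^ (-g) = x ^ (-(2 * g)) * x ^ g := by
      rw [← Real.rpow_add hx']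
      congr 1
      ring
    have h2 : x ^ (-(2 * g)) ≤ x0 ^ (-(2 * g)) :=
      Real.rpow_le_rpow_of_nonpos hx0 hx (by linarith)
    rw [h1, div_mul_eq_mul_div]
    gcongr
    rw [add_mul, one_mul]
    gcongr
  · refine ⟨x0 ^ r / |g + r|, div_pos (Real.rpow_pos_of_pos hx0 _) (abs_pos.2 h), fun x hx => ?_⟩
    have hx' : 0 < x := hx0.trans_le hx
    have h2 : x ^ r ≤ x0 ^ r := Real.rpow_le_rpow_of_nonpos hx0 hx hr.le
    rw [psiBar, if_neg h, abs_div, abs_of_pos (Real.rpow_pos_of_pos hx' _), Real.rpow_add hx',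
      div_mul_eq_mul_div, mul_comm]
    gcongr

/-- The uniform condition is used with `ε = -ρ/2`. The extra factors `x^(ρ/2)` and `x^(3ρ/2)` are
bounded on `x ≥ x0`, so the whole error is relative to `x ^ γ`. -/
lemma CondM2.exists_bound (hM2 : CondM2 μ γ ρ a b A) (i : Fin 2) {x0 : ℝ} (hx0 : 0 < x0) :
    ∃ K t0 : ℝ, 0 < K ∧ 0 < t0 ∧ ∀ t x : ℝ, x0 ≤ x → t0 < t → t0 < t * x →
      |(tailQ μ i (t * x) - b i t) / a i t - boxCox (γ i) x| ≤ K * |A i t| * x ^ γ i := by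
  obtain ⟨hρ, hpos, -, hunif⟩ := hM2 i
  obtain ⟨t0, ht0, H⟩ := hunif (-ρ i / 2) (by linarith) 1 one_pos
  obtain ⟨K, hK, hpsi⟩ := abs_psiBar_le (γ i) hρ hx0
  refine ⟨K + (x0 ^ (ρ i / 2) + x0 ^ (3 * ρ i / 2)), t0, by positivity, ht0,
    fun t x hx ht htx => ?_⟩
  have hx' : 0 < x := hx0.trans_le hx
  have hA : A i t ≠ 0 := (hpos t (ht0.trans ht)).2
  have h1 := H t x hx' ht htx
  obtain ⟨D, hD⟩ : ∃ D, D = (tailQ μ i (t * x) - b i t) / a i t - boxCox (γ i) x := ⟨_, rfl⟩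
  rw [← hD] at h1 ⊢
  have h2 : x ^ (γ i + ρ i) * max (x ^ (-ρ i / 2)) (x ^ (-(-ρ i / 2))) ≤
      (x0 ^ (ρ i / 2) + x0 ^ (3 * ρ i / 2)) * x ^ γ i := by
    rw [mul_max_of_nonneg _ _ (by positivity), ← Real.rpow_add hx', ← Real.rpow_add hx']
    have e1 : x ^ (γ i + ρ i + -ρ i / 2) = x ^ (ρ i / 2) * x ^ γ i := by
      rw [← Real.rpow_add hx']
      congr 1
      ring
    have e2 : x ^ (γ i + ρ i + -(-ρ i / 2)) = x ^ (3 * ρ i / 2) * x ^ γ i := by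
      rw [← Real.rpow_add hx']
      congr 1
      ring
    have h3 : x ^ (ρ i / 2) ≤ x0 ^ (ρ i / 2) :=
      Real.rpow_le_rpow_of_nonpos hx0 hx (by linarith)
    have h4 : x ^ (3 * ρ i / 2) ≤ x0 ^ (3 * ρ i / 2) :=
      Real.rpow_le_rpow_of_nonpos hx0 hx (by linarith)
    have h5 : 0 < x ^ γ i := by positivity
    have h6 : 0 < x0 ^ (ρ i / 2) := by positivity
    have h7 : 0 < x0 ^ (3 * ρ i / 2) := by positivity
    rw [e1, e2]
    refine max_le ?_ ?_
    · exact mul_le_mul_of_nonneg_right (by linarith) h5.le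
    · exact mul_le_mul_of_nonneg_right (by linarith) h5.le
  have h3 : |D / A i t| ≤ (K + (x0 ^ (ρ i / 2) + x0 ^ (3 * ρ i / 2))) * x ^ γ i := by
    have h4 : |D / A i t| ≤ |D / A i t - psiBar (γ i) (ρ i) x| + |psiBar (γ i) (ρ i) x| := by
      have := abs_add_le (D / A i t - psiBar (γ i) (ρ i) x) (psiBar (γ i) (ρ i) x)
      rwa [sub_add_cancel] at this
    have h5 := hpsi x hx
    linarith
  rw [abs_div, div_le_iff₀ (abs_pos.2 hA)] at h3
  linarith

lemma measure_coord_ge [IsProbabilityMeasure μ] (i : Fin 2) (u : ℝ) :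
    μ {z | u ≤ coord i z} = margLaw μ i (Set.Ici u) := by
  rw [margLaw_eq_map, Measure.map_apply (measurable_coord i) measurableSet_Ici]
  rfl

/-- With `ζ = K |A(t)|`, the normalized quantile at `T (1 - ζ)` does not exceed the Box-Cox value of
`T`. The event is therefore contained in an exact quantile tail of probability `1 / (t T (1 - ζ))`.
-/
lemma CondM2.exists_tail_bound [IsProbabilityMeasure μ] (hM1 : CondM1 μ)
    (hM2 : CondM2 μ γ ρ a b A) (i : Fin 2) (hγ : -1 ≤ γ i) {T0 : ℝ} (hT0 : 0 < T0) :
    ∃ K t0 : ℝ, 0 < K ∧ 0 < t0 ∧ ∀ t T : ℝ, T0 ≤ T → t0 < t → K * |A i t| ≤ 1 / 2 →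
      ENNReal.ofReal t * μ {z | boxCox (γ i) T ≤ (coord i z - b i t) / a i t} ≤
        ENNReal.ofReal ((1 + 2 * (K * |A i t|)) / T) := by
  obtain ⟨K, t0, hK, ht0, H⟩ := hM2.exists_bound i (half_pos hT0)
  obtain ⟨t1, ht1, hval, -⟩ := exists_regular_tail hM1 i
  refine ⟨K, max t0 t1 * max 1 (2 / T0), hK, by positivity, fun t T hT ht hζ => ?_⟩
  obtain ⟨ζ, hζ'⟩ : ∃ ζ, ζ = K * |A i t| := ⟨_, rfl⟩
  rw [← hζ'] at hζ ⊢
  have hζ0 : 0 ≤ ζ := by rw [hζ']; positivity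
  have hT' : 0 < T := hT0.trans_le hT
  have hx : T0 / 2 ≤ T * (1 - ζ) := by nlinarith
  have hmax : 0 < max t0 t1 := lt_max_of_lt_left ht0
  have htt : max t0 t1 < t := by
    have := le_max_left 1 (2 / T0)
    nlinarith
  have htx : max t0 t1 < t * (T * (1 - ζ)) := by
    have h1 : max t0 t1 * (2 / T0) < t :=
      lt_of_le_of_lt (by gcongr; exact le_max_right _ _) ht
    rw [mul_div_assoc', div_lt_iff₀ hT0] at h1
    have h2 : 0 < t := hmax.trans htt
    nlinarith
  have hx' : 0 < T * (1 - ζ) := by linarith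
  have ht' : 0 < t := hmax.trans htt
  have hbound := H t (T * (1 - ζ)) hx ((le_max_left _ _).trans_lt htt)
    ((le_max_left _ _).trans_lt htx)
  rw [← hζ'] at hbound
  -- The step from `T (1 - ζ)` up to `T` gains `(T (1 - ζ))^γ` times a Box-Cox value of at least
  -- `ζ`. This just compensates the second order error.
  have hinc : boxCox (γ i) (T * (1 - ζ)) + ζ * (T * (1 - ζ)) ^ γ i ≤ boxCox (γ i) T := by
    have h1ζ : 0 < 1 - ζ := by linarith
    have e : T = T * (1 - ζ) * (1 - ζ)⁻¹ := by field_simp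
    have h2 := boxCox_mul (g := γ i) hx' (inv_pos.2 h1ζ)
    rw [← e] at h2
    have h3 := one_sub_inv_le_boxCox hγ (inv_pos.2 h1ζ)
    rw [inv_inv] at h3
    have h4 : 0 < (T * (1 - ζ)) ^ γ i := Real.rpow_pos_of_pos hx' _
    nlinarith
  have hmain : (tailQ μ i (t * (T * (1 - ζ))) - b i t) / a i t ≤ boxCox (γ i) T := by
    have := (abs_le.1 hbound).2
    linarith
  have ha := ((hM2 i).2.1 t ht').1
  have hsub : {z | boxCox (γ i) T ≤ (coord i z - b i t) / a i t} ⊆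
      {z | tailQ μ i (t * (T * (1 - ζ))) ≤ coord i z} := by
    intro z hz
    have h1 := hmain.trans hz
    rw [div_le_div_iff_of_pos_right ha] at h1
    show tailQ μ i (t * (T * (1 - ζ))) ≤ coord i z
    linarith
  calc ENNReal.ofReal t * μ {z | boxCox (γ i) T ≤ (coord i z - b i t) / a i t}
      ≤ ENNReal.ofReal t * μ {z | tailQ μ i (t * (T * (1 - ζ))) ≤ coord i z} := by gcongr
    _ = ENNReal.ofReal (t * (1 / (t * (T * (1 - ζ))))) := by
        rw [measure_coord_ge, measure_Ici_tailQ ht1 hval ((le_max_right _ _).trans_lt htx),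
          ENNReal.ofReal_mul ht'.le]
    _ ≤ _ := by
        refine ENNReal.ofReal_le_ofReal ?_
        have h1ζ : 0 < 1 - ζ := by linarith
        rw [mul_one_div, ← div_div, div_self ht'.ne', le_div_iff₀ hT', div_mul_eq_mul_div,
          div_le_iff₀ hx']
        have : 1 ≤ (1 + 2 * ζ) * (1 - ζ) := by nlinarith
        nlinarith

end SecondOrder

/-! ### Monotone perturbations of the marginal transformations -/

section Branch

variable {g E l m u X : ℝ} {φ : ℝ → ℝ}

/-- `gpdR g ∘ φ` is a strictly increasing perturbation of `x ↦ l * x` on `[u, X]`. -/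
structure Branch (g E l m u X : ℝ) (φ : ℝ → ℝ) : Prop where
  mono : StrictMonoOn φ (Set.Ici u)
  surj : ∀ w ∈ Set.Icc (φ u) (φ X), ∃ x ∈ Set.Icc u X, φ x = w
  valid : ∀ x ∈ Set.Icc u X, 0 < 1 + g * φ x
  close : ∀ x ∈ Set.Icc u X, Close E l m (gpdR g (φ x)) x

lemma Close.le_mul {p x : ℝ} (h : Close E l m p x) (hl : 0 < l) (hx : 0 < x) :
    l * x / 2 ≤ p ∧ p ≤ 3 / 2 * (l * x) := by
  have h1 := abs_le.1 h.1
  have hlx : 0 < l * x := by positivity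
  constructor
  · have := h1.1
    have h2 : 1 / 2 ≤ p / (l * x) := by linarith
    rw [le_div_iff₀ hlx] at h2
    linarith
  · have := h1.2
    have h2 : p / (l * x) ≤ 3 / 2 := by linarith
    rwa [div_le_iff₀ hlx] at h2

lemma Branch.boxCox_le (h : Branch g E l m u X φ) (hl : 0 < l) (hu : 0 < u) {x p : ℝ}
    (hx : x ∈ Set.Icc u X) (hp : 0 < p) (hpx : p ≤ l * x / 2) : boxCox g p ≤ φ x :=
  boxCox_le_of_le_gpdR (h.valid x hx) hp
    (hpx.trans ((h.close x hx).le_mul hl (hu.trans_le hx.1)).1)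

/-- The value at `X` is at least `l * X / 2`, so every level between the value at `v` and this bound
is attained. -/
lemma Branch.exists_gpdR_eq (h : Branch g E l m u X φ) (hl : 0 < l) (hu : 0 < u) {v p : ℝ}
    (hv : u ≤ v) (hvX : v ≤ X) (hp : gpdR g (φ v) ≤ p) (hpX : p ≤ l * X / 2) :
    ∃ x ∈ Set.Icc v X, gpdR g (φ x) = p := by
  have hvm : v ∈ Set.Icc u X := ⟨hv, hvX⟩
  have hXm : X ∈ Set.Icc u X := ⟨hv.trans hvX, le_rfl⟩
  have hp0 : 0 < p := (gpdR_pos (h.valid v hvm)).trans_le hp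
  have h1 : φ v ≤ boxCox g p := le_boxCox_of_gpdR_le (h.valid v hvm) hp
  have h2 : boxCox g p ≤ φ X := h.boxCox_le hl hu hXm hp0 hpX
  have h3 : φ u ≤ φ v := h.mono.monotoneOn Set.self_mem_Ici hv hv
  obtain ⟨x, hx, hxe⟩ := h.surj _ ⟨h3.trans h1, h2⟩
  refine ⟨x, ⟨?_, hx.2⟩, by rw [hxe, gpdR_boxCox hp0]⟩
  rw [← hxe] at h1
  exact (h.mono.le_iff_le hv hx.1).1 h1

lemma Branch.le_of_gpdInv_eq (h : Branch g E l m u X φ) {v x Y : ℝ} (hv : v ∈ Set.Icc u X)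
    (hx : v ≤ x) (hY : gpdInv g Y = gpdInv g (φ x)) : φ v ≤ Y := by
  refine le_of_gpdInv_le (Or.inl (h.valid v hv)) ?_
  rw [hY]
  exact gpdInv_mono g (h.mono.monotoneOn hv.1 (hv.1.trans hx) hx)

/-- `gpdInv` is not injective on its truncated range. A level below the Box-Cox value of `l X / 2`
forces `x ≤ X`, where the branch is regular and the level is determined. -/
lemma Branch.eq_of_gpdInv_eq (h : Branch g E l m u X φ) (hl : 0 < l) (hu : 0 < u) (hX : u ≤ X)
    {x Y p : ℝ} (hx : u ≤ x) (hY : gpdInv g Y = gpdInv g (φ x)) (hp : 0 < p)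
    (hpX : p ≤ l * X / 2) (hYp : Y < boxCox g p) : x ≤ X ∧ Y = φ x := by
  have hxX : x ≤ X := by
    by_contra hlt
    have h1 := h.le_of_gpdInv_eq ⟨hX, le_rfl⟩ (not_le.1 hlt).le hY
    have h2 := h.boxCox_le hl hu ⟨hX, le_rfl⟩ hp hpX
    linarith
  exact ⟨hxX, ExtremeFailure.eq_of_gpdInv_eq (h.valid x ⟨hx, hxX⟩) hY⟩

lemma Branch.finite_of_eq (h : Branch g E l m u X φ) (hl : 0 < l) (hu : 0 < u) (hX : u ≤ X)
    {x p : ℝ} (hx : u ≤ x) (hp : gpdInv g (φ x) = ENNReal.ofReal p) (hp0 : 0 ≤ p)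
    (hpX : p < l * X / 2) : x ≤ X ∧ p = gpdR g (φ x) := by
  have hxX : x ≤ X := by
    by_contra hlt
    have h1 : gpdInv g (φ X) ≤ ENNReal.ofReal p := by
      rw [← hp]
      exact gpdInv_mono g (h.mono.monotoneOn hX hx (not_le.1 hlt).le)
    rw [gpdInv_eq_ofReal (h.valid X ⟨hX, le_rfl⟩), ENNReal.ofReal_le_ofReal_iff hp0] at h1
    have h2 := ((h.close X ⟨hX, le_rfl⟩).le_mul hl (hu.trans_le hX)).1
    linarith
  refine ⟨hxX, ?_⟩
  have hv := h.valid x ⟨hx, hxX⟩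
  rw [gpdInv_eq_ofReal hv, ENNReal.ofReal_eq_ofReal_iff (gpdR_pos hv).le hp0] at hp
  exact hp.symm

/-- The inverse function of `φ`. -/
noncomputable def branchInv (φ : ℝ → ℝ) (u X w : ℝ) : ℝ := sSup {x | x ∈ Set.Icc u X ∧ φ x ≤ w}

lemma branchInv_nonneg (hu : 0 < u) (w : ℝ) : 0 ≤ branchInv φ u X w :=
  Real.sSup_nonneg fun _ hx => hu.le.trans hx.1.1

lemma branchInv_mono (hu : 0 < u) : Monotone (branchInv φ u X) := by
  intro w w' hw
  rcases Set.eq_empty_or_nonempty {x | x ∈ Set.Icc u X ∧ φ x ≤ w} with h | h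
  · rw [branchInv, h, Real.sSup_empty]
    exact branchInv_nonneg hu w'
  · exact csSup_le_csSup ⟨X, fun x hx => hx.1.2⟩ h fun x hx => ⟨hx.1, hx.2.trans hw⟩

lemma Branch.branchInv_eq (h : Branch g E l m u X φ) {x : ℝ} (hx : x ∈ Set.Icc u X) :
    branchInv φ u X (φ x) = x :=
  IsGreatest.csSup_eq ⟨⟨hx, le_rfl⟩, fun _ hy => (h.mono.le_iff_le hy.1.1 hx.1).1 hy.2⟩

/-- The rescaled, estimated transformation: `hit Y x` says that the level `Y` is mapped to the
rescaled image of `x`, and this amounts to `Y = φ x` on `[u, X]`. -/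
structure HatBranch (d u X : ℝ) (hit : ℝ → ℝ → Prop) (φ : ℝ → ℝ) : Prop where
  mono : StrictMonoOn φ (Set.Ici u)
  surj : ∀ w ∈ Set.Icc (φ u) (φ X), ∃ x ∈ Set.Icc u X, φ x = w
  iff : ∀ x ∈ Set.Icc u X, ∀ Y, hit Y x ↔ Y = φ x
  lt : ∀ x Y, 1 < d * x → x < u → hit Y x → Y < φ u
  ge : ∀ x Y, X < x → hit Y x → φ X ≤ Y

end Branch

/-! ### Corner, edge and overflow events, and the inclusions between them. -/

section Sandwich

variable {μ ν : Measure (ℝ × ℝ)} {η : ℝ × ℝ → ℝ} {q f : ℝ → ℝ≥0∞} {γ a b : Fin 2 → ℝ}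

/-- The part of the failure set with coordinates at least `u` and `v`. -/
def cornerSet (q : ℝ → ℝ≥0∞) (u v : ℝ) : Set (ℝ × ℝ) := {p | p ∈ baseSet q ∧ u ≤ p.1 ∧ v ≤ p.2}

/-- The two marginal transformations. -/
noncomputable def pairMap (γ : Fin 2 → ℝ) (φ ψ : ℝ → ℝ) (p : ℝ × ℝ) : ℝ≥0∞ × ℝ≥0∞ :=
  (gpdInv (γ 0) (φ p.1), gpdInv (γ 1) (ψ p.2))

/-- The event that the standardized observation is in the image of a corner. -/
def cornerEvent (γ a b : Fin 2 → ℝ) (q : ℝ → ℝ≥0∞) (φ ψ : ℝ → ℝ) (u v : ℝ) : Set (ℝ × ℝ) :=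
  {z | standardize γ a b z ∈ pairMap γ φ ψ '' cornerSet q u v}

/-- The normalized coordinates of an observation. -/
noncomputable def level (a b : Fin 2 → ℝ) (i : Fin 2) (z : ℝ × ℝ) : ℝ := (coord i z - b i) / a i

lemma measurable_level (a b : Fin 2 → ℝ) (i : Fin 2) : Measurable (level a b i) :=
  ((measurable_coord i).sub_const _).div_const _

lemma standardize_eq (γ a b : Fin 2 → ℝ) (z : ℝ × ℝ) : standardize γ a b z =
    (gpdInv (γ 0) (level a b 0 z), gpdInv (γ 1) (level a b 1 z)) := rfl

lemma mem_cornerEvent {φ ψ : ℝ → ℝ} {u v : ℝ} {z : ℝ × ℝ} :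
    z ∈ cornerEvent γ a b q φ ψ u v ↔ ∃ x y : ℝ, (x, y) ∈ baseSet q ∧ u ≤ x ∧ v ≤ y ∧
      gpdInv (γ 0) (level a b 0 z) = gpdInv (γ 0) (φ x) ∧
      gpdInv (γ 1) (level a b 1 z) = gpdInv (γ 1) (ψ y) := by
  constructor
  · rintro ⟨p, hp, he⟩
    rw [standardize_eq] at he
    exact ⟨p.1, p.2, hp.1, hp.2.1, hp.2.2, (Prod.ext_iff.1 he).1.symm, (Prod.ext_iff.1 he).2.symm⟩
  · rintro ⟨x, y, hS, hx, hy, h1, h2⟩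
    exact ⟨(x, y), ⟨hS, hx, hy⟩, Prod.ext h1.symm h2.symm⟩

lemma mem_finitePart {φ ψ : ℝ → ℝ} {u v : ℝ} {p : ℝ × ℝ} :
    p ∈ finitePart (pairMap γ φ ψ '' cornerSet q u v) ↔ p ∈ quadrant ∧ ∃ x y : ℝ,
      (x, y) ∈ baseSet q ∧ u ≤ x ∧ v ≤ y ∧ gpdInv (γ 0) (φ x) = ENNReal.ofReal p.1 ∧
      gpdInv (γ 1) (ψ y) = ENNReal.ofReal p.2 := by
  constructor
  · rintro ⟨hp, w, hw, he⟩
    exact ⟨hp, w.1, w.2, hw.1, hw.2.1, hw.2.2, (Prod.ext_iff.1 he).1, (Prod.ext_iff.1 he).2⟩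
  · rintro ⟨hp, x, y, hS, hx, hy, h1, h2⟩
    exact ⟨hp, (x, y), ⟨hS, hx, hy⟩, Prod.ext h1 h2⟩

lemma TailApprox.le [IsProbabilityMeasure μ] {t r : ℝ} {B : Set (ℝ≥0∞ × ℝ≥0∞)}
    (h : TailApprox μ ν γ a b t B r) (ht : 0 < t) :
    ENNReal.ofReal t * μ {z | standardize γ a b z ∈ B} ≤ ν (finitePart B) + ENNReal.ofReal r := by
  have h1 := (abs_le.1 h.2).2
  have hr : 0 ≤ r := (abs_nonneg _).trans h.2
  rw [← ENNReal.ofReal_toReal h.1, ← ENNReal.ofReal_add ENNReal.toReal_nonneg hr,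
    ← ofReal_measureReal (μ := μ), ← ENNReal.ofReal_mul ht.le]
  exact ENNReal.ofReal_le_ofReal (by linarith)

lemma TailApprox.ge [IsProbabilityMeasure μ] {t r : ℝ} {B : Set (ℝ≥0∞ × ℝ≥0∞)}
    (h : TailApprox μ ν γ a b t B r) (ht : 0 < t) :
    ν (finitePart B) ≤ ENNReal.ofReal t * μ {z | standardize γ a b z ∈ B} + ENNReal.ofReal r := by
  have h1 := (abs_le.1 h.2).1
  have hr : 0 ≤ r := (abs_nonneg _).trans h.2
  rw [← ENNReal.ofReal_toReal h.1, ← ofReal_measureReal (μ := μ), ← ENNReal.ofReal_mul ht.le,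
    ← ENNReal.ofReal_add (by positivity) hr]
  exact ENNReal.ofReal_le_ofReal (by linarith)

end Sandwich

section Sandwich

variable {μ ν : Measure (ℝ × ℝ)} {η : ℝ × ℝ → ℝ} {q f : ℝ → ℝ≥0∞} {γ a b : Fin 2 → ℝ}

/-- The event that an observation is mapped into the rescaled estimated failure set. -/
def hatEvent (a b : Fin 2 → ℝ) (q : ℝ → ℝ≥0∞) (d : ℝ) (hit0 hit1 : ℝ → ℝ → Prop) :
    Set (ℝ × ℝ) :=
  {z | ∃ x y : ℝ, (x, y) ∈ baseSet q ∧ 1 < d * x ∧ 1 < d * y ∧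
    hit0 (level a b 0 z) x ∧ hit1 (level a b 1 z) y}

/-- The event that the `i`-th coordinate is very large. -/
def overflow (γ a b : Fin 2 → ℝ) (i : Fin 2) (T : ℝ) : Set (ℝ × ℝ) :=
  {z | boxCox (γ i) T ≤ level a b i z}

/-- The event that one coordinate is small and the other one is not. -/
def edgeEvent (a b : Fin 2 → ℝ) (i j : Fin 2) (w w' : ℝ) : Set (ℝ × ℝ) :=
  {z | level a b i z < w ∧ w' ≤ level a b j z}

/-- Outside the overflow events both preimages `x`, `y` are at most `X/8`. If both exceed the
cut-offs, passing to the smaller branches only increases the preimages, and these stay in the upper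
set. If one is below its cut-off, the other one is at least the boundary value there, which is an
edge event. -/
lemma hatEvent_subset {E l0 l1 m0 m1 d u0 u1 X : ℝ} {φs0 φb0 φ0 φs1 φb1 φ1 : ℝ → ℝ}
    {hit0 hit1 : ℝ → ℝ → Prop} (hqf : DualPair q f) (hl0 : 0 < l0) (hl1 : 0 < l1)
    (hu0 : 0 < u0) (hu1 : 0 < u1) (hX0 : u0 ≤ X / 8) (hX1 : u1 ≤ X / 8)
    (hs0 : Branch (γ 0) E l0 m0 u0 X φs0) (hs1 : Branch (γ 1) E l1 m1 u1 X φs1)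
    (hh0 : HatBranch d u0 X hit0 φ0) (hh1 : HatBranch d u1 X hit1 φ1)
    (hle0 : ∀ x ∈ Set.Icc u0 X, φs0 x ≤ φ0 x ∧ φ0 x ≤ φb0 x)
    (hle1 : ∀ x ∈ Set.Icc u1 X, φs1 x ≤ φ1 x ∧ φ1 x ≤ φb1 x)
    (hy0 : q u0 ≤ ENNReal.ofReal (X / 8) → u1 ≤ (q u0).toReal)
    (hx0 : f u1 ≤ ENNReal.ofReal (X / 8) → u0 ≤ (f u1).toReal) :
    hatEvent a b q d hit0 hit1 ⊆ cornerEvent γ a b q φs0 φs1 u0 u1 ∪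
      {z | q u0 ≤ ENNReal.ofReal (X / 8) ∧ z ∈ edgeEvent a b 0 1 (φb0 u0) (φs1 (q u0).toReal)} ∪
      {z | f u1 ≤ ENNReal.ofReal (X / 8) ∧ z ∈ edgeEvent a b 1 0 (φb1 u1) (φs0 (f u1).toReal)} ∪
      overflow γ a b 0 (l0 * X / 16) ∪ overflow γ a b 1 (l1 * X / 16) := by
  rintro z ⟨x, y, hS, hdx, hdy, hzx, hzy⟩
  by_cases hO0 : z ∈ overflow γ a b 0 (l0 * X / 16)
  · exact Or.inl (Or.inr hO0)
  by_cases hO1 : z ∈ overflow γ a b 1 (l1 * X / 16)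
  · exact Or.inr hO1
  refine Or.inl (Or.inl ?_)
  have hXp : 0 < X := by linarith
  have hO0 : level a b 0 z < boxCox (γ 0) (l0 * X / 16) := not_le.1 hO0
  have hO1 : level a b 1 z < boxCox (γ 1) (l1 * X / 16) := not_le.1 hO1
  have hlarge0 : ∀ x ∈ Set.Icc (X / 8) X, boxCox (γ 0) (l0 * X / 16) ≤ φ0 x := fun x hx => by
    have hx' : x ∈ Set.Icc u0 X := ⟨hX0.trans hx.1, hx.2⟩
    refine (hs0.boxCox_le hl0 hu0 hx' (by positivity) ?_).trans (hle0 x hx').1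
    have := mul_le_mul_of_nonneg_left hx.1 hl0.le
    linarith
  have hlarge1 : ∀ x ∈ Set.Icc (X / 8) X, boxCox (γ 1) (l1 * X / 16) ≤ φ1 x := fun x hx => by
    have hx' : x ∈ Set.Icc u1 X := ⟨hX1.trans hx.1, hx.2⟩
    refine (hs1.boxCox_le hl1 hu1 hx' (by positivity) ?_).trans (hle1 x hx').1
    have := mul_le_mul_of_nonneg_left hx.1 hl1.le
    linarith
  have hXX : X ∈ Set.Icc (X / 8) X := ⟨by linarith, le_rfl⟩
  have hxX : x ≤ X / 8 := by
    by_contra hlt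
    rcases le_or_gt x X with h | h
    · have h1 := hlarge0 x ⟨(not_le.1 hlt).le, h⟩
      rw [← (hh0.iff x ⟨hX0.trans (not_le.1 hlt).le, h⟩ _).1 hzx] at h1
      linarith
    · have h1 := hlarge0 X hXX
      have h2 := hh0.ge x _ h hzx
      linarith
  have hyX : y ≤ X / 8 := by
    by_contra hlt
    rcases le_or_gt y X with h | h
    · have h1 := hlarge1 y ⟨(not_le.1 hlt).le, h⟩
      rw [← (hh1.iff y ⟨hX1.trans (not_le.1 hlt).le, h⟩ _).1 hzy] at h1
      linarith
    · have h1 := hlarge1 X hXX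
      have h2 := hh1.ge y _ h hzy
      linarith
  have hu0m : u0 ∈ Set.Icc u0 X := ⟨le_rfl, by linarith⟩
  have hu1m : u1 ∈ Set.Icc u1 X := ⟨le_rfl, by linarith⟩
  by_cases hxu : x < u0
  · left; right
    have hqy : q u0 ≤ ENNReal.ofReal y :=
      (hqf.anti hS.1 hu0.le hxu.le).trans hS.2.2
    have hq8 : q u0 ≤ ENNReal.ofReal (X / 8) := hqy.trans (ENNReal.ofReal_le_ofReal hyX)
    refine ⟨hq8, (hh0.lt x _ hdx hxu hzx).trans_le (hle0 u0 hu0m).2, ?_⟩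
    have h1 : (q u0).toReal ≤ y := ENNReal.toReal_le_of_le_ofReal hS.2.1 hqy
    have h2 := hy0 hq8
    have hym : y ∈ Set.Icc u1 X := ⟨h2.trans h1, by linarith⟩
    rw [(hh1.iff y hym _).1 hzy]
    exact (hs1.mono.monotoneOn h2 (h2.trans h1) h1).trans (hle1 y hym).1
  by_cases hyu : y < u1
  · right
    have hfx : f u1 ≤ ENNReal.ofReal x := by
      rw [← hqf.iff x u1 hS.1 hu1.le]
      exact hS.2.2.trans (ENNReal.ofReal_le_ofReal hyu.le)
    have hf8 : f u1 ≤ ENNReal.ofReal (X / 8) := hfx.trans (ENNReal.ofReal_le_ofReal hxX)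
    refine ⟨hf8, (hh1.lt y _ hdy hyu hzy).trans_le (hle1 u1 hu1m).2, ?_⟩
    have h1 : (f u1).toReal ≤ x := ENNReal.toReal_le_of_le_ofReal hS.1 hfx
    have h2 := hx0 hf8
    have hxm : x ∈ Set.Icc u0 X := ⟨h2.trans h1, by linarith⟩
    rw [(hh0.iff x hxm _).1 hzx]
    exact (hs0.mono.monotoneOn h2 (h2.trans h1) h1).trans (hle0 x hxm).1
  left; left
  have hxm : x ∈ Set.Icc u0 X := ⟨not_lt.1 hxu, by linarith⟩
  have hym : y ∈ Set.Icc u1 X := ⟨not_lt.1 hyu, by linarith⟩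
  -- The level equals `φ x`, which is at least `φs x`. Without overflow it is also attained by `φs`,
  -- necessarily at some `x' ≥ x`.
  have key : ∀ {i : Fin 2} {l m u : ℝ} {φs φ : ℝ → ℝ} {hit : ℝ → ℝ → Prop} {x : ℝ}, 0 < l →
      0 < u → Branch (γ i) E l m u X φs → HatBranch d u X hit φ → (∀ x ∈ Set.Icc u X, φs x ≤ φ x) →
      x ∈ Set.Icc u X → hit (level a b i z) x → level a b i z < boxCox (γ i) (l * X / 16) →
      ∃ x', x ≤ x' ∧ level a b i z = φs x' := by
    intro i l m u φs φ hit x hl hu hs hh hle hx hz hO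
    have h1 : φs x ≤ level a b i z := by
      rw [(hh.iff x hx _).1 hz]
      exact hle x hx
    have h2 : boxCox (γ i) (l * X / 16) ≤ φs X :=
      hs.boxCox_le hl hu ⟨hx.1.trans hx.2, le_rfl⟩ (by positivity) (by nlinarith)
    obtain ⟨x', hx', he⟩ := hs.surj (level a b i z)
      ⟨(hs.mono.monotoneOn Set.self_mem_Ici hx.1 hx.1).trans h1, hO.le.trans h2⟩
    refine ⟨x', ?_, he.symm⟩
    rw [← he] at h1
    exact (hs.mono.le_iff_le hx.1 hx'.1).1 h1
  obtain ⟨x', hx', hex⟩ := key hl0 hu0 hs0 hh0 (fun x hx => (hle0 x hx).1) hxm hzx hO0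
  obtain ⟨y', hy', hey⟩ := key hl1 hu1 hs1 hh1 (fun x hx => (hle1 x hx).1) hym hzy hO1
  exact mem_cornerEvent.2 ⟨x', y', ⟨hS.1.trans hx', hS.2.1.trans hy',
    hqf.mono hS.1 hx' hy' hS.2.2⟩, hxm.1.trans hx', hym.1.trans hy', by rw [hex], by rw [hey]⟩

/-- A measurable version of the part of a corner event without very large coordinates. -/
def coreEvent (γ a b : Fin 2 → ℝ) (q : ℝ → ℝ≥0∞) (φ ψ : ℝ → ℝ) (u0 u1 X T0 T1 : ℝ) :
    Set (ℝ × ℝ) :=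
  {z | φ u0 ≤ level a b 0 z ∧ level a b 0 z < boxCox (γ 0) T0 ∧ ψ u1 ≤ level a b 1 z ∧
    level a b 1 z < boxCox (γ 1) T1 ∧
    q (branchInv φ u0 X (level a b 0 z)) ≤ ENNReal.ofReal (branchInv ψ u1 X (level a b 1 z))}

lemma measurableSet_coreEvent (hq : AntitoneOn q (Set.Ici 0)) {φ ψ : ℝ → ℝ}
    {u0 u1 X T0 T1 : ℝ} (hu0 : 0 < u0) (hu1 : 0 < u1) :
    MeasurableSet (coreEvent γ a b q φ ψ u0 u1 X T0 T1) := by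
  have h0 := measurable_level a b 0
  have h1 := measurable_level a b 1
  refine (measurableSet_le measurable_const h0).inter ((measurableSet_lt h0 measurable_const).inter
    ((measurableSet_le measurable_const h1).inter ((measurableSet_lt h1 measurable_const).inter ?_)))
  have hm := (measurable_extend hq).comp ((branchInv_mono (φ := φ) (X := X) hu0).measurable.comp h0)
  have hm1 := ((branchInv_mono (φ := ψ) (X := X) hu1).measurable.comp h1).ennreal_ofReal
  have h : MeasurableSet {z | q (branchInv φ u0 X (level a b 0 z)) ≤
      ENNReal.ofReal (branchInv ψ u1 X (level a b 1 z))} := by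
    convert measurableSet_le hm hm1 using 1
    ext z
    simp [(branchInv_nonneg (φ := φ) (X := X) hu0 (level a b 0 z)).not_gt]
  exact h

/-- Replacing the larger branch by the one in between increases the preimage of a level, and
membership in the upper set is kept. The overflow cut ensures that the level is attained by both. -/
lemma coreEvent_subset {E l0 l1 m0 m1 d u0 u1 X : ℝ} {φs0 φb0 φ0 φs1 φb1 φ1 : ℝ → ℝ}
    {hit0 hit1 : ℝ → ℝ → Prop} (hqf : DualPair q f) (hl0 : 0 < l0) (hl1 : 0 < l1)
    (hu0 : 0 < u0) (hu1 : 0 < u1) (hX0 : u0 ≤ X / 8) (hX1 : u1 ≤ X / 8)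
    (hs0 : Branch (γ 0) E l0 m0 u0 X φs0) (hs1 : Branch (γ 1) E l1 m1 u1 X φs1)
    (hb0 : Branch (γ 0) E l0 m0 u0 X φb0) (hb1 : Branch (γ 1) E l1 m1 u1 X φb1)
    (hh0 : HatBranch d u0 X hit0 φ0) (hh1 : HatBranch d u1 X hit1 φ1)
    (hle0 : ∀ x ∈ Set.Icc u0 X, φs0 x ≤ φ0 x ∧ φ0 x ≤ φb0 x)
    (hle1 : ∀ x ∈ Set.Icc u1 X, φs1 x ≤ φ1 x ∧ φ1 x ≤ φb1 x)
    (hd0 : 1 < d * u0) (hd1 : 1 < d * u1) :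
    coreEvent γ a b q φb0 φb1 u0 u1 X (l0 * X / 16) (l1 * X / 16) ⊆
      hatEvent a b q d hit0 hit1 := by
  rintro z ⟨h1, h2, h3, h4, h5⟩
  have hd : 0 < d := pos_of_mul_pos_left (one_pos.trans hd0) hu0.le
  have hXp : 0 < X := by linarith
  have key : ∀ {i : Fin 2} {l m u : ℝ} {φs φb φ : ℝ → ℝ} {hit : ℝ → ℝ → Prop}, 0 < l →
      0 < u → u ≤ X / 8 → Branch (γ i) E l m u X φs → Branch (γ i) E l m u X φb →
      HatBranch d u X hit φ →
      (∀ x ∈ Set.Icc u X, φs x ≤ φ x ∧ φ x ≤ φb x) → φb u ≤ level a b i z →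
      level a b i z < boxCox (γ i) (l * X / 16) →
      ∃ x', u ≤ x' ∧ branchInv φb u X (level a b i z) ≤ x' ∧ hit (level a b i z) x' := by
    intro i l m u φs φb φ hit hl hu huX hs hb hh hle hz hO
    have hXm : X ∈ Set.Icc u X := ⟨by linarith, le_rfl⟩
    have hlX : 0 < l * X := by positivity
    have e1 : boxCox (γ i) (l * X / 16) ≤ φb X :=
      hb.boxCox_le hl hu hXm (by positivity) (by linarith)
    have e2 : boxCox (γ i) (l * X / 16) ≤ φs X :=
      hs.boxCox_le hl hu hXm (by positivity) (by linarith)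
    obtain ⟨x, hx, he⟩ := hb.surj _ ⟨hz, hO.le.trans e1⟩
    rw [← he, hb.branchInv_eq hx, he]
    have e3 : φ x ≤ level a b i z := he ▸ (hle x hx).2
    obtain ⟨x', hx', he'⟩ := hh.surj (level a b i z)
      ⟨(hh.mono.monotoneOn Set.self_mem_Ici hx.1 hx.1).trans e3,
        hO.le.trans (e2.trans (hle X hXm).1)⟩
    refine ⟨x', hx'.1, ?_, (hh.iff x' hx' _).2 he'.symm⟩
    rw [← he'] at e3
    exact (hh.mono.le_iff_le hx.1 hx'.1).1 e3
  obtain ⟨x, hux, hx, hhx⟩ := key hl0 hu0 hX0 hs0 hb0 hh0 hle0 h1 h2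
  obtain ⟨y, huy, hy, hhy⟩ := key hl1 hu1 hX1 hs1 hb1 hh1 hle1 h3 h4
  refine ⟨x, y, ⟨hu0.le.trans hux, hu1.le.trans huy,
    hqf.mono (branchInv_nonneg hu0 _) hx hy h5⟩, ?_, ?_, hhx, hhy⟩
  · nlinarith
  · nlinarith

/-- Without overflow the preimages are unique and given by `branchInv`. Hence the corner event can
be replaced by the measurable core at the cost of two overflow events. -/
lemma cornerEvent_subset {E l0 l1 m0 m1 u0 u1 X : ℝ} {φ ψ : ℝ → ℝ} (hl0 : 0 < l0)
    (hl1 : 0 < l1) (hu0 : 0 < u0) (hu1 : 0 < u1) (hX0 : u0 ≤ X / 8) (hX1 : u1 ≤ X / 8)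
    (h0 : Branch (γ 0) E l0 m0 u0 X φ) (h1 : Branch (γ 1) E l1 m1 u1 X ψ) :
    cornerEvent γ a b q φ ψ u0 u1 ⊆
      coreEvent γ a b q φ ψ u0 u1 X (l0 * X / 16) (l1 * X / 16) ∪
        overflow γ a b 0 (l0 * X / 16) ∪ overflow γ a b 1 (l1 * X / 16) := by
  intro z hz
  by_cases hO0 : z ∈ overflow γ a b 0 (l0 * X / 16)
  · exact Or.inl (Or.inr hO0)
  by_cases hO1 : z ∈ overflow γ a b 1 (l1 * X / 16)
  · exact Or.inr hO1
  refine Or.inl (Or.inl ?_)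
  have hO0 : level a b 0 z < boxCox (γ 0) (l0 * X / 16) := not_le.1 hO0
  have hO1 : level a b 1 z < boxCox (γ 1) (l1 * X / 16) := not_le.1 hO1
  obtain ⟨x, y, hS, hx, hy, ex, ey⟩ := mem_cornerEvent.1 hz
  have hXp : 0 < X := by linarith
  have e0 : 0 < l0 * X := by positivity
  have e1 : 0 < l1 * X := by positivity
  obtain ⟨hxX, hx'⟩ := h0.eq_of_gpdInv_eq hl0 hu0 (by linarith) hx ex
    (by positivity) (by linarith) hO0
  obtain ⟨hyX, hy'⟩ := h1.eq_of_gpdInv_eq hl1 hu1 (by linarith) hy ey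
    (by positivity) (by linarith) hO1
  refine ⟨?_, hO0, ?_, hO1, ?_⟩
  · rw [hx']
    exact h0.mono.monotoneOn Set.self_mem_Ici hx hx
  · rw [hy']
    exact h1.mono.monotoneOn Set.self_mem_Ici hy hy
  · rw [hx', hy', h0.branchInv_eq ⟨hx, hxX⟩, h1.branchInv_eq ⟨hy, hyX⟩]
    exact hS.2.2

end Sandwich

/-! ### Probabilities of the corner and edge events. -/

section Sandwich

variable {μ ν : Measure (ℝ × ℝ)} {η : ℝ × ℝ → ℝ} {q f : ℝ → ℝ≥0∞} {γ a b : Fin 2 → ℝ}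

lemma exists_rpow_lt {s δ : ℝ} (hs : 0 < s) (hδ : 0 < δ) :
    ∃ κ0 : ℝ, 0 < κ0 ∧ ∀ κ, 0 < κ → κ < κ0 → κ ^ s < δ := by
  refine ⟨δ ^ s⁻¹, Real.rpow_pos_of_pos hδ _, fun κ hκ h => ?_⟩
  have := Real.rpow_lt_rpow hκ.le h hs
  rwa [Real.rpow_inv_rpow hδ.le hs.ne'] at this

lemma overflow_le [IsProbabilityMeasure μ] (hν : IsExponentMeasure μ ν) (hD2 : CondD2 ν η)
    (hM1 : CondM1 μ) {r l κ : ℝ} (hr : 0 < r) (hl : r ≤ l) (hκ : 0 < κ) :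
    ν {p | l * κ⁻¹ / 16 ≤ p.1} ≤ ENNReal.ofReal (16 / r * κ) ∧
      ν {p | l * κ⁻¹ / 16 ≤ p.2} ≤ ENNReal.ofReal (16 / r * κ) := by
  have hl0 : 0 < l := hr.trans_le hl
  have hT : 0 < l * κ⁻¹ / 16 := by positivity
  rw [measure_fst_ge hν hD2 hM1 hT, measure_snd_ge hν hD2 hM1 hT, and_self]
  refine ENNReal.ofReal_le_ofReal ?_
  calc 1 / (l * κ⁻¹ / 16) = 16 / l * κ := by field_simp
    _ ≤ 16 / r * κ := by gcongr

/-- The rate condition passes from the probability to the `ν`-mass of the image, which is a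
perturbation of the rescaled set. The constant collects the perturbation error, two tails of mass
`16 κ / r` each, and the rate itself. -/
lemma cornerEvent_measure_le [IsProbabilityMeasure μ] (hν : IsExponentMeasure μ ν)
    (hD2 : CondD2 ν η) (hM1 : CondM1 μ) {C : ℝ} (hb : DensityBound η C) (hqf : DualPair q f)
    (hgq : AxisGrowth (γ 1) q) (hgf : AxisGrowth (γ 0) f) {r R : ℝ} (hr : 0 < r) (hrR : r ≤ R)
    {E0 : ℝ} (hE0 : 0 < E0) :
    ∃ C' : ℝ, 0 < C' ∧ ∀ (a b : Fin 2 → ℝ) (κ l0 l1 t u0 u1 : ℝ) (φ ψ : ℝ → ℝ), 0 < κ →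
      l0 ∈ Set.Icc r R → l1 ∈ Set.Icc r R → 0 < t → 0 < u0 → 0 < u1 → u0 ≤ κ⁻¹ → u1 ≤ κ⁻¹ →
      Branch (γ 0) (E0 * κ) l0 (max (γ 0) (1 / 2)) u0 κ⁻¹ φ →
      Branch (γ 1) (E0 * κ) l1 (max (γ 1) (1 / 2)) u1 κ⁻¹ ψ →
      TailApprox μ ν γ a b t (pairMap γ φ ψ '' cornerSet q u0 u1) κ →
      ENNReal.ofReal t * μ (cornerEvent γ a b q φ ψ u0 u1) ≤
        ν (scaledSet q l0 l1) + ENNReal.ofReal (C' * κ) := by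
  obtain ⟨C', hC', H⟩ := exists_perturbed_le hD2 hb hqf hgq hgf hr hrR hE0
  refine ⟨C' + 16 / r + 16 / r + 1, by positivity, ?_⟩
  intro a b κ l0 l1 t u0 u1 φ ψ hκ hl0 hl1 ht hu0 hu1 hX0 hX1 h0 h1 hTA
  have hl0p : 0 < l0 := hr.trans_le hl0.1
  have hl1p : 0 < l1 := hr.trans_le hl1.1
  have hXp : 0 < κ⁻¹ := inv_pos.2 hκ
  have e0 : 0 < l0 * κ⁻¹ := by positivity
  have e1 : 0 < l1 * κ⁻¹ := by positivity
  have hB := H κ l0 l1 (l0 * κ⁻¹ / 16) (l1 * κ⁻¹ / 16) hκ hl0 hl1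
    (finitePart (pairMap γ φ ψ '' cornerSet q u0 u1)) (by
      intro p hp h2 h3
      obtain ⟨hpq, x, y, hS, hx, hy, ex, ey⟩ := mem_finitePart.1 hp
      obtain ⟨hxX, hpx⟩ := h0.finite_of_eq hl0p hu0 hX0 hx ex hpq.1 (by linarith)
      obtain ⟨hyX, hpy⟩ := h1.finite_of_eq hl1p hu1 hX1 hy ey hpq.2 (by linarith)
      refine ⟨x, y, hu0.trans_le hx, hu1.trans_le hy, ?_, ?_, hS.2.2⟩
      · rw [hpx]
        exact h0.close x ⟨hx, hxX⟩
      · rw [hpy]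
        exact h1.close y ⟨hy, hyX⟩)
  have hO0 := (overflow_le hν hD2 hM1 hr hl0.1 hκ).1
  have hO1 := (overflow_le hν hD2 hM1 hr hl1.1 hκ).2
  calc ENNReal.ofReal t * μ (cornerEvent γ a b q φ ψ u0 u1)
      ≤ ν (scaledSet q l0 l1) + ENNReal.ofReal (C' * κ) + ENNReal.ofReal (16 / r * κ) +
        ENNReal.ofReal (16 / r * κ) + ENNReal.ofReal κ := by
        refine (hTA.le ht).trans ?_
        gcongr
        refine hB.trans ?_
        gcongr
    _ = _ := by
        rw [add_assoc, add_assoc, add_assoc, ← ENNReal.ofReal_add (by positivity) hκ.le,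
          ← ENNReal.ofReal_add (by positivity) (by positivity),
          ← ENNReal.ofReal_add (by positivity) (by positivity)]
        congr 2
        ring

/-- The lower cut-offs are powers of `κ` for which the parts of the rescaled set near the axes have
mass `O(κ)`. All other points below the overflow level have a preimage under both branches. -/
lemma le_cornerEvent_measure [IsProbabilityMeasure μ] (hν : IsExponentMeasure μ ν)
    (hD2 : CondD2 ν η) (hM1 : CondM1 μ) {C : ℝ} (hb : DensityBound η C) (hqf : DualPair q f)
    (hgq : AxisGrowth (γ 1) q) (hgf : AxisGrowth (γ 0) f) {r R : ℝ} (hr : 0 < r) (hrR : r ≤ R)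
    {E0 : ℝ} (hE0 : 0 < E0) :
    ∃ C' κ0 : ℝ, 0 < C' ∧ 0 < κ0 ∧ ∀ (a b : Fin 2 → ℝ) (κ l0 l1 t : ℝ) (φ ψ : ℝ → ℝ), 0 < κ →
      κ < κ0 → l0 ∈ Set.Icc r R → l1 ∈ Set.Icc r R → 0 < t → κ ^ (1 / max (γ 0) 1) ≤ κ⁻¹ →
      κ ^ (1 / max (γ 1) 1) ≤ κ⁻¹ →
      Branch (γ 0) (E0 * κ) l0 (max (γ 0) (1 / 2)) (κ ^ (1 / max (γ 0) 1)) κ⁻¹ φ →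
      Branch (γ 1) (E0 * κ) l1 (max (γ 1) (1 / 2)) (κ ^ (1 / max (γ 1) 1)) κ⁻¹ ψ →
      TailApprox μ ν γ a b t (pairMap γ φ ψ ''
        cornerSet q (κ ^ (1 / max (γ 0) 1)) (κ ^ (1 / max (γ 1) 1))) κ →
      ν (scaledSet q l0 l1) ≤ ENNReal.ofReal t *
        μ (cornerEvent γ a b q φ ψ (κ ^ (1 / max (γ 0) 1)) (κ ^ (1 / max (γ 1) 1))) +
        ENNReal.ofReal (C' * κ) := by
  obtain ⟨C', κ0, hC', hκ0, H⟩ := exists_le_perturbed hD2 hb hqf hgq hgf hr hrR hE0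
  refine ⟨1 + C' + 16 / r + 16 / r, κ0, by positivity, hκ0, ?_⟩
  intro a b κ l0 l1 t φ ψ hκ hκ' hl0 hl1 ht hX0 hX1 h0 h1 hTA
  have hl0p : 0 < l0 := hr.trans_le hl0.1
  have hl1p : 0 < l1 := hr.trans_le hl1.1
  have hXp : 0 < κ⁻¹ := inv_pos.2 hκ
  have e0 : 0 < l0 * κ⁻¹ := by positivity
  have e1 : 0 < l1 * κ⁻¹ := by positivity
  obtain ⟨u0, hu0e⟩ : ∃ u, u = κ ^ (1 / max (γ 0) 1) := ⟨_, rfl⟩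
  obtain ⟨u1, hu1e⟩ : ∃ u, u = κ ^ (1 / max (γ 1) 1) := ⟨_, rfl⟩
  have hu0 : 0 < u0 := hu0e ▸ Real.rpow_pos_of_pos hκ _
  have hu1 : 0 < u1 := hu1e ▸ Real.rpow_pos_of_pos hκ _
  have HB := H κ l0 l1 (l0 * κ⁻¹ / 16) (l1 * κ⁻¹ / 16) hκ hκ' hl0 hl1
  simp only [← hu0e, ← hu1e] at hX0 hX1 h0 h1 hTA HB ⊢
  have hB := HB (finitePart (pairMap γ φ ψ '' cornerSet q u0 u1)) (by
      intro p hp0 hp1 h2 h3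
      have f0 : 0 < l0 * u0 := by positivity
      have f1 : 0 < l1 * u1 := by positivity
      -- The branch maps `u0` to at most `3/2 * l0 * u0`, which is below the cut `2 * l0 * u0`.
      -- Hence `p.1` is in its range.
      have g0 := ((h0.close u0 ⟨le_rfl, hX0⟩).le_mul hl0p hu0).2
      have g1 := ((h1.close u1 ⟨le_rfl, hX1⟩).le_mul hl1p hu1).2
      obtain ⟨x, hx, ex⟩ := h0.exists_gpdR_eq hl0p hu0 le_rfl hX0 (p := p.1) (by linarith)
        (by linarith)
      obtain ⟨y, hy, ey⟩ := h1.exists_gpdR_eq hl1p hu1 le_rfl hX1 (p := p.2) (by linarith)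
        (by linarith)
      have hx0 : 0 < x := hu0.trans_le hx.1
      have hy0 : 0 < y := hu1.trans_le hy.1
      refine ⟨x, y, hx0, hy0, ex ▸ h0.close x hx, ey ▸ h1.close y hy, fun hS => ?_⟩
      refine mem_finitePart.2 ⟨⟨by linarith, by linarith⟩, x, y, ⟨hx0.le, hy0.le, hS⟩, hx.1,
        hy.1, ?_, ?_⟩
      · rw [gpdInv_eq_ofReal (h0.valid x hx), ex]
      · rw [gpdInv_eq_ofReal (h1.valid y hy), ey])
  have hO0 := (overflow_le hν hD2 hM1 hr hl0.1 hκ).1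
  have hO1 := (overflow_le hν hD2 hM1 hr hl1.1 hκ).2
  calc ν (scaledSet q l0 l1)
      ≤ ENNReal.ofReal t * μ (cornerEvent γ a b q φ ψ u0 u1) + ENNReal.ofReal κ +
        ENNReal.ofReal (C' * κ) + ENNReal.ofReal (16 / r * κ) + ENNReal.ofReal (16 / r * κ) := by
        refine hB.trans ?_
        gcongr
        exact hTA.ge ht
    _ = _ := by
        rw [add_assoc, add_assoc, add_assoc, ← ENNReal.ofReal_add (by positivity) (by positivity),
          ← ENNReal.ofReal_add (by positivity) (by positivity),
          ← ENNReal.ofReal_add (by positivity) (by positivity)]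
        congr 2
        ring

/-- The main term `1/T` occurs in both bounds and cancels, which leaves only the errors. -/
lemma le_of_add_ofReal_le {A B : ℝ≥0∞} {T D K : ℝ} (hT : 0 < T) (hK : 0 ≤ K) (hD : 0 ≤ D)
    (h1 : A + B ≤ ENNReal.ofReal ((1 + K) / T))
    (h2 : ENNReal.ofReal (1 / T) ≤ B + ENNReal.ofReal D) :
    A ≤ ENNReal.ofReal (K / T + D) := by
  refine (ENNReal.add_le_add_iff_right (a := ENNReal.ofReal (1 / T)) ENNReal.ofReal_ne_top).1 ?_
  calc A + ENNReal.ofReal (1 / T) ≤ A + B + ENNReal.ofReal D := by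
        rw [add_assoc]
        gcongr
    _ ≤ ENNReal.ofReal ((1 + K) / T) + ENNReal.ofReal D := by gcongr
    _ = _ := by
        rw [← ENNReal.ofReal_add (by positivity) hD,
          ← ENNReal.ofReal_add (by positivity) (by positivity)]
        congr 1
        ring

/-- Edge event and corner event are disjoint parts of a marginal tail event of scaled probability at
most `(1 + K)/T`. Since `q u0 ≤ v`, the boundary does not restrict this corner, so its scaled
probability is nearly the full marginal mass `1/T` of `ν`. The difference is the required bound. -/
lemma edgeEvent_measure_le [IsProbabilityMeasure μ] (hν : IsExponentMeasure μ ν)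
    (hD2 : CondD2 ν η) (hM1 : CondM1 μ) (hq : AntitoneOn q (Set.Ici 0)) {r E κ l0 l1 m0 m1 u0 u1 v t K D : ℝ}
    {φ ψ : ℝ → ℝ} (hr : 0 < r) (hκ : 0 < κ) (hl0 : r ≤ l0) (hl1 : r ≤ l1) (ht : 0 < t)
    (hu0 : 0 < u0) (hu1 : 0 < u1) (hv : u1 ≤ v) (hX0 : u0 ≤ κ⁻¹) (hX1 : v ≤ κ⁻¹)
    (hqv : q u0 ≤ ENNReal.ofReal v) (h0 : Branch (γ 0) E l0 m0 u0 κ⁻¹ φ)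
    (h1 : Branch (γ 1) E l1 m1 u1 κ⁻¹ ψ)
    (hTA : TailApprox μ ν γ a b t (pairMap γ φ ψ '' cornerSet q u0 v) κ)
    (hK : 0 ≤ K) (hD : 0 ≤ D)
    (hstrip : ν {p | p.1 ≤ 2 * l0 * u0 ∧ l1 * v / 2 ≤ p.2} ≤ ENNReal.ofReal D)
    (htail : ∀ T, l1 * v / 2 ≤ T →
      ENNReal.ofReal t * μ (overflow γ a b 1 T) ≤ ENNReal.ofReal ((1 + K) / T)) :
    ENNReal.ofReal t * μ (edgeEvent a b 0 1 (φ u0) (ψ v)) ≤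
      ENNReal.ofReal (2 * K / (l1 * v) + (κ + D + 16 / r * κ + 16 / r * κ)) := by
  have hl0p : 0 < l0 := hr.trans_le hl0
  have hl1p : 0 < l1 := hr.trans_le hl1
  have hXp : 0 < κ⁻¹ := inv_pos.2 hκ
  have hvp : 0 < v := hu1.trans_le hv
  have hlX0 : 0 < l0 * κ⁻¹ := by positivity
  have hlX1 : 0 < l1 * κ⁻¹ := by positivity
  have hlv : 0 < l1 * v := by positivity
  have hlu : 0 < l0 * u0 := by positivity
  obtain ⟨T, hT⟩ : ∃ T, T = gpdR (γ 1) (ψ v) := ⟨_, rfl⟩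
  have hvalid := h1.valid v ⟨hv, hX1⟩
  have hT0 : 0 < T := hT ▸ gpdR_pos hvalid
  have hTv : l1 * v / 2 ≤ T := hT ▸ ((h1.close v ⟨hv, hX1⟩).le_mul hl1p hvp).1
  have hTe : boxCox (γ 1) T = ψ v := by rw [hT, boxCox_gpdR hvalid]
  have hmeas : MeasurableSet (edgeEvent a b 0 1 (φ u0) (ψ v)) :=
    (measurableSet_lt (measurable_level a b 0) measurable_const).inter
      (measurableSet_le measurable_const (measurable_level a b 1))
  have hdisj : Disjoint (edgeEvent a b 0 1 (φ u0) (ψ v)) (cornerEvent γ a b q φ ψ u0 v) := by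
    refine Set.disjoint_left.2 fun z hz hz' => ?_
    obtain ⟨x, y, -, hx, -, ex, -⟩ := mem_cornerEvent.1 hz'
    exact hz.1.not_ge (h0.le_of_gpdInv_eq ⟨le_rfl, hX0⟩ hx ex)
  have hsub : edgeEvent a b 0 1 (φ u0) (ψ v) ∪ cornerEvent γ a b q φ ψ u0 v ⊆
      overflow γ a b 1 T := by
    rintro z (hz | hz)
    · exact hTe.le.trans hz.2
    · obtain ⟨x, y, -, -, hy, -, ey⟩ := mem_cornerEvent.1 hz
      exact hTe.le.trans (h1.le_of_gpdInv_eq ⟨hv, hX1⟩ hy ey)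
  have hA : ENNReal.ofReal t * μ (edgeEvent a b 0 1 (φ u0) (ψ v)) +
      ENNReal.ofReal t * μ (cornerEvent γ a b q φ ψ u0 v) ≤ ENNReal.ofReal ((1 + K) / T) := by
    rw [← mul_add, ← measure_union' hdisj hmeas]
    refine le_trans ?_ (htail T hTv)
    gcongr
  -- The half-plane consists of the image of the corner, the strip near the axis, and the two
  -- overflow parts.
  have hcover : {p : ℝ × ℝ | T ≤ p.2} ⊆
      ((finitePart (pairMap γ φ ψ '' cornerSet q u0 v) ∪
        {p | p.1 ≤ 2 * l0 * u0 ∧ l1 * v / 2 ≤ p.2}) ∪ {p | l0 * κ⁻¹ / 16 ≤ p.1}) ∪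
        {p | l1 * κ⁻¹ / 16 ≤ p.2} := by
    intro p hp
    have hp : T ≤ p.2 := hp
    by_cases c1 : l0 * κ⁻¹ / 16 ≤ p.1
    · exact Or.inl (Or.inr c1)
    by_cases c2 : l1 * κ⁻¹ / 16 ≤ p.2
    · exact Or.inr c2
    by_cases c3 : p.1 ≤ 2 * l0 * u0
    · exact Or.inl (Or.inl (Or.inr ⟨c3, hTv.trans hp⟩))
    have g0 := ((h0.close u0 ⟨le_rfl, hX0⟩).le_mul hl0p hu0).2
    obtain ⟨x, hx, ex⟩ := h0.exists_gpdR_eq hl0p hu0 le_rfl hX0 (p := p.1) (by linarith)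
      (by linarith)
    obtain ⟨y, hy, ey⟩ := h1.exists_gpdR_eq hl1p hu1 hv hX1 (p := p.2) (hT ▸ hp) (by linarith)
    have hx0 : 0 < x := hu0.trans_le hx.1
    refine Or.inl (Or.inl (Or.inl (mem_finitePart.2 ⟨⟨by linarith, by linarith⟩, x, y,
      ⟨hx0.le, hvp.le.trans hy.1, ?_⟩, hx.1, hy.1, ?_, ?_⟩)))
    · exact (hq hu0.le hx0.le hx.1).trans (hqv.trans (ENNReal.ofReal_le_ofReal hy.1))
    · rw [gpdInv_eq_ofReal (h0.valid x hx), ex]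
    · rw [gpdInv_eq_ofReal (h1.valid y ⟨hv.trans hy.1, hy.2⟩), ey]
  have hB : ENNReal.ofReal (1 / T) ≤ ENNReal.ofReal t * μ (cornerEvent γ a b q φ ψ u0 v) +
      ENNReal.ofReal (κ + D + 16 / r * κ + 16 / r * κ) := by
    rw [← measure_snd_ge hν hD2 hM1 hT0, ENNReal.ofReal_add (by positivity) (by positivity),
      ENNReal.ofReal_add (by positivity) (by positivity), ENNReal.ofReal_add hκ.le hD,
      ← add_assoc, ← add_assoc, ← add_assoc]
    refine (measure_mono hcover).trans ((measure_union_le _ _).trans ?_)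
    gcongr
    · refine (measure_union_le _ _).trans ?_
      gcongr
      · refine (measure_union_le _ _).trans ?_
        gcongr
        exact hTA.ge ht
      · exact (overflow_le hν hD2 hM1 hr hl0 hκ).1
    · exact (overflow_le hν hD2 hM1 hr hl1 hκ).2
  refine (le_of_add_ofReal_le hT0 hK (by positivity) hA hB).trans (ENNReal.ofReal_le_ofReal ?_)
  have : K / T ≤ 2 * K / (l1 * v) := by
    calc K / T ≤ K / (l1 * v / 2) := by gcongr
      _ = _ := by field_simp
  linarith

lemma edgeEvent_measure_le_swap [IsProbabilityMeasure μ] (hν : IsExponentMeasure μ ν)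
    (hD2 : CondD2 ν η) (hM1 : CondM1 μ) (hqf : DualPair q f) {r E κ l0 l1 m0 m1 u0 u1 v t K D : ℝ}
    {φ ψ : ℝ → ℝ} (hr : 0 < r) (hκ : 0 < κ) (hl0 : r ≤ l0) (hl1 : r ≤ l1) (ht : 0 < t)
    (hu0 : 0 < u0) (hu1 : 0 < u1) (hv : u0 ≤ v) (hX1 : u1 ≤ κ⁻¹) (hX0 : v ≤ κ⁻¹)
    (hfv : f u1 ≤ ENNReal.ofReal v) (h0 : Branch (γ 0) E l0 m0 u0 κ⁻¹ φ)
    (h1 : Branch (γ 1) E l1 m1 u1 κ⁻¹ ψ)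
    (hTA : TailApprox μ ν γ a b t (pairMap γ φ ψ '' cornerSet q v u1) κ)
    (hK : 0 ≤ K) (hD : 0 ≤ D)
    (hstrip : ν {p | p.2 ≤ 2 * l1 * u1 ∧ l0 * v / 2 ≤ p.1} ≤ ENNReal.ofReal D)
    (htail : ∀ T, l0 * v / 2 ≤ T →
      ENNReal.ofReal t * μ (overflow γ a b 0 T) ≤ ENNReal.ofReal ((1 + K) / T)) :
    ENNReal.ofReal t * μ (edgeEvent a b 1 0 (ψ u1) (φ v)) ≤
      ENNReal.ofReal (2 * K / (l0 * v) + (κ + D + 16 / r * κ + 16 / r * κ)) := by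
  have hl0p : 0 < l0 := hr.trans_le hl0
  have hl1p : 0 < l1 := hr.trans_le hl1
  have hXp : 0 < κ⁻¹ := inv_pos.2 hκ
  have hvp : 0 < v := hu0.trans_le hv
  have hlX0 : 0 < l0 * κ⁻¹ := by positivity
  have hlX1 : 0 < l1 * κ⁻¹ := by positivity
  have hlv : 0 < l0 * v := by positivity
  have hlu : 0 < l1 * u1 := by positivity
  obtain ⟨T, hT⟩ : ∃ T, T = gpdR (γ 0) (φ v) := ⟨_, rfl⟩
  have hvalid := h0.valid v ⟨hv, hX0⟩
  have hT0 : 0 < T := hT ▸ gpdR_pos hvalid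
  have hTv : l0 * v / 2 ≤ T := hT ▸ ((h0.close v ⟨hv, hX0⟩).le_mul hl0p hvp).1
  have hTe : boxCox (γ 0) T = φ v := by rw [hT, boxCox_gpdR hvalid]
  have hmeas : MeasurableSet (edgeEvent a b 1 0 (ψ u1) (φ v)) :=
    (measurableSet_lt (measurable_level a b 1) measurable_const).inter
      (measurableSet_le measurable_const (measurable_level a b 0))
  have hdisj : Disjoint (edgeEvent a b 1 0 (ψ u1) (φ v)) (cornerEvent γ a b q φ ψ v u1) := by
    refine Set.disjoint_left.2 fun z hz hz' => ?_
    obtain ⟨x, y, -, -, hy, -, ey⟩ := mem_cornerEvent.1 hz'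
    exact hz.1.not_ge (h1.le_of_gpdInv_eq ⟨le_rfl, hX1⟩ hy ey)
  have hsub : edgeEvent a b 1 0 (ψ u1) (φ v) ∪ cornerEvent γ a b q φ ψ v u1 ⊆
      overflow γ a b 0 T := by
    rintro z (hz | hz)
    · exact hTe.le.trans hz.2
    · obtain ⟨x, y, -, hx, -, ex, -⟩ := mem_cornerEvent.1 hz
      exact hTe.le.trans (h0.le_of_gpdInv_eq ⟨hv, hX0⟩ hx ex)
  have hA : ENNReal.ofReal t * μ (edgeEvent a b 1 0 (ψ u1) (φ v)) +
      ENNReal.ofReal t * μ (cornerEvent γ a b q φ ψ v u1) ≤ ENNReal.ofReal ((1 + K) / T) := by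
    rw [← mul_add, ← measure_union' hdisj hmeas]
    refine le_trans ?_ (htail T hTv)
    gcongr
  have hcover : {p : ℝ × ℝ | T ≤ p.1} ⊆
      ((finitePart (pairMap γ φ ψ '' cornerSet q v u1) ∪
        {p | p.2 ≤ 2 * l1 * u1 ∧ l0 * v / 2 ≤ p.1}) ∪ {p | l0 * κ⁻¹ / 16 ≤ p.1}) ∪
        {p | l1 * κ⁻¹ / 16 ≤ p.2} := by
    intro p hp
    have hp : T ≤ p.1 := hp
    by_cases c1 : l0 * κ⁻¹ / 16 ≤ p.1
    · exact Or.inl (Or.inr c1)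
    by_cases c2 : l1 * κ⁻¹ / 16 ≤ p.2
    · exact Or.inr c2
    by_cases c3 : p.2 ≤ 2 * l1 * u1
    · exact Or.inl (Or.inl (Or.inr ⟨c3, hTv.trans hp⟩))
    have g1 := ((h1.close u1 ⟨le_rfl, hX1⟩).le_mul hl1p hu1).2
    obtain ⟨y, hy, ey⟩ := h1.exists_gpdR_eq hl1p hu1 le_rfl hX1 (p := p.2) (by linarith)
      (by linarith)
    obtain ⟨x, hx, ex⟩ := h0.exists_gpdR_eq hl0p hu0 hv hX0 (p := p.1) (hT ▸ hp) (by linarith)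
    have hy0 : 0 < y := hu1.trans_le hy.1
    have hx0 : 0 ≤ x := hvp.le.trans hx.1
    refine Or.inl (Or.inl (Or.inl (mem_finitePart.2 ⟨⟨by linarith, by linarith⟩, x, y,
      ⟨hx0, hy0.le, ?_⟩, hx.1, hy.1, ?_, ?_⟩)))
    · refine (hqf.iff x y hx0 hy0.le).2 ?_
      exact (hqf.anti' hu1.le hy0.le hy.1).trans (hfv.trans (ENNReal.ofReal_le_ofReal hx.1))
    · rw [gpdInv_eq_ofReal (h0.valid x ⟨hv.trans hx.1, hx.2⟩), ex]
    · rw [gpdInv_eq_ofReal (h1.valid y hy), ey]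
  have hB : ENNReal.ofReal (1 / T) ≤ ENNReal.ofReal t * μ (cornerEvent γ a b q φ ψ v u1) +
      ENNReal.ofReal (κ + D + 16 / r * κ + 16 / r * κ) := by
    rw [← measure_fst_ge hν hD2 hM1 hT0, ENNReal.ofReal_add (by positivity) (by positivity),
      ENNReal.ofReal_add (by positivity) (by positivity), ENNReal.ofReal_add hκ.le hD,
      ← add_assoc, ← add_assoc, ← add_assoc]
    refine (measure_mono hcover).trans ((measure_union_le _ _).trans ?_)
    gcongr
    · refine (measure_union_le _ _).trans ?_
      gcongr
      · refine (measure_union_le _ _).trans ?_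
        gcongr
        exact hTA.ge ht
      · exact (overflow_le hν hD2 hM1 hr hl0 hκ).1
    · exact (overflow_le hν hD2 hM1 hr hl1 hκ).2
  refine (le_of_add_ofReal_le hT0 hK (by positivity) hA hB).trans (ENNReal.ofReal_le_ofReal ?_)
  have : K / T ≤ 2 * K / (l0 * v) := by
    calc K / T ≤ K / (l0 * v / 2) := by gcongr
      _ = _ := by field_simp
  linarith

end Sandwich

/-! ### Assembly of the enclosing events. -/

section Sandwich

variable {μ ν : Measure (ℝ × ℝ)} {η : ℝ × ℝ → ℝ} {q f : ℝ → ℝ≥0∞} {γ : Fin 2 → ℝ}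

lemma overflow_measure_le {a b : Fin 2 → ℝ} {i : Fin 2} {r l κ t K T0 : ℝ} (hr : 0 < r)
    (hl : r ≤ l) (hκ : 0 < κ) (hκ1 : κ ≤ 1) (hK : 0 ≤ K) (hT0 : T0 ≤ l * κ⁻¹ / 16)
    (htail : ∀ T, T0 ≤ T → ENNReal.ofReal t * μ (overflow γ a b i T) ≤
      ENNReal.ofReal ((1 + K * κ) / T)) :
    ENNReal.ofReal t * μ (overflow γ a b i (l * κ⁻¹ / 16)) ≤
      ENNReal.ofReal ((1 + K) * (16 / r) * κ) := by
  have hl0 : 0 < l := hr.trans_le hl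
  refine (htail _ hT0).trans (ENNReal.ofReal_le_ofReal ?_)
  calc (1 + K * κ) / (l * κ⁻¹ / 16) = (1 + K * κ) * (16 / l) * κ := by field_simp
    _ ≤ (1 + K * 1) * (16 / r) * κ := by gcongr
    _ = _ := by rw [mul_one]

/-- Two-sided approximation of the event that an observation is mapped into the rescaled estimated
failure set, by events that do not depend on the estimates. -/
lemma exists_sandwich [IsProbabilityMeasure μ] (hν : IsExponentMeasure μ ν)
    (hD2 : CondD2 ν η) (hM1 : CondM1 μ) (hqf : DualPair q f)
    (hgq : AxisGrowth (γ 1) q) (hgf : AxisGrowth (γ 0) f) {r R : ℝ} (hr : 0 < r) (hrR : r ≤ R) :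
    ∃ T0 : ℝ, 0 < T0 ∧ ∀ E0 K : ℝ, 0 < E0 → 0 < K → ∃ C κ0 : ℝ, 0 < C ∧ 0 < κ0 ∧
      ∀ (a b : Fin 2 → ℝ) (κ l0 l1 t u0 u1 : ℝ) (φ ψ : Bool → ℝ → ℝ), 0 < κ → κ < κ0 →
      l0 ∈ Set.Icc r R → l1 ∈ Set.Icc r R → 0 < t →
      u0 = κ ^ (1 / max (γ 0) 1) → u1 = κ ^ (1 / max (γ 1) 1) →
      (∀ s, Branch (γ 0) (E0 * κ) l0 (max (γ 0) (1 / 2)) u0 κ⁻¹ (φ s)) →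
      (∀ s, Branch (γ 1) (E0 * κ) l1 (max (γ 1) (1 / 2)) u1 κ⁻¹ (ψ s)) →
      (∀ s s' u v, u0 ≤ u → u1 ≤ v →
        TailApprox μ ν γ a b t (pairMap γ (φ s) (ψ s') '' cornerSet q u v) κ) →
      (∀ i T, T0 ≤ T → ENNReal.ofReal t * μ (overflow γ a b i T) ≤
        ENNReal.ofReal ((1 + K * κ) / T)) →
      ∃ M N : Set (ℝ × ℝ), MeasurableSet M ∧ MeasurableSet N ∧
        (∀ (d : ℝ) (hit0 hit1 : ℝ → ℝ → Prop) (φ' ψ' : ℝ → ℝ), 1 < d * u0 → 1 < d * u1 →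
          HatBranch d u0 κ⁻¹ hit0 φ' → HatBranch d u1 κ⁻¹ hit1 ψ' →
          (∀ x ∈ Set.Icc u0 κ⁻¹, φ false x ≤ φ' x ∧ φ' x ≤ φ true x) →
          (∀ x ∈ Set.Icc u1 κ⁻¹, ψ false x ≤ ψ' x ∧ ψ' x ≤ ψ true x) →
          M ⊆ hatEvent a b q d hit0 hit1 ∧ hatEvent a b q d hit0 hit1 ⊆ N) ∧
        ENNReal.ofReal t * μ N ≤ ν (scaledSet q l0 l1) + ENNReal.ofReal (C * κ) ∧
        ν (scaledSet q l0 l1) ≤ ENNReal.ofReal t * μ M + ENNReal.ofReal (C * κ) := by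
  obtain ⟨Cb, hb⟩ := exists_densityBound hν hD2
  obtain ⟨δ1, A1, x1, hδ1, hδ1e, -, hx1, hax1⟩ := id hgq
  obtain ⟨δ2, A2, x2, hδ2, hδ2e, -, hx2, hax2⟩ := id hgf
  obtain ⟨δ, hδ⟩ : ∃ δ, δ = min δ1 δ2 := ⟨_, rfl⟩
  have hδ0 : 0 < δ := hδ ▸ lt_min hδ1 hδ2
  have hδ1' : δ ≤ 1 := by
    have : Real.exp (-1) ≤ 1 := Real.exp_le_one_iff.2 (by norm_num)
    linarith [hδ ▸ min_le_left δ1 δ2]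
  -- The values `q u0` and `f u1` are at least `δ`, so marginal tails are evaluated only from `r δ /
  -- 2` on. This level depends on neither `E0` nor `K`.
  refine ⟨r * δ / 2, by positivity, fun E0 K hE0 hK => ?_⟩
  obtain ⟨C1, hC1, H1⟩ := cornerEvent_measure_le hν hD2 hM1 hb hqf hgq hgf hr hrR hE0
  obtain ⟨C2, κ2, hC2, hκ2, H2⟩ := le_cornerEvent_measure hν hD2 hM1 hb hqf hgq hgf hr hrR hE0
  obtain ⟨C3, κ3, hC3, hκ3, H3⟩ := hgf.strip_measure_le hD2 hb hqf hr hrR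
  obtain ⟨C4, κ4, hC4, hκ4, H4⟩ := hgq.strip_measure_le_swap hD2 hb hqf hr hrR
  have hs0 : 0 < 1 / max (γ 0) 1 := by positivity
  have hs1 : 0 < 1 / max (γ 1) 1 := by positivity
  obtain ⟨κ5, hκ5, H5⟩ := exists_rpow_lt hs0
    (show 0 < min (min x1 x2) (min δ 1) by positivity)
  obtain ⟨κ6, hκ6, H6⟩ := exists_rpow_lt hs1
    (show 0 < min (min x1 x2) (min δ 1) by positivity)
  -- The error of an edge event: relative tail error divided by the smallest possible level, plus
  -- rate, strip and two overflows.
  obtain ⟨Ce, hCe⟩ : ∃ Ce, Ce = 2 * K / (r * δ) + (1 + (C3 + C4) + 16 / r + 16 / r) := ⟨_, rfl⟩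
  have hCe0 : 0 < Ce := by rw [hCe]; positivity
  obtain ⟨Co, hCo⟩ : ∃ Co, Co = (1 + K) * (16 / r) := ⟨_, rfl⟩
  have hCo0 : 0 < Co := by rw [hCo]; positivity
  refine ⟨C1 + Ce + Ce + Co + Co + C2,
    min (min κ2 (min κ3 κ4)) (min (min κ5 κ6) (1 / 16)), by positivity, by positivity, ?_⟩
  intro a b κ l0 l1 t u0 u1 φ ψ hκ hκlt hl0 hl1 ht hu0e hu1e hφ hψ hTA htail
  simp only [lt_min_iff] at hκlt
  obtain ⟨⟨hκ2', hκ3', hκ4'⟩, ⟨hκ5', hκ6'⟩, hκ16⟩ := hκlt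
  have hl0p : 0 < l0 := hr.trans_le hl0.1
  have hl1p : 0 < l1 := hr.trans_le hl1.1
  have hu0 : 0 < u0 := hu0e ▸ Real.rpow_pos_of_pos hκ _
  have hu1 : 0 < u1 := hu1e ▸ Real.rpow_pos_of_pos hκ _
  have hu0s := hu0e ▸ H5 κ hκ hκ5'
  have hu1s := hu1e ▸ H6 κ hκ hκ6'
  simp only [lt_min_iff] at hu0s hu1s
  obtain ⟨⟨hu0x1, hu0x2⟩, hu0δ, hu01⟩ := hu0s
  obtain ⟨⟨hu1x1, hu1x2⟩, hu1δ, hu11⟩ := hu1s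
  have hX16 : 16 ≤ κ⁻¹ := by
    rw [le_inv_comm₀ (by norm_num) hκ]
    linarith
  have hX0 : u0 ≤ κ⁻¹ / 8 := by linarith
  have hX1 : u1 ≤ κ⁻¹ / 8 := by linarith
  -- the boundary values at the corners
  have hq0 : q u0 ≠ ⊤ → δ ≤ (q u0).toReal ∧
      ν {p | p.1 ≤ 2 * l0 * u0 ∧ l1 * (q u0).toReal / 2 ≤ p.2} ≤ ENNReal.ofReal (C3 * κ) := by
    intro hne
    have hqe : q u0 ≤ ENNReal.ofReal (q u0).toReal := (ENNReal.ofReal_toReal hne).ge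
    obtain ⟨hpos, hst⟩ := H3 κ l0 l1 u0 (q u0).toReal hκ hκ3' hl0 hl1 hu0
      (by rw [← hu0e]; linarith) ENNReal.toReal_nonneg hqe
    refine ⟨?_, hst⟩
    -- A value below `δ1` would force `u0 ≥ x1` by the growth condition, but `u0` has been made
    -- smaller.
    by_contra hlt
    have hlt' : (q u0).toReal < δ1 := by
      have := min_le_left δ1 δ2
      linarith
    have := (hax1 u0 _ hu0.le hpos hlt' hqe).1
    linarith
  have hf1 : f u1 ≠ ⊤ → δ ≤ (f u1).toReal ∧
      ν {p | p.2 ≤ 2 * l1 * u1 ∧ l0 * (f u1).toReal / 2 ≤ p.1} ≤ ENNReal.ofReal (C4 * κ) := by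
    intro hne
    have hqe : f u1 ≤ ENNReal.ofReal (f u1).toReal := (ENNReal.ofReal_toReal hne).ge
    obtain ⟨hpos, hst⟩ := H4 κ l0 l1 u1 (f u1).toReal hκ hκ4' hl0 hl1 hu1
      (by rw [← hu1e]; linarith) ENNReal.toReal_nonneg hqe
    refine ⟨?_, hst⟩
    by_contra hlt
    have hlt' : (f u1).toReal < δ2 := by
      have := min_le_right δ1 δ2
      linarith
    have := (hax2 u1 _ hu1.le hpos hlt' hqe).1
    linarith
  have hy0 : q u0 ≤ ENNReal.ofReal (κ⁻¹ / 8) → u1 ≤ (q u0).toReal := fun h =>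
    hu1δ.le.trans (hq0 (ne_top_of_le_ne_top ENNReal.ofReal_ne_top h)).1
  have hx0 : f u1 ≤ ENNReal.ofReal (κ⁻¹ / 8) → u0 ≤ (f u1).toReal := fun h =>
    hu0δ.le.trans (hf1 (ne_top_of_le_ne_top ENNReal.ofReal_ne_top h)).1
  -- masses of the exceptional events
  have hTX : ∀ l, r ≤ l → r * δ / 2 ≤ l * κ⁻¹ / 16 := by
    intro l hl
    have hl0 : 0 < l := hr.trans_le hl
    have h1 : r * 16 ≤ l * κ⁻¹ := by gcongr
    have h2 : r * δ ≤ r * 1 := by gcongr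
    linarith
  have hO0 := overflow_measure_le (γ := γ) hr hl0.1 hκ (by linarith) hK.le (hTX l0 hl0.1) (htail 0)
  have hO1 := overflow_measure_le (γ := γ) hr hl1.1 hκ (by linarith) hK.le (hTX l1 hl1.1) (htail 1)
  rw [← hCo] at hO0 hO1
  obtain ⟨R1, hR1⟩ : ∃ R1, R1 = {z | q u0 ≤ ENNReal.ofReal (κ⁻¹ / 8) ∧
    z ∈ edgeEvent a b 0 1 (φ true u0) (ψ false (q u0).toReal)} := ⟨_, rfl⟩
  obtain ⟨R2, hR2⟩ : ∃ R2, R2 = {z | f u1 ≤ ENNReal.ofReal (κ⁻¹ / 8) ∧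
    z ∈ edgeEvent a b 1 0 (ψ true u1) (φ false (f u1).toReal)} := ⟨_, rfl⟩
  have hconst : ∀ l v D, r ≤ l → δ ≤ v → D ≤ C3 + C4 →
      2 * (K * κ) / (l * v) + (κ + D * κ + 16 / r * κ + 16 / r * κ) ≤ Ce * κ := by
    intro l v D hl hv hD
    have hl' : 0 < l := hr.trans_le hl
    have hv' : 0 < v := hδ0.trans_le hv
    calc 2 * (K * κ) / (l * v) + (κ + D * κ + 16 / r * κ + 16 / r * κ)
        ≤ 2 * (K * κ) / (r * δ) + (κ + (C3 + C4) * κ + 16 / r * κ + 16 / r * κ) := by gcongr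
      _ = Ce * κ := by rw [hCe]; ring
  have hR1le : ENNReal.ofReal t * μ R1 ≤ ENNReal.ofReal (Ce * κ) := by
    by_cases hq8 : q u0 ≤ ENNReal.ofReal (κ⁻¹ / 8)
    · have hne := ne_top_of_le_ne_top ENNReal.ofReal_ne_top hq8
      obtain ⟨hδv, hst⟩ := hq0 hne
      have hv8 : (q u0).toReal ≤ κ⁻¹ / 8 := ENNReal.toReal_le_of_le_ofReal (by linarith) hq8
      -- The edge is cut by the larger first branch and the smaller second one, so the corner
      -- compared with it uses a mixed pair. For this reason the tail approximation is assumed for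
      -- all pairs of branches.
      have h := edgeEvent_measure_le (a := a) (b := b) hν hD2 hM1 hqf.anti hr hκ hl0.1 hl1.1 ht
        hu0 hu1 (hy0 hq8) (by linarith) (by linarith) (ENNReal.ofReal_toReal hne).ge (hφ true)
        (hψ false) (hTA true false u0 _ le_rfl (hy0 hq8)) (K := K * κ) (by positivity)
        (by positivity) hst (fun T hT => htail 1 T (le_trans (by
          have := hl1.1
          gcongr) hT))
      refine le_trans ?_ (h.trans (ENNReal.ofReal_le_ofReal
        (hconst l1 _ C3 hl1.1 hδv (by linarith))))
      rw [hR1]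
      gcongr
      exact fun z hz => hz.2
    · have : R1 = ∅ := by
        rw [hR1]
        exact Set.eq_empty_of_forall_notMem fun z hz => hq8 hz.1
      rw [this, measure_empty, mul_zero]
      exact bot_le
  have hR2le : ENNReal.ofReal t * μ R2 ≤ ENNReal.ofReal (Ce * κ) := by
    by_cases hf8 : f u1 ≤ ENNReal.ofReal (κ⁻¹ / 8)
    · have hne := ne_top_of_le_ne_top ENNReal.ofReal_ne_top hf8
      obtain ⟨hδv, hst⟩ := hf1 hne
      have hv8 : (f u1).toReal ≤ κ⁻¹ / 8 := ENNReal.toReal_le_of_le_ofReal (by linarith) hf8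
      have h := edgeEvent_measure_le_swap (a := a) (b := b) hν hD2 hM1 hqf hr hκ hl0.1 hl1.1 ht
        hu0 hu1 (hx0 hf8) (by linarith) (by linarith) (ENNReal.ofReal_toReal hne).ge (hφ false)
        (hψ true) (hTA false true _ u1 (hx0 hf8) le_rfl) (K := K * κ) (by positivity)
        (by positivity) hst (fun T hT => htail 0 T (le_trans (by
          have := hl0.1
          gcongr) hT))
      refine le_trans ?_ (h.trans (ENNReal.ofReal_le_ofReal
        (hconst l0 _ C4 hl0.1 hδv (by linarith))))
      rw [hR2]
      gcongr
      exact fun z hz => hz.2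
    · have : R2 = ∅ := by
        rw [hR2]
        exact Set.eq_empty_of_forall_notMem fun z hz => hf8 hz.1
      rw [this, measure_empty, mul_zero]
      exact bot_le
  obtain ⟨O0, hO0e⟩ : ∃ O0, O0 = overflow γ a b 0 (l0 * κ⁻¹ / 16) := ⟨_, rfl⟩
  obtain ⟨O1, hO1e⟩ : ∃ O1, O1 = overflow γ a b 1 (l1 * κ⁻¹ / 16) := ⟨_, rfl⟩
  rw [← hO0e] at hO0
  rw [← hO1e] at hO1
  obtain ⟨Es, hEs⟩ : ∃ Es, Es = cornerEvent γ a b q (φ false) (ψ false) u0 u1 := ⟨_, rfl⟩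
  obtain ⟨M, hM⟩ : ∃ M, M = coreEvent γ a b q (φ true) (ψ true) u0 u1 κ⁻¹ (l0 * κ⁻¹ / 16)
    (l1 * κ⁻¹ / 16) := ⟨_, rfl⟩
  have hup := H1 a b κ l0 l1 t u0 u1 _ _ hκ hl0 hl1 ht hu0 hu1 (by linarith) (by linarith)
    (hφ false) (hψ false) (hTA false false u0 u1 le_rfl le_rfl)
  have hlow := H2 a b κ l0 l1 t (φ true) (ψ true) hκ hκ2' hl0 hl1 ht
  rw [← hu0e, ← hu1e] at hlow
  have hlow := hlow (by linarith) (by linarith) (hφ true) (hψ true)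
    (hTA true true u0 u1 le_rfl le_rfl)
  rw [← hEs] at hup
  -- The upper event contains an image set whose measurability is not available. Its measurable hull
  -- has the same mass.
  refine ⟨M, toMeasurable μ (Es ∪ R1 ∪ R2 ∪ O0 ∪ O1),
    hM ▸ measurableSet_coreEvent hqf.anti hu0 hu1, measurableSet_toMeasurable _ _, ?_, ?_, ?_⟩
  · intro d hit0 hit1 φ' ψ' hd0 hd1 hh0 hh1 hle0 hle1
    constructor
    · rw [hM]
      exact coreEvent_subset hqf hl0p hl1p hu0 hu1 hX0 hX1 (hφ false) (hψ false) (hφ true)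
        (hψ true) hh0 hh1 hle0 hle1 hd0 hd1
    · refine (hatEvent_subset hqf hl0p hl1p hu0 hu1 hX0 hX1 (hφ false) (hψ false) hh0 hh1 hle0
        hle1 hy0 hx0).trans ?_
      rw [← hEs, ← hR1, ← hR2, ← hO0e, ← hO1e]
      exact subset_toMeasurable _ _
  · rw [measure_toMeasurable]
    calc ENNReal.ofReal t * μ (Es ∪ R1 ∪ R2 ∪ O0 ∪ O1)
        ≤ ENNReal.ofReal t * (μ Es + μ R1 + μ R2 + μ O0 + μ O1) := by
          gcongr
          refine (measure_union_le _ _).trans ?_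
          gcongr
          refine (measure_union_le _ _).trans ?_
          gcongr
          refine (measure_union_le _ _).trans ?_
          gcongr
          exact measure_union_le _ _
      _ ≤ ν (scaledSet q l0 l1) + ENNReal.ofReal (C1 * κ) + ENNReal.ofReal (Ce * κ) +
          ENNReal.ofReal (Ce * κ) + ENNReal.ofReal (Co * κ) + ENNReal.ofReal (Co * κ) := by
          rw [mul_add, mul_add, mul_add, mul_add]
          gcongr
      _ ≤ _ := by
          simp only [add_assoc]
          gcongr
          repeat rw [← ENNReal.ofReal_add (by positivity) (by positivity)]
          refine ENNReal.ofReal_le_ofReal ?_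
          have : 0 < C2 * κ := by positivity
          linarith
  · have hsub : cornerEvent γ a b q (φ true) (ψ true) u0 u1 ⊆ M ∪ O0 ∪ O1 := by
      rw [hM, hO0e, hO1e]
      exact cornerEvent_subset hl0p hl1p hu0 hu1 hX0 hX1 (hφ true) (hψ true)
    calc ν (scaledSet q l0 l1)
        ≤ ENNReal.ofReal t * (μ M + μ O0 + μ O1) + ENNReal.ofReal (C2 * κ) := by
          refine hlow.trans ?_
          gcongr
          refine (measure_mono hsub).trans ((measure_union_le _ _).trans ?_)
          gcongr
          exact measure_union_le _ _
      _ ≤ ENNReal.ofReal t * μ M + ENNReal.ofReal (Co * κ) + ENNReal.ofReal (Co * κ) +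
          ENNReal.ofReal (C2 * κ) := by
          rw [mul_add, mul_add]
          gcongr
      _ ≤ _ := by
          simp only [add_assoc]
          gcongr
          repeat rw [← ENNReal.ofReal_add (by positivity) (by positivity)]
          refine ENNReal.ofReal_le_ofReal ?_
          have : 0 < C1 * κ := by positivity
          have : 0 < Ce * κ := by positivity
          linarith

end Sandwich

/-! ### Perturbations of the marginal parameters -/

section Perturbation

/-- The error weight. -/
noncomputable def errWeight (m x : ℝ) : ℝ := x ^ (-m) + x ^ (1 / 2 : ℝ)

/-- Below `1` the smaller exponent dominates, above `1` the larger one. -/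
lemma rpow_le_errWeight {m x e : ℝ} (hx : 0 < x) (h1 : -m ≤ e) (h2 : e ≤ 1 / 2) :
    x ^ e ≤ errWeight m x := by
  have e1 : 0 < x ^ (-m) := Real.rpow_pos_of_pos hx _
  have e2 : 0 < x ^ (1 / 2 : ℝ) := Real.rpow_pos_of_pos hx _
  unfold errWeight
  rcases le_total x 1 with h | h
  · have := Real.rpow_le_rpow_of_exponent_ge hx h h1
    linarith
  · have := Real.rpow_le_rpow_of_exponent_le h h2
    linarith

lemma one_le_errWeight {m x : ℝ} (hm : 0 ≤ m) (hx : 0 < x) : 1 ≤ errWeight m x := by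
  have := rpow_le_errWeight (m := m) (e := 0) hx (by linarith) (by norm_num : (0 : ℝ) ≤ 1 / 2)
  rwa [Real.rpow_zero] at this

lemma abs_log_le_errWeight {m x : ℝ} (hm : 1 / 2 ≤ m) (hx : 0 < x) :
    |Real.log x| ≤ 4 * errWeight m x := by
  have h1 := abs_log_le_rpow hx (show (0 : ℝ) < 1 / 2 by norm_num)
  have h2 := rpow_le_errWeight (m := m) (e := 1 / 2) hx (by linarith) le_rfl
  have h3 := rpow_le_errWeight (m := m) (e := -(1 / 2)) hx (by linarith) (by norm_num)
  refine h1.trans ?_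
  rw [div_le_iff₀ (by norm_num)]
  linarith

lemma abs_rpow_sub_one_le {c p : ℝ} (hc : 1 ≤ c) (h : |p| * Real.log c ≤ 1) :
    |c ^ p - 1| ≤ 2 * (|p| * Real.log c) := by
  have hlog := Real.log_nonneg hc
  rw [Real.rpow_def_of_pos (by linarith)]
  have h1 : |Real.log c * p| = |p| * Real.log c := by
    rw [abs_mul, abs_of_nonneg hlog, mul_comm]
  rw [← h1] at h ⊢
  exact Real.abs_exp_sub_one_le h

lemma abs_one_add_rpow_sub_one_le {ζ p : ℝ} (h1 : |ζ| ≤ 1 / 2) (h2 : 2 * |p| * |ζ| ≤ 1) :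
    |(1 + ζ) ^ p - 1| ≤ 4 * |p| * |ζ| := by
  have hζ := abs_le.1 h1
  have hpos : 0 < 1 + ζ := by linarith
  have hlog : |Real.log (1 + ζ)| ≤ 2 * |ζ| := by
    have e1 := Real.log_le_sub_one_of_pos hpos
    have e2 := Real.one_sub_inv_le_log_of_pos hpos
    have e3 : -(2 * |ζ|) ≤ 1 - (1 + ζ)⁻¹ := by
      have : 1 - (1 + ζ)⁻¹ = ζ / (1 + ζ) := by field_simp; ring
      rw [this, le_div_iff₀ hpos]
      have := neg_abs_le ζ
      have := abs_nonneg ζ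
      nlinarith
    have := le_abs_self ζ
    have := abs_nonneg ζ
    rw [abs_le]
    constructor <;> linarith
  rw [Real.rpow_def_of_pos hpos]
  have h3 : |Real.log (1 + ζ) * p| ≤ 2 * |p| * |ζ| := by
    rw [abs_mul]
    calc |Real.log (1 + ζ)| * |p| ≤ 2 * |ζ| * |p| := by gcongr
      _ = _ := by ring
  have := Real.abs_exp_sub_one_le (h3.trans h2)
  linarith

/-- From a relative error of `1 + g y` to one of `gpdR g y`. -/
lemma gpdR_close_of_rel {g y L ζ : ℝ} (hg : g ≠ 0) (hL : 0 < L) (h : 1 + g * y = L ^ g * (1 + ζ))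
    (h1 : |ζ| ≤ 1 / 2) (h2 : 2 * |1 / g| * |ζ| ≤ 1) :
    0 < 1 + g * y ∧ |gpdR g y / L - 1| ≤ 4 * |1 / g| * |ζ| := by
  have hζ := abs_le.1 h1
  have hpos : 0 < 1 + ζ := by linarith
  have hLg : 0 < L ^ g := Real.rpow_pos_of_pos hL _
  refine ⟨by rw [h]; positivity, ?_⟩
  have e : gpdR g y / L = (1 + ζ) ^ (1 / g) := by
    rw [gpdR, if_neg hg, h, Real.mul_rpow hLg.le hpos.le, ← Real.rpow_mul hL.le,
      mul_one_div_cancel hg, Real.rpow_one]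
    field_simp
  rw [e]
  exact abs_one_add_rpow_sub_one_le h1 h2

/-- The perturbed transformation, in terms of the normalized quantile `v`. -/
noncomputable def perturb (g c p h z v : ℝ) : ℝ := boxCox (g - p) c⁻¹ * (1 + z) + c ^ (-(g + h)) * v

-- The estimate is made for `1 + g φ`, where the target is `L ^ g`. Replacing `c ^ p` and `c ^ (-h)`
-- by `1` costs `ε log c`, the factor `g (1 + z) / (g - p)` costs `ε`, and the quantile
-- approximation costs `δ L ^ g`.
set_option maxHeartbeats 400000 in
lemma perturb_pos_rel {g c p h z v L y ε δ : ℝ} (hg : 0 < g) (hc : 1 ≤ c) (hL : 0 < L)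
    (hy : y = L * c) (hp : |p| ≤ ε) (hh : |h| ≤ ε) (hz : |z| ≤ ε) (hεg : ε ≤ g / 2)
    (hε1 : ε ≤ 1 / 2) (hεc : ε * Real.log c ≤ 1 / 2) (hδ : 0 ≤ δ)
    (hv : |v - boxCox g y| ≤ δ * y ^ g) :
    |1 + g * perturb g c p h z v - L ^ g| ≤
      (8 + 9 / g + 2 * g) * (ε * (1 + Real.log c) + δ) * (1 + L ^ g) := by
  have hc0 : 0 < c := by linarith
  have hlog := Real.log_nonneg hc
  have hε : 0 ≤ ε := (abs_nonneg _).trans hp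
  have hpc : |p| * Real.log c ≤ ε * Real.log c := by gcongr
  have hhc : |-h| * Real.log c ≤ ε * Real.log c := by rw [abs_neg]; gcongr
  have hP := abs_rpow_sub_one_le hc (hpc.trans (by linarith))
  have hH := abs_rpow_sub_one_le hc (hhc.trans (by linarith))
  obtain ⟨Λ, hΛ⟩ : ∃ Λ, Λ = L ^ g := ⟨_, rfl⟩
  obtain ⟨G, hG⟩ : ∃ G, G = c ^ (-g) := ⟨_, rfl⟩
  obtain ⟨P, hPe⟩ : ∃ P, P = c ^ p := ⟨_, rfl⟩
  obtain ⟨H, hHe⟩ : ∃ H, H = c ^ (-h) := ⟨_, rfl⟩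
  have hΛ0 : 0 < Λ := hΛ ▸ Real.rpow_pos_of_pos hL _
  have hG0 : 0 < G := hG ▸ Real.rpow_pos_of_pos hc0 _
  have hG1 : G ≤ 1 := hG ▸ Real.rpow_le_one_of_one_le_of_nonpos hc (by linarith)
  have hP0 : 0 < P := hPe ▸ Real.rpow_pos_of_pos hc0 _
  have hH0 : 0 < H := hHe ▸ Real.rpow_pos_of_pos hc0 _
  have hyg : y ^ g = Λ / G := by
    rw [hy, Real.mul_rpow hL.le hc0.le, hG, Real.rpow_neg hc0.le, hΛ]
    field_simp
  rw [← hPe] at hP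
  rw [← hHe] at hH
  rw [← hΛ]
  have hy0 : 0 < y := by rw [hy]; positivity
  obtain ⟨w, hw⟩ : ∃ w, w = v - boxCox g y := ⟨_, rfl⟩
  rw [← hw, hyg] at hv
  have hgv : g * v = Λ / G - 1 + g * w := by
    have := one_add_mul_boxCox g y
    rw [hyg] at this
    rw [hw]
    linarith
  have hgp : 0 < g - p := by linarith [(abs_le.1 hp).2]
  have hgp' : g / 2 ≤ g - p := by linarith [(abs_le.1 hp).2]
  obtain ⟨ρ, hρ⟩ : ∃ ρ, ρ = g / (g - p) * (1 + z) := ⟨_, rfl⟩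
  have hρ1 : |ρ - 1| ≤ (3 / g + 1) * ε := by
    have e : ρ - 1 = p / (g - p) * (1 + z) + z := by
      rw [hρ]
      field_simp
      ring
    have e1 : |p / (g - p)| ≤ 2 / g * ε := by
      rw [abs_div, abs_of_pos hgp, div_le_iff₀ hgp]
      calc |p| ≤ 2 / g * ε * (g / 2) := by
            have : 2 / g * ε * (g / 2) = ε := by field_simp
            linarith
        _ ≤ 2 / g * ε * (g - p) := by gcongr
    have e2 : |1 + z| ≤ 3 / 2 := by
      have := abs_add_le 1 z
      rw [abs_one] at this
      linarith
    rw [e]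
    calc |p / (g - p) * (1 + z) + z| ≤ |p / (g - p)| * |1 + z| + |z| := by
          rw [← abs_mul]
          exact abs_add_le _ _
      _ ≤ 2 / g * ε * (3 / 2) + ε := by gcongr
      _ = _ := by ring
  have hB : g * (boxCox (g - p) c⁻¹ * (1 + z)) = ρ * (G * P - 1) := by
    have e : (c⁻¹ : ℝ) ^ (g - p) = G * P := by
      rw [Real.inv_rpow hc0.le, ← Real.rpow_neg hc0.le, hG, hPe, ← Real.rpow_add hc0]
      congr 1
      ring
    rw [boxCox, if_neg hgp.ne', e, hρ]
    field_simp
  have hGH : c ^ (-(g + h)) = G * H := by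
    rw [hG, hHe, ← Real.rpow_add hc0]
    congr 1
    ring
  -- An exact expansion in which every summand carries one of the small quantities `H - 1`, `P - 1`,
  -- `ρ - 1`, `w`.
  have hmain : 1 + g * perturb g c p h z v - Λ =
      Λ * (H - 1) + G * H * (g * w) + (1 - ρ) + G * ((ρ - 1) * P + (P - 1) - (H - 1)) := by
    unfold perturb
    rw [mul_add, hB, hGH]
    have : g * (G * H * v) = G * H * (g * v) := by ring
    rw [this, hgv]
    field_simp
    ring
  have b1 : |H - 1| ≤ 2 * (ε * Real.log c) := hH.trans (by linarith)
  have b2 : |P - 1| ≤ 2 * (ε * Real.log c) := hP.trans (by linarith)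
  have b3 : H ≤ 2 := by linarith [(abs_le.1 b1).2]
  have b4 : P ≤ 2 := by linarith [(abs_le.1 b2).2]
  have b5 : |G * H * (g * w)| ≤ 2 * g * δ * Λ := by
    rw [abs_mul, abs_mul g, abs_of_pos hg, abs_of_pos (mul_pos hG0 hH0)]
    calc G * H * (g * |w|) ≤ G * 2 * (g * (δ * (Λ / G))) := by gcongr
      _ = _ := by field_simp
  have b6 : |(ρ - 1) * P + (P - 1) - (H - 1)| ≤
      (3 / g + 1) * ε * 2 + 2 * (ε * Real.log c) + 2 * (ε * Real.log c) := by
    calc |(ρ - 1) * P + (P - 1) - (H - 1)| ≤ |ρ - 1| * P + |P - 1| + |H - 1| := by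
          refine (abs_sub _ _).trans (add_le_add_left ((abs_add_le _ _).trans ?_) _)
          rw [abs_mul, abs_of_pos hP0]
      _ ≤ _ := by gcongr
  rw [hmain]
  calc |Λ * (H - 1) + G * H * (g * w) + (1 - ρ) + G * ((ρ - 1) * P + (P - 1) - (H - 1))|
      ≤ Λ * |H - 1| + |G * H * (g * w)| + |ρ - 1| +
        G * |(ρ - 1) * P + (P - 1) - (H - 1)| := by
        refine (abs_add_le _ _).trans ?_
        rw [abs_mul G, abs_of_pos hG0]
        refine add_le_add_left ?_ _
        refine (abs_add_le _ _).trans ?_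
        rw [abs_sub_comm 1 ρ]
        refine add_le_add_left ?_ _
        refine (abs_add_le _ _).trans ?_
        rw [abs_mul Λ, abs_of_pos hΛ0]
    _ ≤ Λ * (2 * (ε * Real.log c)) + 2 * g * δ * Λ + (3 / g + 1) * ε +
        1 * ((3 / g + 1) * ε * 2 + 2 * (ε * Real.log c) + 2 * (ε * Real.log c)) := by gcongr
    _ ≤ _ := by
        have h1 : 0 ≤ ε * Real.log c := mul_nonneg hε hlog
        have h1' : 0 ≤ ε * Real.log c * Λ := mul_nonneg h1 hΛ0.le
        have h2 : 0 < 3 / g := by positivity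
        have e6 : 9 / g = 3 * (3 / g) := by ring
        rw [e6]
        obtain ⟨K, hK⟩ : ∃ K, K = 8 + 3 * (3 / g) + 2 * g := ⟨_, rfl⟩
        rw [← hK]
        have hK0 : 0 < K := by rw [hK]; positivity
        have k1 : (3 / g + 1) * ε * 3 ≤ K * ε := by
          rw [show (3 / g + 1) * ε * 3 = (3 * (3 / g) + 3) * ε by ring]
          exact mul_le_mul_of_nonneg_right (by linarith) hε
        have k2 : 4 * (ε * Real.log c) ≤ K * (ε * Real.log c) :=
          mul_le_mul_of_nonneg_right (by linarith) h1
        have k3 : 2 * g * δ ≤ K * δ := by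
          gcongr
          linarith
        have k4 : 2 * (ε * Real.log c) * Λ ≤ K * (ε * Real.log c) * Λ := by
          rw [mul_assoc, mul_assoc K]
          exact mul_le_mul_of_nonneg_right (by linarith) h1'
        have k5 : 2 * g * δ * Λ ≤ K * δ * Λ := by gcongr
        have k6 : 0 ≤ K * ε * Λ := by positivity
        have k7 : 0 ≤ K * δ := by positivity
        have hexp : K * (ε * (1 + Real.log c) + δ) * (1 + Λ) =
          K * ε + K * (ε * Real.log c) + K * δ + K * ε * Λ + K * (ε * Real.log c) * Λ +
            K * δ * Λ := by ring
        rw [hexp]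
        linarith

/-- Division by `(l x)^g` turns the absolute error into a relative one and creates `x^(-g)`, the
source of the weight `x^(-m)` near the axis. -/
lemma perturb_close_pos {g r : ℝ} (hg : 0 < g) (hr : 0 < r) :
    ∃ C : ℝ, 0 < C ∧ ∀ c p h z v l x ε δ : ℝ, 1 ≤ c → r ≤ l → 0 < x → |p| ≤ ε → |h| ≤ ε →
      |z| ≤ ε → ε ≤ g / 2 → ε ≤ 1 / 2 → ε * Real.log c ≤ 1 / 2 → 0 ≤ δ →
      |v - boxCox g (l * x * c)| ≤ δ * (l * x * c) ^ g →
      C * (ε * (1 + Real.log c) + δ) * errWeight (max g (1 / 2)) x ≤ 1 →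
      0 < 1 + g * perturb g c p h z v ∧ |gpdR g (perturb g c p h z v) / (l * x) - 1| ≤
        C * (ε * (1 + Real.log c) + δ) * errWeight (max g (1 / 2)) x := by
  obtain ⟨K, hK⟩ : ∃ K, K = (8 + 9 / g + 2 * g) * (1 + r ^ (-g)) := ⟨_, rfl⟩
  have hK0 : 0 < K := by rw [hK]; positivity
  refine ⟨(2 + 4 * |1 / g|) * K, by positivity, ?_⟩
  intro c p h z v l x ε δ hc hl hx hp hh hz hεg hε1 hεc hδ hv hsmall
  have hl0 : 0 < l := hr.trans_le hl
  have hL : 0 < l * x := by positivity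
  have hlog := Real.log_nonneg hc
  have hε : 0 ≤ ε := (abs_nonneg _).trans hp
  have hmain := perturb_pos_rel hg hc hL rfl hp hh hz hεg hε1 hεc hδ hv
  obtain ⟨E, hE⟩ : ∃ E, E = ε * (1 + Real.log c) + δ := ⟨_, rfl⟩
  obtain ⟨W, hW⟩ : ∃ W, W = errWeight (max g (1 / 2)) x := ⟨_, rfl⟩
  have hE0 : 0 ≤ E := by rw [hE]; positivity
  have hW1 : 1 ≤ W := hW ▸ one_le_errWeight (by positivity) hx
  have hΛ : 0 < (l * x) ^ g := Real.rpow_pos_of_pos hL _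
  rw [← hE] at hmain
  rw [← hE, ← hW] at hsmall ⊢
  have hinv : ((l * x) ^ g)⁻¹ ≤ r ^ (-g) * W := by
    rw [← Real.rpow_neg hL.le, Real.mul_rpow hl0.le hx.le]
    have h1 : l ^ (-g) ≤ r ^ (-g) := Real.rpow_le_rpow_of_nonpos hr hl (by linarith)
    have h2 : x ^ (-g) ≤ W := by
      rw [hW]
      exact rpow_le_errWeight hx (by linarith [le_max_left g (1 / 2)]) (by linarith)
    gcongr
  obtain ⟨ζ, hζ⟩ : ∃ ζ, ζ = (1 + g * perturb g c p h z v - (l * x) ^ g) / (l * x) ^ g := ⟨_, rfl⟩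
  have hζle : |ζ| ≤ K * E * W := by
    rw [hζ, abs_div, abs_of_pos hΛ, div_eq_mul_inv]
    calc |1 + g * perturb g c p h z v - (l * x) ^ g| * ((l * x) ^ g)⁻¹
        ≤ (8 + 9 / g + 2 * g) * E * (1 + (l * x) ^ g) * ((l * x) ^ g)⁻¹ := by gcongr
      _ = (8 + 9 / g + 2 * g) * E * (((l * x) ^ g)⁻¹ + 1) := by field_simp
      _ ≤ (8 + 9 / g + 2 * g) * E * (r ^ (-g) * W + 1 * W) := by
          gcongr
          linarith
      _ = _ := by rw [hK]; ring
  have habs : 0 ≤ |1 / g| := abs_nonneg _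
  have hKEW : 0 ≤ K * E * W := by positivity
  have hprod : (2 + 4 * |1 / g|) * K * E * W = 2 * (K * E * W) + 4 * |1 / g| * (K * E * W) := by
    ring
  have hb : 0 ≤ |1 / g| * (K * E * W) := by positivity
  have hb' : |1 / g| * |ζ| ≤ |1 / g| * (K * E * W) := by gcongr
  have heq : 1 + g * perturb g c p h z v = (l * x) ^ g * (1 + ζ) := by
    rw [hζ]
    field_simp
    ring
  obtain ⟨h1, h2⟩ := gpdR_close_of_rel hg.ne' hL heq (by linarith) (by linarith)
  exact ⟨h1, h2.trans (by linarith)⟩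

/-- Only the last parameter is perturbed. Its coefficient is of order `c^(-g)`, which explains the
rate. Division by `(l x)^g` gives `x^(-g)` with exponent at most `1/2`, the source of the weight
`x^(1/2)`. -/
lemma perturb_close_neg {g R : ℝ} (hg : g < 0) (hg' : -(1 / 2) ≤ g) (hR : 0 < R) :
    ∃ C : ℝ, 0 < C ∧ ∀ c z v l x ε δ : ℝ, 1 ≤ c → 0 < l → l ≤ R → 0 < x → |z| ≤ ε → 0 ≤ δ →
      |v - boxCox g (l * x * c)| ≤ δ * (l * x * c) ^ g →
      C * (ε * c ^ (-g) + δ) * errWeight (max g (1 / 2)) x ≤ 1 →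
      0 < 1 + g * perturb g c 0 0 z v ∧ |gpdR g (perturb g c 0 0 z v) / (l * x) - 1| ≤
        C * (ε * c ^ (-g) + δ) * errWeight (max g (1 / 2)) x := by
  obtain ⟨K, hK⟩ : ∃ K, K = R ^ (-g) + |g| := ⟨_, rfl⟩
  have hK0 : 0 < K := by rw [hK]; positivity
  refine ⟨(2 + 4 * |1 / g|) * K, by positivity, ?_⟩
  intro c z v l x ε δ hc hl0 hl hx hz hδ hv hsmall
  have hc0 : 0 < c := by linarith
  have hL : 0 < l * x := by positivity
  have hε : 0 ≤ ε := (abs_nonneg _).trans hz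
  obtain ⟨G, hG⟩ : ∃ G, G = c ^ (-g) := ⟨_, rfl⟩
  have hG1 : 1 ≤ G := hG ▸ Real.one_le_rpow hc (by linarith)
  obtain ⟨W, hW⟩ : ∃ W, W = errWeight (max g (1 / 2)) x := ⟨_, rfl⟩
  have hW1 : 1 ≤ W := hW ▸ one_le_errWeight (by positivity) hx
  obtain ⟨Λ, hΛe⟩ : ∃ Λ, Λ = (l * x) ^ g := ⟨_, rfl⟩
  have hΛ : 0 < Λ := hΛe ▸ Real.rpow_pos_of_pos hL _
  rw [← hG, ← hW] at hsmall ⊢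
  have hinv : Λ⁻¹ ≤ R ^ (-g) * W := by
    rw [hΛe, ← Real.rpow_neg hL.le, Real.mul_rpow hl0.le hx.le]
    have h1 : l ^ (-g) ≤ R ^ (-g) := Real.rpow_le_rpow hl0.le hl (by linarith)
    have h2 : x ^ (-g) ≤ W := by
      rw [hW]
      refine rpow_le_errWeight hx ?_ (by linarith)
      have := le_max_right g (1 / 2)
      linarith
    gcongr
  have hyg : (l * x * c) ^ g = Λ / G := by
    rw [Real.mul_rpow hL.le hc0.le, hG, Real.rpow_neg hc0.le, hΛe]
    field_simp
  obtain ⟨w, hw⟩ : ∃ w, w = v - boxCox g (l * x * c) := ⟨_, rfl⟩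
  rw [← hw, hyg] at hv
  have hgv : g * v = Λ / G - 1 + g * w := by
    have := one_add_mul_boxCox g (l * x * c)
    rw [hyg] at this
    rw [hw]
    linarith
  have hB : g * boxCox g c⁻¹ = G - 1 := by
    have := one_add_mul_boxCox g c⁻¹
    rw [Real.inv_rpow hc0.le, ← Real.rpow_neg hc0.le, ← hG] at this
    linarith
  obtain ⟨ζ, hζ⟩ : ∃ ζ, ζ = (G * (g * w) + z * (G - 1)) * Λ⁻¹ := ⟨_, rfl⟩
  have heq : 1 + g * perturb g c 0 0 z v = (l * x) ^ g * (1 + ζ) := by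
    rw [hζ, ← hΛe]
    unfold perturb
    rw [sub_zero, add_zero, ← hG, mul_add, ← mul_assoc g, hB]
    have : g * (G * v) = G * (g * v) := by ring
    rw [this, hgv]
    field_simp
    ring
  have hζle : |ζ| ≤ K * (ε * G + δ) * W := by
    rw [hζ, abs_mul, abs_of_pos (inv_pos.2 hΛ)]
    have e1 : |G * (g * w)| ≤ |g| * δ * Λ := by
      rw [abs_mul, abs_mul g, abs_of_pos (by linarith : 0 < G)]
      calc G * (|g| * |w|) ≤ G * (|g| * (δ * (Λ / G))) := by gcongr
        _ = _ := by field_simp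
    have e2 : |z * (G - 1)| ≤ ε * G := by
      rw [abs_mul, abs_of_nonneg (by linarith : 0 ≤ G - 1)]
      calc |z| * (G - 1) ≤ ε * (G - 1) := by gcongr
        _ ≤ ε * G := by gcongr; exact sub_le_self _ zero_le_one
    calc |G * (g * w) + z * (G - 1)| * Λ⁻¹ ≤ (|g| * δ * Λ + ε * G) * Λ⁻¹ := by
          gcongr
          exact (abs_add_le _ _).trans (by linarith)
      _ = |g| * δ + ε * G * Λ⁻¹ := by field_simp
      _ ≤ |g| * δ * W + ε * G * (R ^ (-g) * W) := by
          refine add_le_add ?_ (by gcongr)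
          exact le_mul_of_one_le_right (mul_nonneg (abs_nonneg g) hδ) hW1
      _ ≤ |g| * δ * W + ε * G * (R ^ (-g) * W) + (|g| * (ε * G) * W + R ^ (-g) * δ * W) := by
          have : 0 ≤ |g| * (ε * G) * W + R ^ (-g) * δ * W := by positivity
          linarith
      _ = _ := by rw [hK]; ring
  have hKEW : 0 ≤ K * (ε * G + δ) * W := by positivity
  have hprod : (2 + 4 * |1 / g|) * K * (ε * G + δ) * W =
      2 * (K * (ε * G + δ) * W) + 4 * |1 / g| * (K * (ε * G + δ) * W) := by
    ring
  have hb : 0 ≤ |1 / g| * (K * (ε * G + δ) * W) := by positivity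
  have hb' : |1 / g| * |ζ| ≤ |1 / g| * (K * (ε * G + δ) * W) := by gcongr
  obtain ⟨h1, h2⟩ := gpdR_close_of_rel hg.ne hL heq (by linarith) (by linarith)
  exact ⟨h1, h2.trans (by linarith)⟩

/-- Second order expansion of the exponential at `p log c`. The squared logarithm here is the one in
the weight for index `0`. -/
lemma abs_boxCox_add_log_le {c p : ℝ} (hc : 1 ≤ c) (h : |p| * Real.log c ≤ 1) :
    |boxCox (-p) c⁻¹ + Real.log c| ≤ |p| * Real.log c ^ 2 := by
  have hlog := Real.log_nonneg hc
  have hc0 : 0 < c := by linarith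
  unfold boxCox
  split_ifs with h0
  · rw [Real.log_inv, neg_add_cancel, abs_zero]
    positivity
  · have hp : p ≠ 0 := fun h => h0 (by rw [h, neg_zero])
    have h1 : |Real.log c * p| ≤ 1 := by rwa [abs_mul, abs_of_nonneg hlog, mul_comm]
    have h2 := Real.abs_exp_sub_one_sub_id_le h1
    have e : (c⁻¹ : ℝ) ^ (-p) = Real.exp (Real.log c * p) := by
      rw [Real.inv_rpow hc0.le, Real.rpow_neg hc0.le, inv_inv, Real.rpow_def_of_pos hc0]
    have e2 : (c⁻¹ ^ (-p) - 1) / -p + Real.log c =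
        -((Real.exp (Real.log c * p) - 1 - Real.log c * p) / p) := by
      rw [e]
      field_simp
      ring
    rw [e2, abs_neg, abs_div, div_le_iff₀ (abs_pos.2 hp)]
    refine h2.trans (le_of_eq ?_)
    have : |p| * |p| = p * p := abs_mul_abs_self p
    calc (Real.log c * p) ^ 2 = Real.log c ^ 2 * (p * p) := by ring
      _ = _ := by rw [← this]; ring

/-- For index `0` the comparison is additive on the logarithmic scale. The error is at most a
multiple of `1 + |log (l x)|`, which the weight absorbs, and exponentiation turns it into a relative
error. -/
lemma perturb_close_zero {r R : ℝ} (hr : 0 < r) :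
    ∃ C : ℝ, 0 < C ∧ ∀ c p h z v l x ε δ : ℝ, 1 ≤ c → r ≤ l → l ≤ R → 0 < x → |p| ≤ ε →
      |h| ≤ ε → |z| ≤ ε → ε ≤ 1 / 2 → ε * Real.log c ≤ 1 / 2 → 0 ≤ δ →
      |v - boxCox 0 (l * x * c)| ≤ δ * (l * x * c) ^ (0 : ℝ) →
      C * (ε * (1 + Real.log c) ^ 2 + δ) * errWeight (max 0 (1 / 2)) x ≤ 1 →
      0 < 1 + 0 * perturb 0 c p h z v ∧ |gpdR 0 (perturb 0 c p h z v) / (l * x) - 1| ≤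
        C * (ε * (1 + Real.log c) ^ 2 + δ) * errWeight (max 0 (1 / 2)) x := by
  obtain ⟨D, hD⟩ : ∃ D, D = max |Real.log r| |Real.log R| := ⟨_, rfl⟩
  have hD0 : 0 ≤ D := hD ▸ le_max_of_le_left (abs_nonneg _)
  refine ⟨8 * (5 + D), by positivity, ?_⟩
  intro c p h z v l x ε δ hc hl hlR hx hp hh hz hε1 hεc hδ hv hsmall
  have hl0 : 0 < l := hr.trans_le hl
  have hc0 : 0 < c := by linarith
  have hL : 0 < l * x := by positivity
  have hlog := Real.log_nonneg hc
  have hε : 0 ≤ ε := (abs_nonneg _).trans hp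
  obtain ⟨W, hW⟩ : ∃ W, W = errWeight (max 0 (1 / 2)) x := ⟨_, rfl⟩
  have hW1 : 1 ≤ W := hW ▸ one_le_errWeight (by positivity) hx
  have hlogx : |Real.log x| ≤ 4 * W := hW ▸ abs_log_le_errWeight (le_max_right _ _) hx
  have hlogl : |Real.log l| ≤ D := by
    have h1 : Real.log r ≤ Real.log l := Real.log_le_log hr hl
    have h2 : Real.log l ≤ Real.log R := Real.log_le_log hl0 hlR
    rw [hD, abs_le]
    constructor
    · have := neg_abs_le (Real.log r)
      have := le_max_left |Real.log r| |Real.log R|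
      linarith
    · have := le_abs_self (Real.log R)
      have := le_max_right |Real.log r| |Real.log R|
      linarith
  obtain ⟨t, ht⟩ : ∃ t, t = Real.log c := ⟨_, rfl⟩
  rw [← hW, ← ht] at hsmall ⊢
  rw [← ht] at hεc hlog
  obtain ⟨m, hm⟩ : ∃ m, m = Real.log (l * x) := ⟨_, rfl⟩
  have hmW : |m| ≤ (4 + D) * W := by
    rw [hm, Real.log_mul hl0.ne' hx.ne']
    have := abs_add_le (Real.log l) (Real.log x)
    nlinarith
  obtain ⟨w, hw⟩ : ∃ w, w = v - (m + t) := ⟨_, rfl⟩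
  have hv' : |w| ≤ δ := by
    rw [Real.rpow_zero, mul_one, boxCox, if_pos rfl, Real.log_mul hL.ne' hc0.ne', ← ht, ← hm] at hv
    rwa [hw]
  have hpt : |p| * t ≤ ε * t := by gcongr
  have hht : |-h| * t ≤ ε * t := by rw [abs_neg]; gcongr
  have hB := abs_boxCox_add_log_le (p := p) hc (by rw [← ht]; linarith)
  have hH := abs_rpow_sub_one_le (p := -h) hc (by rw [← ht]; linarith)
  rw [← ht] at hB hH
  have hφ : perturb 0 c p h z v - m =
      (boxCox (-p) c⁻¹ + t) * (1 + z) - z * t + (c ^ (-h) - 1) * v + w := by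
    unfold perturb
    rw [hw, zero_sub, zero_add]
    ring
  have hz2 : |1 + z| ≤ 3 / 2 := by
    have := abs_add_le 1 z
    rw [abs_one] at this
    linarith
  have hvb : |v| ≤ |m| + t + δ := by
    have e : v = m + t + w := by rw [hw]; ring
    rw [e]
    have h1 := abs_add_le (m + t) w
    have h2 := abs_add_le m t
    rw [abs_of_nonneg hlog] at h2
    linarith
  obtain ⟨E, hE⟩ : ∃ E, E = ε * (1 + t) ^ 2 + δ := ⟨_, rfl⟩
  rw [← hE] at hsmall ⊢
  have hE0 : 0 ≤ E := by rw [hE]; positivity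
  have herr : |perturb 0 c p h z v - m| ≤ 4 * E * (1 + |m|) := by
    rw [hφ]
    have hm0 := abs_nonneg m
    calc |(boxCox (-p) c⁻¹ + t) * (1 + z) - z * t + (c ^ (-h) - 1) * v + w|
        ≤ |boxCox (-p) c⁻¹ + t| * |1 + z| + |z| * t + |c ^ (-h) - 1| * |v| + |w| := by
          refine (abs_add_le _ _).trans (add_le_add_left ((abs_add_le _ _).trans ?_) _)
          rw [abs_mul (c ^ (-h) - 1)]
          refine add_le_add_left ((abs_sub _ _).trans ?_) _
          rw [abs_mul, abs_mul, abs_of_nonneg hlog]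
      _ ≤ (ε * t ^ 2) * (3 / 2) + ε * t + 2 * (ε * t) * (|m| + t + δ) + δ := by
          gcongr
          · exact hB.trans (by gcongr)
          · linarith
      _ ≤ 4 * E * (1 + |m|) := by
          have k1 : 0 ≤ ε * t := by positivity
          have k2 : 0 ≤ ε * t ^ 2 := by positivity
          have k3 : 0 ≤ ε * t * |m| := by positivity
          have k4 : ε * t * δ ≤ 1 / 2 * δ := by gcongr
          have k5 : 0 ≤ ε * |m| := by positivity
          have k6 : 0 ≤ ε * t ^ 2 * |m| := by positivity
          have k7 : 0 ≤ δ * |m| := by positivity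
          have e1 : 4 * E * (1 + |m|) = 4 * ε + 8 * (ε * t) + 4 * (ε * t ^ 2) + 4 * δ +
              4 * (ε * |m|) + 8 * (ε * t * |m|) + 4 * (ε * t ^ 2 * |m|) + 4 * (δ * |m|) := by
            rw [hE]
            ring
          have e2 : ε * t ^ 2 * (3 / 2) + ε * t + 2 * (ε * t) * (|m| + t + δ) + δ =
              7 / 2 * (ε * t ^ 2) + ε * t + 2 * (ε * t * |m|) + 2 * (ε * t * δ) + δ := by ring
          rw [e1, e2]
          linarith
  have herr' : |perturb 0 c p h z v - m| ≤ 4 * (5 + D) * E * W := by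
    refine herr.trans ?_
    have : 1 + |m| ≤ (5 + D) * W := by nlinarith
    calc 4 * E * (1 + |m|) ≤ 4 * E * ((5 + D) * W) := by gcongr
      _ = _ := by ring
  refine ⟨by norm_num, ?_⟩
  have hexp : gpdR 0 (perturb 0 c p h z v) / (l * x) =
      Real.exp (perturb 0 c p h z v - m) := by
    rw [gpdR, if_pos rfl, Real.exp_sub, hm, Real.exp_log hL]
  rw [hexp]
  have hEW : 8 * (5 + D) * E * W = 2 * (4 * (5 + D) * E * W) := by ring
  have hpos : 0 ≤ 4 * (5 + D) * E * W := by positivity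
  exact (Real.abs_exp_sub_one_le (by linarith)).trans (by linarith)

end Perturbation

/-! ### Monotonicity and domination in the parameters. -/

section Perturbation

/-- For `c ≥ 1` the first summand is a nonpositive Box-Cox value, which decreases with `p` and `z`.
The factor `c ^ (-(g + h))` decreases with `h`, and `v ≥ 0` preserves this. -/
lemma perturb_antitone {g c p h z p' h' z' v : ℝ} (hc : 1 ≤ c) (hv : 0 ≤ v) (hp : p ≤ p')
    (hh : h ≤ h') (hz : z ≤ z') (hz1 : 0 ≤ 1 + z) : perturb g c p' h' z' v ≤ perturb g c p h z v := by
  have hc0 : 0 < c := by linarith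
  have hinv : 0 < c⁻¹ := inv_pos.2 hc0
  have hB : boxCox (g - p') c⁻¹ ≤ 0 := by
    have := boxCox_le_boxCox (g := g - p') hinv (inv_le_one_of_one_le₀ hc)
    rwa [boxCox_one] at this
  have h1 : boxCox (g - p') c⁻¹ ≤ boxCox (g - p) c⁻¹ := boxCox_mono_index hinv (by linarith)
  have h2 : c ^ (-(g + h')) ≤ c ^ (-(g + h)) :=
    Real.rpow_le_rpow_of_exponent_le hc (by linarith)
  unfold perturb
  have h3 : boxCox (g - p') c⁻¹ * (1 + z') ≤ boxCox (g - p) c⁻¹ * (1 + z) :=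
    (mul_le_mul_of_nonpos_left (by linarith) hB).trans (mul_le_mul_of_nonneg_right h1 hz1)
  have h4 := mul_le_mul_of_nonneg_right h2 hv
  linarith

/-- For negative `g`, all perturbations are dominated by that of the last parameter. -/
lemma abs_perturb_sub_le {g c h z v y ε δ K : ℝ} (hg : g < 0) (hc : 1 ≤ c) (hG2 : 2 ≤ c ^ (-g))
    (hy : 0 < y) (hh : |h| ≤ ε) (hz : |z| ≤ ε) (hεg : ε ≤ -g / 2)
    (hεc : ε * Real.log c ≤ 1 / 2) (hδ : -g * δ ≤ 1) (hv : |v - boxCox g y| ≤ δ * y ^ g)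
    (hK : Real.log c * y ^ g ≤ K) :
    |perturb g c (-h) h z v - perturb g c 0 0 0 v| ≤
      (8 * K + 12 / -g + 8) * ε * -boxCox g c⁻¹ := by
  have hgne : g ≠ 0 := hg.ne
  have hc0 : 0 < c := by linarith
  have hlog := Real.log_nonneg hc
  have hε : 0 ≤ ε := (abs_nonneg _).trans hh
  have hhc : |-h| * Real.log c ≤ ε * Real.log c := by rw [abs_neg]; gcongr
  have hH := abs_rpow_sub_one_le hc (hhc.trans (by linarith))
  obtain ⟨G, hG⟩ : ∃ G, G = c ^ (-g) := ⟨_, rfl⟩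
  obtain ⟨H, hHe⟩ : ∃ H, H = c ^ (-h) := ⟨_, rfl⟩
  obtain ⟨Y, hY⟩ : ∃ Y, Y = y ^ g := ⟨_, rfl⟩
  have hH0 : 0 < H := hHe ▸ Real.rpow_pos_of_pos hc0 _
  have hY0 : 0 < Y := hY ▸ Real.rpow_pos_of_pos hy _
  rw [← hHe] at hH
  rw [← hG] at hG2
  rw [← hY] at hK hv
  have hb : |H - 1| ≤ 2 * (ε * Real.log c) := hH.trans (by linarith)
  have hH2 : H ≤ 2 := by linarith [(abs_le.1 hb).2]
  have hgh : g + h ≤ g / 2 := by linarith [(abs_le.1 hh).2]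
  have hgh0 : g + h < 0 := by linarith
  have hGH : c ^ (-(g + h)) = G * H := by
    rw [hG, hHe, ← Real.rpow_add hc0]
    congr 1
    ring
  have hB : ∀ s : ℝ, s ≠ 0 → boxCox s c⁻¹ = (c ^ (-s) - 1) / s := by
    intro s hs
    rw [boxCox, if_neg hs, Real.inv_rpow hc0.le, Real.rpow_neg hc0.le]
  have hgv : |1 + g * v| ≤ 2 * Y := by
    have h1 := one_add_mul_boxCox g y
    have e : 1 + g * v = Y + g * (v - boxCox g y) := by
      rw [hY, ← h1]
      ring
    have h2 : |g * (v - boxCox g y)| ≤ 1 * Y := by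
      rw [abs_mul, abs_of_neg hg]
      calc -g * |v - boxCox g y| ≤ -g * (δ * Y) := by
            have : 0 ≤ -g := by linarith
            gcongr
        _ = -g * δ * Y := by ring
        _ ≤ 1 * Y := by gcongr
    have h3 := abs_add_le Y (g * (v - boxCox g y))
    rw [← e, abs_of_pos hY0] at h3
    linarith
  -- Because index and exponent move together, the change of the power of `c` is multiplied by `1 +
  -- g v`, which is of order `y ^ g`. This cancels the factor `log c` that separate changes would
  -- leave, so all three terms are `O(ε c^(-g))`.
  have hdiff : perturb g c (-h) h z v - perturb g c 0 0 0 v =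
      G * (H - 1) * (1 + g * v) / g + (G * H - 1) * (-h) / (g * (g + h)) +
        (G * H - 1) / (g + h) * z := by
    unfold perturb
    rw [sub_neg_eq_add, sub_zero, add_zero, add_zero, mul_one, hB _ hgh0.ne, hB _ hg.ne, hGH, ← hG]
    field_simp [hg.ne, hgh0.ne]
    ring
  have hGH1 : |G * H - 1| ≤ 2 * G := by
    rw [abs_le]
    constructor <;> nlinarith
  have hn : 0 < -g := by linarith
  have t1 : |G * (H - 1) * (1 + g * v) / g| ≤ 4 * K / -g * (ε * G) := by
    rw [abs_div, abs_mul, abs_mul, abs_of_neg hg, abs_of_pos (by linarith : 0 < G),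
      show 4 * K / -g * (ε * G) = 4 * K * (ε * G) / -g by ring]
    refine div_le_div_of_nonneg_right ?_ hn.le
    calc G * |H - 1| * |1 + g * v| ≤ G * (2 * (ε * Real.log c)) * (2 * Y) := by gcongr
      _ = 4 * (Real.log c * Y) * (ε * G) := by ring
      _ ≤ 4 * K * (ε * G) := by
          have : 0 ≤ ε * G := by nlinarith
          gcongr
  have t2 : |(G * H - 1) * (-h) / (g * (g + h))| ≤ 4 / (-g * -g) * (ε * G) := by
    have h1 : -g / 2 ≤ -(g + h) := by linarith
    have h2 : 0 < g * (g + h) := mul_pos_of_neg_of_neg hg hgh0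
    rw [abs_div, abs_mul, abs_neg, abs_of_pos h2, div_le_iff₀ h2]
    calc |G * H - 1| * |h| ≤ 2 * G * ε := by gcongr
      _ = 4 / (-g * -g) * (ε * G) * (-g * (-g / 2)) := by
          field_simp
          ring
      _ ≤ 4 / (-g * -g) * (ε * G) * (-g * -(g + h)) := by
          have : 0 ≤ 4 / (-g * -g) * (ε * G) := by
            have : 0 ≤ ε * G := by nlinarith
            positivity
          gcongr
      _ = _ := by ring
  have t3 : |(G * H - 1) / (g + h) * z| ≤ 4 / -g * (ε * G) := by
    rw [abs_mul, abs_div, abs_of_neg hgh0]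
    have h1 : -g / 2 ≤ -(g + h) := by linarith
    have h3 : 0 < -g / 2 := by linarith
    calc |G * H - 1| / -(g + h) * |z| ≤ 2 * G / (-g / 2) * ε := by gcongr
      _ = _ := by
        field_simp
        ring
  have hBg : -boxCox g c⁻¹ = (G - 1) / -g := by
    rw [hB _ hg.ne, ← hG]
    field_simp
  -- Here `2 ≤ G` is used: `G - 1` is at least `G / 2`.
  have hBg2 : G / (2 * -g) ≤ -boxCox g c⁻¹ := by
    rw [hBg, div_le_div_iff₀ (by linarith) hn]
    nlinarith
  have hK0 : 0 ≤ K := le_trans (by positivity) hK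
  rw [hdiff]
  calc _ ≤ 4 * K / -g * (ε * G) + 4 / (-g * -g) * (ε * G) + 4 / -g * (ε * G) :=
        (abs_add_le _ _).trans (add_le_add ((abs_add_le _ _).trans (add_le_add t1 t2)) t3)
    _ = (8 * K + 8 / -g + 8) * ε * (G / (2 * -g)) := by
        field_simp
        ring
    _ ≤ (8 * K + 12 / -g + 8) * ε * (G / (2 * -g)) := by
        have : 0 ≤ G / (2 * -g) := by positivity
        gcongr
        norm_num
    _ ≤ _ := by
        have : 0 ≤ (8 * K + 12 / -g + 8) * ε := by positivity
        gcongr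

/-- The reason for the end points: on `[κ^(1/max g 1), κ⁻¹]` each of the two powers in the weight is
at most `κ⁻¹`, so relative errors stay bounded. -/
lemma errWeight_mul_le {g κ x : ℝ} (hκ : 0 < κ) (hκ1 : κ ≤ 1) (hx : κ ^ (1 / max g 1) ≤ x)
    (hxX : x ≤ κ⁻¹) : errWeight (max g (1 / 2)) x * κ ≤ 2 := by
  have hu : 0 < κ ^ (1 / max g 1) := Real.rpow_pos_of_pos hκ _
  have hx0 : 0 < x := hu.trans_le hx
  have hm : 0 < max g 1 := by positivity
  have hmm : max g (1 / 2) ≤ max g 1 := max_le_max le_rfl (by norm_num)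
  have h1 : x ^ (-max g (1 / 2)) ≤ κ⁻¹ := by
    calc x ^ (-max g (1 / 2)) ≤ (κ ^ (1 / max g 1)) ^ (-max g (1 / 2)) :=
          Real.rpow_le_rpow_of_nonpos hu hx (by
            have : 0 < max g (1 / 2) := by positivity
            linarith)
      _ = κ ^ (-(max g (1 / 2) / max g 1)) := by
          rw [← Real.rpow_mul hκ.le]
          congr 1
          ring
      _ ≤ κ ^ (-1 : ℝ) := by
          refine Real.rpow_le_rpow_of_exponent_ge hκ hκ1 ?_
          have : max g (1 / 2) / max g 1 ≤ 1 := (div_le_one hm).2 hmm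
          linarith
      _ = κ⁻¹ := Real.rpow_neg_one κ
  have h2 : x ^ (1 / 2 : ℝ) ≤ κ⁻¹ := by
    have hone : 1 ≤ κ⁻¹ := (one_le_inv₀ hκ).2 hκ1
    calc x ^ (1 / 2 : ℝ) ≤ (κ⁻¹) ^ (1 / 2 : ℝ) := Real.rpow_le_rpow hx0.le hxX (by norm_num)
      _ ≤ (κ⁻¹) ^ (1 : ℝ) := Real.rpow_le_rpow_of_exponent_le hone (by norm_num)
      _ = κ⁻¹ := Real.rpow_one _
  unfold errWeight
  have h3 := mul_le_mul_of_nonneg_right (add_le_add h1 h2) hκ.le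
  have h4 : (κ⁻¹ + κ⁻¹) * κ = 2 := by field_simp; norm_num
  linarith

lemma close_of_le {C E W κ l m x p : ℝ} (hW : W = errWeight m x) (hW0 : 0 ≤ W)
    (h : |p / (l * x) - 1| ≤ C * E * W) (hCE : C * E ≤ κ / 4) (hκ : 0 ≤ κ) (hWκ : W * κ ≤ 2) :
    Close κ l m p x := by
  have h1 : C * E * W ≤ κ / 4 * W := by gcongr
  refine ⟨by linarith, ?_⟩
  have h2 : 0 ≤ κ * W := by positivity
  have h3 : κ * W = κ * (x ^ (-m) + x ^ (1 / 2 : ℝ)) := by rw [hW, errWeight]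
  linarith

end Perturbation

/-! ### Deterministic bounds for the estimated marginal transformations. -/

section Bracket

/-- Two perturbations, with fixed parameters, that are close to a multiple of the identity and
enclose all estimated transformations with estimation errors of at most `M / rk`. -/
structure MarginBracket (g M rk c l κ : ℝ) (θ χ ξ : Bool → ℝ) (V : ℝ → ℝ) : Prop where
  valid : ∀ s, ∀ x ∈ Set.Icc (κ ^ (1 / max g 1)) κ⁻¹,
    0 < 1 + g * perturb g c (θ s / rk) (χ s / rk) (ξ s / rk) (V x)
  close : ∀ s, ∀ x ∈ Set.Icc (κ ^ (1 / max g 1)) κ⁻¹,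
    Close κ l (max g (1 / 2)) (gpdR g (perturb g c (θ s / rk) (χ s / rk) (ξ s / rk) (V x))) x
  hat : ∀ α β h, rk * |α - 1| ≤ M → rk * |β| ≤ M → rk * |h| ≤ M → 0 < α ∧
    ∀ x ∈ Set.Icc (κ ^ (1 / max g 1)) κ⁻¹, 0 < 1 + (g + h) * ((V x - β) / α) ∧
      perturb g c (θ false / rk) (χ false / rk) (ξ false / rk) (V x) ≤
        perturb g c (-h) h (α - (g + h) * β - 1) (V x) ∧
      perturb g c (-h) h (α - (g + h) * β - 1) (V x) ≤
        perturb g c (θ true / rk) (χ true / rk) (ξ true / rk) (V x)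

/-- The relations between the rates. -/
structure MarginInput (g r R KA Kw Ky rk c l κ' κ : ℝ) (V : ℝ → ℝ) : Prop where
  κ_pos : 0 < κ'
  rk_pos : 0 < rk
  one_le : 1 ≤ κ' * rk
  one_le_c : 1 ≤ c
  hl : l ∈ Set.Icc r R
  rate_pos : 0 < g → Real.log c ≤ Kw * (κ' * rk)
  rate_zero : g = 0 → Real.log c ^ 2 ≤ Kw * (κ' * rk)
  rate_neg : g < 0 → c ^ (-g) ≤ Kw * (κ' * rk) ∧ 2 ≤ c ^ (-g)
  approx : ∀ x ∈ Set.Icc (κ ^ (1 / max g 1)) κ⁻¹,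
    |V x - boxCox g (l * x * c)| ≤ KA * κ' * (l * x * c) ^ g
  nonneg : 0 ≤ g → ∀ x ∈ Set.Icc (κ ^ (1 / max g 1)) κ⁻¹, 0 ≤ V x
  log_le : g < 0 → ∀ x ∈ Set.Icc (κ ^ (1 / max g 1)) κ⁻¹, Real.log c * (l * x * c) ^ g ≤ Ky

/-- Errors in scale and location combine into the single parameter `α - (g + h) β - 1`, which is of
order `1 / rk` as well. The last identity reduces regularity of the estimated transformation to the
sign of a numerator. -/
lemma hat_bounds {g M rk ε α β h : ℝ} (hrk : 0 < rk) (hM : 0 ≤ M) (hε : ε = M * (2 + |g|) / rk)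
    (hε1 : ε ≤ 1 / 2) (hα : rk * |α - 1| ≤ M) (hβ : rk * |β| ≤ M) (hh : rk * |h| ≤ M) :
    0 < α ∧ |h| ≤ ε ∧ |α - (g + h) * β - 1| ≤ ε ∧ ∀ v, 1 + (g + h) * ((v - β) / α) =
      (1 + (α - (g + h) * β - 1) + (g + h) * v) / α := by
  have hg := abs_nonneg g
  obtain ⟨e, he⟩ : ∃ e, e = M / rk := ⟨_, rfl⟩
  have hεe : ε = e * (2 + |g|) := by rw [hε, he]; ring
  have he0 : 0 ≤ e := he ▸ div_nonneg hM hrk.le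
  have conv : ∀ x, rk * x ≤ M → x ≤ e := fun x hx => by
    rw [he, le_div_iff₀ hrk]
    linarith
  have hα := conv _ hα
  have hβ := conv _ hβ
  have hh := conv _ hh
  have hge : 0 ≤ e * |g| := by positivity
  have heε : 2 * e ≤ ε := by rw [hεe]; linarith
  have hα0 : 0 < α := by
    have := (abs_le.1 hα).1
    linarith
  refine ⟨hα0, by linarith, ?_, fun v => by field_simp; ring⟩
  have h1 : |(g + h) * β| ≤ (|g| + 1) * e := by
    rw [abs_mul]
    have : |g + h| ≤ |g| + 1 := (abs_add_le g h).trans (by linarith)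
    gcongr
  have e1 : α - (g + h) * β - 1 = (α - 1) - (g + h) * β := by ring
  rw [e1]
  refine (abs_sub _ _).trans ?_
  rw [hεe]
  linarith

/-- As `V` is nonnegative, the transformation is antitone in all three parameters. Setting all of
them to `+M'` (`false`) or `-M'` (`true`) therefore gives lower and upper bounds. The constant `C0`
makes the resulting error at most a quarter of `κ` times the weight. -/
lemma exists_marginBracket_pos {g r R KA Kw Ky M : ℝ} (hg : 0 < g) (hr : 0 < r) (hKA : 0 < KA)
    (hKw : 0 < Kw) (hM : 0 < M) :
    ∃ (C1 : ℝ) (θ χ ξ : Bool → ℝ), 0 < C1 ∧ ∀ C0, C1 ≤ C0 → ∃ κ1 : ℝ, 0 < κ1 ∧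
      ∀ rk c l κ' V, κ' < κ1 → MarginInput g r R KA Kw Ky rk c l κ' (C0 * κ') V →
        MarginBracket g M rk c l (C0 * κ') θ χ ξ V := by
  obtain ⟨C, hC, H⟩ := perturb_close_pos hg hr
  obtain ⟨M', hM'⟩ : ∃ M', M' = M * (2 + |g|) := ⟨_, rfl⟩
  have hM'0 : 0 < M' := by rw [hM']; positivity
  obtain ⟨CE, hCE⟩ : ∃ CE, CE = M' * (1 + Kw) + KA := ⟨_, rfl⟩
  have hCE0 : 0 < CE := by rw [hCE]; positivity
  refine ⟨4 * C * CE, fun s => bif s then -M' else M', fun s => bif s then -M' else M',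
    fun s => bif s then -M' else M', by positivity, fun C0 hC0 => ?_⟩
  have hC00 : 0 < C0 := lt_of_lt_of_le (by positivity) hC0
  refine ⟨min (1 / C0) (min (1 / 2) (g / 2) / CE), by positivity, ?_⟩
  intro rk c l κ' V hκ1 hI
  obtain ⟨hκ', hrk, hone, hc, hl, hw, -, -, hV, hV0, -⟩ := hI
  have hlog := Real.log_nonneg hc
  rw [lt_min_iff, lt_div_iff₀ hC00, lt_div_iff₀ hCE0, lt_min_iff] at hκ1
  obtain ⟨hκ1, hκ2, hκ3⟩ := hκ1
  obtain ⟨ε, hε⟩ : ∃ ε, ε = M * (2 + |g|) / rk := ⟨_, rfl⟩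
  have hε' : ε = M' / rk := by rw [hε, hM']
  have hε0 : 0 < ε := by rw [hε']; positivity
  have hε1 : ε ≤ M' * κ' := by
    rw [hε', div_le_iff₀ hrk]
    nlinarith
  have hεl : ε * Real.log c ≤ M' * Kw * κ' := by
    rw [hε', div_mul_eq_mul_div, div_le_iff₀ hrk]
    calc M' * Real.log c ≤ M' * (Kw * (κ' * rk)) := by gcongr; exact hw hg
      _ = _ := by ring
  have hE : ε * (1 + Real.log c) + KA * κ' ≤ CE * κ' := by
    rw [hCE]
    linarith
  have hεl0 : 0 ≤ ε * Real.log c := by positivity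
  have hKAκ : 0 < KA * κ' := by positivity
  have hκ : 0 < C0 * κ' := by positivity
  have hκ1' : C0 * κ' ≤ 1 := by linarith
  have hCEκ : C * (ε * (1 + Real.log c) + KA * κ') ≤ C0 * κ' / 4 := by
    calc C * (ε * (1 + Real.log c) + KA * κ') ≤ C * (CE * κ') := by gcongr
      _ = 4 * C * CE * κ' / 4 := by ring
      _ ≤ C0 * κ' / 4 := by gcongr
  have habs : ∀ s, |(bif s then -M' else M') / rk| ≤ ε := by
    intro s
    rw [abs_div, abs_of_pos hrk, hε']
    cases s <;> simp [abs_of_pos hM'0]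
  have key : ∀ s, ∀ x ∈ Set.Icc ((C0 * κ') ^ (1 / max g 1)) (C0 * κ')⁻¹,
      0 < 1 + g * perturb g c ((bif s then -M' else M') / rk) ((bif s then -M' else M') / rk)
        ((bif s then -M' else M') / rk) (V x) ∧ Close (C0 * κ') l (max g (1 / 2))
        (gpdR g (perturb g c ((bif s then -M' else M') / rk) ((bif s then -M' else M') / rk)
          ((bif s then -M' else M') / rk) (V x))) x := by
    intro s x hx
    have hx0 : 0 < x := (Real.rpow_pos_of_pos hκ _).trans_le hx.1
    have hWκ := errWeight_mul_le hκ hκ1' hx.1 hx.2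
    have hW1 := one_le_errWeight (m := max g (1 / 2)) (by positivity) hx0
    have hsmall : C * (ε * (1 + Real.log c) + KA * κ') * errWeight (max g (1 / 2)) x ≤ 1 := by
      calc _ ≤ C0 * κ' / 4 * errWeight (max g (1 / 2)) x := by gcongr
        _ ≤ 1 := by linarith
    obtain ⟨h1, h2⟩ := H c _ _ _ (V x) l x ε (KA * κ') hc hl.1 hx0 (habs s) (habs s) (habs s)
      (by linarith) (by linarith) (by linarith) hKAκ.le (hV x hx) hsmall
    exact ⟨h1, close_of_le rfl (by linarith) h2 hCEκ hκ.le hWκ⟩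
  refine ⟨fun s x hx => (key s x hx).1, fun s x hx => (key s x hx).2, ?_⟩
  intro α β h hα hβ hh
  obtain ⟨hα0, hhε, hzε, hid⟩ := hat_bounds hrk hM.le hε (by linarith) hα hβ hh
  have hh' := abs_le.1 hhε
  have hz' := abs_le.1 hzε
  refine ⟨hα0, fun x hx => ⟨?_, ?_, ?_⟩⟩
  · rw [hid]
    have : 0 ≤ (g + h) * V x := mul_nonneg (by linarith) (hV0 hg.le x hx)
    exact div_pos (by linarith) hα0
  · simp only [cond_false, ← hε']
    exact perturb_antitone hc (hV0 hg.le x hx) (by linarith) hh'.2 hz'.2 (by linarith)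
  · simp only [cond_true, neg_div, ← hε']
    exact perturb_antitone hc (hV0 hg.le x hx) (by linarith) hh'.1 hz'.1 (by linarith)

-- The bracket is the one for positive index. In addition the estimated index may be negative, so
-- regularity needs `|h| V x` to be small. As `V x` is about `log (l x c)`, this is the reason for
-- the second lower bound on `C0`.
set_option maxHeartbeats 800000 in
lemma exists_marginBracket_zero {r R KA Kw Ky M : ℝ} (hr : 0 < r) (hKA : 0 < KA)
    (hKw : 0 < Kw) (hM : 0 < M) :
    ∃ (C1 : ℝ) (θ χ ξ : Bool → ℝ), 0 < C1 ∧ ∀ C0, C1 ≤ C0 → ∃ κ1 : ℝ, 0 < κ1 ∧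
      ∀ rk c l κ' V, κ' < κ1 → MarginInput 0 r R KA Kw Ky rk c l κ' (C0 * κ') V →
        MarginBracket 0 M rk c l (C0 * κ') θ χ ξ V := by
  obtain ⟨C, hC, H⟩ := perturb_close_zero (R := R) hr
  obtain ⟨M', hM'⟩ : ∃ M', M' = M * (2 + |(0 : ℝ)|) := ⟨_, rfl⟩
  have hM'0 : 0 < M' := by rw [hM']; positivity
  obtain ⟨CE, hCE⟩ : ∃ CE, CE = 2 * M' * (1 + Kw) + KA := ⟨_, rfl⟩
  have hCE0 : 0 < CE := by rw [hCE]; positivity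
  obtain ⟨D, hD⟩ : ∃ D, D = max |Real.log r| |Real.log R| := ⟨_, rfl⟩
  have hD0 : 0 ≤ D := hD ▸ le_max_of_le_left (abs_nonneg _)
  refine ⟨4 * C * CE + 16 * M' * (D + 4), fun s => bif s then -M' else M',
    fun s => bif s then -M' else M', fun s => bif s then -M' else M', by positivity,
    fun C0 hC0 => ?_⟩
  have hC0a : 4 * C * CE ≤ C0 := le_trans (le_add_of_nonneg_right (by positivity)) hC0
  have hC0b : 16 * M' * (D + 4) ≤ C0 := le_trans (le_add_of_nonneg_left (by positivity)) hC0
  have hC00 : 0 < C0 := lt_of_lt_of_le (by positivity) hC0a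
  refine ⟨min (1 / C0) (1 / 8 / CE), by positivity, ?_⟩
  intro rk c l κ' V hκ1 hI
  obtain ⟨hκ', hrk, hone, hc, hl, -, hw, -, hV, hV0, -⟩ := hI
  have hlog := Real.log_nonneg hc
  rw [lt_min_iff, lt_div_iff₀ hC00, lt_div_iff₀ hCE0] at hκ1
  obtain ⟨hκ1, hκ2⟩ := hκ1
  obtain ⟨ε, hε⟩ : ∃ ε, ε = M * (2 + |(0 : ℝ)|) / rk := ⟨_, rfl⟩
  have hε' : ε = M' / rk := by rw [hε, hM']
  have hε0 : 0 < ε := by rw [hε']; positivity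
  have hε1 : ε ≤ M' * κ' := by
    rw [hε', div_le_iff₀ hrk]
    nlinarith
  have hεl : ε * Real.log c ^ 2 ≤ M' * Kw * κ' := by
    rw [hε', div_mul_eq_mul_div, div_le_iff₀ hrk]
    calc M' * Real.log c ^ 2 ≤ M' * (Kw * (κ' * rk)) := by gcongr; exact hw rfl
      _ = _ := by ring
  have hsq : ε * (1 + Real.log c) ^ 2 ≤ 2 * (ε + ε * Real.log c ^ 2) := by
    nlinarith [mul_nonneg hε0.le (sq_nonneg (1 - Real.log c))]
  have hE : ε * (1 + Real.log c) ^ 2 + KA * κ' ≤ CE * κ' := by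
    rw [hCE]
    linarith
  have hεl0 : 0 ≤ ε * Real.log c := by positivity
  have hεl2 : 0 ≤ ε * Real.log c ^ 2 := by positivity
  have hexp : ε * (1 + Real.log c) ^ 2 = ε + 2 * (ε * Real.log c) + ε * Real.log c ^ 2 := by ring
  have hKAκ : 0 < KA * κ' := by positivity
  have hκ : 0 < C0 * κ' := by positivity
  have hκ1' : C0 * κ' ≤ 1 := by linarith
  have hCEκ : C * (ε * (1 + Real.log c) ^ 2 + KA * κ') ≤ C0 * κ' / 4 := by
    calc C * (ε * (1 + Real.log c) ^ 2 + KA * κ') ≤ C * (CE * κ') := by gcongr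
      _ = 4 * C * CE * κ' / 4 := by ring
      _ ≤ C0 * κ' / 4 := by gcongr
  have habs : ∀ s, |(bif s then -M' else M') / rk| ≤ ε := by
    intro s
    rw [abs_div, abs_of_pos hrk, hε']
    cases s <;> simp [abs_of_pos hM'0]
  have key : ∀ s, ∀ x ∈ Set.Icc ((C0 * κ') ^ (1 / max (0 : ℝ) 1)) (C0 * κ')⁻¹,
      0 < 1 + 0 * perturb 0 c ((bif s then -M' else M') / rk) ((bif s then -M' else M') / rk)
        ((bif s then -M' else M') / rk) (V x) ∧ Close (C0 * κ') l (max 0 (1 / 2))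
        (gpdR 0 (perturb 0 c ((bif s then -M' else M') / rk) ((bif s then -M' else M') / rk)
          ((bif s then -M' else M') / rk) (V x))) x := by
    intro s x hx
    have hx0 : 0 < x := (Real.rpow_pos_of_pos hκ _).trans_le hx.1
    have hWκ := errWeight_mul_le hκ hκ1' hx.1 hx.2
    have hW1 := one_le_errWeight (m := max 0 (1 / 2)) (by positivity) hx0
    have hsmall : C * (ε * (1 + Real.log c) ^ 2 + KA * κ') * errWeight (max 0 (1 / 2)) x ≤ 1 := by
      calc _ ≤ C0 * κ' / 4 * errWeight (max 0 (1 / 2)) x := by gcongr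
        _ ≤ 1 := by linarith
    obtain ⟨h1, h2⟩ := H c _ _ _ (V x) l x ε (KA * κ') hc hl.1 hl.2 hx0 (habs s) (habs s) (habs s)
      (by linarith) (by linarith) hKAκ.le (hV x hx) hsmall
    exact ⟨h1, close_of_le rfl (by linarith) h2 hCEκ hκ.le hWκ⟩
  refine ⟨fun s x hx => (key s x hx).1, fun s x hx => (key s x hx).2, ?_⟩
  intro α β h hα hβ hh
  obtain ⟨hα0, hhε, hzε, hid⟩ := hat_bounds hrk hM.le hε (by linarith) hα hβ hh
  have hh' := abs_le.1 hhε
  have hz' := abs_le.1 hzε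
  refine ⟨hα0, fun x hx => ⟨?_, ?_, ?_⟩⟩
  · rw [hid]
    have hx0 : 0 < x := (Real.rpow_pos_of_pos hκ _).trans_le hx.1
    have hl0 : 0 < l := hr.trans_le hl.1
    have hv := hV0 le_rfl x hx
    have hVx := hV x hx
    rw [Real.rpow_zero, mul_one, boxCox, if_pos rfl, Real.log_mul (by positivity) (by positivity),
      Real.log_mul hl0.ne' hx0.ne'] at hVx
    have hlogx := abs_log_le_errWeight (m := max 0 (1 / 2)) (le_max_right _ _) hx0
    have hW1 := one_le_errWeight (m := max 0 (1 / 2)) (by positivity) hx0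
    have hWκ := errWeight_mul_le hκ hκ1' hx.1 hx.2
    generalize errWeight (max 0 (1 / 2)) x = W at hlogx hW1 hWκ
    have hlogl : Real.log l ≤ D := by
      have h2 : Real.log l ≤ Real.log R := Real.log_le_log hl0 hl.2
      have := le_abs_self (Real.log R)
      have := le_max_right |Real.log r| |Real.log R|
      linarith
    have hVle : V x ≤ (D + 4) * W + Real.log c + KA * κ' := by
      have h1 := (abs_le.1 hVx).2
      have h2 := le_abs_self (Real.log x)
      nlinarith
    have hεW : ε * ((D + 4) * W) ≤ 1 / 8 := by
      calc ε * ((D + 4) * W) ≤ M' * κ' * ((D + 4) * W) := by gcongr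
        _ = 16 * M' * (D + 4) * (κ' * W) / 16 := by ring
        _ ≤ C0 * (κ' * W) / 16 := by gcongr
        _ ≤ 1 / 8 := by
          have : C0 * (κ' * W) = W * (C0 * κ') := by ring
          linarith
    have hεV : ε * V x ≤ 3 / 8 := by
      calc ε * V x ≤ ε * ((D + 4) * W + Real.log c + KA * κ') := by gcongr
        _ = ε * ((D + 4) * W) + ε * Real.log c + ε * (KA * κ') := by ring
        _ ≤ 1 / 8 + 1 / 8 + 1 / 8 := by
          have : ε * (KA * κ') ≤ 1 * (KA * κ') := by gcongr; linarith
          refine add_le_add (add_le_add hεW ?_) ?_ <;> linarith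
        _ = 3 / 8 := by norm_num
    have : -(ε * V x) ≤ (0 + h) * V x := by
      rw [zero_add, ← neg_mul]
      exact mul_le_mul_of_nonneg_right hh'.1 hv
    exact div_pos (by linarith) hα0
  · simp only [cond_false, ← hε']
    exact perturb_antitone hc (hV0 le_rfl x hx) (by linarith) hh'.2 hz'.2 (by linarith)
  · simp only [cond_true, neg_div, ← hε']
    exact perturb_antitone hc (hV0 le_rfl x hx) (by linarith) hh'.1 hz'.1 (by linarith)

/-- Moving index and exponent separately would cost `c^(-g) log c`, a logarithm too much. For the
estimators they move in opposite directions by the same amount. Their joint effect is dominated by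
the last parameter alone, so the bracket uses `ξ` only, enlarged by the factor `C'`. -/
lemma exists_marginBracket_neg {g r R KA Kw Ky M : ℝ} (hg : g < 0) (hg2 : -(1 / 2) ≤ g)
    (hr : 0 < r) (hrR : r ≤ R) (hKA : 0 < KA) (hKw : 0 < Kw) (hKy : 0 < Ky) (hM : 0 < M) :
    ∃ (C1 : ℝ) (θ χ ξ : Bool → ℝ), 0 < C1 ∧ ∀ C0, C1 ≤ C0 → ∃ κ1 : ℝ, 0 < κ1 ∧
      ∀ rk c l κ' V, κ' < κ1 → MarginInput g r R KA Kw Ky rk c l κ' (C0 * κ') V →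
        MarginBracket g M rk c l (C0 * κ') θ χ ξ V := by
  have hR : 0 < R := hr.trans_le hrR
  have hn : 0 < -g := by linarith
  have hgne : g ≠ 0 := hg.ne
  obtain ⟨C, hC, H⟩ := perturb_close_neg hg hg2 hR
  obtain ⟨M', hM'⟩ : ∃ M', M' = M * (2 + |g|) := ⟨_, rfl⟩
  have hM'0 : 0 < M' := by rw [hM']; positivity
  obtain ⟨C', hC'⟩ : ∃ C', C' = 8 * Ky + 12 / -g + 8 := ⟨_, rfl⟩
  have hC'0 : 0 < C' := by rw [hC']; positivity
  obtain ⟨CE, hCE⟩ : ∃ CE, CE = C' * (M' * Kw) + KA := ⟨_, rfl⟩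
  have hCE0 : 0 < CE := by rw [hCE]; positivity
  obtain ⟨D, hD⟩ : ∃ D, D = 4 * (1 + 1 / -g) * (M' * Kw) * R ^ (-g) := ⟨_, rfl⟩
  have hD0 : 0 < D := by rw [hD]; positivity
  refine ⟨4 * C * CE + 4 * D, fun _ => 0, fun _ => 0,
    fun s => bif s then -(C' * M') else C' * M', by positivity, fun C0 hC0 => ?_⟩
  have hC0a : 4 * C * CE ≤ C0 := le_trans (le_add_of_nonneg_right (by positivity)) hC0
  have hC0b : 4 * D ≤ C0 := le_trans (le_add_of_nonneg_left (by positivity)) hC0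
  have hC00 : 0 < C0 := lt_of_lt_of_le (by positivity) hC0a
  refine ⟨min (1 / C0) (min (-g / 2 / (M' + M' * Kw / -g)) (1 / 2 / KA)), by positivity, ?_⟩
  intro rk c l κ' V hκ1 hI
  obtain ⟨hκ', hrk, hone, hc, hl, -, -, hw, hV, -, hKV⟩ := hI
  obtain ⟨hw, hG2⟩ := hw hg
  have hc0 : 0 < c := by linarith
  have hl0 : 0 < l := hr.trans_le hl.1
  have hlog := Real.log_nonneg hc
  rw [lt_min_iff, lt_min_iff, lt_div_iff₀ hC00, lt_div_iff₀ (by positivity),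
    lt_div_iff₀ hKA] at hκ1
  obtain ⟨hκ1, hκ2, hκ3⟩ := hκ1
  obtain ⟨ε, hε⟩ : ∃ ε, ε = M * (2 + |g|) / rk := ⟨_, rfl⟩
  have hε' : ε = M' / rk := by rw [hε, hM']
  have hε0 : 0 < ε := by rw [hε']; positivity
  have hε1 : ε ≤ M' * κ' := by
    rw [hε', div_le_iff₀ hrk]
    nlinarith
  have hεG : ε * c ^ (-g) ≤ M' * Kw * κ' := by
    rw [hε', div_mul_eq_mul_div, div_le_iff₀ hrk]
    calc M' * c ^ (-g) ≤ M' * (Kw * (κ' * rk)) := by gcongr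
      _ = _ := by ring
  have hεl : ε * Real.log c ≤ M' * Kw * κ' / -g := by
    rw [le_div_iff₀ hn]
    have := Real.log_le_rpow_div hc0.le hn
    rw [le_div_iff₀ hn] at this
    calc ε * Real.log c * -g = ε * (Real.log c * -g) := by ring
      _ ≤ ε * c ^ (-g) := by gcongr
      _ ≤ _ := hεG
  have hpos1 : 0 < M' * κ' := by positivity
  have hpos2 : 0 < M' * Kw * κ' / -g := by positivity
  have hsum : M' * κ' + M' * Kw * κ' / -g < -g / 2 := by
    calc M' * κ' + M' * Kw * κ' / -g = κ' * (M' + M' * Kw / -g) := by ring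
      _ < _ := hκ2
  have hKAκ : 0 < KA * κ' := by positivity
  have hE : C' * ε * c ^ (-g) + KA * κ' ≤ CE * κ' := by
    rw [hCE]
    have : C' * ε * c ^ (-g) ≤ C' * (M' * Kw * κ') := by
      rw [mul_assoc]
      gcongr
    linarith
  have hκ : 0 < C0 * κ' := by positivity
  have hκ1' : C0 * κ' ≤ 1 := by linarith
  have hCEκ : C * (C' * ε * c ^ (-g) + KA * κ') ≤ C0 * κ' / 4 := by
    calc C * (C' * ε * c ^ (-g) + KA * κ') ≤ C * (CE * κ') := by gcongr
      _ = 4 * C * CE * κ' / 4 := by ring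
      _ ≤ C0 * κ' / 4 := by gcongr
  have habs : ∀ s, |(bif s then -(C' * M') else C' * M') / rk| ≤ C' * ε := by
    intro s
    rw [abs_div, abs_of_pos hrk, hε', mul_div_assoc']
    cases s <;> simp [abs_of_pos hM'0, abs_of_pos hC'0]
  have key : ∀ s, ∀ x ∈ Set.Icc ((C0 * κ') ^ (1 / max g 1)) (C0 * κ')⁻¹,
      0 < 1 + g * perturb g c (0 / rk) (0 / rk)
        ((bif s then -(C' * M') else C' * M') / rk) (V x) ∧ Close (C0 * κ') l (max g (1 / 2))
        (gpdR g (perturb g c (0 / rk) (0 / rk)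
          ((bif s then -(C' * M') else C' * M') / rk) (V x))) x := by
    intro s x hx
    have hx0 : 0 < x := (Real.rpow_pos_of_pos hκ _).trans_le hx.1
    have hWκ := errWeight_mul_le hκ hκ1' hx.1 hx.2
    have hW1 := one_le_errWeight (m := max g (1 / 2)) (by positivity) hx0
    have hsmall : C * (C' * ε * c ^ (-g) + KA * κ') * errWeight (max g (1 / 2)) x ≤ 1 := by
      calc _ ≤ C0 * κ' / 4 * errWeight (max g (1 / 2)) x := by gcongr
        _ ≤ 1 := by linarith
    obtain ⟨h1, h2⟩ := H c _ (V x) l x (C' * ε) (KA * κ') hc hl0 hl.2 hx0 (habs s)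
      hKAκ.le (hV x hx) hsmall
    rw [zero_div]
    exact ⟨h1, close_of_le rfl (by linarith) h2 hCEκ hκ.le hWκ⟩
  refine ⟨fun s x hx => (key s x hx).1, fun s x hx => (key s x hx).2, ?_⟩
  intro α β h hα hβ hh
  obtain ⟨hα0, hhε, hzε, hid⟩ := hat_bounds hrk hM.le hε (by linarith) hα hβ hh
  have hh' := abs_le.1 hhε
  have hz' := abs_le.1 hzε
  have hδ1 : -g * (KA * κ') ≤ 1 / 2 := by
    have : -g * (KA * κ') ≤ 1 * (KA * κ') := by gcongr; linarith
    linarith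
  refine ⟨hα0, fun x hx => ?_⟩
  have hx0 : 0 < x := (Real.rpow_pos_of_pos hκ _).trans_le hx.1
  have hy : 0 < l * x * c := by positivity
  have hdiff := abs_perturb_sub_le hg hc hG2 hy hhε hzε (by linarith) (by linarith)
    (by linarith) (hV x hx) (hKV hg x hx)
  rw [← hC'] at hdiff
  have hlin : ∀ z', perturb g c 0 0 z' (V x) = perturb g c 0 0 0 (V x) + boxCox g c⁻¹ * z' := by
    intro z'
    unfold perturb
    rw [sub_zero]
    ring
  refine ⟨?_, ?_, ?_⟩
  · rw [hid]
    obtain ⟨z, hz⟩ : ∃ z, z = α - (g + h) * β - 1 := ⟨_, rfl⟩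
    rw [← hz] at hz' ⊢
    obtain ⟨Y, hY⟩ : ∃ Y, Y = (l * x * c) ^ g := ⟨_, rfl⟩
    have hY0 : 0 < Y := hY ▸ Real.rpow_pos_of_pos hy _
    have hWκ := errWeight_mul_le hκ hκ1' hx.1 hx.2
    have hxW : x ^ (-g) ≤ errWeight (max g (1 / 2)) x := by
      refine rpow_le_errWeight hx0 ?_ (by linarith)
      have := le_max_right g (1 / 2)
      linarith
    generalize errWeight (max g (1 / 2)) x = W at hxW hWκ
    have hW0 : 0 < W := (Real.rpow_pos_of_pos hx0 _).trans_le hxW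
    have hYinv : Y⁻¹ ≤ R ^ (-g) * W * c ^ (-g) := by
      rw [hY, ← Real.rpow_neg hy.le, Real.mul_rpow (by positivity) hc0.le,
        Real.mul_rpow hl0.le hx0.le]
      have : l ^ (-g) ≤ R ^ (-g) := Real.rpow_le_rpow hl0.le hl.2 hn.le
      gcongr
    have hεY : 4 * (1 + 1 / -g) * ε * Y⁻¹ ≤ 1 / 2 := by
      calc 4 * (1 + 1 / -g) * ε * Y⁻¹ ≤ 4 * (1 + 1 / -g) * ε * (R ^ (-g) * W * c ^ (-g)) := by
            gcongr
        _ = 4 * (1 + 1 / -g) * (ε * c ^ (-g)) * R ^ (-g) * W := by ring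
        _ ≤ 4 * (1 + 1 / -g) * (M' * Kw * κ') * R ^ (-g) * W := by gcongr
        _ = 4 * D * (κ' * W) / 4 := by rw [hD]; ring
        _ ≤ C0 * (κ' * W) / 4 := by gcongr
        _ ≤ 1 / 2 := by
          have : C0 * (κ' * W) = W * (C0 * κ') := by ring
          linarith
    have hεY' : 4 * (1 + 1 / -g) * ε ≤ Y / 2 := by
      have := mul_le_mul_of_nonneg_right hεY hY0.le
      rw [mul_assoc, inv_mul_cancel₀ hY0.ne', mul_one] at this
      linarith
    have hgv : Y / 2 ≤ 1 + g * V x := by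
      have h1 := one_add_mul_boxCox g (l * x * c)
      have e : 1 + g * V x = Y + g * (V x - boxCox g (l * x * c)) := by
        rw [hY, ← h1]
        ring
      have h2 : |g * (V x - boxCox g (l * x * c))| ≤ 1 / 2 * Y := by
        rw [abs_mul, abs_of_neg hg]
        calc -g * |V x - boxCox g (l * x * c)| ≤ -g * (KA * κ' * Y) := by
              have := hV x hx
              rw [← hY] at this
              gcongr
          _ = -g * (KA * κ') * Y := by ring
          _ ≤ 1 / 2 * Y := by gcongr
      have := (abs_le.1 h2).1
      linarith
    have hratio : 1 / 2 ≤ (g + h) / g := by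
      rw [le_div_iff_of_neg hg]
      linarith
    have hhg : |h / g| ≤ 1 / -g * ε := by
      rw [abs_div, abs_of_neg hg, one_div_mul_eq_div]
      gcongr
    have e2 : 1 + z + (g + h) * V x = z - h / g + (g + h) / g * (1 + g * V x) := by
      field_simp
      ring
    have h3 : 1 / 2 * (Y / 2) ≤ (g + h) / g * (1 + g * V x) := by gcongr
    have h4 := (abs_le.1 hhg).2
    rw [e2]
    have h5 : 4 * (1 + 1 / -g) * ε = 4 * ε + 4 * (1 / -g * ε) := by ring
    refine div_pos ?_ hα0
    have : 0 < 1 / -g * ε := by positivity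
    linarith
  · have e1 : (bif false then -(C' * M') else C' * M') / rk = C' * ε := by
      rw [cond_false, hε', mul_div_assoc]
    rw [zero_div, e1, hlin]
    have := (abs_le.1 hdiff).1
    linarith
  · have e1 : (bif true then -(C' * M') else C' * M') / rk = -(C' * ε) := by
      rw [cond_true, hε', neg_div, mul_div_assoc]
    rw [zero_div, e1, hlin]
    have := (abs_le.1 hdiff).2
    linarith

end Bracket

/-! ### From quantile functions to branches. -/

section QuantileBranch

/-- Order properties of a normalized quantile function on `[u, X]`. -/
structure QuantileLike (d u X : ℝ) (V : ℝ → ℝ) : Prop where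
  mono : StrictMonoOn V (Set.Ici u)
  surj : ∀ w ∈ Set.Icc (V u) (V X), ∃ x ∈ Set.Icc u X, V x = w
  lt : ∀ x, 1 < d * x → x < u → V x < V u

/-- In the regular tail the quantile function is strictly increasing and inverse to `y ↦ 1 / (1 -
F(y))`, which provides the preimages. -/
lemma exists_quantileLike {μ : Measure (ℝ × ℝ)} [IsProbabilityMeasure μ] (hM1 : CondM1 μ)
    (i : Fin 2) : ∃ t1 : ℝ, 1 < t1 ∧ ∀ a b d u X, 0 < a → 0 < d → t1 < d * u → u ≤ X →
      QuantileLike d u X (fun x => (tailQ μ i (d * x) - b) / a) := by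
  obtain ⟨t1, ht1, hF, hinv⟩ := exists_regular_tail hM1 i
  have hlt : ∀ s t, 1 < s → s < t → t1 < t → tailQ μ i s < tailQ μ i t := by
    intro s t hs hst ht
    have key : ∀ s, t1 ≤ s → s < t → tailQ μ i s < tailQ μ i t := by
      intro s hs hst
      refine lt_of_le_of_ne (tailQ_mono (ht1.trans_le hs) hst.le) fun h => ?_
      have h1 := hF s hs
      rw [h, hF t ht.le] at h1
      have : 1 / t < 1 / s := one_div_lt_one_div_of_lt (by linarith) hst
      linarith
    rcases le_total t1 s with h | h
    · exact key s h hst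
    · exact (tailQ_mono hs h).trans_lt (key t1 le_rfl ht)
  refine ⟨t1, ht1, fun a b d u X ha hd hu huX => ⟨?_, ?_, ?_⟩⟩
  · intro x hx y hy hxy
    have h1 : d * u ≤ d * x := by gcongr; exact hx
    have h2 : d * x < d * y := by gcongr
    have := hlt _ _ (by linarith) h2 (by linarith)
    simp only
    gcongr
  · intro w hw
    rw [Set.mem_Icc, div_le_iff₀ ha, le_div_iff₀ ha] at hw
    have hdX : d * u ≤ d * X := by gcongr
    obtain ⟨y, hy⟩ : ∃ y, y = w * a + b := ⟨_, rfl⟩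
    have hy1 : tailQ μ i (d * u) ≤ y := by linarith [hw.1]
    have hy2 : y ≤ tailQ μ i (d * X) := by linarith [hw.2]
    have hFy : margCDF μ i y ≤ 1 - 1 / (d * X) := by
      rw [← hF _ (by linarith)]
      exact (cdf _).mono hy2
    have hX0 : 0 < 1 / (d * X) := one_div_pos.2 (by linarith)
    have hFy1 := (tailQ_le_iff (by linarith) _).1 hy1
    have hty := (hinv y ((tailQ_mono ht1 hu.le).trans hy1) (by linarith)).2
    have hpos : 0 < 1 - margCDF μ i y := by linarith
    refine ⟨1 / (1 - margCDF μ i y) / d, ⟨?_, ?_⟩, ?_⟩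
    · rw [le_div_iff₀ hd, le_div_iff₀ hpos]
      have h3 : 1 - margCDF μ i y ≤ 1 / (d * u) := by linarith
      rw [le_div_iff₀ (by linarith)] at h3
      linarith
    · rw [div_le_iff₀ hd, div_le_iff₀ hpos]
      have h3 : 1 / (d * X) ≤ 1 - margCDF μ i y := by linarith
      rw [div_le_iff₀ (by linarith)] at h3
      linarith
    · rw [mul_div_cancel₀ _ hd.ne', hty, hy]
      field_simp
      ring
  · intro x hx hxu
    have h2 : d * x < d * u := by gcongr
    have := hlt _ _ hx h2 hu
    show (_ - _) / _ < (_ - _) / _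
    gcongr

lemma exists_marginBracket {g r R KA Kw Ky M : ℝ} (hg : g < 0 → -(1 / 2) ≤ g)
    (hr : 0 < r) (hrR : r ≤ R) (hKA : 0 < KA) (hKw : 0 < Kw) (hKy : 0 < Ky) (hM : 0 < M) :
    ∃ (C1 : ℝ) (θ χ ξ : Bool → ℝ), 0 < C1 ∧ ∀ C0, C1 ≤ C0 → ∃ κ1 : ℝ, 0 < κ1 ∧
      ∀ rk c l κ' V, κ' < κ1 → MarginInput g r R KA Kw Ky rk c l κ' (C0 * κ') V →
        MarginBracket g M rk c l (C0 * κ') θ χ ξ V := by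
  rcases lt_trichotomy g 0 with h | rfl | h
  · exact exists_marginBracket_neg h (hg h) hr hrR hKA hKw hKy hM
  · exact exists_marginBracket_zero hr hKA hKw hM
  · exact exists_marginBracket_pos h hr hKA hKw hM

variable {g M rk c l κ : ℝ} {θ χ ξ : Bool → ℝ} {V : ℝ → ℝ} {d u X : ℝ}

lemma QuantileLike.perturb (hV : QuantileLike d u X V) (hc : 0 < c) (p h z : ℝ) :
    QuantileLike d u X (fun x => perturb g c p h z (V x)) := by
  have hcp : 0 < c ^ (-(g + h)) := Real.rpow_pos_of_pos hc _
  refine ⟨fun x hx y hy hxy => ?_, fun w hw => ?_, fun x hx hxu => ?_⟩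
  · have := hV.mono hx hy hxy
    simp only [ExtremeFailure.perturb]
    gcongr
  · simp only [ExtremeFailure.perturb, Set.mem_Icc] at hw
    obtain ⟨x, hx, hxe⟩ := hV.surj ((w - boxCox (g - p) c⁻¹ * (1 + z)) / c ^ (-(g + h)))
      ⟨by rw [le_div_iff₀ hcp]; linarith [hw.1], by rw [div_le_iff₀ hcp]; linarith [hw.2]⟩
    refine ⟨x, hx, ?_⟩
    simp only [ExtremeFailure.perturb, hxe]
    field_simp
    ring
  · have := hV.lt x hx hxu
    simp only [ExtremeFailure.perturb]
    gcongr

lemma MarginBracket.branch (hB : MarginBracket g M rk c l κ θ χ ξ V) (hc : 0 < c)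
    (hV : QuantileLike d (κ ^ (1 / max g 1)) κ⁻¹ V) (s : Bool) :
    Branch g (1 * κ) l (max g (1 / 2)) (κ ^ (1 / max g 1)) κ⁻¹
      (fun x => perturb g c (θ s / rk) (χ s / rk) (ξ s / rk) (V x)) := by
  rw [one_mul]
  exact ⟨(hV.perturb hc _ _ _).mono, (hV.perturb hc _ _ _).surj, hB.valid s, hB.close s⟩

/-- Shrinking by `c` on the standardized scale is affine on the original one. Solving the relation
for `Y` gives `perturb` with parameters `-h`, `h` and `α - (g + h) β - 1`. Regularity on the
interval makes the solution unique, and monotonicity of `gpdInv` is enough outside. -/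
lemma MarginBracket.hatBranch (hB : MarginBracket g M rk c l κ θ χ ξ V) (hc : 0 < c)
    (hu : κ ^ (1 / max g 1) ≤ κ⁻¹)
    (hV : QuantileLike d (κ ^ (1 / max g 1)) κ⁻¹ V) {α β h : ℝ} (hα : rk * |α - 1| ≤ M)
    (hβ : rk * |β| ≤ M) (hh : rk * |h| ≤ M) :
    HatBranch d (κ ^ (1 / max g 1)) κ⁻¹
      (fun Y x => gpdInv (g + h) ((Y - β) / α) =
        ENNReal.ofReal c⁻¹ * gpdInv (g + h) ((V x - β) / α))
      (fun x => perturb g c (-h) h (α - (g + h) * β - 1) (V x)) := by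
  obtain ⟨hα0, hx⟩ := hB.hat α β h hα hβ hh
  have hQ := hV.perturb (g := g) hc (-h) h (α - (g + h) * β - 1)
  obtain ⟨φ, hφ⟩ : ∃ φ, φ = fun x =>
    ExtremeFailure.perturb g c (-h) h (α - (g + h) * β - 1) (V x) := ⟨_, rfl⟩
  have hlin : ∀ x, (φ x - β) / α =
      boxCox (g + h) c⁻¹ + c ^ (-(g + h)) * ((V x - β) / α) := by
    intro x
    have h1 := one_add_mul_boxCox (g + h) c⁻¹
    rw [Real.inv_rpow hc.le, ← Real.rpow_neg hc.le] at h1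
    rw [hφ]
    simp only [ExtremeFailure.perturb, sub_neg_eq_add, ← h1]
    field_simp
    ring
  have hval : ∀ x ∈ Set.Icc (κ ^ (1 / max g 1)) κ⁻¹,
      0 < 1 + (g + h) * ((φ x - β) / α) ∧
      ENNReal.ofReal c⁻¹ * gpdInv (g + h) ((V x - β) / α) = gpdInv (g + h) ((φ x - β) / α) := by
    intro x hxm
    have h1 := (hx x hxm).1
    rw [hlin, gpdInv_rescale hc h1, one_add_mul_rescale hc]
    exact ⟨mul_pos (Real.rpow_pos_of_pos hc _) h1, rfl⟩
  have hc0 : ENNReal.ofReal c⁻¹ ≠ 0 := by simpa using hc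
  rw [← hφ] at hQ ⊢
  refine ⟨hQ.mono, hQ.surj, fun x hxm Y => ?_, fun x Y hdx hxu hhit => ?_,
    fun x Y hxX hhit => ?_⟩
  · obtain ⟨h1, h2⟩ := hval x hxm
    rw [h2]
    refine ⟨fun h3 => ?_, fun h3 => by rw [h3]⟩
    have := eq_of_gpdInv_eq h1 h3
    rw [div_left_inj' hα0.ne'] at this
    linarith
  · have hum : κ ^ (1 / max g 1) ∈ Set.Icc (κ ^ (1 / max g 1)) κ⁻¹ := ⟨le_rfl, hu⟩
    obtain ⟨h1, h2⟩ := hval _ hum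
    have hVlt : (V x - β) / α < (V (κ ^ (1 / max g 1)) - β) / α := by
      have := hV.lt x hdx hxu
      gcongr
    have h3 := ENNReal.mul_lt_mul_right hc0 ENNReal.ofReal_ne_top
      (gpdInv_lt_of_lt_right (hx _ hum).1 hVlt)
    rw [h2, ← hhit] at h3
    by_contra! hcon
    refine absurd (gpdInv_mono (g + h) ?_) (not_le.2 h3)
    gcongr
  · have hXm : κ⁻¹ ∈ Set.Icc (κ ^ (1 / max g 1)) κ⁻¹ := ⟨hu, le_rfl⟩
    obtain ⟨h1, h2⟩ := hval _ hXm
    have hVle : (V κ⁻¹ - β) / α ≤ (V x - β) / α := by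
      have := hV.mono.monotoneOn (show _ ∈ Set.Ici _ from hu) (show _ ∈ Set.Ici _ from
        hu.trans hxX.le) hxX.le
      gcongr
    have h3 : ENNReal.ofReal c⁻¹ * _ ≤ ENNReal.ofReal c⁻¹ * _ :=
      mul_le_mul_right (gpdInv_mono (g + h) hVle) _
    rw [h2, ← hhit] at h3
    have := le_of_gpdInv_le (Or.inl h1) h3
    rw [div_le_div_iff_of_pos_right hα0] at this
    linarith

end QuantileBranch

/-! ### Relations between the sequences. -/

section Rates

/-- The order of the error of the marginal approximations. -/
noncomputable def errRate (γ : Fin 2 → ℝ) (k d e : ℕ → ℝ) (n : ℕ) : ℝ :=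
  max (weight k d e (γ 0) n) (weight k d e (γ 1) n) / Real.sqrt (k n)

variable {γ : Fin 2 → ℝ} {k d e : ℕ → ℝ}

lemma weight_le_errRate_mul (i : Fin 2) {n : ℕ} (hk : 0 < k n) :
    weight k d e (γ i) n ≤ errRate γ k d e n * Real.sqrt (k n) := by
  rw [errRate, div_mul_cancel₀ _ (Real.sqrt_pos.2 hk).ne']
  fin_cases i
  · exact le_max_left _ _
  · exact le_max_right _ _

lemma CondS1.exists_ratio (h : CondS1 γ k d e) :
    ∃ r R : ℝ, 0 < r ∧ r ≤ R ∧ ∀ᶠ n in atTop, r ≤ d n / e n ∧ d n / e n ≤ R := by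
  obtain ⟨hpos, -, -, -, -, hΘ, -⟩ := h
  obtain ⟨R, hR, h1⟩ := hΘ.1.exists_pos
  obtain ⟨r, hr, h2⟩ := hΘ.2.exists_pos
  refine ⟨min r⁻¹ R, R, by positivity, min_le_right _ _, ?_⟩
  filter_upwards [h1.bound, h2.bound] with n h1 h2
  obtain ⟨-, hd, he⟩ := hpos n
  rw [Real.norm_of_nonneg hd.le, Real.norm_of_nonneg he.le] at h1 h2
  refine ⟨(min_le_left _ _).trans ?_, by rwa [div_le_iff₀ he]⟩
  rw [le_div_iff₀ he, inv_mul_le_iff₀ hr]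
  exact h2

lemma CondS1.exists_le_cSeq (h : CondS1 γ k d e) :
    ∃ c0 : ℝ, 0 < c0 ∧ ∀ᶠ n in atTop, c0 * k n ≤ cSeq k e n := by
  obtain ⟨hpos, -, -, -, hO, -, -⟩ := h
  obtain ⟨K, hK, h1⟩ := hO.exists_pos
  refine ⟨K⁻¹, by positivity, ?_⟩
  filter_upwards [h1.bound, eventually_gt_atTop 0] with n h1 hn
  obtain ⟨hk, -, he⟩ := hpos n
  have hn : (0 : ℝ) < n := by exact_mod_cast hn
  rw [Real.norm_of_nonneg hn.le, Real.norm_of_nonneg he.le] at h1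
  rw [cSeq, inv_mul_le_iff₀ hK]
  calc k n = k n / n * n := by field_simp
    _ ≤ k n / n * (K * e n) := by gcongr
    _ = _ := by ring

lemma CondS1.tendsto_cSeq (h : CondS1 γ k d e) : Tendsto (cSeq k e) atTop atTop := by
  obtain ⟨c0, hc0, h1⟩ := h.exists_le_cSeq
  exact tendsto_atTop_mono' _ h1 (h.2.1.const_mul_atTop hc0)

lemma eventually_tau (h : CondS1 γ k d e) :
    ∀ᶠ n : ℕ in atTop, d n * k n / n = d n / e n * cSeq k e n := by
  filter_upwards with n
  have := (h.1 n).2.2.ne'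
  rw [cSeq]
  field_simp

lemma CondS1.tendsto_tau (h : CondS1 γ k d e) :
    Tendsto (fun n : ℕ => d n * k n / n) atTop atTop := by
  obtain ⟨r, R, hr, -, h1⟩ := h.exists_ratio
  refine tendsto_atTop_mono' _ ?_ (h.tendsto_cSeq.const_mul_atTop hr)
  filter_upwards [h1, eventually_tau h, h.tendsto_cSeq.eventually_ge_atTop 0] with n h1 h2 h3
  rw [h2]
  gcongr
  exact h1.1

lemma CondS1.tendsto_weight (h : CondS1 γ k d e) (g : ℝ) :
    Tendsto (weight k d e g) atTop atTop := by
  have hlog : Tendsto (fun n => Real.log (cSeq k e n)) atTop atTop :=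
    Real.tendsto_log_atTop.comp h.tendsto_cSeq
  unfold weight
  rcases lt_trichotomy g 0 with hg | rfl | hg
  · simp only [if_neg hg.not_gt, if_neg hg.ne]
    exact (tendsto_rpow_atTop (by linarith)).comp h.tendsto_tau
  · simp only [if_neg (lt_irrefl _), if_true]
    exact ((tendsto_pow_atTop two_ne_zero).comp hlog).atTop_div_const two_pos
  · simpa only [if_pos hg] using hlog

lemma CondS1.tendsto_errRate (h : CondS1 γ k d e) :
    Tendsto (errRate γ k d e) atTop (𝓝 0) := by
  have h0 := (h.2.2.2.2.2.2 0).tendsto_div_nhds_zero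
  have h1 := (h.2.2.2.2.2.2 1).tendsto_div_nhds_zero
  have := h0.max h1
  rw [max_self] at this
  refine this.congr fun n => ?_
  rw [errRate, max_div_div_right (Real.sqrt_nonneg _)]

/-- The weights diverge, so `errRate` dominates any multiple of `1 / √k`, the order of both the
estimation errors and the sampling noise. -/
lemma CondS1.eventually_le_errRate_mul (h : CondS1 γ k d e) (B : ℝ) :
    ∀ᶠ n in atTop, B ≤ errRate γ k d e n * Real.sqrt (k n) := by
  filter_upwards [(h.tendsto_weight (γ 0)).eventually_ge_atTop B] with n hn
  exact hn.trans (weight_le_errRate_mul 0 (h.1 n).1)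

/-- Here `d k / n` is at least of order `k`, so its power `-γ` can be `o(√k)` only if `-γ` does not
exceed `1/2`. -/
lemma CondS1.neg_half_le (h : CondS1 γ k d e) (i : Fin 2) (hg : γ i < 0) :
    -(1 / 2) ≤ γ i := by
  by_contra! hlt
  obtain ⟨c0, hc0, h1⟩ := h.exists_le_cSeq
  obtain ⟨r, R, hr, -, h2⟩ := h.exists_ratio
  have hc1 : 0 < r * c0 := by positivity
  have h3 := (h.2.2.2.2.2.2 i).bound (show 0 < Real.sqrt (r * c0) / 2 by positivity)
  obtain ⟨n, h1, h2, h3, h4, h5⟩ := (h1.and (h2.and (h3.and ((eventually_tau h).and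
    ((h.2.1.const_mul_atTop hc1).eventually_ge_atTop 1))))).exists
  obtain ⟨hk, hd, -⟩ := h.1 n
  have hτ : r * c0 * k n ≤ d n * k n / n := by
    rw [h4, mul_assoc]
    exact mul_le_mul h2.1 h1 (by positivity) (hr.le.trans h2.1)
  rw [weight, if_neg hg.not_gt, if_neg hg.ne, Real.norm_of_nonneg (by positivity),
    Real.norm_of_nonneg (Real.sqrt_nonneg _)] at h3
  have h6 : Real.sqrt (r * c0) * Real.sqrt (k n) ≤ (d n * k n / n) ^ (-γ i) := by
    rw [← Real.sqrt_mul hc1.le, Real.sqrt_eq_rpow]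
    calc (r * c0 * k n) ^ (1 / 2 : ℝ) ≤ (r * c0 * k n) ^ (-γ i) :=
          Real.rpow_le_rpow_of_exponent_le h5 (by linarith)
      _ ≤ _ := Real.rpow_le_rpow (by positivity) hτ (by linarith)
  have h7 : 0 < Real.sqrt (r * c0) * Real.sqrt (k n) := by positivity
  linarith

/-- The lower end of the range of the marginal approximations, on the scale of the intermediate
order statistics. -/
lemma CondS1.exists_le_tau_mul (h : CondS1 γ k d e) {C0 : ℝ} (hC0 : 0 < C0) (g : ℝ) :
    ∃ c1 : ℝ, 0 < c1 ∧ ∀ᶠ n : ℕ in atTop,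
      c1 * cSeq k e n ^ (1 / 2 : ℝ) ≤
        d n * k n / n * (C0 * errRate γ k d e n) ^ (1 / max g 1) := by
  obtain ⟨c0, hc0, h1⟩ := h.exists_le_cSeq
  obtain ⟨r, R, hr, -, h2⟩ := h.exists_ratio
  refine ⟨r * C0 * c0 ^ (1 / 2 : ℝ), by positivity, ?_⟩
  have h3 := h.tendsto_errRate.const_mul C0
  rw [mul_zero] at h3
  filter_upwards [h1, h2, h3.eventually_le_const one_pos, eventually_tau h,
    h.eventually_le_errRate_mul 1, h.tendsto_cSeq.eventually_gt_atTop 0] with n h1 h2 h3 h4 h5 hc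
  have hk := (h.1 n).1
  have hsk : 0 < Real.sqrt (k n) := Real.sqrt_pos.2 hk
  have hε : 1 / Real.sqrt (k n) ≤ errRate γ k d e n := by rwa [div_le_iff₀ hsk]
  have hε0 : 0 < errRate γ k d e n := lt_of_lt_of_le (by positivity) hε
  have hu : C0 * errRate γ k d e n ≤ (C0 * errRate γ k d e n) ^ (1 / max g 1) := by
    refine Real.self_le_rpow_of_le_one (by positivity) h3 ?_
    rw [div_le_one (by positivity)]
    exact le_max_right _ _
  rw [h4]
  -- Since `c_n ≥ c0 k`, the factor `1 / √k` lost at the lower end costs at most half of the power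
  -- of `c_n`.
  have h6 : c0 ^ (1 / 2 : ℝ) * cSeq k e n ^ (1 / 2 : ℝ) * Real.sqrt (k n) ≤ cSeq k e n := by
    rw [Real.sqrt_eq_rpow, ← Real.mul_rpow hc0.le hc.le, ← Real.mul_rpow (by positivity) hk.le]
    calc (c0 * cSeq k e n * k n) ^ (1 / 2 : ℝ) ≤ (cSeq k e n ^ 2) ^ (1 / 2 : ℝ) := by
          refine Real.rpow_le_rpow (by positivity) ?_ (by norm_num)
          nlinarith
      _ = cSeq k e n := by
          rw [← Real.sqrt_eq_rpow, Real.sqrt_sq hc.le]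
  calc r * C0 * c0 ^ (1 / 2 : ℝ) * cSeq k e n ^ (1 / 2 : ℝ)
      = r * C0 * (c0 ^ (1 / 2 : ℝ) * cSeq k e n ^ (1 / 2 : ℝ) * Real.sqrt (k n)) *
        (1 / Real.sqrt (k n)) := by field_simp
    _ ≤ r * C0 * cSeq k e n * errRate γ k d e n := by gcongr
    _ = r * cSeq k e n * (C0 * errRate γ k d e n) := by ring
    _ ≤ _ := mul_le_mul (mul_le_mul_of_nonneg_right h2.1 hc.le) hu (by positivity)
        (mul_nonneg (hr.le.trans h2.1) hc.le)

lemma CondS1.tendsto_tau_mul (h : CondS1 γ k d e) {C0 : ℝ} (hC0 : 0 < C0) (g : ℝ) :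
    Tendsto (fun n : ℕ => d n * k n / n * (C0 * errRate γ k d e n) ^ (1 / max g 1))
      atTop atTop := by
  obtain ⟨c1, hc1, h1⟩ := h.exists_le_tau_mul hC0 g
  exact tendsto_atTop_mono' _ h1
    (((tendsto_rpow_atTop (by norm_num)).comp h.tendsto_cSeq).const_mul_atTop hc1)

lemma CondS1.tendsto_level (h : CondS1 γ k d e) :
    Tendsto (fun n : ℕ => n / k n) atTop atTop := by
  have : Tendsto (fun n : ℕ => k n / n) atTop (𝓝[>] 0) := by
    rw [tendsto_nhdsWithin_iff]
    refine ⟨h.2.2.1, ?_⟩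
    filter_upwards [eventually_gt_atTop 0] with n hn
    have hn : (0 : ℝ) < n := by exact_mod_cast hn
    exact div_pos (h.1 n).1 hn
  refine (tendsto_inv_nhdsGT_zero.comp this).congr fun n => ?_
  simp

lemma CondS1.tendsto_mul (h : CondS1 γ k d e) {C0 : ℝ} (hC0 : 0 < C0) (g : ℝ) :
    Tendsto (fun n : ℕ => d n * (C0 * errRate γ k d e n) ^ (1 / max g 1)) atTop atTop := by
  refine tendsto_atTop_mono' _ ?_ (h.tendsto_tau_mul hC0 g)
  filter_upwards [h.tendsto_level.eventually_ge_atTop 1, eventually_gt_atTop 0,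
    h.eventually_le_errRate_mul 1] with n h1 hn h2
  have hn : (0 : ℝ) < n := by exact_mod_cast hn
  obtain ⟨hk, hd, he⟩ := h.1 n
  have hε : 0 ≤ errRate γ k d e n := by
    by_contra! hneg
    nlinarith [Real.sqrt_nonneg (k n)]
  rw [le_div_iff₀ hk, one_mul] at h1
  have : d n * k n / n ≤ d n := by
    rw [div_le_iff₀ hn]
    gcongr
  gcongr

end Rates

/-! ### Verification of the rate relations for the two margins. -/

section MarginInput

variable {γ ρ : Fin 2 → ℝ} {a b A : Fin 2 → ℝ → ℝ} {A0 : ℝ → ℝ} {k d e : ℕ → ℝ}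
  {μ : Measure (ℝ × ℝ)}

lemma CondS2.eventually_abs_le (h : CondS2 γ A A0 k d e) (hS1 : CondS1 γ k d e) (i : Fin 2) :
    ∀ᶠ n : ℕ in atTop, |A i (n / k n)| ≤ errRate γ k d e n := by
  filter_upwards [(h.1 i).bound one_pos, (hS1.tendsto_weight (γ i)).eventually_ge_atTop 0]
    with n h1 h2
  have hsk : 0 < Real.sqrt (k n) := Real.sqrt_pos.2 (hS1.1 n).1
  rw [Real.norm_eq_abs, one_mul, Real.norm_of_nonneg (by positivity)] at h1
  refine h1.trans ?_
  rw [div_le_iff₀ hsk]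
  exact weight_le_errRate_mul i (hS1.1 n).1

/-- `boxCox g y` dominates the relative error `δ y ^ g` for large `y`. -/
lemma exists_mul_rpow_le_boxCox {g : ℝ} (hg : 0 ≤ g) :
    ∃ B δ : ℝ, 0 < δ ∧ ∀ y, B ≤ y → δ * y ^ g ≤ boxCox g y := by
  rcases hg.eq_or_lt with rfl | hg
  · refine ⟨Real.exp 1, 1, one_pos, fun y hy => ?_⟩
    rw [Real.rpow_zero, boxCox, if_pos rfl, mul_one,
      Real.le_log_iff_exp_le ((Real.exp_pos 1).trans_le hy)]
    exact hy
  · refine ⟨2 ^ (1 / g), 1 / (2 * g), by positivity, fun y hy => ?_⟩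
    have h2 : 2 ≤ y ^ g := by
      calc (2 : ℝ) = (2 ^ (1 / g)) ^ g := by
            rw [← Real.rpow_mul zero_le_two, one_div_mul_cancel hg.ne', Real.rpow_one]
        _ ≤ y ^ g := Real.rpow_le_rpow (by positivity) hy hg.le
    rw [boxCox, if_neg hg.ne', div_mul_eq_mul_div, div_le_div_iff₀ (by positivity) hg]
    nlinarith

lemma CondS1.tendsto_log_mul_rpow (hS1 : CondS1 γ k d e) {p : ℝ} (hp : p < 0) :
    Tendsto (fun n => Real.log (cSeq k e n) * cSeq k e n ^ p) atTop (𝓝 0) := by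
  have h := (isLittleO_log_rpow_atTop (neg_pos.2 hp)).tendsto_div_nhds_zero
  refine (h.comp hS1.tendsto_cSeq).congr' ?_
  filter_upwards [hS1.tendsto_cSeq.eventually_gt_atTop 0] with n hn
  simp only [Function.comp_apply, Real.rpow_neg hn.le, div_inv_eq_mul]

-- The product of `d/e * (1 + s)` and `c_n / (1 + s)` is `d k / n` whatever `s` is. The second order
-- bound at `n/k` thus applies to the same argument for all `s`, and `|s| < 1/2` changes only the
-- constants.
set_option maxHeartbeats 800000 in
lemma exists_marginInput (hS1 : CondS1 γ k d e) (hM2 : CondM2 μ γ ρ a b A)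
    (hS2 : CondS2 γ A A0 k d e) (i : Fin 2) :
    ∃ r R KA Kw : ℝ, 0 < r ∧ r ≤ R ∧ 0 < KA ∧ 0 < Kw ∧ ∀ C0 : ℝ, 0 < C0 → ∀ s : ℕ → ℝ,
      Tendsto s atTop (𝓝 0) → ∀ᶠ n : ℕ in atTop,
        MarginInput (γ i) r R KA Kw 1 (Real.sqrt (k n)) (cSeq k e n / (1 + s n))
          (d n / e n * (1 + s n)) (errRate γ k d e n) (C0 * errRate γ k d e n)
          (fun x => (tailQ μ i (d n * x) - b i (n / k n)) / a i (n / k n)) := by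
  obtain ⟨r, R, hr, hrR, hratio⟩ := hS1.exists_ratio
  obtain ⟨KA, t0, hKA, ht0, H⟩ := hM2.exists_bound i one_pos
  have hR : 0 < R := hr.trans_le hrR
  obtain ⟨g, hg⟩ : ∃ g, g = γ i := ⟨_, rfl⟩
  rw [← hg] at H ⊢
  refine ⟨r / 2, 2 * R, KA, 8 + (2 / r) ^ (-g), by positivity, by linarith, hKA, by positivity,
    fun C0 hC0 s hs => ?_⟩
  have hsb : ∀ᶠ n in atTop, |s n| < 1 / 2 := by
    have := hs.abs
    rw [abs_zero] at this
    exact this.eventually_lt_const (by norm_num)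
  have hB : ∃ B : ℝ, 1 ≤ B ∧ ∃ δ : ℝ, 0 < δ ∧ ∀ y, B ≤ y → 0 ≤ g → δ * y ^ g ≤ boxCox g y := by
    by_cases h0 : 0 ≤ g
    · obtain ⟨B, δ, hδ, h1⟩ := exists_mul_rpow_le_boxCox h0
      exact ⟨max B 1, le_max_right _ _, δ, hδ, fun y hy _ => h1 y ((le_max_left _ _).trans hy)⟩
    · exact ⟨1, le_rfl, 1, one_pos, fun y _ h => absurd h h0⟩
  obtain ⟨B, hB1, δ, hδ, hBC⟩ := hB
  have hδev : ∀ᶠ n in atTop, KA * errRate γ k d e n < δ := by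
    have := hS1.tendsto_errRate.const_mul KA
    rw [mul_zero] at this
    exact this.eventually_lt_const hδ
  -- At the lower end `d k / n * x` is at least of order `c_n^(1/2)`, so its negative power `g`
  -- beats the logarithm.
  have hlogev : g < 0 → ∀ᶠ n : ℕ in atTop, 2 * Real.log (cSeq k e n) *
      (d n * k n / n * (C0 * errRate γ k d e n) ^ (1 / max g 1)) ^ g ≤ 1 := by
    intro hg0
    obtain ⟨c1, hc1, h1⟩ := hS1.exists_le_tau_mul hC0 g
    have h2 := (hS1.tendsto_log_mul_rpow (show g / 2 < 0 by linarith)).const_mul (2 * c1 ^ g)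
    rw [mul_zero] at h2
    filter_upwards [h1, h2.eventually_le_const one_pos, hS1.tendsto_cSeq.eventually_ge_atTop 1]
      with n h1 h2 h3
    have hc : 0 < cSeq k e n := by linarith
    refine le_trans ?_ h2
    have h4 := Real.rpow_le_rpow_of_nonpos (by positivity) h1 hg0.le
    rw [Real.mul_rpow hc1.le (by positivity), ← Real.rpow_mul hc.le] at h4
    have h5 := Real.log_nonneg h3
    calc _ ≤ 2 * Real.log (cSeq k e n) * (c1 ^ g * cSeq k e n ^ (1 / 2 * g)) := by gcongr
      _ = _ := by rw [show 1 / 2 * g = g / 2 by ring]; ring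
  have hlogev' : ∀ᶠ n : ℕ in atTop, g < 0 → 2 * Real.log (cSeq k e n) *
      (d n * k n / n * (C0 * errRate γ k d e n) ^ (1 / max g 1)) ^ g ≤ 1 := by
    by_cases hg0 : g < 0
    · filter_upwards [hlogev hg0] with n hn _ using hn
    · exact Eventually.of_forall fun n h => absurd h hg0
  have hbig : ∀ᶠ n : ℕ in atTop, g < 0 → 2 ≤ (1 / 2 * cSeq k e n) ^ (-g) := by
    by_cases hg0 : g < 0
    · have := (tendsto_rpow_atTop (neg_pos.2 hg0)).comp
        (hS1.tendsto_cSeq.const_mul_atTop (show (0 : ℝ) < 1 / 2 by norm_num))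
      filter_upwards [this.eventually_ge_atTop 2] with n hn _ using hn
    · exact Eventually.of_forall fun n h => absurd h hg0
  filter_upwards [hratio, hsb, hδev, hlogev', hbig, eventually_tau hS1,
    hS1.tendsto_cSeq.eventually_ge_atTop 4, hS1.eventually_le_errRate_mul 1,
    (hS1.tendsto_tau_mul hC0 g).eventually_ge_atTop B,
    (hS1.tendsto_mul hC0 g).eventually_gt_atTop t0,
    hS1.tendsto_level.eventually_gt_atTop t0, hS2.eventually_abs_le hS1 i,
    eventually_gt_atTop 0]
    with n h1 h2 h3 h4 h5 h6 h7 h8 h9 h10 h11 h12 hn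
  have hn : (0 : ℝ) < n := by exact_mod_cast hn
  obtain ⟨hk, hd, he⟩ := hS1.1 n
  have hw := weight_le_errRate_mul (γ := γ) (d := d) (e := e) i hk
  rw [← hg] at hw
  have hsk : 0 < Real.sqrt (k n) := Real.sqrt_pos.2 hk
  have hε0 : 0 < errRate γ k d e n := by
    by_contra! hneg
    nlinarith
  obtain ⟨u, hu⟩ : ∃ u, u = (C0 * errRate γ k d e n) ^ (1 / max g 1) := ⟨_, rfl⟩
  have hu0 : 0 < u := by rw [hu]; positivity
  rw [← hu] at h4 h9 h10
  have hs' := abs_lt.1 h2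
  have hs1 : 0 < 1 + s n := by linarith
  obtain ⟨c, hc⟩ : ∃ c, c = cSeq k e n := ⟨_, rfl⟩
  rw [← hc] at h4 h5 h6 h7
  have hc1 : 1 / 2 * c ≤ c / (1 + s n) := by
    rw [le_div_iff₀ hs1]
    nlinarith
  have hc2 : c / (1 + s n) ≤ 2 * c := by
    rw [div_le_iff₀ hs1]
    nlinarith
  have hc0 : 0 < c / (1 + s n) := by linarith
  have hlogc : Real.log (c / (1 + s n)) ≤ 2 * Real.log c := by
    have : c / (1 + s n) ≤ c ^ 2 := by nlinarith
    calc _ ≤ Real.log (c ^ 2) := Real.log_le_log hc0 this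
      _ = 2 * Real.log c := by rw [Real.log_pow]; norm_num
  have hlogc0 : 0 ≤ Real.log (c / (1 + s n)) := Real.log_nonneg (by linarith)
  have hK0 : 0 < (2 / r) ^ (-g) := by positivity
  have hek : 0 < errRate γ k d e n * Real.sqrt (k n) := by positivity
  have hlx : ∀ x, d n / e n * (1 + s n) * x * (c / (1 + s n)) = d n * k n / n * x := by
    intro x
    rw [h6]
    field_simp
  have hτ0 : 0 < d n * k n / n := by positivity
  rw [← hc]
  have happ : ∀ x ∈ Set.Icc u (C0 * errRate γ k d e n)⁻¹,
      |(tailQ μ i (d n * x) - b i (n / k n)) / a i (n / k n) - boxCox g (d n * k n / n * x)| ≤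
        KA * errRate γ k d e n * (d n * k n / n * x) ^ g := by
    intro x hx
    have hx0 : 0 < x := hu0.trans_le hx.1
    have e1 : n / k n * (d n * k n / n * x) = d n * x := by field_simp
    have hBx : B ≤ d n * k n / n * x := h9.trans (by gcongr; exact hx.1)
    have hdx : d n * u ≤ d n * x := by gcongr; exact hx.1
    have := H (n / k n) (d n * k n / n * x) (by linarith) h11 (by rw [e1]; linarith)
    rw [e1] at this
    refine this.trans ?_
    gcongr
  refine ⟨hε0, hsk, h8, by linarith, ⟨?_, ?_⟩, fun hg0 => ?_, fun hg0 => ?_, fun hg0 => ⟨?_, ?_⟩,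
    fun x hx => ?_, fun hg0 x hx => ?_, fun hg0 x hx => ?_⟩
  · calc r / 2 = r * (1 / 2) := by ring
      _ ≤ _ := mul_le_mul h1.1 (by linarith) (by norm_num) (hr.le.trans h1.1)
  · rw [mul_comm 2 R]
    exact mul_le_mul h1.2 (by linarith) hs1.le hR.le
  · rw [weight, if_pos hg0, ← hc] at hw
    nlinarith
  · rw [weight, if_neg hg0.not_gt, if_pos hg0, ← hc] at hw
    nlinarith
  · rw [weight, if_neg hg0.not_gt, if_neg hg0.ne, h6] at hw
    have h13 : (r / 2) ^ (-g) * (c / (1 + s n)) ^ (-g) ≤ (d n / e n * c) ^ (-g) := by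
      rw [← Real.mul_rpow (by positivity) hc0.le]
      refine Real.rpow_le_rpow (by positivity) ?_ (by linarith)
      calc r / 2 * (c / (1 + s n)) ≤ r / 2 * (2 * c) := by gcongr
        _ = r * c := by ring
        _ ≤ _ := mul_le_mul_of_nonneg_right h1.1 (by linarith)
    have h14 : (2 / r) ^ (-g) * (r / 2) ^ (-g) = 1 := by
      rw [← Real.mul_rpow (by positivity) (by positivity), div_mul_div_comm, mul_comm r 2,
        div_self (by positivity), Real.one_rpow]
    calc (c / (1 + s n)) ^ (-g)
        = (2 / r) ^ (-g) * ((r / 2) ^ (-g) * (c / (1 + s n)) ^ (-g)) := by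
          rw [← mul_assoc, h14, one_mul]
      _ ≤ (2 / r) ^ (-g) * (errRate γ k d e n * Real.sqrt (k n)) := by
          exact mul_le_mul_of_nonneg_left (h13.trans hw) hK0.le
      _ ≤ _ := by gcongr; linarith
  · exact (h5 hg0).trans (Real.rpow_le_rpow (by linarith) hc1 (by linarith))
  · rw [← hu] at hx
    rw [hlx]
    exact happ x hx
  · rw [← hu] at hx
    have hx0 : 0 < x := hu0.trans_le hx.1
    have hBx : B ≤ d n * k n / n * x := h9.trans (by gcongr; exact hx.1)
    have h13 := (abs_le.1 (happ x hx)).1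
    have h14 := hBC _ hBx hg0
    have h15 : KA * errRate γ k d e n * (d n * k n / n * x) ^ g ≤
        δ * (d n * k n / n * x) ^ g := by gcongr
    linarith
  · rw [← hu] at hx
    rw [hlx]
    refine le_trans ?_ (h4 hg0)
    have h13 : (d n * k n / n * x) ^ g ≤ (d n * k n / n * u) ^ g :=
      Real.rpow_le_rpow_of_nonpos (by positivity) (by gcongr; exact hx.1) hg0.le
    exact mul_le_mul hlogc h13 (by have := hu0.trans_le hx.1; positivity) (by linarith)

end MarginInput

/-! ### The enclosing events at sample size `n`. -/

section SampleSandwich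

variable {μ ν : Measure (ℝ × ℝ)} {η : ℝ × ℝ → ℝ} {q : ℝ → ℝ≥0∞} {γ ρ : Fin 2 → ℝ}
  {a b A : Fin 2 → ℝ → ℝ} {A0 : ℝ → ℝ} {k d e : ℕ → ℝ}

lemma tildeH_eq_gpdInv {g α β k c d θ χ ξ x : ℝ} {U : ℝ → ℝ} (hc : 0 < c) (hx : 1 < d * x) :
    tildeH g α β U k c d θ χ ξ x = gpdInv g (perturb g c (θ / Real.sqrt k) (χ / Real.sqrt k)
      (ξ / Real.sqrt k) ((U (d * x) - β) / α)) := by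
  rw [tildeH, if_pos hx, perturb, boxCox, Real.log_inv, Real.inv_rpow hc.le, ← Real.rpow_neg hc.le]

/-- The event that the level `Y` is transformed to the image of `x`, shrunk by the factor `c`,
for normalized estimators with errors `α - 1`, `β` and `h`. -/
def hatHit (g c α β h : ℝ) (V : ℝ → ℝ) (Y x : ℝ) : Prop :=
  gpdInv (g + h) ((Y - β) / α) = ENNReal.ofReal c⁻¹ * gpdInv (g + h) ((V x - β) / α)

lemma TailApprox.mono {a b : Fin 2 → ℝ} {t r r' : ℝ} {B : Set (ℝ≥0∞ × ℝ≥0∞)}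
    (h : TailApprox μ ν γ a b t B r) (hr : r ≤ r') : TailApprox μ ν γ a b t B r' :=
  ⟨h.1, h.2.trans hr⟩

/-- The abstract sandwich is applied with `κ = C0 * errRate` and quantiles normalized at `n/k`, the
factor `1 + s` entering the second margin only. The constant `C0` serves both brackets, and the
bracket parameters depend on `M` but not on `n`. -/
lemma exists_sample_sandwich [IsProbabilityMeasure μ] (hν : IsExponentMeasure μ ν)
    (hD2 : CondD2 ν η) (hM1 : CondM1 μ) (hM2 : CondM2 μ γ ρ a b A) (hQ1 : CondQ1 q)
    (hQ2 : CondQ2 γ q) (hS1 : CondS1 γ k d e) (hS2 : CondS2 γ A A0 k d e) {s : ℕ → ℝ}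
    (hs : Tendsto s atTop (𝓝 0)) (hD1 : CondD1Analog μ ν γ a b A0 q k d e s) {M : ℝ}
    (hM : 0 < M) :
    ∃ C : ℝ, 0 < C ∧ ∀ᶠ n : ℕ in atTop, ∃ Ms Ns : Set (ℝ × ℝ),
      MeasurableSet Ms ∧ MeasurableSet Ns ∧
      (∀ α β h : Fin 2 → ℝ, (∀ i, Real.sqrt (k n) * |α i - 1| ≤ M ∧
          Real.sqrt (k n) * |β i| ≤ M ∧ Real.sqrt (k n) * |h i| ≤ M) →
        ∀ E : Set (ℝ × ℝ), E = hatEvent (fun i => a i (n / k n)) (fun i => b i (n / k n)) q (d n)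
          (hatHit (γ 0) (cSeq k e n) (α 0) (β 0) (h 0)
            (fun x => (tailQ μ 0 (d n * x) - b 0 (n / k n)) / a 0 (n / k n)))
          (hatHit (γ 1) (cSeq k e n / (1 + s n)) (α 1) (β 1) (h 1)
            (fun x => (tailQ μ 1 (d n * x) - b 1 (n / k n)) / a 1 (n / k n))) →
        Ms ⊆ E ∧ E ⊆ Ns) ∧
      ENNReal.ofReal (n / k n) * μ Ns ≤ ν (scaledSet q (d n / e n) (d n / e n * (1 + s n))) +
        ENNReal.ofReal (C * errRate γ k d e n) ∧
      ν (scaledSet q (d n / e n) (d n / e n * (1 + s n))) ≤ ENNReal.ofReal (n / k n) * μ Ms +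
        ENNReal.ofReal (C * errRate γ k d e n) := by
  obtain ⟨r0, R0, KA0, Kw0, hr0, hrR0, hKA0, hKw0, I0⟩ := exists_marginInput hS1 hM2 hS2 0
  obtain ⟨r1, R1, KA1, Kw1, hr1, hrR1, hKA1, hKw1, I1⟩ := exists_marginInput hS1 hM2 hS2 1
  obtain ⟨T0, hT0, HS⟩ := exists_sandwich hν hD2 hM1 hQ1.dualPair (hQ1.axisGrowth hQ2)
    (hQ1.axisGrowth_dual hQ2) (lt_min hr0 hr1)
    ((min_le_left _ _).trans (hrR0.trans (le_max_left R0 R1)))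
  obtain ⟨B0, θ0, χ0, ξ0, hB0, H0⟩ := exists_marginBracket (hS1.neg_half_le 0) hr0 hrR0 hKA0 hKw0
    one_pos hM
  obtain ⟨B1, θ1, χ1, ξ1, hB1, H1⟩ := exists_marginBracket (hS1.neg_half_le 1) hr1 hrR1 hKA1 hKw1
    one_pos hM
  obtain ⟨C0, hC0⟩ : ∃ C0, C0 = max B0 B1 := ⟨_, rfl⟩
  have hC0p : 0 < C0 := hC0 ▸ lt_max_of_lt_left hB0
  obtain ⟨κ0, hκ0, H0⟩ := H0 C0 (hC0 ▸ le_max_left _ _)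
  obtain ⟨κ1, hκ1, H1⟩ := H1 C0 (hC0 ▸ le_max_right _ _)
  have hγ : ∀ i, -1 ≤ γ i := fun i => by
    rcases lt_or_ge (γ i) 0 with h | h
    · linarith [hS1.neg_half_le i h]
    · linarith
  choose Kt tt hKt htt HT using fun i => CondM2.exists_tail_bound hM1 hM2 i (hγ i) hT0
  obtain ⟨K, hK⟩ : ∃ K, K = Kt 0 + Kt 1 := ⟨_, rfl⟩
  have hK0 : 0 < K := hK ▸ add_pos (hKt 0) (hKt 1)
  have hKi : ∀ i, Kt i ≤ K := fun i => by
    have := hKt 0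
    have := hKt 1
    fin_cases i <;> simp [hK] <;> linarith
  obtain ⟨C, κ2, hC, hκ2, HS⟩ := HS 1 (2 * K / C0) one_pos (by positivity)
  choose Q hQt hQ using fun i => exists_quantileLike hM1 i
  obtain ⟨v0, v1, -, -, hsample⟩ := hD1
  -- A single bound for all parameters of both brackets, so that the uniform rate condition covers
  -- every pair of branches.
  obtain ⟨M', hM'⟩ : ∃ M', M' = 1 + ∑ s : Bool, (|θ0 s| + |χ0 s| + |ξ0 s| + |θ1 s| + |χ1 s| + |ξ1 s|) :=
    ⟨_, rfl⟩
  have hM'0 : 0 < M' := by rw [hM']; positivity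
  obtain ⟨KD, hKD⟩ := hsample M' hM'0
  have hM's : ∀ s, |θ0 s| ≤ M' ∧ |χ0 s| ≤ M' ∧ |ξ0 s| ≤ M' ∧ |θ1 s| ≤ M' ∧ |χ1 s| ≤ M' ∧
      |ξ1 s| ≤ M' := by
    intro s
    have h1 := Finset.single_le_sum (f := fun s => |θ0 s| + |χ0 s| + |ξ0 s| + |θ1 s| + |χ1 s| + |ξ1 s|)
      (fun s _ => by positivity) (Finset.mem_univ s)
    have := abs_nonneg (θ0 s)
    have := abs_nonneg (χ0 s)
    have := abs_nonneg (ξ0 s)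
    have := abs_nonneg (θ1 s)
    have := abs_nonneg (χ1 s)
    have := abs_nonneg (ξ1 s)
    refine ⟨?_, ?_, ?_, ?_, ?_, ?_⟩ <;> linarith
  have hε : ∀ c : ℝ, 0 < c → ∀ᶠ n in atTop, errRate γ k d e n < c := fun c hc =>
    hS1.tendsto_errRate.eventually_lt_const hc
  have hC0e : ∀ c : ℝ, 0 < c → ∀ᶠ n in atTop, C0 * errRate γ k d e n < c := fun c hc => by
    have := hS1.tendsto_errRate.const_mul C0
    rw [mul_zero] at this
    exact this.eventually_lt_const hc
  refine ⟨C * C0, by positivity, ?_⟩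
  have hsb : ∀ᶠ n in atTop, -1 < s n := hs.eventually_const_lt (by norm_num)
  filter_upwards [I0 C0 hC0p (fun _ => 0) tendsto_const_nhds, I1 C0 hC0p s hs,
    hε κ0 hκ0, hε κ1 hκ1, hC0e κ2 hκ2, hC0e 1 one_pos, hKD,
    hS2.2.bound (show 0 < C0 / (|KD| + 1) by positivity),
    (hS1.tendsto_mul hC0p (γ 0)).eventually_gt_atTop (Q 0),
    (hS1.tendsto_mul hC0p (γ 1)).eventually_gt_atTop (Q 1),
    hS1.tendsto_level.eventually_gt_atTop (max (tt 0) (tt 1)),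
    hS2.eventually_abs_le hS1 0, hS2.eventually_abs_le hS1 1,
    hε (1 / 2 / K) (by positivity), eventually_gt_atTop 0, hS1.tendsto_cSeq.eventually_gt_atTop 0,
    hsb] with n h0 h1 h2 h3 h4 h5 h6 h7 h8 h9 h10 h11 h12 h13 hn hc hsn
  have hn : (0 : ℝ) < n := by exact_mod_cast hn
  obtain ⟨hk, hd, he⟩ := hS1.1 n
  have hs1 : 0 < 1 + s n := by linarith
  have hε0 := h0.κ_pos
  obtain ⟨κ, hκ⟩ : ∃ κ, κ = C0 * errRate γ k d e n := ⟨_, rfl⟩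
  have hκ0' : 0 < κ := by rw [hκ]; positivity
  have b0 := H0 _ _ _ _ _ h2 h0
  have b1 := H1 _ _ _ _ _ h3 h1
  have hl0 := h0.hl
  have hl1 := h1.hl
  rw [add_zero, div_one, mul_one] at b0
  rw [add_zero, mul_one] at hl0
  rw [← hκ] at b0 b1 h4 h5 h8 h9
  have ha : ∀ i, 0 < a i (n / k n) := fun i => ((hM2 i).2.1 _ (by positivity)).1
  have hu : ∀ g : ℝ, 0 < κ ^ (1 / max g 1) ∧ κ ^ (1 / max g 1) ≤ κ⁻¹ := fun g =>
    ⟨by positivity, (Real.rpow_le_one hκ0'.le h5.le (by positivity)).trans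
      ((one_le_inv₀ hκ0').2 h5.le)⟩
  have hV0 := hQ 0 (a 0 (n / k n)) (b 0 (n / k n)) (d n) _ _ (ha 0) hd h8 (hu _).2
  have hV1 := hQ 1 (a 1 (n / k n)) (b 1 (n / k n)) (d n) _ _ (ha 1) hd h9 (hu _).2
  have hc1 : 0 < cSeq k e n / (1 + s n) := by positivity
  have hKκ : 2 * K / C0 * κ = 2 * (K * errRate γ k d e n) := by
    rw [hκ]
    field_simp
  have hS := HS (fun i => a i (n / k n)) (fun i => b i (n / k n))
    κ (d n / e n) (d n / e n * (1 + s n)) (n / k n) _ _ _ _ hκ0' h4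
    ⟨(min_le_left _ _).trans hl0.1, hl0.2.trans (le_max_left _ _)⟩
    ⟨(min_le_right _ _).trans hl1.1, hl1.2.trans (le_max_right _ _)⟩ (by positivity) rfl rfl
    (b0.branch hc hV0) (b1.branch hc1 hV1)
  have hS := hS ?_ ?_
  · obtain ⟨Ms, Ns, hMs, hNs, hsub, hup, hlow⟩ := hS
    refine ⟨Ms, Ns, hMs, hNs, fun α β h hb E hE => ?_, ?_, ?_⟩
    · obtain ⟨p0, p1, p2⟩ := hb 0
      obtain ⟨p3, p4, p5⟩ := hb 1
      rw [hE]
      exact hsub (d n) _ _ _ _ ((hQt 0).trans h8) ((hQt 1).trans h9)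
        (b0.hatBranch hc (hu _).2 hV0 p0 p1 p2) (b1.hatBranch hc1 (hu _).2 hV1 p3 p4 p5)
        (fun x hx => ((b0.hat _ _ _ p0 p1 p2).2 x hx).2)
        (fun x hx => ((b1.hat _ _ _ p3 p4 p5).2 x hx).2)
    · rwa [mul_assoc, ← hκ]
    · rwa [mul_assoc, ← hκ]
  · intro s s' u v hu0 hv0
    have h14 := h6 (fun i => if i = 0 then θ0 s else θ1 s') (fun i => if i = 0 then χ0 s else χ1 s')
      (fun i => if i = 0 then ξ0 s else ξ1 s') (fun i => by
        obtain ⟨m1, m2, m3, -⟩ := hM's s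
        obtain ⟨-, -, -, m4, m5, m6⟩ := hM's s'
        fin_cases i
        · exact ⟨m1, m2, m3⟩
        · exact ⟨m4, m5, m6⟩) (cornerSet q u v)
      (Or.inl ⟨u, v, (hu _).1.trans_le hu0, (hu _).1.trans_le hv0, rfl⟩)
    refine (TailApprox.mono ?_ (r := KD * A0 (n / k n)) ?_)
    · convert h14 using 1
      refine Set.image_congr fun p hp => ?_
      have e0 : 1 < d n * p.1 := ((hQt 0).trans h8).trans_le
        (mul_le_mul_of_nonneg_left (hu0.trans hp.2.1) hd.le)
      have e1 : 1 < d n * p.2 := ((hQt 1).trans h9).trans_le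
        (mul_le_mul_of_nonneg_left (hv0.trans hp.2.2) hd.le)
      simp only [if_true, if_neg one_ne_zero, pairMap]
      rw [tildeH_eq_gpdInv hc e0, tildeH_eq_gpdInv hc1 e1]
    -- The bias condition makes the rate `A0(n/k)` a small multiple of `errRate`, so the
    -- approximation error is at most `κ` itself.
    · rw [Real.norm_eq_abs, Real.norm_eq_abs] at h7
      have h15 : |errRate γ k d e n| = errRate γ k d e n := abs_of_pos hε0
      rw [← errRate, h15, div_mul_eq_mul_div, ← hκ, le_div_iff₀ (by positivity)] at h7
      calc KD * A0 (n / k n) ≤ |KD| * |A0 (n / k n)| := by rw [← abs_mul]; exact le_abs_self _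
        _ ≤ |A0 (n / k n)| * (|KD| + 1) := by
          have := abs_nonneg (A0 (n / k n))
          linarith
        _ ≤ κ := h7
  · intro i T hT
    have hA : |A i (n / k n)| ≤ errRate γ k d e n := by
      fin_cases i
      · exact h11
      · exact h12
    have hti : tt i < n / k n := by
      refine lt_of_le_of_lt ?_ h10
      fin_cases i
      · exact le_max_left _ _
      · exact le_max_right _ _
    have hKA : Kt i * |A i (n / k n)| ≤ K * errRate γ k d e n := by
      have := hKi i
      have := (hKt i).le
      gcongr
    rw [lt_div_iff₀ hK0] at h13
    refine (HT i (n / k n) T hT hti (by linarith)).trans (ENNReal.ofReal_le_ofReal ?_)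
    have : 0 < T := hT0.trans_le hT
    rw [hKκ]
    gcongr

end SampleSandwich

/-! ### Tail empirical measure and boundedness of the estimation errors. -/

section Empirical

open Classical in
/-- The tail empirical measure `k⁻¹ #{i < n | Z_i ∈ B}`. -/
noncomputable def empirical (k : ℝ) (n : ℕ) (Z : ℕ → ℝ × ℝ) (B : Set (ℝ × ℝ)) : ℝ :=
  1 / k * ((Finset.range n).filter (fun i => Z i ∈ B)).card

lemma empirical_mono {k : ℝ} (hk : 0 < k) (n : ℕ) (Z : ℕ → ℝ × ℝ) {B B' : Set (ℝ × ℝ)}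
    (h : B ⊆ B') : empirical k n Z B ≤ empirical k n Z B' := by
  classical
  unfold empirical
  gcongr with i

/-- Passing to the levels `(X - b)/a` replaces the estimators by their normalized errors. Stretching
by `1 + s` combines with the scaling `n/(k e)` into shrinking by `c_n / (1 + s)`. -/
lemma nuHat_blownUpSet_eq {μ : Measure (ℝ × ℝ)} {q : ℝ → ℝ≥0∞} {γ a b γh ah bh : Fin 2 → ℝ}
    {k e d s : ℝ} {n : ℕ} (Z : ℕ → ℝ × ℝ) (ha : ∀ i, 0 < a i) (hs : 0 ≤ 1 + s) :
    nuHat k n γh ah bh Z (blownUpSet k e n γh ah bh (failureSet μ q d) s) =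
      empirical k n Z (hatEvent a b q d
        (hatHit (γ 0) (k / n * e) (ah 0 / a 0) ((bh 0 - b 0) / a 0) (γh 0 - γ 0)
          (fun x => (tailQ μ 0 (d * x) - b 0) / a 0))
        (hatHit (γ 1) (k / n * e / (1 + s)) (ah 1 / a 1) ((bh 1 - b 1) / a 1) (γh 1 - γ 1)
          (fun x => (tailQ μ 1 (d * x) - b 1) / a 1))) := by
  classical
  have hst : ∀ i, ∀ y : ℝ, ((y - b i) / a i - (bh i - b i) / a i) / (ah i / a i) =
      (y - bh i) / ah i := by
    intro i y
    rw [← sub_div, div_div_div_cancel_right₀ (ha i).ne', sub_sub_sub_cancel_right]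
  have h0 : ENNReal.ofReal (k / n * e)⁻¹ = ENNReal.ofReal (n / (k * e)) := by
    congr 1
    rw [div_mul_eq_mul_div, inv_div]
  have h1 : ENNReal.ofReal (k / n * e / (1 + s))⁻¹ =
      ENNReal.ofReal (1 + s) * ENNReal.ofReal (n / (k * e)) := by
    rw [← ENNReal.ofReal_mul hs]
    congr 1
    rw [div_mul_eq_mul_div, inv_div, div_div_eq_mul_div, mul_div_assoc]
  have key : ∀ z, standardize γh ah bh z ∈ blownUpSet k e n γh ah bh (failureSet μ q d) s ↔
      z ∈ hatEvent a b q d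
        (hatHit (γ 0) (k / n * e) (ah 0 / a 0) ((bh 0 - b 0) / a 0) (γh 0 - γ 0)
          (fun x => (tailQ μ 0 (d * x) - b 0) / a 0))
        (hatHit (γ 1) (k / n * e / (1 + s)) (ah 1 / a 1) ((bh 1 - b 1) / a 1) (γh 1 - γ 1)
          (fun x => (tailQ μ 1 (d * x) - b 1) / a 1)) := by
    intro z
    simp only [hatEvent, hatHit, level, hst, h0, h1, add_sub_cancel, blownUpSet, failureSet,
      imageU, dilate, Set.mem_image, Set.mem_ofPred_eq, standardize, Prod.mk.injEq]
    constructor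
    · rintro ⟨_, ⟨_, ⟨⟨x, y⟩, hp, rfl⟩, hx, hy, rfl⟩, e0, e1⟩
      exact ⟨x, y, hp, hx, hy, e0.symm, by rw [mul_assoc]; exact e1.symm⟩
    · rintro ⟨x, y, hp, hx, hy, e0, e1⟩
      exact ⟨_, ⟨_, ⟨⟨x, y⟩, hp, rfl⟩, hx, hy, rfl⟩, e0.symm, by rw [← mul_assoc]; exact e1.symm⟩
  unfold nuHat empirical
  congr 3
  ext i
  simp only [Finset.mem_filter, key]

variable {Ω : Type*} [MeasurableSpace Ω] {P : Measure Ω} [IsProbabilityMeasure P]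
  {μ : Measure (ℝ × ℝ)} {Z : ℕ → Ω → ℝ × ℝ}

/-- Chebyshev's inequality for a sum of independent indicators, whose variance is at most `n μ(B)`.
-/
lemma measure_empirical_sub_le [IsProbabilityMeasure μ] (hZ_meas : ∀ i, Measurable (Z i))
    (hZ_indep : iIndepFun Z P) (hZ_law : ∀ i, P.map (Z i) = μ) {k δ : ℝ} (hk : 0 < k) (hδ : 0 < δ)
    (n : ℕ) {B : Set (ℝ × ℝ)} (hB : MeasurableSet B) :
    P {ω | δ ≤ |empirical k n (fun i => Z i ω) B - n / k * μ.real B|} ≤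
      ENNReal.ofReal (n / k * μ.real B / (k * δ ^ 2)) := by
  classical
  obtain ⟨f, hf⟩ : ∃ f : ℝ × ℝ → ℝ, f = B.indicator 1 := ⟨_, rfl⟩
  have hfm : Measurable f := hf ▸ measurable_one.indicator hB
  have hf0 : ∀ z, 0 ≤ f z ∧ f z ≤ 1 := fun z => by
    rw [hf]
    by_cases hz : z ∈ B <;> simp [hz]
  have hXm : ∀ i, Measurable (fun ω => f (Z i ω)) := fun i => hfm.comp (hZ_meas i)
  have hL2 : ∀ i, MemLp (fun ω => f (Z i ω)) 2 P := fun i =>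
    MemLp.of_bound (hXm i).aestronglyMeasurable 1 (ae_of_all _ fun ω => by
      rw [Real.norm_of_nonneg (hf0 _).1]
      exact (hf0 _).2)
  have hE : ∀ i, ∫ ω, f (Z i ω) ∂P = μ.real B := by
    intro i
    rw [← integral_map (hZ_meas i).aemeasurable (f := f) hfm.aestronglyMeasurable, hZ_law, hf,
      integral_indicator_one hB]
  have hvar : ∀ i, variance (fun ω => f (Z i ω)) P ≤ μ.real B := by
    intro i
    refine (variance_le_expectation_sq (hXm i).aestronglyMeasurable).trans ?_
    rw [← hE i]
    refine le_of_eq (integral_congr_ae (ae_of_all _ fun ω => ?_))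
    rw [hf]
    by_cases hz : Z i ω ∈ B <;> simp [hz]
  have hind : iIndepFun (fun i ω => f (Z i ω)) P := hZ_indep.comp _ fun _ => hfm
  obtain ⟨S, hS⟩ : ∃ S : Ω → ℝ, S = ∑ i ∈ Finset.range n, fun ω => f (Z i ω) := ⟨_, rfl⟩
  have hSL : MemLp S 2 P := hS ▸ memLp_finsetSum' _ fun i _ => hL2 i
  have hSv : variance S P ≤ n * μ.real B := by
    rw [hS, IndepFun.variance_sum (fun i _ => hL2 i) fun i _ j _ hij => hind.indepFun hij]
    calc _ ≤ ∑ i ∈ Finset.range n, μ.real B := Finset.sum_le_sum fun i _ => hvar i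
      _ = _ := by simp
  have hSE : ∫ ω, S ω ∂P = n * μ.real B := by
    rw [hS]
    simp only [Finset.sum_apply]
    rw [integral_finsetSum _ fun i _ => (hL2 i).integrable one_le_two]
    simp [hE]
  have hemp : ∀ ω, empirical k n (fun i => Z i ω) B = S ω / k := by
    intro ω
    rw [empirical, hS, Finset.sum_apply, hf, Finset.card_filter]
    push_cast
    simp [Set.indicator_apply, div_eq_inv_mul]
  have hcheb := meas_ge_le_variance_div_sq hSL (mul_pos hk hδ)
  rw [hSE] at hcheb
  refine (measure_mono fun ω hω => ?_).trans (hcheb.trans (ENNReal.ofReal_le_ofReal ?_))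
  · simp only [Set.mem_ofPred_eq] at hω ⊢
    rw [hemp, div_mul_eq_mul_div, ← sub_div, abs_div, abs_of_pos hk, le_div_iff₀ hk] at hω
    linarith
  · calc variance S P / (k * δ) ^ 2 ≤ n * μ.real B / (k * δ) ^ 2 := by gcongr
      _ = _ := by field_simp

/-- Convergence in distribution implies boundedness in probability. -/
lemma exists_bound_of_tendstoInDistribution {Ω' E : Type*} [MeasurableSpace Ω'] {P' : Measure Ω'}
    [IsProbabilityMeasure P'] [NormedAddCommGroup E] [MeasurableSpace E] [BorelSpace E]
    {X : ℕ → Ω → E} {L : Ω' → E}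
    (h : TendstoInDistribution X atTop L (fun _ => P) P') {ε : ℝ≥0∞} (hε : 0 < ε) :
    ∃ M : ℝ, 0 < M ∧ ∀ᶠ n in atTop, P {ω | M ≤ ‖X n ω‖} < ε := by
  have hclosed : ∀ M : ℝ, IsClosed {x : E | M ≤ ‖x‖} := fun M =>
    isClosed_le continuous_const continuous_norm
  have hL : Tendsto (fun m : ℕ => P'.map L {x : E | (m : ℝ) ≤ ‖x‖}) atTop (𝓝 0) := by
    have : IsProbabilityMeasure (P'.map L) := Measure.isProbabilityMeasure_map h.aemeasurable_limit
    have h1 := tendsto_measure_iInter_atTop (μ := P'.map L)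
      (s := fun m : ℕ => {x : E | (m : ℝ) ≤ ‖x‖})
      (fun m => (hclosed m).measurableSet.nullMeasurableSet)
      (fun m m' hmm x (hx : (m' : ℝ) ≤ ‖x‖) => le_trans (by exact_mod_cast hmm) hx)
      ⟨0, measure_ne_top _ _⟩
    have h2 : ⋂ m : ℕ, {x : E | (m : ℝ) ≤ ‖x‖} = ∅ := by
      refine Set.eq_empty_of_forall_notMem fun x hx => ?_
      obtain ⟨m, hm⟩ := exists_nat_gt ‖x‖
      exact absurd (Set.mem_iInter.1 hx m) (not_le.2 hm)
    rwa [h2, measure_empty] at h1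
  obtain ⟨m, hm, hm0⟩ := ((hL.eventually_lt_const hε).and (eventually_gt_atTop 0)).exists
  refine ⟨m, by exact_mod_cast hm0, ?_⟩
  have h3 := (ProbabilityMeasure.limsup_measure_closed_le_of_tendsto h.tendsto
    (hclosed m)).trans_lt hm
  filter_upwards [eventually_lt_of_limsup_lt h3] with n hn
  rwa [ProbabilityMeasure.coe_mk, Measure.map_apply_of_aemeasurable (h.forall_aemeasurable n)
    (hclosed m).measurableSet] at hn

end Empirical

/-! ### Consistency of `ν̂_n` at the scale `ℓ_n`. -/

section Consistency

/-- The estimation errors control the arguments of the sandwich. -/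
lemma marginalError_bounds {Ω : Type*} {γ : Fin 2 → ℝ} {a b : Fin 2 → ℝ → ℝ} {k : ℕ → ℝ}
    {ahat bhat γhat : Fin 2 → ℕ → Ω → ℝ} {M : ℝ} {n : ℕ} {ω : Ω}
    (h : ‖marginalError γ a b k ahat bhat γhat n ω‖ ≤ M) (i : Fin 2) :
    Real.sqrt (k n) * |ahat i n ω / a i (n / k n) - 1| ≤ M ∧
      Real.sqrt (k n) * |(bhat i n ω - b i (n / k n)) / a i (n / k n)| ≤ M ∧
      Real.sqrt (k n) * |γhat i n ω - γ i| ≤ M := by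
  have h1 := (norm_le_pi_norm (marginalError γ a b k ahat bhat γhat n ω) i).trans h
  have h2 := norm_fst_le (marginalError γ a b k ahat bhat γhat n ω i)
  have h3 := norm_snd_le (marginalError γ a b k ahat bhat γhat n ω i)
  have h4 := norm_fst_le (marginalError γ a b k ahat bhat γhat n ω i).2
  have h5 := norm_snd_le (marginalError γ a b k ahat bhat γhat n ω i).2
  have conv : ∀ x, Real.sqrt (k n) * |x| = ‖Real.sqrt (k n) * x‖ := fun x => by
    rw [norm_mul, Real.norm_of_nonneg (Real.sqrt_nonneg _), Real.norm_eq_abs]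
  rw [conv, conv, conv]
  exact ⟨h2.trans h1, h4.trans (h3.trans h1), h5.trans (h3.trans h1)⟩

variable {Ω Ω' : Type*} [MeasurableSpace Ω] [MeasurableSpace Ω'] {P : Measure Ω}
  [IsProbabilityMeasure P] {P' : Measure Ω'} [IsProbabilityMeasure P']
  {μ ν : Measure (ℝ × ℝ)} [IsProbabilityMeasure μ] {η : ℝ × ℝ → ℝ} {q : ℝ → ℝ≥0∞}
  {γ ρ : Fin 2 → ℝ} {a b A : Fin 2 → ℝ → ℝ} {A0 : ℝ → ℝ} {k d e ℓ : ℕ → ℝ}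
  {Z : ℕ → Ω → ℝ × ℝ} {ahat bhat γhat : Fin 2 → ℕ → Ω → ℝ} {L : Ω' → Fin 2 → ℝ × ℝ × ℝ}

lemma eventually_errRate_le (hℓ : ∀ n, 0 < ℓ n)
    (hrate : ∀ i : Fin 2, (fun n => weight k d e (γ i) n / Real.sqrt (k n)) =o[atTop] ℓ)
    {c : ℝ} (hc : 0 < c) : ∀ᶠ n in atTop, errRate γ k d e n ≤ c * ℓ n := by
  filter_upwards [(hrate 0).bound hc, (hrate 1).bound hc] with n h0 h1
  rw [Real.norm_eq_abs, Real.norm_of_nonneg (hℓ n).le] at h0 h1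
  rw [errRate, ← max_div_div_right (Real.sqrt_nonneg _)]
  exact max_le ((le_abs_self _).trans h0) ((le_abs_self _).trans h1)

/-- Unless the estimation error exceeds `M`, monotonicity places the random count between those of
the two enclosing events. Both are within `δ ℓ_n / 2` of their expectations by Chebyshev, and these
are within `C * errRate`, which is `o(ℓ_n)`, of the target. -/
lemma tendsto_measureReal_nuHat_sub
    (hZ_meas : ∀ i, Measurable (Z i)) (hZ_indep : iIndepFun Z P) (hZ_law : ∀ i, P.map (Z i) = μ)
    (hM1 : CondM1 μ) (hM2 : CondM2 μ γ ρ a b A)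
    (hM3 : TendstoInDistribution (marginalError γ a b k ahat bhat γhat) atTop L (fun _ => P) P')
    (hQ1 : CondQ1 q) (hQ2 : CondQ2 γ q) (hν : IsExponentMeasure μ ν) (hD2 : CondD2 ν η)
    (hS1 : CondS1 γ k d e) (hS2 : CondS2 γ A A0 k d e) (hℓ : ∀ n, 0 < ℓ n)
    (hrate : ∀ i : Fin 2, (fun n => weight k d e (γ i) n / Real.sqrt (k n)) =o[atTop] ℓ)
    {s : ℕ → ℝ} (hs : Tendsto s atTop (𝓝 0)) (hD1 : CondD1Analog μ ν γ a b A0 q k d e s)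
    {δ : ℝ} (hδ : 0 < δ) :
    Tendsto (fun n => P.real {ω | δ * ℓ n <
      |nuHat (k n) n (fun i => γhat i n ω) (fun i => ahat i n ω) (fun i => bhat i n ω)
          (fun i => Z i ω) (blownUpSet (k n) (e n) n (fun i => γhat i n ω) (fun i => ahat i n ω)
            (fun i => bhat i n ω) (failureSet μ q (d n)) (s n)) -
        (ν (scaledSet q (d n / e n) (d n / e n * (1 + s n)))).toReal|}) atTop (𝓝 0) := by
  refine tendsto_order.2 ⟨fun x hx => Eventually.of_forall fun n => hx.trans_le measureReal_nonneg,
    fun ε hε => ?_⟩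
  obtain ⟨M, hM, hMε⟩ := exists_bound_of_tendstoInDistribution hM3
    (ENNReal.ofReal_pos.2 (show 0 < ε / 4 by positivity))
  obtain ⟨C, hC, hsand⟩ := exists_sample_sandwich hν hD2 hM1 hM2 hQ1 hQ2 hS1 hS2 hs hD1 hM
  obtain ⟨r, R, hr, -, hratio⟩ := hS1.exists_ratio
  obtain ⟨mb, hmb⟩ : ∃ mb, mb = r⁻¹ * (ν (scaledSet q 1 (1 / 2))).toReal := ⟨_, rfl⟩
  have hfin := fun {t : ℝ} (ht : 0 < t) =>
    measure_scaledSet_lt_top hν hD2 hM1 (hQ1.axisGrowth hQ2) ht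
  have hmb0 : 0 ≤ mb := by rw [hmb]; positivity
  -- The eventual bound for `errRate / ℓ_n`. The second entry makes the bias at most `δ ℓ_n / 2`,
  -- and the third makes each Chebyshev bound at most `ε / 4`.
  obtain ⟨c, hc⟩ : ∃ c, c = min 1 (min (δ / (2 * C)) (ε * δ ^ 2 / (16 * (mb + 1)))) := ⟨_, rfl⟩
  have hc0 : 0 < c := by rw [hc]; positivity
  have hc1 : c ≤ 1 := hc ▸ min_le_left _ _
  have hc2 : c * (2 * C) ≤ δ := by
    rw [← le_div_iff₀ (by positivity), hc]
    exact (min_le_right _ _).trans (min_le_left _ _)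
  have hc3 : c * (16 * (mb + 1)) ≤ ε * δ ^ 2 := by
    rw [← le_div_iff₀ (by positivity), hc]
    exact (min_le_right _ _).trans (min_le_right _ _)
  have hCe : ∀ᶠ n in atTop, C * errRate γ k d e n < 1 := by
    have := hS1.tendsto_errRate.const_mul C
    rw [mul_zero] at this
    exact this.eventually_lt_const one_pos
  filter_upwards [hMε, hsand, hratio, eventually_errRate_le hℓ hrate hc0, hCe,
    hS1.eventually_le_errRate_mul 1, hs.eventually_const_lt (show (-(1 / 2) : ℝ) < 0 by norm_num),
    eventually_gt_atTop 0] with n h1 h2 h3 h4 h5 h6 h7 hn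
  have hn : (0 : ℝ) < n := by exact_mod_cast hn
  obtain ⟨hk, hd, he⟩ := hS1.1 n
  have hde : 0 < d n / e n := by positivity
  have hs0 : 0 < 1 + s n := by linarith
  have hℓn := hℓ n
  have ha : ∀ i, 0 < a i (n / k n) := fun i => ((hM2 i).2.1 _ (by positivity)).1
  obtain ⟨Ms, Ns, hMs, hNs, hsub, hup, hlow⟩ := h2
  have hscale := measure_scaledSet hν hD2 hQ1.1 hde (s := 1 + s n)
  obtain ⟨m, hm⟩ : ∃ m, m = (ν (scaledSet q (d n / e n) (d n / e n * (1 + s n)))).toReal :=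
    ⟨_, rfl⟩
  have hνfin : ν (scaledSet q (d n / e n) (d n / e n * (1 + s n))) ≠ ⊤ := by
    rw [hscale]
    exact ENNReal.mul_ne_top ENNReal.ofReal_ne_top (hfin hs0).ne
  have hνm : ν (scaledSet q (d n / e n) (d n / e n * (1 + s n))) = ENNReal.ofReal m := by
    rw [hm, ENNReal.ofReal_toReal hνfin]
  have hm0 : 0 ≤ m := hm ▸ ENNReal.toReal_nonneg
  have hmle : m ≤ mb := by
    rw [hm, hscale, ENNReal.toReal_mul, ENNReal.toReal_ofReal (by positivity), hmb]
    refine mul_le_mul (inv_anti₀ hr h3.1) (ENNReal.toReal_mono (hfin (by norm_num)).ne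
      (measure_mono fun p hp => ⟨hp.1, hp.2.trans (ENNReal.ofReal_le_ofReal ?_)⟩))
      ENNReal.toReal_nonneg (by positivity)
    exact div_le_div_of_nonneg_left hp.1.2 (by norm_num) (by linarith)
  have hε0 : 0 < errRate γ k d e n := by
    by_contra! hneg
    nlinarith [Real.sqrt_nonneg (k n)]
  have hreal : ∀ B, ENNReal.ofReal (n / k n) * μ B = ENNReal.ofReal (n / k n * μ.real B) :=
    fun B => by
      rw [ENNReal.ofReal_mul (by positivity), measureReal_def,
        ENNReal.ofReal_toReal (measure_ne_top _ _)]
  rw [hνm, hreal, ← ENNReal.ofReal_add hm0 (by positivity),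
    ENNReal.ofReal_le_ofReal_iff (by positivity)] at hup
  rw [hνm, hreal, ← ENNReal.ofReal_add (by positivity) (by positivity),
    ENNReal.ofReal_le_ofReal_iff (by positivity)] at hlow
  -- Vanishing estimation errors are admissible, so the inclusion needs no random outcome.
  have hMN : Ms ⊆ Ns := by
    obtain ⟨i1, i2⟩ := hsub (fun _ => 1) (fun _ => 0) (fun _ => 0) (fun i => by simp [hM.le]) _ rfl
    exact i1.trans i2
  have hμMN : n / k n * μ.real Ms ≤ n / k n * μ.real Ns := by
    have := measureReal_mono (μ := μ) hMN
    gcongr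
  have hsmall : C * errRate γ k d e n ≤ δ * ℓ n / 2 := by
    calc C * errRate γ k d e n ≤ C * (c * ℓ n) := by gcongr
      _ = c * (2 * C) * ℓ n / 2 := by ring
      _ ≤ δ * ℓ n / 2 := by gcongr
  have hcheb : ∀ B, MeasurableSet B → n / k n * μ.real B ≤ mb + 1 →
      P.real {ω | δ * ℓ n / 2 ≤ |empirical (k n) n (fun i => Z i ω) B - n / k n * μ.real B|} ≤
        ε / 4 := by
    intro B hB hBm
    have h8 := measure_empirical_sub_le hZ_meas hZ_indep hZ_law hk
      (show 0 < δ * ℓ n / 2 by positivity) n hB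
    rw [measureReal_def]
    refine ENNReal.toReal_le_of_le_ofReal (by positivity) (h8.trans (ENNReal.ofReal_le_ofReal ?_))
    -- From `1 ≤ errRate * √k` and `errRate ≤ c ℓ_n`. Thus `k ℓ_n²` is at least `1 / c²`, which
    -- makes the Chebyshev bound small.
    have h9 : 1 ≤ k n * (c * ℓ n) ^ 2 := by
      have : 1 ≤ c * ℓ n * Real.sqrt (k n) := h6.trans (by gcongr)
      calc (1 : ℝ) ≤ (c * ℓ n * Real.sqrt (k n)) ^ 2 := one_le_pow₀ this
        _ = k n * (c * ℓ n) ^ 2 := by rw [mul_pow, Real.sq_sqrt hk.le]; ring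
    have h10 : c ^ 2 ≤ c := by nlinarith
    have h11 : 1 ≤ k n * ℓ n ^ 2 * c := by
      have : k n * (c * ℓ n) ^ 2 = k n * ℓ n ^ 2 * c ^ 2 := by ring
      rw [this] at h9
      exact h9.trans (by gcongr)
    rw [div_le_iff₀ (by positivity)]
    calc n / k n * μ.real B ≤ (mb + 1) * 1 := by linarith
      _ ≤ (mb + 1) * (k n * ℓ n ^ 2 * c) := by gcongr
      _ = c * (16 * (mb + 1)) * (k n * ℓ n ^ 2) / 16 := by ring
      _ ≤ ε * δ ^ 2 * (k n * ℓ n ^ 2) / 16 := by gcongr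
      _ = _ := by ring
  have hfinal : P.real {ω | M ≤ ‖marginalError γ a b k ahat bhat γhat n ω‖} < ε / 4 :=
    ENNReal.toReal_lt_of_lt_ofReal h1
  rw [← hm]
  refine lt_of_le_of_lt (measureReal_mono (s₂ :=
    ({ω | M ≤ ‖marginalError γ a b k ahat bhat γhat n ω‖} ∪
    {ω | δ * ℓ n / 2 ≤ |empirical (k n) n (fun i => Z i ω) Ns - n / k n * μ.real Ns|}) ∪
    {ω | δ * ℓ n / 2 ≤ |empirical (k n) n (fun i => Z i ω) Ms - n / k n * μ.real Ms|})
    fun ω hω => ?_) ?_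
  · by_contra hcon
    simp only [Set.mem_union, Set.mem_ofPred_eq, not_or, not_le] at hcon hω
    obtain ⟨⟨hg, hgN⟩, hgM⟩ := hcon
    rw [nuHat_blownUpSet_eq (γ := γ) (a := fun i => a i (n / k n)) (b := fun i => b i (n / k n))
      (fun i => Z i ω) ha hs0.le] at hω
    obtain ⟨i1, i2⟩ := hsub _ _ _ (marginalError_bounds hg.le) _ rfl
    have j1 := empirical_mono hk n (fun i => Z i ω) i1
    have j2 := empirical_mono hk n (fun i => Z i ω) i2
    simp only [cSeq] at j1 j2
    have hgN := (abs_lt.1 hgN).2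
    have hgM := (abs_lt.1 hgM).1
    rcases lt_abs.1 hω with h | h <;> linarith
  · have k1 := hcheb Ns hNs (by linarith)
    have k2 := hcheb Ms hMs (by linarith)
    refine (measureReal_union_le _ _).trans_lt ?_
    have := measureReal_union_le (μ := P)
      {ω | M ≤ ‖marginalError γ a b k ahat bhat γhat n ω‖}
      {ω | δ * ℓ n / 2 ≤ |empirical (k n) n (fun i => Z i ω) Ns - n / k n * μ.real Ns|}
    linarith

end Consistency

end ExtremeFailure

theorem corollary2
    {Ω Ω' : Type*} [MeasurableSpace Ω] [MeasurableSpace Ω']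
    (P : Measure Ω) [IsProbabilityMeasure P] (P' : Measure Ω') [IsProbabilityMeasure P']
    (μ : Measure (ℝ × ℝ)) [IsProbabilityMeasure μ]
    (Z : ℕ → Ω → ℝ × ℝ)
    (hZ_meas : ∀ i, Measurable (Z i)) (hZ_indep : iIndepFun Z P) (hZ_law : ∀ i, P.map (Z i) = μ)
    (γ ρ : Fin 2 → ℝ) (a b A : Fin 2 → ℝ → ℝ) (A0 : ℝ → ℝ)
    (q : ℝ → ℝ≥0∞) (ν : Measure (ℝ × ℝ)) (η : ℝ × ℝ → ℝ)
    (k d e ℓ : ℕ → ℝ)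
    (ahat bhat γhat : Fin 2 → ℕ → Ω → ℝ) (L : Ω' → Fin 2 → ℝ × ℝ × ℝ)
    (hFirst : FirstOrder μ γ a b)
    (hM1 : CondM1 μ) (hM2 : CondM2 μ γ ρ a b A)
    (hM3 : TendstoInDistribution (marginalError γ a b k ahat bhat γhat) atTop L (fun _ => P) P')
    (hQ1 : CondQ1 q) (hQ2 : CondQ2 γ q)
    (hν : IsExponentMeasure μ ν) (hD1 : CondD1 μ ν γ a b A0 q k d e) (hD2 : CondD2 ν η)
    (hS1 : CondS1 γ k d e) (hS2 : CondS2 γ A A0 k d e) (hS3 : CondS3 γ q k e)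
    (hℓ_pos : ∀ n, 0 < ℓ n) (hℓ_anti : Antitone ℓ) (hℓ_lim : Tendsto ℓ atTop (𝓝 0))
    (hℓ_rate : ∀ i : Fin 2,
      (fun n => weight k d e (γ i) n / Real.sqrt (k n)) =o[atTop] ℓ)
    (hD1_plus : CondD1Analog μ ν γ a b A0 q k d e ℓ)
    (hD1_minus : CondD1Analog μ ν γ a b A0 q k d e (fun n => -ℓ n)) :
    IntegrableOn (fun u : ℝ => (q u).toReal * η (u, (q u).toReal)) (Set.Ioi (xLow q)) ∧
      ∃ R : ℕ → Ω → ℝ,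
        TendstoInMeasure P R atTop (fun _ => (0 : ℝ)) ∧
        ∀ n ω, IHat μ q k d e ℓ ahat bhat γhat Z n ω
          = e n / d n
            * (∫ u in Set.Ioi (xLow q), (q u).toReal * η (u, (q u).toReal))
            * (1 + R n ω) := by
  have hq := hQ1.1
  obtain ⟨hint, hder⟩ := derivative_scaledSet hν hD2 hM1 hq (hQ1.axisGrowth hQ2) (xLow_nonneg q)
    (fun x hx h => eq_top_of_lt_xLow hx h) (fun x h => hQ1.lt_top h)
  refine ⟨hint, ?_⟩
  have hI := setIntegral_boundary_pos hD2 hQ2 hint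
  obtain ⟨I, hIe⟩ : ∃ I, I = ∫ u in Set.Ioi (xLow q), (q u).toReal * η (u, (q u).toReal) :=
    ⟨_, rfl⟩
  rw [← hIe] at hder hI ⊢
  -- The remainder is defined by the identity itself, which is possible because the integral is
  -- nonzero. What has to be shown is its convergence in probability.
  refine ⟨fun n ω => IHat μ q k d e ℓ ahat bhat γhat Z n ω * (d n / e n) / I - 1, ?_, ?_⟩
  swap
  · intro n ω
    obtain ⟨-, hd, he⟩ := hS1.1 n
    field_simp
    ring
  obtain ⟨r, R, hr, hrR, hratio⟩ := hS1.exists_ratio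
  have hR : 0 < R := hr.trans_le hrR
  rw [tendstoInMeasure_iff_measureReal_norm]
  intro ε hε
  have hderℓ := hder.comp (tendsto_nhdsWithin_iff.2 ⟨hℓ_lim, Eventually.of_forall hℓ_pos⟩)
  have hdist := (Metric.tendsto_nhds.1 hderℓ) (ε * I / 2) (by positivity)
  -- The factor `d/e ≤ R` and two errors of this size over `2 ℓ_n` leave at most `ε I / 4`. The
  -- difference quotient contributes less than `ε I / 2`, so the sum stays below `ε I`.
  have hδ : 0 < ε * I / (4 * R) := by positivity
  have hm := tendsto_measureReal_nuHat_sub hZ_meas hZ_indep hZ_law hM1 hM2 hM3 hQ1 hQ2 hν hD2 hS1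
    hS2 hℓ_pos hℓ_rate (s := fun n => -ℓ n) (by simpa using hℓ_lim.neg) hD1_minus hδ
  have hp := tendsto_measureReal_nuHat_sub hZ_meas hZ_indep hZ_law hM1 hM2 hM3 hQ1 hQ2 hν hD2 hS1
    hS2 hℓ_pos hℓ_rate hℓ_lim hD1_plus hδ
  have hsum := hm.add hp
  rw [add_zero] at hsum
  refine tendsto_of_tendsto_of_tendsto_of_le_of_le' tendsto_const_nhds hsum
    (Eventually.of_forall fun n => measureReal_nonneg) ?_
  filter_upwards [hratio, hdist] with n h1 h2
  refine (measureReal_mono fun ω hω => ?_).trans (measureReal_union_le _ _)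
  by_contra hcon
  simp only [Set.mem_union, Set.mem_ofPred_eq, not_or, not_lt] at hcon hω
  obtain ⟨g1, g2⟩ := hcon
  obtain ⟨-, hd, he⟩ := hS1.1 n
  have hde : 0 < d n / e n := by positivity
  have hℓ := hℓ_pos n
  rw [measure_scaledSet hν hD2 hq hde, ENNReal.toReal_mul,
    ENNReal.toReal_ofReal (inv_nonneg.2 hde.le)] at g1 g2
  rw [Function.comp_apply, Real.dist_eq] at h2
  rw [sub_zero, Real.norm_eq_abs, IHat] at hω
  rw [← sub_eq_add_neg] at g1
  generalize (ν (scaledSet q 1 (1 - ℓ n))).toReal = m1 at g1 h2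
  generalize (ν (scaledSet q 1 (1 + ℓ n))).toReal = m2 at g2 h2
  generalize nuHat _ _ _ _ _ _ (blownUpSet _ _ _ _ _ _ _ (-ℓ n)) = v1 at g1 hω
  generalize nuHat _ _ _ _ _ _ (blownUpSet _ _ _ _ _ _ _ (ℓ n)) = v2 at g2 hω
  obtain ⟨l, hl⟩ : ∃ l, l = d n / e n := ⟨_, rfl⟩
  rw [← hl] at g1 g2 hω h1 hde
  -- The remainder splits into the stochastic errors of the two empirical masses and the error of
  -- the deterministic difference quotient.
  have e1 : (v1 - v2) / (2 * ℓ n) * l / I - 1 =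
      (l / (2 * ℓ n) * ((v1 - l⁻¹ * m1) - (v2 - l⁻¹ * m2)) + ((m1 - m2) / (2 * ℓ n) - I)) / I := by
    field_simp
    ring
  rw [e1, abs_div, abs_of_pos hI, le_div_iff₀ hI] at hω
  have h3 := (abs_sub (v1 - l⁻¹ * m1) (v2 - l⁻¹ * m2)).trans (add_le_add g1 g2)
  have h4 : |l / (2 * ℓ n) * ((v1 - l⁻¹ * m1) - (v2 - l⁻¹ * m2))| ≤ ε * I / 4 := by
    rw [abs_mul, abs_of_pos (by positivity : 0 < l / (2 * ℓ n))]
    calc l / (2 * ℓ n) * |(v1 - l⁻¹ * m1) - (v2 - l⁻¹ * m2)|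
        ≤ R / (2 * ℓ n) * (ε * I / (4 * R) * ℓ n + ε * I / (4 * R) * ℓ n) := by
          gcongr
          exact h1.2
      _ = ε * I / 4 := by
          field_simp
          norm_num
  have h5 := abs_add_le (l / (2 * ℓ n) * ((v1 - l⁻¹ * m1) - (v2 - l⁻¹ * m2)))
    ((m1 - m2) / (2 * ℓ n) - I)
  have h6 : 0 < ε * I := by positivity
  linarith
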